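/- Let $k$ be a field of characteristic $\neq 2$. Let $\mathrm{svec}$ be the category of finite dimensional $\mathbb Z/2$-graded vector spaces (superspaces) over $k$ with all linear maps as morphisms; $\Pi M$ denotes the superspace $M$ with the opposite grading. The symmetric group $\mathfrak S_d$ acts on $M^{\otimes d}$ by place permutations with the rule of signs, $\Gamma^d M$ is the space of invariants and $S^dM$ the space of coinvariants. A strict polynomial superfunctor of degree $d$ is an even $k$-linear functor to $\mathrm{svec}$ from the category $\mathsf\Gamma^d$ with the objects of $\mathrm{svec}$ and with $\hom(M,M')=\Gamma^d\mathrm{Hom}(M,M')=\mathrm{Hom}_{\mathfrak S_d}(M^{\otimes d},M'^{\otimes d})$. A strict polynomial bisuperfunctor of degree $d$ is an even $k$-linear functor to $\mathrm{svec}$ from the category of pairs $(M,N)$ of objects of $\mathrm{svec}$ with $\hom((M,N),(M',N'))=\bigoplus_{e+f=d}\Gamma^e\mathrm{Hom}(M,M')\otimes\Gamma^f\mathrm{Hom}(N,N')$, composition following the rule of signs. Write $F^{\mathsf{bi}}(M,N)=F(M\oplus N)$ and $(S\boxtimes S')(M,N)=S(M)\otimes S'(N)$. For partitions $\mu\subset\lambda$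 with $d=|\lambda/\mu|$ and conjugates $\mu',\lambda'$, put $\Gamma_\Pi^{\lambda'/\mu'}(M)=\bigotimes_j\Gamma^{\lambda'_j-\mu'_j}(\Pi M)\subset(\Pi M)^{\otimes d}$ and $S^{\lambda/\mu}(M)=\bigotimes_iS^{\lambda_i-\mu_i}(M)$. Let $$\hat\theta_{\lambda/\mu}:\ \Gamma_\Pi^{\lambda'/\mu'}(M)\to M^{\otimes d}\to M^{\otimes d}\to S^{\lambda/\mu}(M)$$ be the composite of $1^{\otimes d}$ (the tensor power of the odd identity map $\Pi M\to M$), of the signed place permutation that takes the position of a cell of $\lambda/\mu$ in the column-by-column reading to its position in the row-by-row reading, and of the projection. The Schur superfunctor is $\widehat S_{\lambda/\mu}(M)=\mathrm{Im}\,\hat\theta_{\lambda/\mu}$. For $\mu\subset\nu\subset\lambda$ let $x\otimes y\mapsto x\circledast y$ be the embedding $\Gamma_\Pi^{\nu'/\mu'}(M)\otimes\Gamma_\Pi^{\lambda'/\nu'}(N)\to\Gamma_\Pi^{\lambda'/\mu'}(M\oplus N)$ given in each column by the sum over all shuffles, with the rule of signs. Let $\preceq$ be the lexicographic order on partitions.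 For $\mu\subset\xi\subset\lambda$ let $K^\xi(M,N)$ (respectively $\dot K^\xi(M,N)$) be the sum of the images of these embeddings over all $\mu\subset\nu\subset\lambda$ with $\nu\preceq\xi$ (respectively $\nu\prec\xi$), and put $$L_\xi(M,N)=\hat\theta_{\lambda/\mu}(K^\xi(M,N)),\qquad \dot L_\xi(M,N)=\hat\theta_{\lambda/\mu}(\dot K^\xi(M,N)).$$ **Theorem.** Let $\mu\subset\lambda$ be partitions. The $L_\xi$ and $\dot L_\xi$, for $\mu\subset\xi\subset\lambda$, are subfunctors of the bisuperfunctor $(\widehat S_{\lambda/\mu})^{\mathsf{bi}}$. For each $\xi$ with $\mu\subset\xi\subset\lambda$ there is a natural even isomorphism of bisuperfunctors $$\psi_\xi:\ \widehat S_{\xi/\mu}\boxtimes\widehat S_{\lambda/\xi}\ \xrightarrow{\ \sim\ }\ L_\xi/\dot L_\xi,\qquad \psi_\xi\big((\hat\theta_{\xi/\mu}\boxtimes\hat\theta_{\lambda/\xi})(x\otimes y)\big)=\big[\hat\theta_{\lambda/\mu}(x\circledast y)\big]$$ for all $x\in\Gamma_\Pi^{\xi'/\mu'}(M)$, $y\in\Gamma_\Pi^{\lambda'/\xi'}(N)$,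 where the tensor product of maps follows the rule of signs. The $L_\xi$ form a filtration of $(\widehat S_{\lambda/\mu})^{\mathsf{bi}}$: $L_\nu\subset L_\xi$ if $\nu\preceq\xi$, $L_\lambda=(\widehat S_{\lambda/\mu})^{\mathsf{bi}}$, and $\dot L_\xi=\sum_{\nu\prec\xi}L_\nu$ (sum over $\mu\subset\nu\subset\lambda$). Its associated graded object $\bigoplus_\xi L_\xi/\sum_{\nu\prec\xi}L_\nu$ is isomorphic, by an even natural isomorphism, to $\bigoplus_{\mu\subset\xi\subset\lambda}\widehat S_{\xi/\mu}\boxtimes\widehat S_{\lambda/\xi}$. -/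

import Mathlib

open scoped TensorProduct

universe u v w

set_option linter.unusedSectionVars false

namespace SuperSchur

/-- A vector superspace: a `ZMod 2`-grading `M = M₀ ⊕ M₁`, recorded by its two projections
`proj 0`, `proj 1 : M → M` (complementary idempotents); `M_ε` is the range of `proj ε`. -/
class SuperSpace (k : Type u) (M : Type v) [Field k] [AddCommGroup M] [Module k M] where
  proj : ZMod 2 → M →ₗ[k] M
  proj_proj : ∀ a b x, proj a (proj b x) = if a = b then proj b x else 0
  proj_add : ∀ x, proj 0 x + proj 1 x = x

section Basic

variable {k : Type u} [Field k] {M N P : Type v}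
  [AddCommGroup M] [Module k M] [SuperSpace k M]
  [AddCommGroup N] [Module k N] [SuperSpace k N]
  [AddCommGroup P] [Module k P] [SuperSpace k P]

variable (k) in
/-- The projection to the homogeneous component of parity `a`. -/
abbrev pr (a : ZMod 2) : M →ₗ[k] M := SuperSpace.proj a

/-- `x` is homogeneous of parity `a`. -/
def Homog (k : Type u) [Field k] {M : Type v} [AddCommGroup M] [Module k M] [SuperSpace k M]
    (a : ZMod 2) (x : M) : Prop := pr k a x = x

lemma zmod2_cases (a : ZMod 2) : a = 0 ∨ a = 1 := by revert a; decide

@[simp] lemma pr_same (a : ZMod 2) (x : M) : pr k a (pr k a x) = pr k a x := by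
  simp [SuperSpace.proj_proj]

@[simp] lemma pr_01 (x : M) : pr k 0 (pr k 1 x) = 0 := by simp [SuperSpace.proj_proj]

@[simp] lemma pr_10 (x : M) : pr k 1 (pr k 0 x) = 0 := by simp [SuperSpace.proj_proj]

lemma pr_ne {a b : ZMod 2} (h : a ≠ b) (x : M) : pr k a (pr k b x) = 0 := by
  simp [SuperSpace.proj_proj, h]

lemma pr_add (x : M) : pr k 0 x + pr k 1 x = x := SuperSpace.proj_add x

lemma sum_pr (x : M) : ∑ a, pr k a x = x := by
  rw [show (Finset.univ : Finset (ZMod 2)) = {0, 1} from rfl]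
  rw [Finset.sum_pair (by decide), pr_add]

lemma homog_pr (a : ZMod 2) (x : M) : Homog k a (pr k a x) := pr_same a x

lemma Homog.pr_of_ne {a b : ZMod 2} {x : M} (hx : Homog k b x) (h : a ≠ b) : pr k a x = 0 := by
  rw [← hx, pr_ne h]

variable (k) in
/-- The parity involution `x ↦ (-1)^{|x|} x`. -/
def par : M →ₗ[k] M := pr k 0 - pr k 1

/-- The direct sum of superspaces. -/
instance : SuperSpace k (M × N) where
  proj a := (pr k a).prodMap (pr k a)
  proj_proj a b x := by
    ext <;> by_cases h : a = b <;> simp [SuperSpace.proj_proj, h]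
  proj_add x := by ext <;> simp [SuperSpace.proj_add]

lemma one_add_one : (1 : ZMod 2) + 1 = 0 := rfl

/-- `Hom(M, N)` as a superspace: `f` has parity `a` if `f(M_b) ⊆ N_{a+b}`. The component of `f` of
parity `a` is `pr a ∘ f ∘ pr 0 + pr (a + 1) ∘ f ∘ pr 1`. -/
instance : SuperSpace k (M →ₗ[k] N) where
  proj a := (LinearMap.llcomp k M N N (pr k a)) ∘ₗ (LinearMap.lcomp k N (pr k 0)) +
    (LinearMap.llcomp k M N N (pr k (a + 1))) ∘ₗ (LinearMap.lcomp k N (pr k 1))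
  proj_proj a b f := by
    ext x
    rcases zmod2_cases a with rfl | rfl <;> rcases zmod2_cases b with rfl | rfl <;>
      simp [one_add_one]
  proj_add f := by
    ext x
    have h1 := pr_add (k := k) (f (pr k 0 x))
    have h2 := pr_add (k := k) (f (pr k 1 x))
    have h3 := congrArg f (pr_add (k := k) x)
    rw [map_add, ← h1, ← h2] at h3
    rw [← h3]
    simp only [zero_add, one_add_one, LinearMap.add_apply,
      LinearMap.comp_apply, LinearMap.lcomp_apply', LinearMap.llcomp_apply']
    abel

lemma pr_hom_apply (a : ZMod 2) (f : M →ₗ[k] N) (x : M) :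
    pr k a f x = pr k a (f (pr k 0 x)) + pr k (a + 1) (f (pr k 1 x)) := rfl

/-- The tensor product of superspaces: `M_b ⊗ N_c` has parity `b + c`. -/
instance : SuperSpace k (M ⊗[k] N) where
  proj a := TensorProduct.map (pr k 0) (pr k a) + TensorProduct.map (pr k 1) (pr k (a + 1))
  proj_proj a b x := by
    induction x with
    | zero => simp
    | add x y hx hy => rw [map_add, map_add, hx, hy]; split_ifs <;> simp
    | tmul x y =>
      rcases zmod2_cases a with rfl | rfl <;> rcases zmod2_cases b with rfl | rfl <;>
        simp [one_add_one]
  proj_add x := by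
    induction x with
    | zero => simp
    | add x y hx hy =>
      rw [map_add, map_add, add_add_add_comm, hx, hy]
    | tmul x y =>
      conv_rhs => rw [← pr_add (k := k) x, ← pr_add (k := k) y]
      simp [one_add_one, TensorProduct.add_tmul, TensorProduct.tmul_add]
      abel

lemma pr_tmul (a : ZMod 2) (x : M) (y : N) :
    pr k a (x ⊗ₜ[k] y) = pr k 0 x ⊗ₜ pr k a y + pr k 1 x ⊗ₜ pr k (a + 1) y := rfl

/-- The direct sum of a finite family of superspaces. -/
instance superPi {ι : Type w} (F : ι → Type v) [∀ i, AddCommGroup (F i)] [∀ i, Module k (F i)]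
    [∀ i, SuperSpace k (F i)] : SuperSpace k (∀ i, F i) where
  proj a := LinearMap.pi fun i => pr k a ∘ₗ LinearMap.proj i
  proj_proj a b x := by
    ext i; by_cases h : a = b <;> simp [SuperSpace.proj_proj, h]
  proj_add x := by ext i; simp [SuperSpace.proj_add]

/-- A subspace `U` is a subsuperspace if `U = (U ∩ M₀) ⊕ (U ∩ M₁)`. -/
def IsSubsuper (U : Submodule k M) : Prop := ∀ a, ∀ x ∈ U, pr k a x ∈ U

/-- The induced grading of a subsuperspace. -/
abbrev superSub (U : Submodule k M) (h : IsSubsuper U) : SuperSpace k U where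
  proj a := (pr k a).restrict (h a)
  proj_proj a b x := by
    ext; by_cases hh : a = b <;> simp [SuperSpace.proj_proj, hh]
  proj_add x := by ext; simp [SuperSpace.proj_add]

/-- The induced grading of the quotient by a subsuperspace. -/
abbrev superQuot (U : Submodule k M) (h : IsSubsuper U) : SuperSpace k (M ⧸ U) where
  proj a := U.mapQ U (pr k a) (fun x hx => h a x hx)
  proj_proj a b x := by
    obtain ⟨x, rfl⟩ := U.mkQ_surjective x
    by_cases hh : a = b <;> simp [SuperSpace.proj_proj, hh]
  proj_add x := by
    obtain ⟨x, rfl⟩ := U.mkQ_surjective x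
    simp only [Submodule.mkQ_apply, Submodule.mapQ_apply]
    rw [← Submodule.Quotient.mk_add, SuperSpace.proj_add]

/-- The parity change `ΠM`: the same space with the opposite grading. -/
def Parity (M : Type v) : Type v := M

instance : AddCommGroup (Parity M) := inferInstanceAs (AddCommGroup M)
instance : Module k (Parity M) := inferInstanceAs (Module k M)

instance : SuperSpace k (Parity M) where
  proj a := (pr k (a + 1) : M →ₗ[k] M)
  proj_proj a b x := by
    have := SuperSpace.proj_proj (k := k) (M := M) (a + 1) (b + 1) x
    simp only [add_left_inj] at this
    exact this
  proj_add x := by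
    have := SuperSpace.proj_add (k := k) (M := M) x
    rw [add_comm] at this
    exact this

variable (k) in
/-- The identity map `1 : ΠM → M`, an odd map. -/
def unPar : Parity M →ₗ[k] M := (LinearMap.id : M →ₗ[k] M)

variable (k) in
/-- The identity map `M → ΠM`. -/
def toPar : M →ₗ[k] Parity M := (LinearMap.id : M →ₗ[k] M)

/-- A linear map `f : M → N`, regarded as a linear map `ΠM → ΠN`. -/
def parMap (f : M →ₗ[k] N) : Parity M →ₗ[k] Parity N := f

/-- The tensor product of maps of superspaces with the rule of signs,
`(f ⊗ g)(x ⊗ y) = (-1)^{|g||x|} f(x) ⊗ g(y)`. -/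
def superTensor {M' N' : Type v} [AddCommGroup M'] [Module k M'] [AddCommGroup N'] [Module k N']
    [SuperSpace k N'] :
    (M →ₗ[k] M') →ₗ[k] (N →ₗ[k] N') →ₗ[k] (M ⊗[k] N →ₗ[k] M' ⊗[k] N') :=
  (TensorProduct.mapBilinear _ M N M' N').compl₂ (pr k 0) +
    ((TensorProduct.mapBilinear _ M N M' N').compl₂ (pr k 1)) ∘ₗ (LinearMap.lcomp k M' (par k))

lemma superTensor_apply {M' N' : Type v} [AddCommGroup M'] [Module k M'] [AddCommGroup N']
    [Module k N'] [SuperSpace k N'] (f : M →ₗ[k] M') (g : N →ₗ[k] N') (x : M) (y : N) :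
    superTensor f g (x ⊗ₜ y) = f x ⊗ₜ pr k 0 g y + f (par k x) ⊗ₜ pr k 1 g y := by
  simp [superTensor]

end Basic

section TensorPower

variable {k : Type u} [Field k] {M N P : Type u}
  [AddCommGroup M] [Module k M] [SuperSpace k M]
  [AddCommGroup N] [Module k N] [SuperSpace k N]
  [AddCommGroup P] [Module k P]
variable {ι κ ω : Type} [Fintype ι] [LinearOrder ι] [Fintype κ] [LinearOrder κ]
  [Fintype ω] [LinearOrder ω]

/-- The tensor power `M^{⊗ι}`, whose factors are indexed by a finite totally ordered set `ι`. -/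
abbrev T (k : Type u) [Field k] (ι : Type) (M : Type u) [AddCommGroup M] [Module k M] :=
  PiTensorProduct k (fun _ : ι => M)

/-- The projection of `M^{⊗ι}` to the summand `⨂ᵢ M_{δ i}`. -/
def prT (δ : ι → ZMod 2) : T k ι M →ₗ[k] T k ι M := PiTensorProduct.map fun i => pr k (δ i)

lemma prT_tprod (δ : ι → ZMod 2) (v : ι → M) :
    prT δ (PiTensorProduct.tprod k v) = PiTensorProduct.tprod k fun i => pr k (δ i) (v i) := by
  simp [prT]

lemma tprod_zero_of {v : ι → M} (i : ι) (h : v i = 0) : PiTensorProduct.tprod k v = 0 :=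
  (PiTensorProduct.tprod k).map_coord_zero i h

lemma sum_tprod {C : Type} [Fintype C] (q : C → M →ₗ[k] M) (hq : ∀ x, ∑ c, q c x = x) (v : ι → M) :
    ∑ γ : ι → C, PiTensorProduct.tprod k (fun i => q (γ i) (v i)) = PiTensorProduct.tprod k v := by
  classical
  rw [← (PiTensorProduct.tprod k).map_sum (fun i c => q c (v i))]
  simp [hq]

lemma sum_prT (x : T k ι M) : ∑ δ : ι → ZMod 2, prT δ x = x := by
  have : ∑ δ : ι → ZMod 2, prT (k := k) (M := M) δ = LinearMap.id := by
    ext v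
    simp only [LinearMap.compMultilinearMap_apply, LinearMap.sum_apply, prT_tprod]
    exact sum_tprod (pr k) sum_pr v
  simpa using congrArg (fun f => f x) this

lemma prT_prT (δ δ' : ι → ZMod 2) (x : T k ι M) :
    prT δ (prT δ' x) = if δ = δ' then prT δ' x else 0 := by
  have : prT (k := k) (M := M) δ ∘ₗ prT δ' = if δ = δ' then prT δ' else 0 := by
    ext v
    simp only [LinearMap.compMultilinearMap_apply, LinearMap.comp_apply, prT_tprod]
    by_cases h : δ = δ'
    · simp [h, prT_tprod]
    · obtain ⟨i, hi⟩ := Function.ne_iff.mp h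
      rw [tprod_zero_of i (pr_ne hi _)]
      simp [h]
  have := congrArg (fun f => f x) this
  simp only [LinearMap.comp_apply] at this
  rw [this]; split_ifs <;> rfl

/-- The tensor power as a superspace: `⨂ᵢ M_{δ i}` has parity `∑ᵢ δ i`. -/
instance : SuperSpace k (T k ι M) where
  proj a := ∑ δ : ι → ZMod 2, if ∑ i, δ i = a then prT δ else 0
  proj_proj a b x := by
    simp only [LinearMap.sum_apply, map_sum]
    have key : ∀ δ δ' : ι → ZMod 2,
        (if ∑ i, δ i = a then prT (k := k) (M := M) δ else 0)
          ((if ∑ i, δ' i = b then prT (k := k) (M := M) δ' else 0) x) =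
        if δ = δ' then (if ∑ i, δ i = a ∧ ∑ i, δ i = b then prT δ x else 0) else 0 := by
      intro δ δ'
      by_cases h1 : ∑ i, δ i = a <;> by_cases h2 : ∑ i, δ' i = b <;> by_cases h3 : δ = δ' <;>
        simp_all [prT_prT]
    simp only [key]
    simp only [Finset.sum_ite_eq', Finset.mem_univ, if_true]
    by_cases h : a = b
    · subst h; simp only [and_self, if_true]
      refine Finset.sum_congr rfl fun δ _ => ?_
      split_ifs <;> simp
    · rw [if_neg h]
      refine Finset.sum_eq_zero fun δ _ => ?_
      rw [if_neg]
      rintro ⟨rfl, h2⟩; exact h h2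
  proj_add x := by
    simp only [LinearMap.sum_apply]
    rw [← Finset.sum_add_distrib]
    conv_rhs => rw [← sum_prT x]
    refine Finset.sum_congr rfl fun δ _ => ?_
    rcases zmod2_cases (∑ i, δ i) with h | h <;> simp [h]

lemma pr_T (a : ZMod 2) (x : T k ι M) :
    pr k a x = ∑ δ : ι → ZMod 2, if ∑ i, δ i = a then prT δ x else 0 := by
  change (∑ δ : ι → ZMod 2, if ∑ i, δ i = a then prT δ else 0) x = _
  simp only [LinearMap.sum_apply]
  refine Finset.sum_congr rfl fun δ _ => ?_
  split_ifs <;> simp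

lemma prT_homog {δ : ι → ZMod 2} {v : ι → M} (hv : ∀ i, Homog k (δ i) (v i)) (δ' : ι → ZMod 2) :
    prT δ' (PiTensorProduct.tprod k v) = if δ' = δ then PiTensorProduct.tprod k v else 0 := by
  rw [prT_tprod]
  by_cases h : δ' = δ
  · subst h; rw [if_pos rfl]; congr 1; funext i; exact hv i
  · obtain ⟨i, hi⟩ := Function.ne_iff.mp h
    rw [if_neg h, tprod_zero_of i ((hv i).pr_of_ne hi)]

lemma pr_T_homog {δ : ι → ZMod 2} {v : ι → M} (hv : ∀ i, Homog k (δ i) (v i)) (a : ZMod 2) :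
    pr k a (PiTensorProduct.tprod k v) = if ∑ i, δ i = a then PiTensorProduct.tprod k v else 0 := by
  rw [pr_T, Finset.sum_eq_single δ]
  · simp [prT_homog hv]
  · intro δ' _ h; simp [prT_homog hv, h]
  · simp

/-- Linear maps on a tensor power agree if they agree on tensors of homogeneous vectors. -/
lemma T_ext {F G : T k ι M →ₗ[k] P}
    (h : ∀ (δ : ι → ZMod 2) (v : ι → M), (∀ i, Homog k (δ i) (v i)) →
      F (PiTensorProduct.tprod k v) = G (PiTensorProduct.tprod k v)) : F = G := by
  ext v
  simp only [LinearMap.compMultilinearMap_apply]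
  rw [← sum_tprod (pr k) sum_pr v, map_sum, map_sum]
  exact Finset.sum_congr rfl fun δ _ => h δ _ fun i => homog_pr _ _

/-- The sign `(-1)^{ab}`. -/
def kos (a b : ZMod 2) : ℤ := if a = 1 ∧ b = 1 then -1 else 1

lemma kos_comm (a b : ZMod 2) : kos a b = kos b a := by simp [kos, and_comm]

lemma kos_sq (a b : ZMod 2) : kos a b * kos a b = 1 := by unfold kos; split_ifs <;> rfl

/-- The product of `f i j` over all pairs `i < j`. -/
def pairProd (f : ι → ι → ℤ) : ℤ := ∏ p : ι × ι, if p.1 < p.2 then f p.1 p.2 else 1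

lemma pairProd_mul (f g : ι → ι → ℤ) :
    pairProd f * pairProd g = pairProd fun i j => f i j * g i j := by
  unfold pairProd
  rw [← Finset.prod_mul_distrib]
  refine Finset.prod_congr rfl fun p _ => ?_
  split_ifs <;> simp

lemma pairProd_congr {f g : ι → ι → ℤ} (h : ∀ i j, i < j → f i j = g i j) :
    pairProd f = pairProd g := by
  unfold pairProd
  refine Finset.prod_congr rfl fun p _ => ?_
  split_ifs with hp
  · exact h _ _ hp
  · rfl

lemma pairProd_one {f : ι → ι → ℤ} (h : ∀ i j, i < j → f i j = 1) : pairProd f = 1 := by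
  unfold pairProd
  refine Finset.prod_eq_one fun p _ => ?_
  split_ifs with hp
  · exact h _ _ hp
  · rfl

/-- Over unordered pairs, a symmetric product does not depend on the order. -/
lemma pairProd_equiv (e : ι ≃ κ) (f : κ → κ → ℤ) (hf : ∀ p q, f p q = f q p) :
    pairProd f = pairProd fun i j => f (e i) (e j) := by
  unfold pairProd
  rw [← (Equiv.prodCongr e e).prod_comp]
  simp only [Equiv.prodCongr_apply, Prod.map_fst, Prod.map_snd]
  have h1 : ∀ p : ι × ι, (if e p.1 < e p.2 then f (e p.1) (e p.2) else 1) =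
      (if p.1 < p.2 ∧ e p.1 < e p.2 then f (e p.1) (e p.2) else 1) *
      (if p.2 < p.1 ∧ e p.1 < e p.2 then f (e p.1) (e p.2) else 1) := by
    intro p
    rcases lt_trichotomy p.1 p.2 with h | h | h
    · simp [h, h.not_gt]
    · simp [h]
    · simp [h, h.not_gt]
  have h2 : ∀ p : ι × ι, (if p.1 < p.2 then f (e p.1) (e p.2) else 1) =
      (if p.1 < p.2 ∧ e p.1 < e p.2 then f (e p.1) (e p.2) else 1) *
      (if p.1 < p.2 ∧ e p.2 < e p.1 then f (e p.1) (e p.2) else 1) := by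
    intro p
    rcases lt_trichotomy (e p.1) (e p.2) with h | h | h
    · simp [h, h.not_gt]
    · have := e.injective h; simp [this]
    · simp [h, h.not_gt]
  rw [Finset.prod_congr rfl fun p _ => h1 p, Finset.prod_congr rfl fun p _ => h2 p,
    Finset.prod_mul_distrib, Finset.prod_mul_distrib]
  congr 1
  rw [← (Equiv.prodComm ι ι).prod_comp]
  refine Finset.prod_congr rfl fun p _ => ?_
  simp only [Equiv.prodComm_apply, Prod.fst_swap, Prod.snd_swap]
  rw [hf]
  congr 1

/-- The Koszul sign of moving the factor in position `i` to position `e i` for all `i`, when the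
factors have parities `δ`: the product of `(-1)^{δ i δ j}` over all `i < j` with `e i > e j`. -/
def sgn (δ : ι → ZMod 2) (e : ι ≃ κ) : ℤ :=
  pairProd fun i j => if e j < e i then kos (δ i) (δ j) else 1

lemma sgn_sq (δ : ι → ZMod 2) (e : ι ≃ κ) : sgn δ e * sgn δ e = 1 := by
  unfold sgn
  rw [pairProd_mul]
  refine pairProd_one fun i j _ => ?_
  split_ifs <;> simp [kos_sq]

lemma sgn_trans (δ : ι → ZMod 2) (e : ι ≃ κ) (e' : κ ≃ ω) :
    sgn δ e * sgn (δ ∘ e.symm) e' = sgn δ (e.trans e') := by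
  have h : sgn (δ ∘ e.symm) e' = pairProd fun i j : ι =>
      if (e i < e j ↔ e' (e i) < e' (e j)) then 1 else kos (δ i) (δ j) := by
    unfold sgn
    rw [pairProd_congr (g := fun p q : κ =>
      if (p < q ↔ e' p < e' q) then 1 else kos (δ (e.symm p)) (δ (e.symm q)))]
    · rw [pairProd_equiv e]
      · simp
      · intro p q
        rcases eq_or_ne p q with rfl | hne
        · rfl
        · have h' : e' p ≠ e' q := fun hh => hne (e'.injective hh)
          rw [kos_comm]
          congr 1
          rcases lt_or_gt_of_ne hne with h1 | h1 <;> rcases lt_or_gt_of_ne h' with h2 | h2 <;>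
            simp [h1, h2, h1.not_gt, h2.not_gt]
    · intro p q hpq
      have h' : e' p ≠ e' q := fun hh => hpq.ne (e'.injective hh)
      rcases lt_or_gt_of_ne h' with h2 | h2 <;> simp [hpq, h2, h2.not_gt]
  rw [h]
  unfold sgn
  rw [pairProd_mul]
  refine pairProd_congr fun i j hij => ?_
  have h1 : e i ≠ e j := fun hh => hij.ne (e.injective hh)
  have h2 : e' (e i) ≠ e' (e j) := fun hh => h1 (e'.injective hh)
  rcases lt_or_gt_of_ne h1 with h1 | h1 <;> rcases lt_or_gt_of_ne h2 with h2 | h2 <;>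
    simp [h1, h2, h1.not_gt, h2.not_gt, kos_sq]

/-- The place permutation with the rule of signs: `R e` moves the factor in position `i` to
position `e i`, with the Koszul sign. For `σ` in the symmetric group, the right action of `σ` on tensors is
`x.σ = R σ⁻¹ x`. -/
def R (e : ι ≃ κ) : T k ι M →ₗ[k] T k κ M :=
  ∑ δ : ι → ZMod 2,
    (sgn δ e : k) • ((PiTensorProduct.reindex k (fun _ : ι => M) e).toLinearMap ∘ₗ prT δ)

lemma R_homog (e : ι ≃ κ) {δ : ι → ZMod 2} {v : ι → M} (hv : ∀ i, Homog k (δ i) (v i)) :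
    R e (PiTensorProduct.tprod k v) =
      (sgn δ e : k) • PiTensorProduct.tprod k (fun j => v (e.symm j)) := by
  unfold R
  rw [LinearMap.sum_apply, Finset.sum_eq_single δ]
  · rw [LinearMap.smul_apply, LinearMap.comp_apply, prT_homog hv, if_pos rfl]
    simp
  · intro δ' _ h
    rw [LinearMap.smul_apply, LinearMap.comp_apply, prT_homog hv, if_neg h, map_zero]
    exact smul_zero _
  · simp

lemma R_R (e : ι ≃ κ) (e' : κ ≃ ω) (x : T k ι M) : R e' (R e x) = R (e.trans e') x := by
  have : R (k := k) (M := M) e' ∘ₗ R e = R (e.trans e') := by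
    apply T_ext; intro δ v hv
    rw [LinearMap.comp_apply, R_homog e hv, map_smul,
      R_homog e' (δ := δ ∘ e.symm) (fun i => hv _), R_homog _ hv, smul_smul, ← Int.cast_mul, sgn_trans]
    rfl
  exact congrArg (fun f => f x) this

lemma R_refl (x : T k ι M) : R (Equiv.refl ι) x = x := by
  have : R (k := k) (M := M) (Equiv.refl ι) = LinearMap.id := by
    apply T_ext; intro δ v hv
    rw [R_homog _ hv]
    have : sgn δ (Equiv.refl ι) = 1 := pairProd_one fun i j h => by simp [h.not_gt]
    simp [this]
  exact congrArg (fun f => f x) this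

lemma R_symm_R (e : ι ≃ κ) (x : T k ι M) : R e.symm (R e x) = x := by
  rw [R_R, Equiv.self_trans_symm, R_refl]

lemma pr_R (e : ι ≃ κ) (a : ZMod 2) (x : T k ι M) : pr k a (R e x) = R e (pr k a x) := by
  have : pr k a ∘ₗ R (k := k) (M := M) e = R e ∘ₗ pr k a := by
    apply T_ext; intro δ v hv
    rw [LinearMap.comp_apply, LinearMap.comp_apply, R_homog e hv, map_smul, pr_T_homog hv,
      pr_T_homog (δ := δ ∘ e.symm) (fun i => hv _)]
    have : ∑ i, (δ ∘ e.symm) i = ∑ i, δ i := e.symm.sum_comp δ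
    rw [this]
    split_ifs
    · rw [R_homog e hv]
    · simp
  exact congrArg (fun f => f x) this

/-- Concatenation `M^{⊗ι} ⊗ M^{⊗κ} ≃ M^{⊗(ι ⊕ κ)}`, the positions in `ι` coming first. -/
def concat : T k ι M ⊗[k] T k κ M ≃ₗ[k] T k (ι ⊕ₗ κ) M :=
  (PiTensorProduct.tmulEquiv k M).trans (PiTensorProduct.reindex k (fun _ => M) toLex)

/-- `M^{⊗ι} ⊗ N^{⊗κ} → (M ⊕ N)^{⊗(ι ⊕ κ)}`. -/
def incl : T k ι M ⊗[k] T k κ N →ₗ[k] T k (ι ⊕ₗ κ) (M × N) :=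
  concat.toLinearMap ∘ₗ TensorProduct.map
    (PiTensorProduct.map fun _ => LinearMap.inl k M N)
    (PiTensorProduct.map fun _ => LinearMap.inr k M N)

/-- The projection `(M ⊕ N)^{⊗(ι ⊕ κ)} → M^{⊗ι} ⊗ N^{⊗κ}`. -/
def coincl : T k (ι ⊕ₗ κ) (M × N) →ₗ[k] T k ι M ⊗[k] T k κ N :=
  TensorProduct.map (PiTensorProduct.map fun _ => LinearMap.fst k M N)
    (PiTensorProduct.map fun _ => LinearMap.snd k M N) ∘ₗ concat.symm.toLinearMap

lemma concat_tmul (v : ι → M) (w : κ → M) :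
    concat (PiTensorProduct.tprod k v ⊗ₜ[k] PiTensorProduct.tprod k w) =
      PiTensorProduct.tprod k fun i : ι ⊕ₗ κ => Sum.elim v w (ofLex i) := by
  simp [concat]

lemma incl_tmul (v : ι → M) (w : κ → N) :
    incl (PiTensorProduct.tprod k v ⊗ₜ[k] PiTensorProduct.tprod k w) =
      PiTensorProduct.tprod k fun i : ι ⊕ₗ κ =>
        Sum.elim (fun a => ((v a, 0) : M × N)) (fun b => (0, w b)) (ofLex i) := by
  simp [incl, concat_tmul]

lemma coincl_tprod (z : ι ⊕ₗ κ → M × N) :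
    coincl (PiTensorProduct.tprod k z) =
      (PiTensorProduct.tprod k fun a => (z (toLex (Sum.inl a))).1) ⊗ₜ[k]
        (PiTensorProduct.tprod k fun b => (z (toLex (Sum.inr b))).2) := by
  simp [coincl, concat]

lemma coincl_incl (x : T k ι M ⊗[k] T k κ N) : coincl (incl x) = x := by
  have : coincl (k := k) ∘ₗ incl (ι := ι) (κ := κ) (M := M) (N := N) = LinearMap.id := by
    ext v w
    simp [incl_tmul, coincl_tprod]
  exact congrArg (fun f => f x) this

/-- Linear maps on `M^{⊗ι} ⊗ N^{⊗κ}` agree if they do on homogeneous tensors. -/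
lemma TT_ext {F G : T k ι M ⊗[k] T k κ N →ₗ[k] P}
    (h : ∀ (δ : ι → ZMod 2) (v : ι → M) (ε : κ → ZMod 2) (w : κ → N),
      (∀ i, Homog k (δ i) (v i)) → (∀ i, Homog k (ε i) (w i)) →
      F (PiTensorProduct.tprod k v ⊗ₜ PiTensorProduct.tprod k w) =
        G (PiTensorProduct.tprod k v ⊗ₜ PiTensorProduct.tprod k w)) : F = G := by
  refine TensorProduct.ext ?_
  apply T_ext; intro δ v hv
  apply T_ext; intro ε w hw
  exact h δ v ε w hv hw

lemma homog_inl {a : ZMod 2} {x : M} (h : Homog k a x) : Homog k a ((x, 0) : M × N) := by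
  change ((pr k a x, pr k a (0 : N)) : M × N) = _
  rw [h, map_zero]

lemma homog_inr {a : ZMod 2} {y : N} (h : Homog k a y) : Homog k a ((0, y) : M × N) := by
  change ((pr k a (0 : M), pr k a y) : M × N) = _
  rw [h, map_zero]

lemma homog_elim {δ : ι → ZMod 2} {v : ι → M} {ε : κ → ZMod 2} {w : κ → N}
    (hv : ∀ i, Homog k (δ i) (v i)) (hw : ∀ i, Homog k (ε i) (w i)) (i : ι ⊕ₗ κ) :
    Homog k (Sum.elim δ ε (ofLex i))
      (Sum.elim (fun a => ((v a, 0) : M × N)) (fun b => (0, w b)) (ofLex i)) := by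
  rcases ofLex i with a | b
  · exact homog_inl (hv a)
  · exact homog_inr (hw b)

/-- `incl` followed by a placement of the factors. -/
def inclR (ρ : ι ⊕ₗ κ ≃ ω) : T k ι M ⊗[k] T k κ N →ₗ[k] T k ω (M × N) := R ρ ∘ₗ incl

/-- The projection onto the summand that is the image of `inclR ρ`. -/
def coinclR (ρ : ι ⊕ₗ κ ≃ ω) : T k ω (M × N) →ₗ[k] T k ι M ⊗[k] T k κ N :=
  coincl ∘ₗ R ρ.symm

lemma coinclR_inclR (ρ : ι ⊕ₗ κ ≃ ω) (x : T k ι M ⊗[k] T k κ N) :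
    coinclR ρ (inclR ρ x) = x := by
  simp [coinclR, inclR, R_symm_R, coincl_incl]

lemma inclR_tmul (ρ : ι ⊕ₗ κ ≃ ω) {δ : ι → ZMod 2} {v : ι → M} {ε : κ → ZMod 2} {w : κ → N}
    (hv : ∀ i, Homog k (δ i) (v i)) (hw : ∀ i, Homog k (ε i) (w i)) :
    inclR ρ (PiTensorProduct.tprod k v ⊗ₜ[k] PiTensorProduct.tprod k w) =
      (sgn (fun i => Sum.elim δ ε (ofLex i)) ρ : k) •
      PiTensorProduct.tprod k fun p : ω =>
        Sum.elim (fun a => ((v a, 0) : M × N)) (fun b => (0, w b)) (ofLex (ρ.symm p)) := by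
  rw [inclR, LinearMap.comp_apply, incl_tmul, R_homog ρ (homog_elim hv hw)]

lemma coinclR_inclR_ne {ι' κ' : Type} [Fintype ι'] [LinearOrder ι'] [Fintype κ'] [LinearOrder κ']
    (ρ : ι ⊕ₗ κ ≃ ω) (ρ' : ι' ⊕ₗ κ' ≃ ω) (p : ω)
    (h : (ofLex (ρ.symm p)).isLeft ≠ (ofLex (ρ'.symm p)).isLeft) :
    coinclR (k := k) (M := M) (N := N) ρ' ∘ₗ inclR ρ = 0 := by
  apply TT_ext; intro δ v ε w hv hw
  rw [LinearMap.comp_apply, inclR_tmul ρ hv hw, map_smul, coinclR, LinearMap.comp_apply,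
    R_homog _ (δ := fun p => Sum.elim δ ε (ofLex (ρ.symm p)))
      (fun p => homog_elim hv hw (ρ.symm p)), map_smul, coincl_tprod]
  simp only [Equiv.symm_symm, LinearMap.zero_apply]
  have hz : (PiTensorProduct.tprod k fun a : ι' =>
        (Sum.elim (fun a => ((v a, 0) : M × N)) (fun b => (0, w b))
          (ofLex (ρ.symm (ρ' (toLex (Sum.inl a)))))).1) ⊗ₜ[k]
      (PiTensorProduct.tprod k fun b : κ' =>
        (Sum.elim (fun a => ((v a, 0) : M × N)) (fun b => (0, w b))
          (ofLex (ρ.symm (ρ' (toLex (Sum.inr b)))))).2) = 0 := by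
    rcases h' : ofLex (ρ'.symm p) with a | b
    · have hp : ρ' (toLex (Sum.inl a)) = p := by rw [← h']; simp
      rw [tprod_zero_of a, TensorProduct.zero_tmul]
      rw [hp]
      rcases h'' : ofLex (ρ.symm p) with c | c
      · simp [h', h''] at h
      · simp
    · have hp : ρ' (toLex (Sum.inr b)) = p := by rw [← h']; simp
      rw [tprod_zero_of (v := fun b : κ' => (Sum.elim (fun a => ((v a, 0) : M × N))
        (fun b => (0, w b)) (ofLex (ρ.symm (ρ' (toLex (Sum.inr b)))))).2) b,
        TensorProduct.tmul_zero]
      rw [hp]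
      rcases h'' : ofLex (ρ.symm p) with c | c
      · simp
      · simp [h', h''] at h
  rw [hz, smul_zero, smul_zero]

/-- Block permutations act on the two factors separately. -/
lemma inclR_perm (α : Equiv.Perm ι) (β : Equiv.Perm κ) (ρ : ι ⊕ₗ κ ≃ ω)
    (x : T k ι M ⊗[k] T k κ N) :
    inclR (((ofLex.trans (Equiv.sumCongr α β)).trans toLex).trans ρ) x =
      inclR ρ (TensorProduct.map (R α) (R β) x) := by
  suffices h : inclR (k := k) (M := M) (N := N)
      (((ofLex.trans (Equiv.sumCongr α β)).trans toLex).trans ρ) =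
      inclR ρ ∘ₗ TensorProduct.map (R α) (R β) from congrArg (fun f => f x) h
  apply TT_ext; intro δ v ε w hv hw
  have hs : sgn (fun i : ι ⊕ₗ κ => Sum.elim δ ε (ofLex i))
      ((ofLex.trans (Equiv.sumCongr α β)).trans toLex) = sgn δ α * sgn ε β := by
    unfold sgn pairProd
    rw [Fintype.prod_prod_type]
    rw [← (toLex : ι ⊕ κ ≃ ι ⊕ₗ κ).prod_comp, Fintype.prod_sum_type]
    have h1 : ∀ f : ι ⊕ₗ κ → ℤ, ∏ q, f q =
        (∏ a, f (toLex (Sum.inl a))) * ∏ b, f (toLex (Sum.inr b)) := by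
      intro f
      rw [← (toLex : ι ⊕ κ ≃ ι ⊕ₗ κ).prod_comp, Fintype.prod_sum_type]
    simp only [h1]
    rw [Fintype.prod_prod_type, Fintype.prod_prod_type]
    congr 1
    · refine Finset.prod_congr rfl fun a _ => ?_
      simp
    · refine Finset.prod_congr rfl fun a _ => ?_
      simp
  rw [LinearMap.comp_apply, inclR_tmul _ hv hw, TensorProduct.map_tmul, R_homog α hv,
    R_homog β hw, TensorProduct.smul_tmul_smul, map_smul,
    inclR_tmul ρ (δ := δ ∘ α.symm) (ε := ε ∘ β.symm) (fun i => hv _) (fun i => hw _),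
    ← sgn_trans, hs, smul_smul, Int.cast_mul, Int.cast_mul]
  congr 2
  · congr 2
    funext i
    rcases h : ofLex i with a | b <;> simp [h]
  · funext p
    rcases h : ofLex (ρ.symm p) with a | b <;> simp [h]

end TensorPower

section Enriched

open CategoryTheory

/-- A finite dimensional vector superspace over `k`. -/
structure SVec (k : Type u) [Field k] : Type (u + 1) where
  carrier : Type u
  [addCommGroup : AddCommGroup carrier]
  [module : Module k carrier]
  [finite : Module.Finite k carrier]
  [super : SuperSpace k carrier]

attribute [instance] SVec.addCommGroup SVec.module SVec.finite SVec.super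

instance (k : Type u) [Field k] : CoeSort (SVec k) (Type u) := ⟨SVec.carrier⟩

/-- An enrichment in superspaces: the hom-spaces of a `k`-linear category are superspaces and
composition is even. -/
class SvecEnriched (k : Type u) [Field k] (C : Type w) [Category.{u} C] [Preadditive C]
    [Linear k C] where
  homSuper : ∀ X Y : C, SuperSpace k (X ⟶ Y)
  id_even : ∀ X : C, Homog k 0 (𝟙 X)
  comp_even : ∀ {X Y Z : C} (f : X ⟶ Y) (g : Y ⟶ Z) (a b : ZMod 2),
    Homog k a f → Homog k b g → Homog k (a + b) (f ≫ g)

attribute [reducible, instance] SvecEnriched.homSuper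

variable {k : Type u} [Field k]

lemma homog_hom_iff {M N : Type u} [AddCommGroup M] [Module k M] [SuperSpace k M] [AddCommGroup N]
    [Module k N] [SuperSpace k N] {a : ZMod 2} {f : M →ₗ[k] N} :
    Homog k a f ↔ ∀ b x, Homog k b x → Homog k (a + b) (f x) := by
  constructor
  · intro hf b x hx
    have h := pr_hom_apply a f x
    rw [hf] at h
    rcases zmod2_cases b with rfl | rfl
    · rw [hx, hx.pr_of_ne (by decide), map_zero, map_zero, add_zero] at h
      rw [add_zero, h]; exact homog_pr _ _
    · rw [hx, hx.pr_of_ne (by decide), map_zero, map_zero, zero_add] at h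
      rw [h]; exact homog_pr _ _
  · intro h
    refine LinearMap.ext fun x => ?_
    rw [pr_hom_apply]
    have h0 := h 0 _ (homog_pr (k := k) 0 x)
    have h1 := h 1 _ (homog_pr (k := k) 1 x)
    rw [add_zero] at h0
    rw [h0, h1, ← map_add, pr_add]

lemma homog_comp {M N P : Type u} [AddCommGroup M] [Module k M] [SuperSpace k M] [AddCommGroup N]
    [Module k N] [SuperSpace k N] [AddCommGroup P] [Module k P] [SuperSpace k P] {a b : ZMod 2}
    {f : M →ₗ[k] N} {g : N →ₗ[k] P} (hf : Homog k a f) (hg : Homog k b g) :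
    Homog k (a + b) (g ∘ₗ f) := by
  rw [homog_hom_iff] at *
  intro c x hx
  rw [show a + b + c = b + (a + c) by ring]
  exact hg _ _ (hf _ _ hx)

lemma homog_id {M : Type u} [AddCommGroup M] [Module k M] [SuperSpace k M] :
    Homog k 0 (LinearMap.id : M →ₗ[k] M) := by
  rw [homog_hom_iff]; intro b x hx; simpa using hx

/-- An even `k`-linear functor from a category enriched in superspaces to the category of finite
dimensional superspaces (whose morphisms are all the linear maps). -/
structure SuperFunctor (k : Type u) [Field k] (C : Type w) [Category.{u} C] [Preadditive C]
    [Linear k C] [SvecEnriched k C] where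
  obj : C → SVec k
  map : ∀ {X Y : C}, (X ⟶ Y) →ₗ[k] (obj X →ₗ[k] obj Y)
  map_id : ∀ X, map (𝟙 X) = LinearMap.id
  map_comp : ∀ {X Y Z : C} (f : X ⟶ Y) (g : Y ⟶ Z), map (f ≫ g) = map g ∘ₗ map f
  map_even : ∀ {X Y : C} (f : X ⟶ Y) (a : ZMod 2), Homog k a f → Homog k a (map f)

section SuperFunctor

variable {C : Type w} [Category.{u} C] [Preadditive C] [Linear k C] [SvecEnriched k C]

/-- An even isomorphism of functors: an even linear isomorphism at each object, natural with
respect to all morphisms (even and odd). -/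
structure EvenIso (F G : SuperFunctor k C) where
  app : ∀ X : C, F.obj X ≃ₗ[k] G.obj X
  even : ∀ (X : C) (a : ZMod 2) (x : F.obj X), Homog k a x → Homog k a (app X x)
  natural : ∀ {X Y : C} (f : X ⟶ Y) (x : F.obj X), app Y (F.map f x) = G.map f (app X x)

/-- A subfunctor: a subsuperspace of each value, stable under all morphisms. -/
@[ext] structure SubFunctor (F : SuperFunctor k C) where
  sub : ∀ X : C, Submodule k (F.obj X)
  isSubsuper : ∀ X, IsSubsuper (sub X)
  stable : ∀ {X Y : C} (f : X ⟶ Y), ∀ x ∈ sub X, F.map f x ∈ sub Y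

namespace SubFunctor

variable {F : SuperFunctor k C}

instance : LE (SubFunctor F) := ⟨fun A B => ∀ X, A.sub X ≤ B.sub X⟩

instance : Top (SubFunctor F) :=
  ⟨{ sub := fun _ => ⊤, isSubsuper := fun _ _ _ _ => trivial, stable := fun _ _ _ => trivial }⟩

lemma homog_sub {M : Type u} [AddCommGroup M] [Module k M] [SuperSpace k M] {U : Submodule k M}
    (h : IsSubsuper U) {a : ZMod 2} {x : U} :
    @Homog k _ U _ _ (superSub U h) a x ↔ Homog k a (x : M) :=
  Subtype.ext_iff

/-- A subfunctor as a functor. -/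
def toSuperFunctor (A : SubFunctor F) : SuperFunctor k C where
  obj X := letI := superSub (A.sub X) (A.isSubsuper X); ⟨A.sub X⟩
  map {X Y} :=
    { toFun := fun f => ((F.map f).restrict (A.stable f) : A.sub X →ₗ[k] A.sub Y)
      map_add' := fun f g => by
        ext x; exact congrArg (fun g => g (x : F.obj X)) (F.map.map_add f g)
      map_smul' := fun r f => by
        ext x; exact congrArg (fun g => g (x : F.obj X)) (F.map.map_smul r f) }
  map_id X := LinearMap.ext fun x => Subtype.ext <|
    congrArg (fun g => g ((x : A.sub X) : F.obj X)) (F.map_id X)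
  map_comp {X _ _} f g := LinearMap.ext fun x => Subtype.ext <|
    congrArg (fun g => g ((x : A.sub X) : F.obj X)) (F.map_comp f g)
  map_even {X Y} f a hf := by
    have h := homog_hom_iff.mp (F.map_even f a hf)
    let _ := superSub (A.sub X) (A.isSubsuper X)
    let _ := superSub (A.sub Y) (A.isSubsuper Y)
    refine homog_hom_iff.mpr fun b x hx => ?_
    exact (homog_sub (A.isSubsuper Y)).mpr (h b x.1 ((homog_sub (A.isSubsuper X)).mp hx))

lemma homog_mk {M : Type u} [AddCommGroup M] [Module k M] [SuperSpace k M] {U : Submodule k M}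
    (h : IsSubsuper U) {a : ZMod 2} {x : M} (hx : Homog k a x) :
    @Homog k _ (M ⧸ U) _ _ (superQuot U h) a (U.mkQ x) := by
  change U.mapQ U (pr k a) _ (U.mkQ x) = _
  rw [Submodule.mkQ_apply, Submodule.mapQ_apply, hx]

lemma exists_homog_mk {M : Type u} [AddCommGroup M] [Module k M] [SuperSpace k M]
    {U : Submodule k M} (h : IsSubsuper U) {a : ZMod 2} {y : M ⧸ U}
    (hy : @Homog k _ (M ⧸ U) _ _ (superQuot U h) a y) : ∃ x, Homog k a x ∧ U.mkQ x = y := by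
  obtain ⟨x, rfl⟩ := U.mkQ_surjective y
  exact ⟨pr k a x, homog_pr _ _, hy⟩

/-- The quotient of a functor by a subfunctor. -/
def quotient (A : SubFunctor F) : SuperFunctor k C where
  obj X := letI := superQuot (A.sub X) (A.isSubsuper X); ⟨F.obj X ⧸ A.sub X⟩
  map {X Y} :=
    { toFun := fun f => ((A.sub X).mapQ (A.sub Y) (F.map f) (fun x hx => A.stable f x hx) :
        (F.obj X ⧸ A.sub X) →ₗ[k] (F.obj Y ⧸ A.sub Y))
      map_add' := fun f g => by
        refine Submodule.linearMap_qext _ (LinearMap.ext fun x => ?_)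
        exact congrArg (fun g => (A.sub Y).mkQ (g x)) (F.map.map_add f g)
      map_smul' := fun r f => by
        refine Submodule.linearMap_qext _ (LinearMap.ext fun x => ?_)
        exact congrArg (fun g => (A.sub Y).mkQ (g x)) (F.map.map_smul r f) }
  map_id X := by
    refine Submodule.linearMap_qext _ (LinearMap.ext fun x => ?_)
    exact congrArg (fun g => (A.sub X).mkQ (g x)) (F.map_id X)
  map_comp {X _ Z} f g := by
    refine Submodule.linearMap_qext _ (LinearMap.ext fun x => ?_)
    exact congrArg (fun g => (A.sub Z).mkQ (g x)) (F.map_comp f g)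
  map_even {X Y} f a hf := by
    have h := homog_hom_iff.mp (F.map_even f a hf)
    let _ := superQuot (A.sub X) (A.isSubsuper X)
    let _ := superQuot (A.sub Y) (A.isSubsuper Y)
    refine homog_hom_iff.mpr fun b y hy => ?_
    obtain ⟨x, hx, rfl⟩ := exists_homog_mk (A.isSubsuper X) hy
    exact homog_mk (A.isSubsuper Y) (h b x hx)

/-- The part of `B` that lies in `A`, as a subfunctor of `A`. -/
def restrict (A B : SubFunctor F) : SubFunctor A.toSuperFunctor where
  sub X := (B.sub X).comap (A.sub X).subtype
  isSubsuper X a _ hx := B.isSubsuper X a _ hx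
  stable f _ hx := B.stable f _ hx

/-- The quotient `A / B` of two subfunctors (used for `B ≤ A`). -/
def subquotient (A B : SubFunctor F) : SuperFunctor k C := (A.restrict B).quotient

/-- The sum of a family of subfunctors. -/
def sum {ι : Type} (A : ι → SubFunctor F) : SubFunctor F where
  sub X := ⨆ i, (A i).sub X
  isSubsuper X a := by
    have : ⨆ i, (A i).sub X ≤ (⨆ i, (A i).sub X).comap (pr k a) :=
      iSup_le fun i x hx => Submodule.mem_iSup_of_mem i ((A i).isSubsuper X a x hx)
    exact this
  stable {X Y} f := by
    have : ⨆ i, (A i).sub X ≤ (⨆ i, (A i).sub Y).comap (F.map f) :=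
      iSup_le fun i x hx => Submodule.mem_iSup_of_mem i ((A i).stable f x hx)
    exact this

end SubFunctor

/-- The direct sum of a finite family of functors. -/
def directSum {ι : Type} [Finite ι] (F : ι → SuperFunctor k C) : SuperFunctor k C where
  obj X := ⟨∀ i, (F i).obj X⟩
  map {X Y} :=
    { toFun := fun f => (LinearMap.pi fun i => (F i).map f ∘ₗ LinearMap.proj i :
        (∀ i, (F i).obj X) →ₗ[k] (∀ i, (F i).obj Y))
      map_add' := fun f g => LinearMap.ext fun x => funext fun i =>
        congrArg (fun g => g (x i)) ((F i).map.map_add f g)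
      map_smul' := fun r f => LinearMap.ext fun x => funext fun i =>
        congrArg (fun g => g (x i)) ((F i).map.map_smul r f) }
  map_id X := LinearMap.ext fun x => funext fun i =>
    congrArg (fun g => g (x i)) ((F i).map_id X)
  map_comp f g := LinearMap.ext fun x => funext fun i =>
    congrArg (fun g => g (x i)) ((F i).map_comp f g)
  map_even f a hf := homog_hom_iff.mpr fun b x hx => funext fun i =>
    homog_hom_iff.mp ((F i).map_even f a hf) b (x i) (congrFun hx i)

end SuperFunctor

end Enriched

section Gamma

open CategoryTheory

variable {k : Type u} [Field k]

/-- The `𝔖_d`-equivariant linear maps `M^{⊗d} → N^{⊗d}`, a model of `Γ^d Hom(M, N)`. -/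
def equivar (d : ℕ) (M N : SVec k) : Submodule k (T k (Fin d) M →ₗ[k] T k (Fin d) N) where
  carrier := {f | ∀ (σ : Equiv.Perm (Fin d)) x, f (R σ x) = R σ (f x)}
  add_mem' hf hg σ x := by simp [hf σ x, hg σ x]
  zero_mem' σ x := by simp
  smul_mem' r f hf σ x := by simp [hf σ x]

lemma equivar_isSubsuper (d : ℕ) (M N : SVec k) : IsSubsuper (equivar d M N) := by
  intro a f hf σ x
  rw [pr_hom_apply, pr_hom_apply, pr_R, pr_R, hf, hf, pr_R, pr_R, map_add]

/-- An object of the category `Γ^d` of degree `d` divided powers of `svec`: a finite dimensional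
superspace. -/
structure GammaObj (k : Type u) [Field k] (d : ℕ) where
  of : SVec k

/-- The category `Γ^d`, with `hom(M, N) = Γ^d Hom(M, N) ≃ Hom_{k𝔖_d}(M^{⊗d}, N^{⊗d})`, and with the
composition of the right hand side. -/
instance (d : ℕ) : Category.{u} (GammaObj k d) where
  Hom X Y := equivar d X.of Y.of
  id X := ⟨LinearMap.id, fun _ _ => rfl⟩
  comp f g := ⟨g.1 ∘ₗ f.1, fun σ x => by
    rw [LinearMap.comp_apply, f.2 σ x, g.2 σ (f.1 x)]; rfl⟩

instance (d : ℕ) : Preadditive (GammaObj k d) where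
  homGroup X Y := inferInstanceAs (AddCommGroup (equivar d X.of Y.of))
  add_comp _ _ _ f f' g := Subtype.ext (LinearMap.comp_add f.1 f'.1 g.1)
  comp_add _ _ _ f g g' := Subtype.ext (LinearMap.add_comp f.1 g'.1 g.1)

instance (d : ℕ) : Linear k (GammaObj k d) where
  homModule X Y := inferInstanceAs (Module k (equivar d X.of Y.of))
  smul_comp _ _ _ r f g := Subtype.ext (LinearMap.comp_smul g.1 r f.1)
  comp_smul _ _ _ f r g := Subtype.ext (LinearMap.smul_comp r g.1 f.1)

instance (d : ℕ) : SvecEnriched k (GammaObj k d) where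
  homSuper X Y := superSub (equivar d X.of Y.of) (equivar_isSubsuper d X.of Y.of)
  id_even X := (SubFunctor.homog_sub (equivar_isSubsuper d X.of X.of)).mpr homog_id
  comp_even {X Y Z} _ _ _ _ hf hg :=
    (SubFunctor.homog_sub (equivar_isSubsuper d X.of Z.of)).mpr
      (homog_comp ((SubFunctor.homog_sub (equivar_isSubsuper d X.of Y.of)).mp hf)
        ((SubFunctor.homog_sub (equivar_isSubsuper d Y.of Z.of)).mp hg))

/-- Strict polynomial superfunctors, homogeneous of degree `d`. -/
abbrev Pol (k : Type u) [Field k] (d : ℕ) := SuperFunctor k (GammaObj k d)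

section Signs

lemma kos_add_left (a b c : ZMod 2) : kos (a + b) c = kos a c * kos b c := by
  revert a b c; decide

lemma kos_add_right (a b c : ZMod 2) : kos a (b + c) = kos a b * kos a c := by
  revert a b c; decide

lemma kos_zero_left (a : ZMod 2) : kos 0 a = 1 := by revert a; decide

lemma kos_zero_right (a : ZMod 2) : kos a 0 = 1 := by revert a; decide

variable {A B : Type u} [AddCommGroup A] [Module k A] [SuperSpace k A]
  [AddCommGroup B] [Module k B] [SuperSpace k B]

/-- Every tensor is a sum of tensors of homogeneous elements. -/
lemma tensor_ind {p : A ⊗[k] B → Prop} (x : A ⊗[k] B) (h0 : p 0)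
    (hadd : ∀ x y, p x → p y → p (x + y))
    (h : ∀ a b x y, Homog k a x → Homog k b y → p (x ⊗ₜ y)) : p x := by
  induction x with
  | zero => exact h0
  | add x y hx hy => exact hadd x y hx hy
  | tmul x y =>
    rw [← pr_add (k := k) x, ← pr_add (k := k) y, TensorProduct.add_tmul, TensorProduct.tmul_add,
      TensorProduct.tmul_add]
    exact hadd _ _ (hadd _ _ (h _ _ _ _ (homog_pr _ _) (homog_pr _ _))
      (h _ _ _ _ (homog_pr _ _) (homog_pr _ _))) (hadd _ _
      (h _ _ _ _ (homog_pr _ _) (homog_pr _ _)) (h _ _ _ _ (homog_pr _ _) (homog_pr _ _)))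

lemma homog_tmul {a b : ZMod 2} {x : A} {y : B} (hx : Homog k a x) (hy : Homog k b y) :
    Homog k (a + b) (x ⊗ₜ[k] y) := by
  unfold Homog
  rw [pr_tmul]
  rcases zmod2_cases a with rfl | rfl
  · rw [zero_add, hx, hy, hx.pr_of_ne (by decide), TensorProduct.zero_tmul, add_zero]
  · rw [hx.pr_of_ne (by decide), hx, TensorProduct.zero_tmul, zero_add,
      show (1 : ZMod 2) + b + 1 = b by rw [add_comm 1 b, add_assoc, one_add_one, add_zero], hy]

lemma Homog.zero (a : ZMod 2) : Homog k a (0 : A) := map_zero _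

lemma Homog.add {a : ZMod 2} {x y : A} (hx : Homog k a x) (hy : Homog k a y) :
    Homog k a (x + y) := by unfold Homog; rw [map_add, hx, hy]

lemma Homog.smul {a : ZMod 2} {x : A} (r : k) (hx : Homog k a x) : Homog k a (r • x) := by
  unfold Homog; rw [map_smul, hx]

lemma Homog.par_eq {a : ZMod 2} {x : A} (hx : Homog k a x) :
    par k x = (kos a 1 : k) • x := by
  rcases zmod2_cases a with rfl | rfl
  · simp [par, kos, hx.pr_of_ne (a := 1) (by decide), show pr k 0 x = x from hx]
  · simp [par, kos, hx.pr_of_ne (a := 0) (by decide), show pr k 1 x = x from hx]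

lemma superTensor_homog {A' B' : Type u} [AddCommGroup A'] [Module k A'] [AddCommGroup B']
    [Module k B'] [SuperSpace k B'] (f : A →ₗ[k] A') {g : B →ₗ[k] B'} {a b : ZMod 2}
    (hg : Homog k b g) {x : A} (hx : Homog k a x) (y : B) :
    superTensor f g (x ⊗ₜ y) = (kos b a : k) • (f x ⊗ₜ[k] g y) := by
  rw [superTensor_apply, hx.par_eq]
  rcases zmod2_cases b with rfl | rfl
  · rw [hg.pr_of_ne (a := 1) (by decide), show pr k 0 g = g from hg, kos_zero_left]
    simp
  · rw [hg.pr_of_ne (a := 0) (by decide), show pr k 1 g = g from hg, kos_comm]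
    simp [TensorProduct.smul_tmul']

/-- `superTensor` as a map `Hom(A, A') ⊗ Hom(B, B') → Hom(A ⊗ B, A' ⊗ B')`. -/
def superTensorL {A' B' : Type u} [AddCommGroup A'] [Module k A'] [AddCommGroup B']
    [Module k B'] [SuperSpace k B'] :
    (A →ₗ[k] A') ⊗[k] (B →ₗ[k] B') →ₗ[k] (A ⊗[k] B →ₗ[k] A' ⊗[k] B') :=
  TensorProduct.lift superTensor

lemma superTensor_even {A' B' : Type u} [AddCommGroup A'] [Module k A'] [SuperSpace k A']
    [AddCommGroup B'] [Module k B'] [SuperSpace k B'] {f : A →ₗ[k] A'} {g : B →ₗ[k] B'}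
    {a b : ZMod 2} (hf : Homog k a f) (hg : Homog k b g) : Homog k (a + b) (superTensor f g) := by
  refine LinearMap.ext fun z => ?_
  refine tensor_ind (p := fun z => pr k (a + b) (superTensor f g) z = superTensor f g z) z
    (by simp) (fun x y hx hy => by rw [map_add, map_add, hx, hy]) ?_
  intro c d x y hx hy
  have hfx := homog_hom_iff.mp hf c x hx
  have hgy := homog_hom_iff.mp hg d y hy
  have h1 : Homog k (a + b + (c + d)) (superTensor f g (x ⊗ₜ y)) := by
    rw [superTensor_homog f hg hx, show a + b + (c + d) = (a + c) + (b + d) by ring]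
    exact (homog_tmul hfx hgy).smul _
  have h2 := homog_tmul hx hy
  rw [pr_hom_apply]
  rcases zmod2_cases (c + d) with h | h <;> rw [h] at h1 h2
  · rw [show pr k 0 (x ⊗ₜ[k] y) = _ from h2, h2.pr_of_ne (a := 1) (by decide), map_zero, map_zero,
      add_zero]
    rw [add_zero] at h1; exact h1
  · rw [show pr k 1 (x ⊗ₜ[k] y) = _ from h2, h2.pr_of_ne (a := 0) (by decide), map_zero, map_zero,
      zero_add]
    exact h1

lemma superTensor_comp {A' B' A'' B'' : Type u} [AddCommGroup A'] [Module k A'] [SuperSpace k A']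
    [AddCommGroup B'] [Module k B'] [SuperSpace k B'] [AddCommGroup A''] [Module k A'']
    [AddCommGroup B''] [Module k B''] [SuperSpace k B'']
    {f : A →ₗ[k] A'} {g : B →ₗ[k] B'} {f' : A' →ₗ[k] A''} {g' : B' →ₗ[k] B''}
    {a b b' : ZMod 2} (hf : Homog k a f) (hg : Homog k b g) (hg' : Homog k b' g') :
    superTensor f' g' ∘ₗ superTensor f g =
      (kos b' a : k) • superTensor (f' ∘ₗ f) (g' ∘ₗ g) := by
  refine LinearMap.ext fun z => ?_
  refine tensor_ind (p := fun z => (superTensor f' g' ∘ₗ superTensor f g) z =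
      ((kos b' a : k) • superTensor (f' ∘ₗ f) (g' ∘ₗ g)) z) z
    (by simp) (fun x y hx hy => by rw [map_add, map_add, hx, hy]) ?_
  intro c d x y hx hy
  have hfx := homog_hom_iff.mp hf c x hx
  rw [LinearMap.comp_apply, superTensor_homog f hg hx, map_smul, superTensor_homog f' hg' hfx,
    LinearMap.smul_apply, superTensor_homog _ (homog_comp hg hg') hx, smul_smul, smul_smul,
    ← Int.cast_mul, ← Int.cast_mul, kos_add_right, kos_add_left]
  rw [show kos b c * (kos b' a * kos b' c) = kos b' a * (kos b c * kos b' c) by ring]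
  rfl

lemma superTensor_id : superTensor (LinearMap.id : A →ₗ[k] A) (LinearMap.id : B →ₗ[k] B) =
    LinearMap.id := by
  refine LinearMap.ext fun z => ?_
  refine tensor_ind (p := fun z => superTensor (LinearMap.id : A →ₗ[k] A)
    (LinearMap.id : B →ₗ[k] B) z = LinearMap.id z) z
    (by simp) (fun x y hx hy => by rw [map_add, map_add, hx, hy]) ?_
  intro c d x y hx hy
  rw [superTensor_homog _ homog_id hx, kos_zero_left]
  simp

end Signs

section Product

variable {C D : Type w} [Category.{u} C] [Preadditive C] [Linear k C] [SvecEnriched k C]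
  [Category.{u} D] [Preadditive D] [Linear k D] [SvecEnriched k D]

/-- The composition in the product of two enriched categories, whose hom-spaces are the tensor
products of hom-spaces: `(g ⊗ g') ∘ (f ⊗ f') = (-1)^{|g'||f|} (g ∘ f) ⊗ (g' ∘ f')`. -/
def superComp {X Y Z : C} {X' Y' Z' : D} :
    (X ⟶ Y) ⊗[k] (X' ⟶ Y') →ₗ[k] (Y ⟶ Z) ⊗[k] (Y' ⟶ Z') →ₗ[k] (X ⟶ Z) ⊗[k] (X' ⟶ Z') :=
  TensorProduct.map₂ (Linear.comp X Y Z) ((Linear.comp X' Y' Z').compl₂ (pr k 0)) +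
    TensorProduct.map₂ (Linear.comp X Y Z ∘ₗ par k) ((Linear.comp X' Y' Z').compl₂ (pr k 1))

lemma superComp_homog {X Y Z : C} {X' Y' Z' : D} {a b : ZMod 2} {f : X ⟶ Y} (hf : Homog k a f)
    (f' : X' ⟶ Y') (g : Y ⟶ Z) {g' : Y' ⟶ Z'} (hg : Homog k b g') :
    superComp (k := k) (f ⊗ₜ f') (g ⊗ₜ g') = (kos b a : k) • ((f ≫ g) ⊗ₜ[k] (f' ≫ g')) := by
  simp only [superComp, LinearMap.add_apply, TensorProduct.map₂_apply_tmul,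
    TensorProduct.map_tmul, LinearMap.compl₂_apply, LinearMap.comp_apply, Linear.comp_apply]
  rw [hf.par_eq]
  rcases zmod2_cases b with rfl | rfl
  · rw [hg.pr_of_ne (a := 1) (by decide), show pr k 0 g' = g' from hg, kos_zero_left]
    simp
  · rw [hg.pr_of_ne (a := 0) (by decide), show pr k 1 g' = g' from hg, kos_comm]
    simp [TensorProduct.smul_tmul']

lemma superComp_assoc {X Y Z W : C} {X' Y' Z' W' : D} (f : (X ⟶ Y) ⊗[k] (X' ⟶ Y'))
    (g : (Y ⟶ Z) ⊗[k] (Y' ⟶ Z')) (h : (Z ⟶ W) ⊗[k] (Z' ⟶ W')) :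
    superComp (superComp f g) h = superComp f (superComp g h) := by
  refine tensor_ind (p := fun f => superComp (superComp f g) h = superComp f (superComp g h)) f
    (by simp) (fun x y hx hy => by simp only [map_add, LinearMap.add_apply, hx, hy]) ?_
  intro a a' f f' hf hf'
  refine tensor_ind (p := fun g => superComp (superComp (f ⊗ₜ f') g) h =
      superComp (f ⊗ₜ f') (superComp g h)) g
    (by simp) (fun x y hx hy => by simp only [map_add, LinearMap.add_apply, hx, hy]) ?_
  intro b b' g g' hg hg'
  refine tensor_ind (p := fun h => superComp (superComp (f ⊗ₜ f') (g ⊗ₜ g')) h =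
      superComp (f ⊗ₜ f') (superComp (g ⊗ₜ g') h)) h
    (by simp) (fun x y hx hy => by simp only [map_add, hx, hy]) ?_
  intro c c' h h' hh hh'
  rw [superComp_homog hf f' g hg', superComp_homog hg g' h hh', map_smul, map_smul,
    LinearMap.smul_apply, superComp_homog (SvecEnriched.comp_even f g a b hf hg) _ _ hh',
    superComp_homog hf _ _ (SvecEnriched.comp_even g' h' b' c' hg' hh'), smul_smul, smul_smul,
    ← Int.cast_mul, ← Int.cast_mul, kos_add_right, kos_add_left, Category.assoc, Category.assoc]
  congr 2
  ring

lemma superComp_id {X Y : C} {X' Y' : D} (f : (X ⟶ Y) ⊗[k] (X' ⟶ Y')) :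
    superComp f (𝟙 Y ⊗ₜ 𝟙 Y') = f := by
  refine tensor_ind (p := fun f => superComp f (𝟙 Y ⊗ₜ 𝟙 Y') = f) f
    (by simp) (fun x y hx hy => by simp only [map_add, LinearMap.add_apply, hx, hy]) ?_
  intro a a' f f' hf hf'
  rw [superComp_homog hf f' _ (SvecEnriched.id_even Y'), kos_zero_left]
  simp

lemma id_superComp {X Y : C} {X' Y' : D} (f : (X ⟶ Y) ⊗[k] (X' ⟶ Y')) :
    superComp (𝟙 X ⊗ₜ 𝟙 X') f = f := by
  refine tensor_ind (p := fun f => superComp (𝟙 X ⊗ₜ 𝟙 X') f = f) f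
    (by simp) (fun x y hx hy => by simp only [map_add, hx, hy]) ?_
  intro a a' f f' hf hf'
  rw [superComp_homog (SvecEnriched.id_even X) _ f hf', kos_zero_right]
  simp

lemma superComp_even {X Y Z : C} {X' Y' Z' : D} {a b : ZMod 2} {f : (X ⟶ Y) ⊗[k] (X' ⟶ Y')}
    {g : (Y ⟶ Z) ⊗[k] (Y' ⟶ Z')} (hf : Homog k a f) (hg : Homog k b g) :
    Homog k (a + b) (superComp f g) := by
  suffices h : ∀ a b, Homog k (a + b) (superComp (pr k a f) (pr k b g)) by
    have := h a b; rwa [hf, hg] at this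
  clear hf hg a b
  intro a b
  refine tensor_ind (p := fun f => Homog k (a + b) (superComp (pr k a f) (pr k b g))) f
    (by simpa using Homog.zero _) (fun x y hx hy => by
      simp only [map_add, LinearMap.add_apply]; exact hx.add hy) ?_
  intro c c' f f' hf hf'
  refine tensor_ind (p := fun g => Homog k (a + b) (superComp (pr k a (f ⊗ₜ[k] f')) (pr k b g))) g
    (by simpa using Homog.zero _) (fun x y hx hy => by
      simp only [map_add]; exact hx.add hy) ?_
  intro d d' g g' hg hg'
  have h1 := homog_tmul hf hf'
  have h2 := homog_tmul hg hg'
  by_cases ha : a = c + c'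
  · by_cases hb : b = d + d'
    · subst ha hb
      rw [h1, h2, superComp_homog hf _ _ hg',
        show c + c' + (d + d') = (c + d) + (c' + d') by ring]
      exact (homog_tmul (SvecEnriched.comp_even _ _ _ _ hf hg)
        (SvecEnriched.comp_even _ _ _ _ hf' hg')).smul _
    · rw [h2.pr_of_ne hb, map_zero]; exact Homog.zero _
  · rw [h1.pr_of_ne ha, map_zero, LinearMap.zero_apply]; exact Homog.zero _

end Product

/-- An object of the category `Γ^d(svec × svec)`: a pair of finite dimensional superspaces. -/
structure GammaBi (k : Type u) [Field k] (d : ℕ) where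
  fst : SVec k
  snd : SVec k

/-- The morphisms of `Γ^d(svec × svec)`, the direct sum over `e + f = d` of
`Γ^e Hom(M, M') ⊗ Γ^f Hom(N, N')`. -/
abbrev GammaBiHom {d : ℕ} (X Y : GammaBi k d) :=
  ∀ p : {p : ℕ × ℕ // p.1 + p.2 = d},
    ((⟨X.fst⟩ : GammaObj k p.1.1) ⟶ ⟨Y.fst⟩) ⊗[k] ((⟨X.snd⟩ : GammaObj k p.1.2) ⟶ ⟨Y.snd⟩)

instance (d : ℕ) : Category.{u} (GammaBi k d) where
  Hom X Y := GammaBiHom X Y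
  id _ := fun _ => 𝟙 _ ⊗ₜ 𝟙 _
  comp f g := fun p => superComp (f p) (g p)
  id_comp f := funext fun p => id_superComp (f p)
  comp_id f := funext fun p => superComp_id (f p)
  assoc f g h := funext fun p => superComp_assoc (f p) (g p) (h p)

instance (d : ℕ) : Preadditive (GammaBi k d) where
  homGroup X Y := inferInstanceAs (AddCommGroup (GammaBiHom X Y))
  add_comp _ _ _ f f' g := funext fun p => by
    exact LinearMap.map_add₂ superComp (f p) (f' p) (g p)
  comp_add _ _ _ f g g' := funext fun p => by
    exact (superComp (f p)).map_add (g p) (g' p)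

instance (d : ℕ) : Linear k (GammaBi k d) where
  homModule X Y := inferInstanceAs (Module k (GammaBiHom X Y))
  smul_comp _ _ _ r f g := funext fun p => by
    exact LinearMap.map_smul₂ superComp r (f p) (g p)
  comp_smul _ _ _ f r g := funext fun p => by
    exact (superComp (f p)).map_smul r (g p)

instance (d : ℕ) : SvecEnriched k (GammaBi k d) where
  homSuper X Y := inferInstanceAs (SuperSpace k (GammaBiHom X Y))
  id_even X := funext fun p => by
    have h := homog_tmul (k := k) (SvecEnriched.id_even (k := k) (⟨X.fst⟩ : GammaObj k p.1.1))
      (SvecEnriched.id_even (⟨X.snd⟩ : GammaObj k p.1.2))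
    exact h
  comp_even f g a b hf hg := funext fun p =>
    superComp_even (congrFun hf p) (congrFun hg p)

/-- Strict polynomial bisuperfunctors, homogeneous of degree `d`. -/
abbrev BiPol (k : Type u) [Field k] (d : ℕ) := SuperFunctor k (GammaBi k d)

end Gamma

section External

open CategoryTheory

variable {k : Type u} [Field k] {d e f : ℕ}

lemma superTensorL_tmul {A B A' B' : Type u} [AddCommGroup A] [Module k A] [SuperSpace k A]
    [AddCommGroup B] [Module k B] [SuperSpace k B] [AddCommGroup A'] [Module k A']
    [AddCommGroup B'] [Module k B'] [SuperSpace k B'] (f : A →ₗ[k] A') (g : B →ₗ[k] B') :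
    superTensorL (f ⊗ₜ[k] g) = superTensor f g := TensorProduct.lift.tmul _ _

lemma extTensor_comp (S : Pol k e) (S' : Pol k f) {X Y Z : GammaObj k e} {X' Y' Z' : GammaObj k f}
    (x : (X ⟶ Y) ⊗[k] (X' ⟶ Y')) (y : (Y ⟶ Z) ⊗[k] (Y' ⟶ Z')) :
    superTensorL (TensorProduct.map S.map S'.map (superComp x y))
      = superTensorL (TensorProduct.map S.map S'.map y) ∘ₗ
        superTensorL (TensorProduct.map S.map S'.map x) := by
  refine tensor_ind (p := fun x => superTensorL (TensorProduct.map S.map S'.map (superComp x y))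
      = superTensorL (TensorProduct.map S.map S'.map y) ∘ₗ
        superTensorL (TensorProduct.map S.map S'.map x)) x ?_ (fun x x' hx hx' => ?_) ?_
  · rw [map_zero superComp, LinearMap.zero_apply, map_zero, map_zero, map_zero, map_zero,
      LinearMap.comp_zero]
  · rw [map_add superComp, LinearMap.add_apply, map_add, map_add, map_add, map_add, hx, hx',
      LinearMap.comp_add]
  intro a a' f f' hf hf'
  refine tensor_ind (p := fun y => superTensorL (TensorProduct.map S.map S'.map
    (superComp (f ⊗ₜ f') y)) = superTensorL (TensorProduct.map S.map S'.map y) ∘ₗ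
      superTensorL (TensorProduct.map S.map S'.map (f ⊗ₜ f'))) y ?_ (fun x x' hx hx' => ?_) ?_
  · rw [map_zero, map_zero, map_zero, map_zero, map_zero, LinearMap.zero_comp]
  · rw [map_add, map_add, map_add, map_add, map_add, hx, hx', LinearMap.add_comp]
  intro b b' g g' hg hg'
  rw [superComp_homog hf f' g hg', map_smul, map_smul, TensorProduct.map_tmul,
    TensorProduct.map_tmul, TensorProduct.map_tmul, superTensorL_tmul, superTensorL_tmul,
    superTensorL_tmul,
    superTensor_comp (S.map_even f a hf) (S'.map_even f' a' hf') (S'.map_even g' b' hg'),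
    S.map_comp, S'.map_comp]

/-- `φ₁ ⊗ φ₂ ↦ S(φ₁) ⊗ S'(φ₂)`. -/
def extMap (S : Pol k e) (S' : Pol k f) {X Y : GammaObj k e} {X' Y' : GammaObj k f} :
    (X ⟶ Y) ⊗[k] (X' ⟶ Y') →ₗ[k] (S.obj X ⊗[k] S'.obj X' →ₗ[k] S.obj Y ⊗[k] S'.obj Y') :=
  superTensorL ∘ₗ TensorProduct.map S.map S'.map

lemma extMap_even (S : Pol k e) (S' : Pol k f) {X Y : GammaObj k e} {X' Y' : GammaObj k f}
    {a : ZMod 2} {x : (X ⟶ Y) ⊗[k] (X' ⟶ Y')} (hx : Homog k a x) :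
    Homog k a (extMap S S' x) := by
  suffices h2 : ∀ a, Homog k a (extMap S S' (pr k a x)) by
    have := h2 a; rwa [hx] at this
  clear hx a
  intro a
  refine tensor_ind (p := fun x => Homog k a (extMap S S' (pr k a x))) x ?_
    (fun x y hx hy => ?_) ?_
  · rw [map_zero, map_zero]; exact Homog.zero _
  · rw [map_add, map_add]; exact hx.add hy
  intro b c g g' hg hg'
  have h1 := homog_tmul hg hg'
  by_cases ha : a = b + c
  · subst ha
    rw [h1, extMap, LinearMap.comp_apply, TensorProduct.map_tmul, superTensorL_tmul]
    exact superTensor_even (S.map_even g b hg) (S'.map_even g' c hg')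
  · rw [h1.pr_of_ne ha, map_zero]; exact Homog.zero _

/-- The component of a given bidegree of a morphism of `Γ^d(svec × svec)`. -/
def GammaBi.comp (p : {p : ℕ × ℕ // p.1 + p.2 = d}) {X Y : GammaBi k d} :
    (X ⟶ Y) →ₗ[k] ((⟨X.fst⟩ : GammaObj k p.1.1) ⟶ ⟨Y.fst⟩) ⊗[k]
      ((⟨X.snd⟩ : GammaObj k p.1.2) ⟶ ⟨Y.snd⟩) :=
  (LinearMap.proj p : GammaBiHom X Y →ₗ[k] _)

lemma GammaBi.comp_comp (p : {p : ℕ × ℕ // p.1 + p.2 = d}) {X Y Z : GammaBi k d} (φ : X ⟶ Y)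
    (φ' : Y ⟶ Z) :
    GammaBi.comp p (φ ≫ φ') = superComp (GammaBi.comp p φ) (GammaBi.comp p φ') := rfl

lemma GammaBi.comp_id (p : {p : ℕ × ℕ // p.1 + p.2 = d}) (X : GammaBi k d) :
    GammaBi.comp p (𝟙 X) = 𝟙 (⟨X.fst⟩ : GammaObj k p.1.1) ⊗ₜ[k] 𝟙 (⟨X.snd⟩ : GammaObj k p.1.2) :=
  rfl

lemma GammaBi.comp_homog (p : {p : ℕ × ℕ // p.1 + p.2 = d}) {X Y : GammaBi k d} {φ : X ⟶ Y}
    {a : ZMod 2} (hφ : Homog k a φ) : Homog k a (GammaBi.comp p φ) := by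
  have := congrFun hφ p
  exact this

/-- The external tensor product `S ⊠ S'` of `S` of degree `e` and `S'` of degree `f`, where
`p = (e, f)`: on objects `(M, N) ↦ S(M) ⊗ S'(N)`; a morphism acts through its component of bidegree
`(e, f)`, by `φ₁ ⊗ φ₂ ↦ S(φ₁) ⊗ S'(φ₂)`. -/
def extTensorAt (p : {p : ℕ × ℕ // p.1 + p.2 = d}) (S : Pol k p.1.1) (S' : Pol k p.1.2) :
    BiPol k d where
  obj X := ⟨S.obj ⟨X.fst⟩ ⊗[k] S'.obj ⟨X.snd⟩⟩
  map := extMap S S' ∘ₗ GammaBi.comp p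
  map_id X := by
    rw [LinearMap.comp_apply, GammaBi.comp_id, extMap, LinearMap.comp_apply,
      TensorProduct.map_tmul, S.map_id, S'.map_id, superTensorL_tmul, superTensor_id]
  map_comp {X Y Z} φ φ' := by
    rw [LinearMap.comp_apply, GammaBi.comp_comp]
    exact extTensor_comp S S' (GammaBi.comp p φ) (GammaBi.comp p φ')
  map_even _ _ hφ := extMap_even S S' (GammaBi.comp_homog p hφ)

/-- The external tensor product `S ⊠ S'` of functors of degrees `e` and `f`, where `e + f = d`. -/
def extTensor (h : e + f = d) (S : Pol k e) (S' : Pol k f) : BiPol k d :=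
  extTensorAt ⟨(e, f), h⟩ S S'

/-- The direct sum of two superspaces. -/
abbrev SVec.sum (M N : SVec k) : SVec k := ⟨M × N⟩

/-- An element of `Γ^e Hom(M, M') ⊗ Γ^f Hom(N, N')` as a map
`M^{⊗e} ⊗ N^{⊗f} → M'^{⊗e} ⊗ N'^{⊗f}`. -/
def realize {M M' N N' : SVec k} :
    ((⟨M⟩ : GammaObj k e) ⟶ ⟨M'⟩) ⊗[k] ((⟨N⟩ : GammaObj k f) ⟶ ⟨N'⟩) →ₗ[k]
      (T k (Fin e) M ⊗[k] T k (Fin f) N →ₗ[k] T k (Fin e) M' ⊗[k] T k (Fin f) N') :=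
  superTensorL ∘ₗ TensorProduct.map (equivar e M M').subtype (equivar f N N').subtype

lemma realize_perm {M M' N N' : SVec k}
    (φ : ((⟨M⟩ : GammaObj k e) ⟶ ⟨M'⟩) ⊗[k] ((⟨N⟩ : GammaObj k f) ⟶ ⟨N'⟩))
    (α : Equiv.Perm (Fin e)) (β : Equiv.Perm (Fin f)) (x : T k (Fin e) M ⊗[k] T k (Fin f) N) :
    realize φ (TensorProduct.map (R α) (R β) x) = TensorProduct.map (R α) (R β) (realize φ x) := by
  induction φ with
  | zero => simp
  | add φ ψ h h' => simp only [map_add, LinearMap.add_apply, h, h']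
  | tmul φ ψ =>
    induction x with
    | zero => simp
    | add x y h h' => simp only [map_add, h, h']
    | tmul x y =>
      change superTensor φ.1 ψ.1 _ = TensorProduct.map (R α) (R β) (superTensor φ.1 ψ.1 _)
      have hp : par k (R α x) = R α (par k x) := by
        simp only [par, LinearMap.sub_apply, pr_R, map_sub]
      have hψ : ∀ a, pr k a ψ.1 (R β y) = R β (pr k a ψ.1 y) :=
        fun a => equivar_isSubsuper f N N' a ψ.1 ψ.2 β y
      rw [TensorProduct.map_tmul, superTensor_apply, superTensor_apply, map_add,
        TensorProduct.map_tmul, TensorProduct.map_tmul, hψ, hψ, hp, φ.2 α x, φ.2 α (par k x)]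

/-- The increasing enumeration of `A`, followed by the increasing enumeration of its complement. -/
def placeOf (A : Finset (Fin d)) {e f : ℕ} (he : A.card = e) (hf : Aᶜ.card = f) :
    Fin e ⊕ₗ Fin f ≃ Fin d :=
  ofLex.trans (finSumEquivOfFinset he hf)

lemma placeOf_isLeft (A : Finset (Fin d)) {e f : ℕ} (he : A.card = e) (hf : Aᶜ.card = f)
    (p : Fin d) : (ofLex ((placeOf A he hf).symm p)).isLeft = decide (p ∈ A) := by
  obtain ⟨q, rfl⟩ := (placeOf A he hf).surjective p
  rw [Equiv.symm_apply_apply]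
  rcases h : ofLex q with a | b
  · have : placeOf A he hf q = A.orderEmbOfFin he a := by
      simp [placeOf, h]
    rw [this]; simp
  · have : placeOf A he hf q = Aᶜ.orderEmbOfFin hf b := by
      simp [placeOf, h]
    have h2 := Finset.orderEmbOfFin_mem Aᶜ hf b
    rw [Finset.mem_compl] at h2
    rw [this]; simp [h2]

lemma card_add_compl (A : Finset (Fin d)) : A.card + Aᶜ.card = d := by
  rw [Finset.card_add_card_compl, Fintype.card_fin]

/-- The embedding of `⊕ Γ^e Hom(M, M') ⊗ Γ^f Hom(N, N')` into `Hom((M⊕N)^{⊗d}, (M'⊕N')^{⊗d})` that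
comes from the exponential property: `φ₁ ⊗ φ₂` goes to the sum of the copies of `φ₁ ⊗ φ₂` over all
ways to place `e` factors from `M` and `f` factors from `N`. -/
def biLin {X Y : GammaBi k d} (φ : X ⟶ Y) :
    T k (Fin d) (X.fst.sum X.snd) →ₗ[k] T k (Fin d) (Y.fst.sum Y.snd) :=
  ∑ A : Finset (Fin d), inclR (placeOf A rfl rfl) ∘ₗ
    realize (φ ⟨(A.card, Aᶜ.card), card_add_compl A⟩) ∘ₗ coinclR (placeOf A rfl rfl)

lemma biLin_placeOf {X Y : GammaBi k d} (φ : X ⟶ Y) (h : e + f = d) (A : Finset (Fin d))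
    (he : A.card = e) (hf : Aᶜ.card = f) (x : T k (Fin e) X.fst ⊗[k] T k (Fin f) X.snd) :
    biLin φ (inclR (placeOf A he hf) x) =
      inclR (placeOf A he hf) (realize (φ ⟨(e, f), h⟩) x) := by
  subst he hf
  unfold biLin
  rw [LinearMap.sum_apply, Finset.sum_eq_single A]
  · simp only [LinearMap.comp_apply, coinclR_inclR]
  · intro B _ hB
    obtain ⟨p, hp⟩ : ∃ p, ¬ (p ∈ A ↔ p ∈ B) := by
      by_contra hh; push Not at hh; exact hB (Finset.ext fun p => (hh p).symm)
    have := coinclR_inclR_ne (k := k) (M := X.fst) (N := X.snd) (placeOf A rfl rfl)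
      (placeOf B rfl rfl) p (by
        rw [placeOf_isLeft, placeOf_isLeft]
        intro hh; exact hp (by simpa using hh))
    have := congrArg (fun f => f x) this
    simp only [LinearMap.comp_apply, LinearMap.zero_apply] at this
    simp only [LinearMap.comp_apply, this, map_zero]
  · simp

lemma exists_placeOf (ρ : Fin e ⊕ₗ Fin f ≃ Fin d) :
    ∃ (A : Finset (Fin d)) (he : A.card = e) (hf : Aᶜ.card = f) (α : Equiv.Perm (Fin e))
      (β : Equiv.Perm (Fin f)),
      ρ = ((ofLex.trans (Equiv.sumCongr α β)).trans toLex).trans (placeOf A he hf) := by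
  classical
  let A : Finset (Fin d) := Finset.univ.map
    ⟨fun a : Fin e => ρ (toLex (Sum.inl a)), fun a b h => by simpa using h⟩
  have hd : e + f = d := by
    have := Fintype.card_congr ((toLex : Fin e ⊕ Fin f ≃ _).trans ρ)
    simpa using this
  have he : A.card = e := by simp [A]
  have hf : Aᶜ.card = f := by
    have := card_add_compl A; omega
  have hA : ∀ q, ρ q ∈ A ↔ (ofLex q).isLeft := by
    intro q
    rcases h : ofLex q with a | b
    · have : q = toLex (Sum.inl a) := by rw [← h]; simp
      simpa [A, this] using ⟨a, rfl⟩
    · have : q = toLex (Sum.inr b) := by rw [← h]; simp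
      simp only [A, this, Finset.mem_map, Finset.mem_univ, true_and, Sum.isLeft_inr,
        Bool.false_eq_true, iff_false, not_exists]
      intro x hx
      have := ρ.injective hx
      simp at this
  let τ : Equiv.Perm (Fin e ⊕ Fin f) :=
    ((toLex.trans ρ).trans (placeOf A he hf).symm).trans ofLex
  have hτ : τ ∈ (Equiv.Perm.sumCongrHom (Fin e) (Fin f)).range := by
    apply Equiv.Perm.mem_sumCongrHom_range_of_perm_mapsTo_inl
    rintro _ ⟨a, rfl⟩
    have h1 : (τ (Sum.inl a)).isLeft = true := by
      simp only [τ, Equiv.trans_apply, placeOf_isLeft, decide_eq_true_eq, hA]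
      rfl
    obtain ⟨b, hb⟩ := Sum.isLeft_iff.mp h1
    exact ⟨b, hb.symm⟩
  obtain ⟨⟨α, β⟩, h⟩ := hτ
  refine ⟨A, he, hf, α, β, ?_⟩
  have h' : Equiv.sumCongr α β = τ := h
  rw [h']
  ext q
  simp [τ]

/-- The property that characterizes `biLin`. -/
lemma biLin_inclR {X Y : GammaBi k d} (φ : X ⟶ Y) (h : e + f = d) (ρ : Fin e ⊕ₗ Fin f ≃ Fin d)
    (x : T k (Fin e) X.fst ⊗[k] T k (Fin f) X.snd) :
    biLin φ (inclR ρ x) = inclR ρ (realize (φ ⟨(e, f), h⟩) x) := by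
  obtain ⟨A, he, hf, α, β, rfl⟩ := exists_placeOf ρ
  rw [inclR_perm, inclR_perm, biLin_placeOf φ h, realize_perm]

/-- The images of the maps `inclR` span. -/
lemma bi_ext {M N : SVec k} {P : Type u} [AddCommGroup P] [Module k P]
    {F G : T k (Fin d) (M.sum N) →ₗ[k] P}
    (h : ∀ (e f : ℕ) (_ : e + f = d) (ρ : Fin e ⊕ₗ Fin f ≃ Fin d)
      (x : T k (Fin e) M ⊗[k] T k (Fin f) N), F (inclR ρ x) = G (inclR ρ x)) : F = G := by
  classical
  ext v
  simp only [LinearMap.compMultilinearMap_apply]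
  let q : Bool × ZMod 2 → (M × N) →ₗ[k] (M × N) := fun c =>
    if c.1 then LinearMap.inl k M N ∘ₗ pr k c.2 ∘ₗ LinearMap.fst k M N
    else LinearMap.inr k M N ∘ₗ pr k c.2 ∘ₗ LinearMap.snd k M N
  have hq : ∀ x, ∑ c, q c x = x := by
    intro x
    rw [Fintype.sum_prod_type]
    simp only [Fintype.sum_bool, q, if_true, Bool.false_eq_true, if_false, LinearMap.comp_apply]
    rw [← map_sum, ← map_sum, sum_pr, sum_pr]
    ext <;> simp
  rw [← sum_tprod q hq v, map_sum, map_sum]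
  refine Finset.sum_congr rfl fun γ _ => ?_
  let A : Finset (Fin d) := Finset.univ.filter fun i => (γ i).1
  let ρ := placeOf A rfl rfl
  have hm : ∀ i : Fin A.card, Homog k (γ (ρ (toLex (Sum.inl i)))).2
      (pr k (γ (ρ (toLex (Sum.inl i)))).2 (v (ρ (toLex (Sum.inl i)))).1) := fun i => homog_pr _ _
  have hn : ∀ i : Fin Aᶜ.card, Homog k (γ (ρ (toLex (Sum.inr i)))).2
      (pr k (γ (ρ (toLex (Sum.inr i)))).2 (v (ρ (toLex (Sum.inr i)))).2) := fun i => homog_pr _ _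
  have key := inclR_tmul ρ hm hn
  have hv : (fun p => Sum.elim
      (fun i => ((pr k (γ (ρ (toLex (Sum.inl i)))).2 (v (ρ (toLex (Sum.inl i)))).1, 0) : M × N))
      (fun i => (0, pr k (γ (ρ (toLex (Sum.inr i)))).2 (v (ρ (toLex (Sum.inr i)))).2))
      (ofLex (ρ.symm p))) = fun p => q (γ p) (v p) := by
    funext p
    have hp := placeOf_isLeft A rfl rfl p
    rcases h' : ofLex (ρ.symm p) with i | i
    · have hp' : ρ (toLex (Sum.inl i)) = p := by rw [← h']; simp
      have h1 : (γ p).1 = true := by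
        change (ofLex (ρ.symm p)).isLeft = _ at hp
        rw [h'] at hp
        simpa [A] using hp
      subst hp'
      simp [q, h1]
    · have hp' : ρ (toLex (Sum.inr i)) = p := by rw [← h']; simp
      have h1 : (γ p).1 = false := by
        change (ofLex (ρ.symm p)).isLeft = _ at hp
        rw [h'] at hp
        simpa [A] using hp
      subst hp'
      simp [q, h1]
  rw [hv] at key
  set s := sgn (fun i => Sum.elim (fun i => (γ (ρ (toLex (Sum.inl i)))).2)
    (fun i => (γ (ρ (toLex (Sum.inr i)))).2) (ofLex i)) ρ with hs
  have hss : ((s : k) * (s : k)) = 1 := by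
    rw [← Int.cast_mul, hs, sgn_sq, Int.cast_one]
  have key2 : PiTensorProduct.tprod k (fun p => q (γ p) (v p)) = (s : k) • inclR ρ
      ((PiTensorProduct.tprod k fun i : Fin A.card =>
          pr k (γ (ρ (toLex (Sum.inl i)))).2 (v (ρ (toLex (Sum.inl i)))).1) ⊗ₜ[k]
        PiTensorProduct.tprod k fun i : Fin Aᶜ.card =>
          pr k (γ (ρ (toLex (Sum.inr i)))).2 (v (ρ (toLex (Sum.inr i)))).2) := by
    rw [key, smul_smul, hss, one_smul]
  rw [key2, map_smul, map_smul, h _ _ (card_add_compl A)]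

lemma biLin_mem {X Y : GammaBi k d} (φ : X ⟶ Y) :
    biLin φ ∈ equivar d (X.fst.sum X.snd) (Y.fst.sum Y.snd) := by
  intro σ
  suffices h : biLin φ ∘ₗ R σ = R σ ∘ₗ biLin φ from fun x => congrArg (fun f => f x) h
  apply bi_ext
  intro e f h ρ x
  have h1 : ∀ {M N : SVec k} (x : T k (Fin e) M ⊗[k] T k (Fin f) N),
      R σ (inclR ρ x) = inclR (ρ.trans σ) x := by
    intro M N x; simp only [inclR, LinearMap.comp_apply, R_R]
  rw [LinearMap.comp_apply, LinearMap.comp_apply, h1, biLin_inclR φ h, biLin_inclR φ h, h1]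

/-- The action on morphisms of the functor `(M, N) ↦ M ⊕ N` from `Γ^d(svec × svec)` to `Γ^d`. -/
def biMap {X Y : GammaBi k d} :
    (X ⟶ Y) →ₗ[k] ((⟨X.fst.sum X.snd⟩ : GammaObj k d) ⟶ ⟨Y.fst.sum Y.snd⟩) where
  toFun φ := ⟨biLin φ, biLin_mem φ⟩
  map_add' φ ψ := by
    refine Subtype.ext ?_
    change biLin (φ + ψ) = biLin φ + biLin ψ
    apply bi_ext
    intro e f h ρ x
    rw [LinearMap.add_apply, biLin_inclR _ h, biLin_inclR _ h, biLin_inclR _ h, ← map_add,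
      ← LinearMap.add_apply, ← map_add]
    rfl
  map_smul' r φ := by
    refine Subtype.ext ?_
    change biLin (r • φ) = r • biLin φ
    apply bi_ext
    intro e f h ρ x
    rw [LinearMap.smul_apply, biLin_inclR _ h, biLin_inclR _ h, ← map_smul,
      ← LinearMap.smul_apply, ← map_smul]
    rfl

end External

section Bi

open CategoryTheory

variable {k : Type u} [Field k] {d e f : ℕ}

/-- The functor `M ↦ M^{⊗d}`. -/
def tensorPow (k : Type u) [Field k] (d : ℕ) : Pol k d where
  obj X := ⟨T k (Fin d) X.of⟩
  map {X Y} := (equivar d X.of Y.of).subtype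
  map_id _ := rfl
  map_comp _ _ := rfl
  map_even {X Y} _ _ hf := (SubFunctor.homog_sub (equivar_isSubsuper d X.of Y.of)).mp hf

lemma realize_eq {M M' N N' : SVec k} :
    realize (e := e) (f := f) (M := M) (M' := M') (N := N) (N' := N') =
      extMap (tensorPow k e) (tensorPow k f) := rfl

lemma pr_inclR {M N : SVec k} (ρ : Fin e ⊕ₗ Fin f ≃ Fin d) (a : ZMod 2)
    (x : T k (Fin e) M ⊗[k] T k (Fin f) N) : pr k a (inclR ρ x) = inclR ρ (pr k a x) := by
  suffices h : pr k a ∘ₗ inclR ρ = inclR ρ ∘ₗ pr k a from congrArg (fun f => f x) h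
  apply TT_ext
  intro δ v ε w hv hw
  rw [LinearMap.comp_apply, LinearMap.comp_apply]
  have h1 : Homog k (∑ i, δ i) (PiTensorProduct.tprod k v) := by
    unfold Homog; rw [pr_T_homog hv, if_pos rfl]
  have h2 : Homog k (∑ i, ε i) (PiTensorProduct.tprod k w) := by
    unfold Homog; rw [pr_T_homog hw, if_pos rfl]
  have h3 := homog_tmul h1 h2
  have hs : ∑ i : Fin e ⊕ₗ Fin f, Sum.elim δ ε (ofLex i) = ∑ i, δ i + ∑ i, ε i := by
    rw [← (toLex : Fin e ⊕ Fin f ≃ _).sum_comp, Fintype.sum_sum_type]; rfl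
  have h4 : Homog k (∑ i, δ i + ∑ i, ε i)
      (inclR ρ (PiTensorProduct.tprod k v ⊗ₜ[k] PiTensorProduct.tprod k w)) := by
    rw [inclR, LinearMap.comp_apply]
    unfold Homog
    rw [pr_R, incl_tmul, pr_T_homog (homog_elim hv hw), if_pos hs]
  by_cases ha : a = ∑ i, δ i + ∑ i, ε i
  · subst ha; rw [h3, h4]
  · rw [h4.pr_of_ne ha, h3.pr_of_ne ha, map_zero]

lemma biLin_comp {X Y : GammaBi k d} (φ : X ⟶ Y) (p : {p : ℕ × ℕ // p.1 + p.2 = d})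
    (ρ : Fin p.1.1 ⊕ₗ Fin p.1.2 ≃ Fin d) (x : T k (Fin p.1.1) X.fst ⊗[k] T k (Fin p.1.2) X.snd) :
    biLin φ (inclR ρ x) = inclR ρ (realize (GammaBi.comp p φ) x) := biLin_inclR φ p.2 ρ x

lemma bi_ext_comp {M N : SVec k} {P : Type u} [AddCommGroup P] [Module k P]
    {F G : T k (Fin d) (M.sum N) →ₗ[k] P}
    (h : ∀ (p : {p : ℕ × ℕ // p.1 + p.2 = d}) (ρ : Fin p.1.1 ⊕ₗ Fin p.1.2 ≃ Fin d)
      (x : T k (Fin p.1.1) M ⊗[k] T k (Fin p.1.2) N), F (inclR ρ x) = G (inclR ρ x)) : F = G :=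
  bi_ext fun e f hh ρ x => h ⟨(e, f), hh⟩ ρ x

lemma realize_comp {M M' M'' N N' N'' : SVec k}
    (φ : ((⟨M⟩ : GammaObj k e) ⟶ ⟨M'⟩) ⊗[k] ((⟨N⟩ : GammaObj k f) ⟶ ⟨N'⟩))
    (φ' : ((⟨M'⟩ : GammaObj k e) ⟶ ⟨M''⟩) ⊗[k] ((⟨N'⟩ : GammaObj k f) ⟶ ⟨N''⟩)) :
    realize (superComp φ φ') = realize φ' ∘ₗ realize φ :=
  extTensor_comp (tensorPow k e) (tensorPow k f) φ φ'

/-- The bisuperfunctor `F^{bi}(M, N) = F(M ⊕ N)`. -/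
def bi (F : Pol k d) : BiPol k d where
  obj X := F.obj ⟨X.fst.sum X.snd⟩
  map := F.map ∘ₗ biMap
  map_id X := by
    have : biMap (𝟙 X) = 𝟙 (⟨X.fst.sum X.snd⟩ : GammaObj k d) := by
      refine Subtype.ext ?_
      change biLin (𝟙 X) = LinearMap.id
      apply bi_ext
      intro e f h ρ x
      rw [biLin_inclR _ h, LinearMap.id_apply]
      congr 1
      change superTensor LinearMap.id LinearMap.id x = x
      rw [superTensor_id, LinearMap.id_apply]
    rw [LinearMap.comp_apply, this, F.map_id]
  map_comp {X Y Z} φ φ' := by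
    have : biMap (φ ≫ φ') = biMap φ ≫ biMap φ' := by
      refine Subtype.ext ?_
      change biLin (φ ≫ φ') = biLin φ' ∘ₗ biLin φ
      apply bi_ext_comp
      intro p ρ x
      rw [LinearMap.comp_apply, biLin_comp φ, biLin_comp φ', biLin_comp, GammaBi.comp_comp,
        realize_comp, LinearMap.comp_apply]
    rw [LinearMap.comp_apply, this, F.map_comp]
    rfl
  map_even {X Y} φ a hφ := by
    refine F.map_even _ a ?_
    refine (SubFunctor.homog_sub (equivar_isSubsuper d _ _)).mpr ?_
    change pr k a (biLin φ) = biLin φ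
    apply bi_ext_comp
    intro p ρ x
    have h1 : Homog k a (realize (GammaBi.comp p φ)) :=
      extMap_even (tensorPow k p.1.1) (tensorPow k p.1.2) (GammaBi.comp_homog p hφ)
    rw [pr_hom_apply, pr_inclR, pr_inclR, biLin_comp φ, biLin_comp φ, biLin_comp φ,
      pr_inclR, pr_inclR, ← map_add, ← pr_hom_apply, h1]

end Bi

section ParityShift

variable {k : Type u} [Field k] {M N : Type u}
  [AddCommGroup M] [Module k M] [SuperSpace k M]
  [AddCommGroup N] [Module k N] [SuperSpace k N]
variable {ι κ : Type} [Fintype ι] [LinearOrder ι] [Fintype κ] [LinearOrder κ]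

/-- The sign `∏_{i < j} (-1)^{δ i}`. -/
def oneSgn (δ : ι → ZMod 2) : ℤ := pairProd fun i _ => kos (δ i) 1

lemma oneSgn_sq (δ : ι → ZMod 2) : oneSgn δ * oneSgn δ = 1 := by
  unfold oneSgn
  rw [pairProd_mul]
  exact pairProd_one fun i j _ => kos_sq _ _

/-- The tensor power `1^{⊗ι} : (ΠM)^{⊗ι} → M^{⊗ι}` of the odd map `1 : ΠM → M`, with the rule of
signs: `v₁ ⊗ ⋯ ⊗ v_d ↦ ∏_{i < j} (-1)^{|v_i|} v₁ ⊗ ⋯ ⊗ v_d`, with parities taken in `ΠM`. -/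
def oneMap : T k ι (Parity M) →ₗ[k] T k ι M :=
  ∑ δ : ι → ZMod 2, (oneSgn δ : k) • (PiTensorProduct.map fun _ => unPar k) ∘ₗ prT δ

lemma oneMap_homog {δ : ι → ZMod 2} {v : ι → Parity M} (hv : ∀ i, Homog k (δ i) (v i)) :
    oneMap (PiTensorProduct.tprod k v) =
      (oneSgn δ : k) • PiTensorProduct.tprod k (fun i => unPar k (v i)) := by
  unfold oneMap
  rw [LinearMap.sum_apply, Finset.sum_eq_single δ]
  · rw [LinearMap.smul_apply, LinearMap.comp_apply, prT_homog hv, if_pos rfl,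
      PiTensorProduct.map_tprod]
  · intro δ' _ h
    rw [LinearMap.smul_apply, LinearMap.comp_apply, prT_homog hv, if_neg h, map_zero, smul_zero]
  · simp

lemma homog_unPar {a : ZMod 2} {x : Parity M} (h : Homog k a x) : Homog k (a + 1) (unPar k x) := h

lemma homog_toPar {a : ZMod 2} {x : M} (h : Homog k a x) : Homog k (a + 1) (toPar k x) := by
  change pr k (a + 1 + 1) x = x
  rw [add_assoc, one_add_one, add_zero]; exact h

/-- The inverse of `oneMap`. -/
def oneInv : T k ι M →ₗ[k] T k ι (Parity M) :=
  ∑ δ : ι → ZMod 2, (oneSgn (fun i => δ i + 1) : k) •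
    (PiTensorProduct.map fun _ => toPar k) ∘ₗ prT δ

lemma oneInv_homog {δ : ι → ZMod 2} {v : ι → M} (hv : ∀ i, Homog k (δ i) (v i)) :
    oneInv (PiTensorProduct.tprod k v) =
      (oneSgn (fun i => δ i + 1) : k) • PiTensorProduct.tprod k (fun i => toPar k (v i)) := by
  unfold oneInv
  rw [LinearMap.sum_apply, Finset.sum_eq_single δ]
  · rw [LinearMap.smul_apply, LinearMap.comp_apply, prT_homog hv, if_pos rfl,
      PiTensorProduct.map_tprod]
  · intro δ' _ h
    rw [LinearMap.smul_apply, LinearMap.comp_apply, prT_homog hv, if_neg h, map_zero, smul_zero]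
  · simp

lemma oneMap_oneInv (x : T k ι M) : oneMap (oneInv x) = x := by
  suffices h : oneMap ∘ₗ oneInv = (LinearMap.id : T k ι M →ₗ[k] _) from congrArg (fun f => f x) h
  apply T_ext
  intro δ v hv
  rw [LinearMap.comp_apply, oneInv_homog hv, map_smul, oneMap_homog fun i => homog_toPar (hv i),
    smul_smul, ← Int.cast_mul, oneSgn_sq, Int.cast_one, one_smul]
  rfl

lemma oneInv_oneMap (x : T k ι (Parity M)) : oneInv (oneMap x) = x := by
  suffices h : oneInv ∘ₗ oneMap = (LinearMap.id : T k ι (Parity M) →ₗ[k] _) from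
    congrArg (fun f => f x) h
  apply T_ext
  intro δ v hv
  rw [LinearMap.comp_apply, oneMap_homog hv, map_smul, oneInv_homog fun i => homog_unPar (hv i),
    smul_smul, ← Int.cast_mul]
  have : (fun i => δ i + 1 + 1) = δ := by
    funext i; rw [add_assoc, one_add_one, add_zero]
  rw [this, oneSgn_sq, Int.cast_one, one_smul]
  rfl

/-- The sign of a bijection of finite totally ordered sets. -/
def invSgn (e : ι ≃ κ) : ℤ := sgn (fun _ => 1) e

lemma invSgn_sq (e : ι ≃ κ) : invSgn e * invSgn e = 1 := sgn_sq _ _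

lemma oneSgn_perm (e : ι ≃ κ) (δ : ι → ZMod 2) :
    sgn δ e * oneSgn (δ ∘ e.symm) = invSgn e * (oneSgn δ * sgn (fun i => δ i + 1) e) := by
  have h : oneSgn (δ ∘ e.symm) =
      pairProd fun i j : ι => if e i < e j then kos (δ i) 1 else kos (δ j) 1 := by
    unfold oneSgn
    rw [pairProd_congr (g := fun p q : κ =>
      if p < q then kos (δ (e.symm p)) 1 else kos (δ (e.symm q)) 1), pairProd_equiv e]
    · simp
    · intro p q
      rcases lt_trichotomy p q with h | h | h
      · simp [h, h.not_gt]
      · simp [h]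
      · simp [h, h.not_gt]
    · intro p q hpq; simp [hpq]
  rw [h]
  unfold invSgn oneSgn sgn
  rw [pairProd_mul, pairProd_mul, pairProd_mul]
  refine pairProd_congr fun i j hij => ?_
  have h1 : e i ≠ e j := fun hh => hij.ne (e.injective hh)
  rcases lt_or_gt_of_ne h1 with h1 | h1
  · simp [h1, h1.not_gt]
  · simp only [h1, h1.not_gt, if_true, if_false]
    generalize δ i = a
    generalize δ j = b
    revert a b
    decide

lemma oneMap_R (e : ι ≃ κ) (x : T k ι (Parity M)) :
    oneMap (R e x) = (invSgn e : k) • R e (oneMap x) := by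
  suffices h : oneMap ∘ₗ R e = (invSgn e : k) • (R e ∘ₗ oneMap (k := k) (M := M)) from
    congrArg (fun f => f x) h
  apply T_ext
  intro δ v hv
  rw [LinearMap.comp_apply, R_homog e hv, map_smul, oneMap_homog (δ := δ ∘ e.symm) fun i => hv _,
    LinearMap.smul_apply, LinearMap.comp_apply, oneMap_homog hv, map_smul,
    R_homog e fun i => homog_unPar (hv i), smul_smul, smul_smul, smul_smul, ← Int.cast_mul,
    ← Int.cast_mul, ← Int.cast_mul, oneSgn_perm, mul_assoc]

lemma pr_oneMap (a : ZMod 2) (x : T k ι (Parity M)) :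
    pr k a (oneMap x) = oneMap (pr k (a + Fintype.card ι) x) := by
  suffices h : pr k a ∘ₗ oneMap = oneMap ∘ₗ pr k (a + Fintype.card ι) (M := T k ι (Parity M)) from
    congrArg (fun f => f x) h
  apply T_ext
  intro δ v hv
  rw [LinearMap.comp_apply, LinearMap.comp_apply, oneMap_homog hv, map_smul,
    pr_T_homog fun i => homog_unPar (hv i), pr_T_homog hv]
  have hs : ∑ i, (δ i + 1) = ∑ i, δ i + Fintype.card ι := by
    rw [Finset.sum_add_distrib]; simp
  have hc : (∑ i, (δ i + 1) = a) ↔ (∑ i, δ i = a + Fintype.card ι) := by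
    rw [hs]
    generalize (∑ i, δ i) = s
    generalize (Fintype.card ι : ZMod 2) = c
    revert a s c
    decide
  by_cases hh : ∑ i, δ i = a + Fintype.card ι
  · rw [if_pos hh, if_pos (hc.mpr hh), oneMap_homog hv]
  · rw [if_neg hh, if_neg (fun h' => hh (hc.mp h')), map_zero, smul_zero]

end ParityShift

section Blocks

open CategoryTheory

variable {k : Type u} [Field k] {d : ℕ}

/-- `σ` lies in the Young subgroup of the partition of `{1, …, d}` into the fibres of `c`. -/
def InYoung (c : Fin d → ℕ) (σ : Equiv.Perm (Fin d)) : Prop := ∀ i, c (σ i) = c i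

lemma InYoung.symm {c : Fin d → ℕ} {σ : Equiv.Perm (Fin d)} (h : InYoung c σ) :
    InYoung c σ.symm := fun i => by
  rw [← h (σ.symm i), Equiv.apply_symm_apply]

/-- The tensor product `Γ^{α₁}(V) ⊗ Γ^{α₂}(V) ⊗ ⋯` of divided powers, as the invariants in `V^{⊗d}`
of a Young subgroup; the fibres of `c` have sizes `α₁, α₂, …`. -/
def gammaInv (c : Fin d → ℕ) (V : Type u) [AddCommGroup V] [Module k V] [SuperSpace k V] :
    Submodule k (T k (Fin d) V) where
  carrier := {x | ∀ σ, InYoung c σ → R σ x = x}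
  add_mem' hx hy σ hσ := by rw [map_add, hx σ hσ, hy σ hσ]
  zero_mem' σ _ := map_zero _
  smul_mem' r x hx σ hσ := by rw [map_smul, hx σ hσ]

lemma gammaInv_isSubsuper (c : Fin d → ℕ) (V : Type u) [AddCommGroup V] [Module k V]
    [SuperSpace k V] : IsSubsuper (gammaInv (k := k) c V) := by
  intro a x hx σ hσ
  rw [← pr_R, hx σ hσ]

/-- The span of the elements `x.σ - x`, for `σ` in a Young subgroup. -/
def coinv (k : Type u) [Field k] (c : Fin d → ℕ) : SubFunctor (tensorPow k d) where
  sub X := Submodule.span k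
    {y : T k (Fin d) X.of | ∃ σ, InYoung c σ ∧ ∃ x : T k (Fin d) X.of, y = R σ x - x}
  isSubsuper X a := by
    suffices h : Submodule.span k
        {y : T k (Fin d) X.of | ∃ σ, InYoung c σ ∧ ∃ x : T k (Fin d) X.of, y = R σ x - x} ≤
        (Submodule.span k {y : T k (Fin d) X.of |
          ∃ σ, InYoung c σ ∧ ∃ x : T k (Fin d) X.of, y = R σ x - x}).comap (pr k a) from h
    rw [Submodule.span_le]
    rintro _ ⟨σ, hσ, x, rfl⟩
    refine Submodule.subset_span ⟨σ, hσ, pr k a x, ?_⟩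
    rw [map_sub, pr_R]
  stable {X Y} φ := by
    suffices h : Submodule.span k
        {y : T k (Fin d) X.of | ∃ σ, InYoung c σ ∧ ∃ x : T k (Fin d) X.of, y = R σ x - x} ≤
        (Submodule.span k {y : T k (Fin d) Y.of |
          ∃ σ, InYoung c σ ∧ ∃ x : T k (Fin d) Y.of, y = R σ x - x}).comap φ.1 from h
    rw [Submodule.span_le]
    rintro _ ⟨σ, hσ, x, rfl⟩
    refine Submodule.subset_span ⟨σ, hσ, φ.1 x, ?_⟩
    rw [map_sub, φ.2]

/-- The tensor product `S^{α₁} ⊗ S^{α₂} ⊗ ⋯` of symmetric powers, as the coinvariants of a Young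
subgroup on the tensor power; the fibres of `c` have sizes `α₁, α₂, …`. -/
def symPow (k : Type u) [Field k] (c : Fin d → ℕ) : Pol k d := (coinv k c).quotient

/-- The projection `M^{⊗d} → S^{α}(M)`. -/
def symMk (c : Fin d → ℕ) (M : SVec k) : T k (Fin d) M →ₗ[k] (symPow k c).obj ⟨M⟩ :=
  ((coinv k c).sub ⟨M⟩).mkQ

lemma pr_symMk (c : Fin d → ℕ) (M : SVec k) (a : ZMod 2) (x : T k (Fin d) M) :
    pr k a (symMk c M x) = symMk c M (pr k a x) := rfl

lemma map_symMk (c : Fin d → ℕ) {M N : SVec k} (φ : (⟨M⟩ : GammaObj k d) ⟶ ⟨N⟩)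
    (x : T k (Fin d) M) : (symPow k c).map φ (symMk c M x) = symMk c N (φ.1 x) := rfl

end Blocks

section Schur

open CategoryTheory

/-- The number of cells of the skew diagram `lam / mu`. -/
def skewSize (lam mu : YoungDiagram) : ℕ := (lam.cells \ mu.cells).card

/-- The cells of `lam / mu`, with the lexicographic order on (row, column). -/
def rowSet (lam mu : YoungDiagram) : Finset (ℕ ×ₗ ℕ) :=
  (lam.cells \ mu.cells).map (toLex : ℕ × ℕ ≃ ℕ ×ₗ ℕ).toEmbedding

/-- The cells of `lam / mu`, with the lexicographic order on (column, row). -/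
def colSet (lam mu : YoungDiagram) : Finset (ℕ ×ₗ ℕ) :=
  (lam.cells \ mu.cells).map ((Equiv.prodComm ℕ ℕ).trans toLex).toEmbedding

/-- The cells of `lam / mu`, read row by row. -/
def rowReading (lam mu : YoungDiagram) : Fin (skewSize lam mu) ≃ rowSet lam mu :=
  ((rowSet lam mu).orderIsoOfFin (Finset.card_map _)).toEquiv

/-- The cells of `lam / mu`, read column by column. -/
def colReading (lam mu : YoungDiagram) : Fin (skewSize lam mu) ≃ colSet lam mu :=
  ((colSet lam mu).orderIsoOfFin (Finset.card_map _)).toEquiv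

/-- The row of the `i`-th cell in the row reading. -/
def rowOf (lam mu : YoungDiagram) (i : Fin (skewSize lam mu)) : ℕ :=
  (ofLex (rowReading lam mu i).1).1

/-- The column of the `i`-th cell in the column reading. -/
def colOf (lam mu : YoungDiagram) (i : Fin (skewSize lam mu)) : ℕ :=
  (ofLex (colReading lam mu i).1).1

/-- The bijection that exchanges the two names of a cell. -/
def colSetEquiv (lam mu : YoungDiagram) : colSet lam mu ≃ rowSet lam mu :=
  ((ofLex.trans (Equiv.prodComm ℕ ℕ)).trans toLex).subtypeEquiv fun x => by
    obtain ⟨⟨j, i⟩, rfl⟩ := (toLex : ℕ × ℕ ≃ ℕ ×ₗ ℕ).surjective x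
    simp [rowSet, colSet]

/-- The permutation that takes the position of a cell in the column reading to its position in the
row reading. -/
def colToRow (lam mu : YoungDiagram) : Equiv.Perm (Fin (skewSize lam mu)) :=
  ((colReading lam mu).trans (colSetEquiv lam mu)).trans (rowReading lam mu).symm

variable {k : Type u} [Field k]

/-- `Γ_Π^{lam'/mu'}(M) = ⨂_j Γ^{lam'_j - mu'_j}(ΠM)`, one factor for each column of `lam / mu`, with
the grading of `(ΠM)^{⊗d}`. -/
def gammaPi (lam mu : YoungDiagram) (M : SVec k) : SVec k :=
  letI := superSub (gammaInv (k := k) (colOf lam mu) (Parity M)) (gammaInv_isSubsuper _ _)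
  haveI : Module.Finite k (Parity M) := M.finite
  ⟨gammaInv (k := k) (colOf lam mu) (Parity M)⟩

/-- The inclusion `Γ_Π^{lam'/mu'}(M) → (ΠM)^{⊗d}`. -/
def gammaPiIncl (lam mu : YoungDiagram) (M : SVec k) :
    gammaPi lam mu M →ₗ[k] T k (Fin (skewSize lam mu)) (Parity M) :=
  (gammaInv (k := k) (colOf lam mu) (Parity M)).subtype

/-- The composite `(ΠM)^{⊗d} → M^{⊗d} → M^{⊗d} → S^{lam/mu}(M)` of `1^{⊗d}`, of the permutation from
the column reading to the row reading, and of the projection to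
`S^{lam/mu}(M) = ⨂_i S^{lam_i - mu_i}(M)`. -/
def thetaT (lam mu : YoungDiagram) (M : SVec k) :
    T k (Fin (skewSize lam mu)) (Parity M) →ₗ[k] (symPow k (rowOf lam mu)).obj ⟨M⟩ :=
  symMk (rowOf lam mu) M ∘ₗ R (colToRow lam mu) ∘ₗ oneMap

/-- The image of `Γ_Π^{lam'/mu'}(M) → S^{lam/mu}(M)`, as a subfunctor. -/
def schurSub (k : Type u) [Field k] (lam mu : YoungDiagram) :
    SubFunctor (symPow k (rowOf lam mu)) where
  sub X := LinearMap.range (thetaT lam mu X.of ∘ₗ gammaPiIncl lam mu X.of)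
  isSubsuper X a := by
    rintro _ ⟨x, rfl⟩
    refine ⟨pr k (a + Fintype.card (Fin (skewSize lam mu))) x, ?_⟩
    change thetaT lam mu X.of (pr k _ (gammaPiIncl lam mu X.of x)) = pr k a (symMk _ _ _)
    rw [pr_symMk, LinearMap.comp_apply, pr_R, pr_oneMap]
    rfl
  stable {X Y} φ := by
    rintro _ ⟨x, rfl⟩
    have hx : ∀ σ, InYoung (colOf lam mu) σ →
        R σ (gammaPiIncl lam mu X.of x) = gammaPiIncl lam mu X.of x := x.2
    let y := oneInv (φ.1 (oneMap (gammaPiIncl lam mu X.of x)))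
    have hy : oneMap y = φ.1 (oneMap (gammaPiIncl lam mu X.of x)) := oneMap_oneInv _
    have hy' : ∀ σ, InYoung (colOf lam mu) σ → R σ y = y := by
      intro σ hσ
      rw [← oneInv_oneMap (R σ y), oneMap_R, hy, ← φ.2, ← map_smul, ← oneMap_R, hx σ hσ]
    refine ⟨⟨y, hy'⟩, ?_⟩
    change symMk _ _ (R _ (oneMap y)) = (symPow k (rowOf lam mu)).map φ (symMk _ _ (R _ _))
    rw [map_symMk, hy, φ.2]

/-- The Schur superfunctor `Ŝ_{lam/mu}`. -/
def schur (k : Type u) [Field k] (lam mu : YoungDiagram) : Pol k (skewSize lam mu) :=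
  (schurSub k lam mu).toSuperFunctor

/-- The inclusion `Ŝ_{lam/mu}(M) → S^{lam/mu}(M)`. -/
def schurIncl (lam mu : YoungDiagram) (M : SVec k) :
    (schur k lam mu).obj ⟨M⟩ →ₗ[k] (symPow k (rowOf lam mu)).obj ⟨M⟩ :=
  ((schurSub k lam mu).sub ⟨M⟩).subtype

/-- The map `θ̂_{lam/mu} : Γ_Π^{lam'/mu'}(M) → Ŝ_{lam/mu}(M)`. -/
def thetaHat (lam mu : YoungDiagram) (M : SVec k) :
    gammaPi lam mu M →ₗ[k] (schur k lam mu).obj ⟨M⟩ :=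
  (thetaT lam mu M ∘ₗ gammaPiIncl lam mu M).rangeRestrict

/-- The map `Γ_Π^{nu'/mu'}(M) ⊗ Γ_Π^{lam'/nu'}(N) → Γ_Π^{lam'/mu'}(M ⊕ N)`, extended to the tensor
powers: in each column of `lam / mu`, shuffle the factors from `M` in this column of `nu / mu` with
the factors from `N` in this column of `lam / nu`, with the rule of signs, and sum over all
shuffles. -/
def shuffle (lam nu mu : YoungDiagram) (M N : SVec k) :
    T k (Fin (skewSize nu mu)) (Parity M) ⊗[k] T k (Fin (skewSize lam nu)) (Parity N) →ₗ[k]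
      T k (Fin (skewSize lam mu)) (Parity (M.sum N)) :=
  open Classical in
  ∑ ρ : Fin (skewSize nu mu) ⊕ₗ Fin (skewSize lam nu) ≃ Fin (skewSize lam mu) with
      (∀ a, colOf lam mu (ρ (toLex (Sum.inl a))) = colOf nu mu a) ∧
      (∀ b, colOf lam mu (ρ (toLex (Sum.inr b))) = colOf lam nu b) ∧
      StrictMono (fun a => ρ (toLex (Sum.inl a))) ∧ StrictMono (fun b => ρ (toLex (Sum.inr b))),
    R ρ ∘ₗ concat.toLinearMap ∘ₗ TensorProduct.map
      (PiTensorProduct.map fun _ => parMap (LinearMap.inl k M N))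
      (PiTensorProduct.map fun _ => parMap (LinearMap.inr k M N))

/-- The strict lexicographic order on partitions. -/
def lexLt (nu xi : YoungDiagram) : Prop :=
  ∃ i, (∀ j < i, nu.rowLen j = xi.rowLen j) ∧ nu.rowLen i < xi.rowLen i

/-- The lexicographic order on partitions. -/
def lexLe (nu xi : YoungDiagram) : Prop := nu = xi ∨ lexLt nu xi

/-- The image in `Γ_Π^{lam'/mu'}(M ⊕ N)` of the direct sum of all
`Γ_Π^{nu'/mu'}(M) ⊗ Γ_Π^{lam'/nu'}(N)` such that `mu ⊆ nu ⊆ lam` and `P nu`. -/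
def kSub (lam mu : YoungDiagram) (P : YoungDiagram → Prop) (M N : SVec k) :
    Submodule k (T k (Fin (skewSize lam mu)) (Parity (M.sum N))) :=
  ⨆ nu : {nu : YoungDiagram // mu ≤ nu ∧ nu ≤ lam ∧ P nu},
    LinearMap.range (shuffle lam nu.1 mu M N ∘ₗ
      TensorProduct.map (gammaPiIncl nu.1 mu M) (gammaPiIncl lam nu.1 N))

/-- `L_ξ(M, N)`, the image of `kSub` for `nu ≼ ξ` under `θ̂_{lam/mu}`. -/
def lSub (lam mu xi : YoungDiagram) (M N : SVec k) :
    Submodule k ((symPow k (rowOf lam mu)).obj ⟨M.sum N⟩) :=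
  (kSub lam mu (fun nu => lexLe nu xi) M N).map (thetaT lam mu (M.sum N))

/-- `L̇_ξ(M, N)`, the image of `kSub` for `nu ≺ ξ` under `θ̂_{lam/mu}`. -/
def lDotSub (lam mu xi : YoungDiagram) (M N : SVec k) :
    Submodule k ((symPow k (rowOf lam mu)).obj ⟨M.sum N⟩) :=
  (kSub lam mu (fun nu => lexLt nu xi) M N).map (thetaT lam mu (M.sum N))

/-- The class of an element of `A` in `A / B`. -/
def SubFunctor.mkSubquot {C : Type w} [Category.{u} C] [Preadditive C] [Linear k C]
    [SvecEnriched k C] {F : SuperFunctor k C} (A B : SubFunctor F) (X : C) :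
    A.sub X →ₗ[k] (A.subquotient B).obj X :=
  ((A.restrict B).sub X).mkQ

lemma skewSize_add {lam xi mu : YoungDiagram} (h1 : mu ≤ xi) (h2 : xi ≤ lam) :
    skewSize xi mu + skewSize lam xi = skewSize lam mu := by
  have h1' : mu.cells ⊆ xi.cells := h1
  have h2' : xi.cells ⊆ lam.cells := h2
  unfold skewSize
  rw [Finset.card_sdiff_of_subset h1', Finset.card_sdiff_of_subset h2',
    Finset.card_sdiff_of_subset (h1'.trans h2')]
  have := Finset.card_le_card h1'
  have := Finset.card_le_card h2'
  omega

instance (lam mu : YoungDiagram) : Finite (Set.Icc mu lam) := by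
  have hf : Function.Injective (fun xi : Set.Icc mu lam =>
      (⟨xi.1.cells, Finset.mem_powerset.mpr xi.2.2⟩ : lam.cells.powerset)) := by
    intro x y h
    exact Subtype.ext (YoungDiagram.ext (congrArg Subtype.val h))
  exact Finite.of_injective _ hf

end Schur

end SuperSchur

open SuperSchur

/-! Write V for ΠM. Since 1^{⊗d} turns the signed place permutation of σ into sgn(σ)σ, everything
can be computed in V^{⊗d}, in the column reading. There Γ_Π is the space `gammaInv` of tensors fixed
by the permutations within columns, and the kernel of θ̂ is its intersection with `skewCoinv`, the
span of the x - sgn(σ)σx for σ preserving the rows (`thetaT_eq_zero_iff`). For V₁ ⊕ V₂ the tensor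
power splits into blocks, one for each set B of cells carrying factors from V₁ (`blockPr`). The
blocks with given numbers of cells in the columns form one orbit of the column group, so an
invariant tensor splits into invariant pieces indexed by column counts. The embedding x ⊗ y ↦ x ⊛ y
for ν is an isomorphism onto the piece with the column lengths of ν/μ (`range_shuf`), so K^ξ is a
condition on supports (`kSub_eq`).

Injectivity of ψ_ξ is triangularity. A set of cells with the column lengths of ν/μ and the row
lengths of ξ/μ satisfies ξ ≼ ν, and if ν = ξ it is the set of cells of ξ/μ (`lexLe_of_counts`). The
signed sum of the components at all sets with the row lengths of ξ/μ kills `skewCoinv`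
(`rowSum_eq_zero`). On a tensor supported in diagrams ν ≼ ξ only the component at ξ/μ contributes to
this sum. Hence the leading component of an element of the kernel of θ̂ lies in the kernel of θ̂ ⊠
θ̂ (`leading_mem_ker`).

Well-definedness rests on straightening. If a + b cells in columns j and j + 1 are too many to lie
in distinct rows, a tensor that is symmetric in them is killed by θ̂, because two of them share a
row and 2 ≠ 0; such tensors generate `colRel` (`colRel_le_skewCoinv`). A block that is not of
diagram shape is equivalent, modulo these relations, to blocks with the V₁ factors further left
(`suppSub_le_straighten`); this gives L_λ = everything. A relation in x or in y extends to a
relation for λ/μ up to blocks with V₁ factors further left (`exists_rel_left`, `exists_rel_right`).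
As conjugation reverses dominance, those blocks straighten to diagrams ≺ ξ (`shapeShuf_mem_of_rel`).

It remains to know that the kernel of θ̂ on Γ consists of these relations (`ColKer`). This follows
by induction on the dimension, by the same two arguments. For V₁ ⊕ V₂ the leading component of a
kernel element lies in the kernel of θ̂ ⊠ θ̂, hence is a combination of relations in V₁ and V₂,
hence can be removed at the cost of smaller diagrams (`ColKer.prod`). Lines are checked directly
(`colKer_odd_line`, `colKer_even_line`).

Finally, θ̂ ⊠ θ̂ and x ⊗ y ↦ [θ̂(x ⊛ y)] are surjections from one space with the same kernel
(`gradedMap_eq_zero_iff`), which defines ψ_ξ. Both are homogeneous of parity |λ/μ|, so ψ_ξ is even;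
naturality holds because one lift of a morphism, with one sign, serves both maps (`exists_lift`). -/

namespace SuperSchur

/-! ### Block decomposition of the tensor power of a direct sum. -/

section BlockProjections

variable {k : Type u} [Field k] {M N M' : Type u}
  [AddCommGroup M] [Module k M] [SuperSpace k M]
  [AddCommGroup N] [Module k N] [SuperSpace k N]
  [AddCommGroup M'] [Module k M'] [SuperSpace k M']
variable {ι κ ω : Type} [Fintype ι] [LinearOrder ι] [Fintype κ] [LinearOrder κ]
  [Fintype ω] [LinearOrder ω]

/-- A family of even maps commutes with the signed place permutations. -/
lemma R_map (e : ι ≃ κ) (f : ι → M →ₗ[k] M') (hf : ∀ i a x, Homog k a x → Homog k a (f i x))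
    (x : T k ι M) :
    R e (PiTensorProduct.map f x) = PiTensorProduct.map (fun j => f (e.symm j)) (R e x) := by
  suffices h : R e ∘ₗ PiTensorProduct.map f =
      PiTensorProduct.map (fun j => f (e.symm j)) ∘ₗ R e from congrArg (fun g => g x) h
  apply T_ext
  intro δ v hv
  rw [LinearMap.comp_apply, LinearMap.comp_apply, R_homog e hv, map_smul,
    PiTensorProduct.map_tprod, PiTensorProduct.map_tprod, R_homog e fun i => hf i _ _ (hv i)]

lemma pr_map (f : ι → M →ₗ[k] M') (hf : ∀ i a x, Homog k a x → Homog k a (f i x))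
    (a : ZMod 2) (x : T k ι M) :
    pr k a (PiTensorProduct.map f x) = PiTensorProduct.map f (pr k a x) := by
  suffices h : pr k a ∘ₗ PiTensorProduct.map f = PiTensorProduct.map f ∘ₗ pr k a from
    congrArg (fun g => g x) h
  apply T_ext
  intro δ v hv
  rw [LinearMap.comp_apply, LinearMap.comp_apply, PiTensorProduct.map_tprod, pr_T_homog hv,
    pr_T_homog fun i => hf i _ _ (hv i)]
  split_ifs
  · rw [PiTensorProduct.map_tprod]
  · rw [map_zero]

/-- The idempotent of `M × N` with image `M` or `N`. -/
def sidePr (k : Type u) [Field k] (M N : Type u) [AddCommGroup M] [Module k M]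
    [AddCommGroup N] [Module k N] (b : Prop) [Decidable b] : M × N →ₗ[k] M × N :=
  if b then LinearMap.inl k M N ∘ₗ LinearMap.fst k M N
  else LinearMap.inr k M N ∘ₗ LinearMap.snd k M N

lemma sidePr_apply (b : Prop) [Decidable b] (x : M × N) :
    sidePr k M N b x = if b then (x.1, 0) else (0, x.2) := by
  unfold sidePr; split_ifs <;> rfl

lemma sidePr_even (b : Prop) [Decidable b] (a : ZMod 2) (x : M × N) (hx : Homog k a x) :
    Homog k a (sidePr k M N b x) := by
  rw [sidePr_apply]
  split_ifs
  · exact homog_inl (congrArg Prod.fst hx)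
  · exact homog_inr (congrArg Prod.snd hx)

/-- The projection of `(M ⊕ N)^{⊗ι}` to the summand with factor `M` in the positions in `B` and
factor `N` in the other positions. -/
def blockPr (B : Finset ι) : T k ι (M × N) →ₗ[k] T k ι (M × N) :=
  PiTensorProduct.map fun i => sidePr k M N (i ∈ B)

lemma blockPr_tprod (B : Finset ι) (v : ι → M × N) :
    blockPr B (PiTensorProduct.tprod k v) =
      PiTensorProduct.tprod k fun i => if i ∈ B then ((v i).1, 0) else (0, (v i).2) := by
  rw [blockPr, PiTensorProduct.map_tprod]
  simp only [sidePr_apply]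

lemma R_blockPr (e : ι ≃ κ) (B : Finset ι) (x : T k ι (M × N)) :
    R e (blockPr B x) = blockPr (B.map e.toEmbedding) (R e x) := by
  rw [blockPr, R_map _ _ (fun i => sidePr_even _), blockPr]
  congr 2
  funext j
  congr 1
  simp

lemma pr_blockPr (a : ZMod 2) (B : Finset ι) (x : T k ι (M × N)) :
    pr k a (blockPr B x) = blockPr B (pr k a x) :=
  pr_map _ (fun _ => sidePr_even _) a x

lemma sum_blockPr (x : T k ι (M × N)) : ∑ B : Finset ι, blockPr B x = x := by
  suffices h : ∑ B : Finset ι, blockPr (k := k) (M := M) (N := N) B = LinearMap.id by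
    simpa using congrArg (fun g => g x) h
  ext v
  simp only [LinearMap.compMultilinearMap_apply, LinearMap.sum_apply, blockPr_tprod,
    LinearMap.id_apply]
  have h := sum_tprod (k := k) (ι := ι) (C := Bool) (fun c => sidePr k M N (c = true))
    (fun x => by simp [sidePr_apply]) v
  rw [← h]
  let e : Finset ι ≃ (ι → Bool) :=
    { toFun := fun B i => decide (i ∈ B)
      invFun := fun f => Finset.univ.filter fun i => f i = true
      left_inv := fun B => by ext; simp
      right_inv := fun f => by ext; simp }
  refine Fintype.sum_equiv e _ _ fun B => ?_
  congr 1
  funext i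
  simp [e, sidePr_apply]

lemma blockPr_blockPr (B C : Finset ι) (x : T k ι (M × N)) :
    blockPr B (blockPr C x) = if B = C then blockPr C x else 0 := by
  suffices h : blockPr (k := k) (M := M) (N := N) B ∘ₗ blockPr C =
      if B = C then blockPr C else 0 by
    have := congrArg (fun g => g x) h
    simp only [LinearMap.comp_apply] at this
    rw [this]; split_ifs <;> rfl
  ext v
  simp only [LinearMap.compMultilinearMap_apply, LinearMap.comp_apply, blockPr_tprod]
  split_ifs with h
  · subst h
    rw [blockPr_tprod]
    congr 1
    funext i
    split_ifs <;> rfl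
  · obtain ⟨i, hi⟩ : ∃ i, ¬ (i ∈ B ↔ i ∈ C) := by
      by_contra hh; push Not at hh; exact h (Finset.ext hh)
    rw [LinearMap.zero_apply]
    refine tprod_zero_of i ?_
    by_cases h1 : i ∈ B <;> by_cases h2 : i ∈ C <;> simp_all

/-- The positions that a placement assigns to the left block. -/
def leftSet (ρ : ι ⊕ₗ κ ≃ ω) : Finset ω :=
  Finset.univ.filter fun p => (ofLex (ρ.symm p)).isLeft

lemma mem_leftSet {ρ : ι ⊕ₗ κ ≃ ω} {p : ω} :
    p ∈ leftSet ρ ↔ (ofLex (ρ.symm p)).isLeft := by simp [leftSet]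

lemma inl_mem_leftSet (ρ : ι ⊕ₗ κ ≃ ω) (a : ι) : ρ (toLex (Sum.inl a)) ∈ leftSet ρ := by
  simp [mem_leftSet]

lemma inr_notMem_leftSet (ρ : ι ⊕ₗ κ ≃ ω) (b : κ) : ρ (toLex (Sum.inr b)) ∉ leftSet ρ := by
  simp [mem_leftSet]

lemma forall_placement (ρ : ι ⊕ₗ κ ≃ ω) {P : ω → Prop} (hl : ∀ a, P (ρ (toLex (Sum.inl a))))
    (hr : ∀ b, P (ρ (toLex (Sum.inr b)))) (p : ω) : P p := by
  rcases h : ofLex (ρ.symm p) with a | b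
  · have : ρ (toLex (Sum.inl a)) = p := by rw [← h]; simp
    exact this ▸ hl a
  · have : ρ (toLex (Sum.inr b)) = p := by rw [← h]; simp
    exact this ▸ hr b

lemma mem_leftSet_iff {ρ : ι ⊕ₗ κ ≃ ω} {p : ω} :
    p ∈ leftSet ρ ↔ ∃ a, ρ (toLex (Sum.inl a)) = p := by
  refine forall_placement ρ (P := fun p => p ∈ leftSet ρ ↔ ∃ a, ρ (toLex (Sum.inl a)) = p)
    (fun a => ?_) (fun b => ?_) p
  · exact ⟨fun _ => ⟨a, rfl⟩, fun _ => inl_mem_leftSet ρ a⟩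
  · refine ⟨fun h => absurd h (inr_notMem_leftSet ρ b), ?_⟩
    rintro ⟨a, h⟩
    exact h ▸ inl_mem_leftSet ρ a

lemma leftSet_trans {ω' : Type} [Fintype ω'] [LinearOrder ω'] (ρ : ι ⊕ₗ κ ≃ ω) (e : ω ≃ ω') :
    leftSet (ρ.trans e) = (leftSet ρ).map e.toEmbedding := by
  ext p
  rw [mem_leftSet]
  simp [mem_leftSet]

lemma blockPr_inclR (ρ : ι ⊕ₗ κ ≃ ω) (B : Finset ω) (x : T k ι M ⊗[k] T k κ N) :
    blockPr B (inclR ρ x) = if B = leftSet ρ then inclR ρ x else 0 := by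
  suffices h : blockPr (k := k) (M := M) (N := N) B ∘ₗ inclR ρ =
      if B = leftSet ρ then inclR ρ else 0 by
    have := congrArg (fun g => g x) h
    simp only [LinearMap.comp_apply] at this
    rw [this]; split_ifs <;> rfl
  apply TT_ext
  intro δ v ε w hv hw
  rw [LinearMap.comp_apply, inclR_tmul ρ hv hw, map_smul, blockPr_tprod]
  split_ifs with h
  · rw [inclR_tmul ρ hv hw]
    congr 2
    funext p
    subst h
    simp only [mem_leftSet]
    rcases ofLex (ρ.symm p) with a | b <;> simp
  · obtain ⟨i, hi⟩ : ∃ i, ¬ (i ∈ B ↔ i ∈ leftSet ρ) := by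
      by_contra hh; push Not at hh; exact h (Finset.ext hh)
    rw [LinearMap.zero_apply, tprod_zero_of i, smul_zero]
    rw [mem_leftSet] at hi
    rcases h' : ofLex (ρ.symm i) with a | b <;> simp_all

lemma incl_coincl (x : T k (ι ⊕ₗ κ) (M × N)) :
    incl (coincl x) = blockPr (leftSet (Equiv.refl (ι ⊕ₗ κ))) x := by
  suffices h : incl (k := k) ∘ₗ coincl (ι := ι) (κ := κ) (M := M) (N := N) =
      blockPr (leftSet (Equiv.refl (ι ⊕ₗ κ))) from congrArg (fun g => g x) h
  ext v
  simp only [LinearMap.compMultilinearMap_apply, LinearMap.comp_apply, blockPr_tprod,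
    coincl_tprod, incl_tmul]
  congr 1
  funext p
  simp only [mem_leftSet]
  obtain ⟨p, rfl⟩ := (toLex : ι ⊕ κ ≃ ι ⊕ₗ κ).surjective p
  rcases p with a | b <;> simp

/-- Together with `coinclR_inclR` this identifies the block of `leftSet ρ` with the tensor product
of the two tensor powers. The projection depends only on the left set, while the identification,
with its sign, depends on the whole placement. -/
lemma inclR_coinclR (ρ : ι ⊕ₗ κ ≃ ω) (x : T k ω (M × N)) :
    inclR ρ (coinclR ρ x) = blockPr (leftSet ρ) x := by
  rw [inclR, coinclR, LinearMap.comp_apply, LinearMap.comp_apply, incl_coincl, R_blockPr, R_R,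
    Equiv.symm_trans_self, R_refl]
  congr 1
  rw [← leftSet_trans, Equiv.refl_trans]

lemma coinclR_blockPr (ρ : ι ⊕ₗ κ ≃ ω) (x : T k ω (M × N)) :
    coinclR ρ (blockPr (leftSet ρ) x) = coinclR ρ x := by
  rw [← inclR_coinclR, coinclR_inclR]

lemma blockPr_eq_zero_iff (ρ : ι ⊕ₗ κ ≃ ω) (x : T k ω (M × N)) :
    blockPr (leftSet ρ) x = 0 ↔ coinclR ρ x = 0 := by
  constructor
  · intro h; rw [← coinclR_blockPr, h, map_zero]
  · intro h; rw [← inclR_coinclR, h, map_zero]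

lemma R_inclR {ω' : Type} [Fintype ω'] [LinearOrder ω'] (ρ : ι ⊕ₗ κ ≃ ω) (e : ω ≃ ω')
    (x : T k ι M ⊗[k] T k κ N) : R e (inclR ρ x) = inclR (ρ.trans e) x := by
  simp only [inclR, LinearMap.comp_apply, R_R]

lemma coinclR_R {ω' : Type} [Fintype ω'] [LinearOrder ω'] (ρ : ι ⊕ₗ κ ≃ ω') (e : ω ≃ ω')
    (x : T k ω (M × N)) : coinclR ρ (R e x) = coinclR (ρ.trans e.symm) x := by
  simp only [coinclR, LinearMap.comp_apply, R_R]
  rfl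

/-- The permutation of `ι ⊕ κ` that permutes the two blocks separately. -/
abbrev blockPerm (α : Equiv.Perm ι) (β : Equiv.Perm κ) : Equiv.Perm (ι ⊕ₗ κ) :=
  (ofLex.trans (Equiv.sumCongr α β)).trans toLex

lemma leftSet_blockPerm (α : Equiv.Perm ι) (β : Equiv.Perm κ) (ρ : ι ⊕ₗ κ ≃ ω) :
    leftSet ((blockPerm α β).trans ρ) = leftSet ρ := by
  ext p
  revert p
  refine forall_placement ρ (fun a => ?_) (fun b => ?_) <;> simp [mem_leftSet]

lemma coinclR_perm (α : Equiv.Perm ι) (β : Equiv.Perm κ) (ρ : ι ⊕ₗ κ ≃ ω)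
    (x : T k ω (M × N)) :
    TensorProduct.map (R α) (R β) (coinclR ((blockPerm α β).trans ρ) x) = coinclR ρ x := by
  rw [← coinclR_blockPr ρ, ← leftSet_blockPerm α β ρ, ← inclR_coinclR, inclR_perm, coinclR_inclR]

/-- Two placements with the same left positions differ by a permutation of each block. -/
lemma exists_blockPerm {ρ ρ' : ι ⊕ₗ κ ≃ ω} (h : leftSet ρ' = leftSet ρ) :
    ∃ (α : Equiv.Perm ι) (β : Equiv.Perm κ), ρ' = (blockPerm α β).trans ρ := by
  classical
  -- The comparison of the two placements preserves the left summand, since the left sets agree; so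
  -- it is a pair of permutations.
  let τ : Equiv.Perm (ι ⊕ κ) := ((toLex.trans ρ').trans ρ.symm).trans ofLex
  have hτ : τ ∈ (Equiv.Perm.sumCongrHom ι κ).range := by
    apply Equiv.Perm.mem_sumCongrHom_range_of_perm_mapsTo_inl
    rintro _ ⟨a, rfl⟩
    have h1 : (τ (Sum.inl a)).isLeft = true := by
      have := inl_mem_leftSet ρ' a
      rw [h, mem_leftSet] at this
      exact this
    obtain ⟨b, hb⟩ := Sum.isLeft_iff.mp h1
    exact ⟨b, hb.symm⟩
  obtain ⟨⟨α, β⟩, h'⟩ := hτ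
  refine ⟨α, β, ?_⟩
  have h'' : Equiv.sumCongr α β = τ := h'
  unfold blockPerm
  rw [h'']
  ext q
  simp [τ]

/-- Every set of positions is the left set of a placement. -/
lemma leftSet_placeOf {d e f : ℕ} (A : Finset (Fin d)) (he : A.card = e) (hf : Aᶜ.card = f) :
    leftSet (placeOf A he hf) = A := by
  ext p
  rw [mem_leftSet, placeOf_isLeft]
  simp

end BlockProjections

/-! ### Equivariant families of tensors indexed by colourings. -/

section Families

variable {k : Type u} [Field k] {V V₁ V₂ : Type u}
  [AddCommGroup V] [Module k V] [SuperSpace k V]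
  [AddCommGroup V₁] [Module k V₁] [SuperSpace k V₁]
  [AddCommGroup V₂] [Module k V₂] [SuperSpace k V₂]
variable {d e f : ℕ} {K K₁ K₂ : Type}

/-- A family of tensors indexed by the colourings of the positions is equivariant if it is
compatible with all place permutations. -/
def EquivFam (F : (Fin d → K) → T k (Fin d) V) : Prop :=
  ∀ (σ : Equiv.Perm (Fin d)) (c : Fin d → K), R σ (F c) = F (c ∘ σ.symm)

/-- A tensor that is invariant under the stabilizer of a colouring extends to an equivariant
family, supported on the orbit of the colouring. -/
lemma exists_orbitFam (c₀ : Fin d → K) (z : T k (Fin d) V)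
    (hz : ∀ σ : Equiv.Perm (Fin d), (∀ i, c₀ (σ i) = c₀ i) → R σ z = z) :
    ∃ F : (Fin d → K) → T k (Fin d) V, EquivFam F ∧ F c₀ = z ∧
      ∀ c, F c ≠ 0 → ∃ σ : Equiv.Perm (Fin d), c = c₀ ∘ σ.symm := by
  classical
  let F : (Fin d → K) → T k (Fin d) V := fun c =>
    if h : ∃ σ : Equiv.Perm (Fin d), c = c₀ ∘ σ.symm then R h.choose z else 0
  have hF : ∀ σ : Equiv.Perm (Fin d), F (c₀ ∘ σ.symm) = R σ z := by
    intro σ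
    have h : ∃ τ : Equiv.Perm (Fin d), c₀ ∘ σ.symm = c₀ ∘ τ.symm := ⟨σ, rfl⟩
    change (if h : ∃ τ : Equiv.Perm (Fin d), c₀ ∘ σ.symm = c₀ ∘ τ.symm then R h.choose z else 0) = _
    rw [dif_pos h]
    have h' := h.choose_spec
    set τ := h.choose
    -- σ and the chosen τ carry c₀ to the same colouring, so they differ by an element of its
    -- stabilizer, which fixes z; the choice is immaterial.
    have h1 : R (τ.trans σ.symm) z = z := hz _ fun i => by
      have := congrFun h' (τ i)
      simpa using this
    rw [← R_R] at h1
    have h2 := congrArg (R σ) h1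
    rwa [R_R, Equiv.symm_trans_self, R_refl] at h2
  have hF0 : ∀ c, F c ≠ 0 → ∃ σ : Equiv.Perm (Fin d), c = c₀ ∘ σ.symm := by
    intro c hc
    by_contra h
    exact hc (dif_neg h)
  refine ⟨F, ?_, ?_, hF0⟩
  · intro σ c
    by_cases h : ∃ τ : Equiv.Perm (Fin d), c = c₀ ∘ τ.symm
    · obtain ⟨τ, rfl⟩ := h
      rw [hF, R_R, ← hF]
      rfl
    · have h1 : F c = 0 := dif_neg h
      have h2 : F (c ∘ σ.symm) = 0 := by
        refine dif_neg ?_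
        rintro ⟨τ, hτ⟩
        refine h ⟨τ.trans σ.symm, ?_⟩
        funext i
        have := congrFun hτ (σ i)
        simpa using this
      rw [h1, h2, map_zero]
  · have := hF (Equiv.refl _)
    rwa [R_refl] at this

/-- The colouring of the positions that is induced by a placement of two coloured blocks. -/
def placeCol (ρ : Fin e ⊕ₗ Fin f ≃ Fin d) (c₁ : Fin e → K₁) (c₂ : Fin f → K₂) :
    Fin d → K₁ ⊕ K₂ := fun p => Sum.map c₁ c₂ (ofLex (ρ.symm p))

@[simp] lemma placeCol_inl (ρ : Fin e ⊕ₗ Fin f ≃ Fin d) (c₁ : Fin e → K₁) (c₂ : Fin f → K₂)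
    (a : Fin e) : placeCol ρ c₁ c₂ (ρ (toLex (Sum.inl a))) = Sum.inl (c₁ a) := by
  simp [placeCol]

@[simp] lemma placeCol_inr (ρ : Fin e ⊕ₗ Fin f ≃ Fin d) (c₁ : Fin e → K₁) (c₂ : Fin f → K₂)
    (b : Fin f) : placeCol ρ c₁ c₂ (ρ (toLex (Sum.inr b))) = Sum.inr (c₂ b) := by
  simp [placeCol]

lemma placeCol_blockPerm (ρ : Fin e ⊕ₗ Fin f ≃ Fin d) (c₁ : Fin e → K₁) (c₂ : Fin f → K₂)
    (α : Equiv.Perm (Fin e)) (β : Equiv.Perm (Fin f)) :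
    placeCol ((blockPerm α β).trans ρ) c₁ c₂ = placeCol ρ (c₁ ∘ α.symm) (c₂ ∘ β.symm) := by
  funext p
  refine forall_placement ρ (P := fun p => placeCol ((blockPerm α β).trans ρ) c₁ c₂ p =
    placeCol ρ (c₁ ∘ α.symm) (c₂ ∘ β.symm) p) (fun a => ?_) (fun b => ?_) p
  · rw [placeCol_inl]; simp [placeCol]
  · rw [placeCol_inr]; simp [placeCol]

lemma leftSet_eq_of_placeCol {ρ ρ' : Fin e ⊕ₗ Fin f ≃ Fin d} {c₁ c₁' : Fin e → K₁}
    {c₂ c₂' : Fin f → K₂} (h : placeCol ρ' c₁' c₂' = placeCol ρ c₁ c₂) :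
    leftSet ρ' = leftSet ρ := by
  ext p
  have := congrArg Sum.isLeft (congrFun h p)
  simp only [placeCol, Sum.isLeft_map] at this
  rw [mem_leftSet, mem_leftSet, this]

lemma placeCol_inj {ρ : Fin e ⊕ₗ Fin f ≃ Fin d} {c₁ c₁' : Fin e → K₁}
    {c₂ c₂' : Fin f → K₂} (h : placeCol ρ c₁' c₂' = placeCol ρ c₁ c₂) : c₁' = c₁ ∧ c₂' = c₂ := by
  constructor
  · funext a
    have := congrFun h (ρ (toLex (Sum.inl a)))
    simpa using this
  · funext b
    have := congrFun h (ρ (toLex (Sum.inr b)))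
    simpa using this

/-- The external product of two equivariant families. -/
lemma exists_prodFam {Z₁ : (Fin e → K₁) → T k (Fin e) V₁} {Z₂ : (Fin f → K₂) → T k (Fin f) V₂}
    (h₁ : EquivFam Z₁) (h₂ : EquivFam Z₂) :
    ∃ F : (Fin d → K₁ ⊕ K₂) → T k (Fin d) (V₁ × V₂), EquivFam F ∧
      (∀ (ρ : Fin e ⊕ₗ Fin f ≃ Fin d) c₁ c₂, F (placeCol ρ c₁ c₂) = inclR ρ (Z₁ c₁ ⊗ₜ Z₂ c₂)) ∧
      ∀ c, F c ≠ 0 → ∃ (ρ : Fin e ⊕ₗ Fin f ≃ Fin d) (c₁ : Fin e → K₁) (c₂ : Fin f → K₂),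
        c = placeCol ρ c₁ c₂ := by
  classical
  -- Two descriptions of one colouring differ by a permutation of each block, and the equivariance
  -- of Z₁ and Z₂ absorbs these permutations. So the choice in the definition of F is immaterial.
  have key : ∀ (ρ ρ' : Fin e ⊕ₗ Fin f ≃ Fin d) (c₁ c₁' : Fin e → K₁) (c₂ c₂' : Fin f → K₂),
      placeCol ρ' c₁' c₂' = placeCol ρ c₁ c₂ →
      inclR ρ' (Z₁ c₁' ⊗ₜ[k] Z₂ c₂') = inclR ρ (Z₁ c₁ ⊗ₜ[k] Z₂ c₂) := by
    intro ρ ρ' c₁ c₁' c₂ c₂' h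
    obtain ⟨α, β, rfl⟩ := exists_blockPerm (leftSet_eq_of_placeCol h)
    rw [placeCol_blockPerm] at h
    obtain ⟨rfl, rfl⟩ := placeCol_inj h
    rw [inclR_perm, TensorProduct.map_tmul, h₁, h₂]
  let F : (Fin d → K₁ ⊕ K₂) → T k (Fin d) (V₁ × V₂) := fun c =>
    if h : ∃ q : (Fin e ⊕ₗ Fin f ≃ Fin d) × (Fin e → K₁) × (Fin f → K₂),
      c = placeCol q.1 q.2.1 q.2.2 then
      inclR h.choose.1 (Z₁ h.choose.2.1 ⊗ₜ Z₂ h.choose.2.2) else 0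
  have hF : ∀ (ρ : Fin e ⊕ₗ Fin f ≃ Fin d) c₁ c₂,
      F (placeCol ρ c₁ c₂) = inclR ρ (Z₁ c₁ ⊗ₜ Z₂ c₂) := by
    intro ρ c₁ c₂
    have h : ∃ q : (Fin e ⊕ₗ Fin f ≃ Fin d) × (Fin e → K₁) × (Fin f → K₂),
      placeCol ρ c₁ c₂ = placeCol q.1 q.2.1 q.2.2 := ⟨(ρ, c₁, c₂), rfl⟩
    change dite _ _ _ = _
    rw [dif_pos h]
    exact key _ _ _ _ _ _ h.choose_spec.symm
  have hF0 : ∀ c, F c ≠ 0 → ∃ (ρ : Fin e ⊕ₗ Fin f ≃ Fin d) (c₁ : Fin e → K₁) (c₂ : Fin f → K₂),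
      c = placeCol ρ c₁ c₂ := by
    intro c hc
    by_contra h
    refine hc (dif_neg ?_)
    rintro ⟨q, hq⟩
    exact h ⟨_, _, _, hq⟩
  have hcomp : ∀ (ρ : Fin e ⊕ₗ Fin f ≃ Fin d) (c₁ : Fin e → K₁) (c₂ : Fin f → K₂)
      (σ : Equiv.Perm (Fin d)), placeCol ρ c₁ c₂ ∘ σ.symm = placeCol (ρ.trans σ) c₁ c₂ :=
    fun _ _ _ _ => rfl
  refine ⟨F, fun σ c => ?_, hF, hF0⟩
  by_cases h : F c = 0
  · rw [h, map_zero]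
    by_contra h'
    obtain ⟨ρ, c₁, c₂, hc⟩ := hF0 _ (Ne.symm h')
    have hc' : c = placeCol (ρ.trans σ.symm) c₁ c₂ := by
      rw [← hcomp, ← hc]
      funext i
      simp
    rw [hc, hF] at h'
    rw [hc', hF, ← R_inclR] at h
    refine h' ?_
    have := congrArg (R σ) h
    rw [R_R, Equiv.symm_trans_self, R_refl, map_zero] at this
    exact this.symm
  · obtain ⟨ρ, c₁, c₂, rfl⟩ := hF0 _ h
    rw [hcomp, hF, hF, R_inclR]

/-- Used to read off which terms of a relation survive: a nonzero block of a product family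
determines the positions of the V₁ factors, and both colourings lie in the supports of the given
families. -/
lemma EquivFam.exists_placeCol {F : (Fin d → K₁ ⊕ K₂) → T k (Fin d) (V₁ × V₂)}
    {Z₁ : (Fin e → K₁) → T k (Fin e) V₁} {Z₂ : (Fin f → K₂) → T k (Fin f) V₂}
    (hF : ∀ (ρ : Fin e ⊕ₗ Fin f ≃ Fin d) c₁ c₂, F (placeCol ρ c₁ c₂) = inclR ρ (Z₁ c₁ ⊗ₜ Z₂ c₂))
    (hF0 : ∀ c, F c ≠ 0 → ∃ (ρ : Fin e ⊕ₗ Fin f ≃ Fin d) (c₁ : Fin e → K₁) (c₂ : Fin f → K₂),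
        c = placeCol ρ c₁ c₂) {B : Finset (Fin d)} {c : Fin d → K₁ ⊕ K₂}
    (h : blockPr B (F c) ≠ 0) :
    ∃ (ρ : Fin e ⊕ₗ Fin f ≃ Fin d) (c₁ : Fin e → K₁) (c₂ : Fin f → K₂),
      c = placeCol ρ c₁ c₂ ∧ B = leftSet ρ ∧ Z₁ c₁ ≠ 0 ∧ Z₂ c₂ ≠ 0 := by
  have h0 : F c ≠ 0 := fun h' => h (by rw [h', map_zero])
  obtain ⟨ρ, c₁, c₂, rfl⟩ := hF0 _ h0
  rw [hF] at h h0
  refine ⟨ρ, c₁, c₂, rfl, ?_, ?_, ?_⟩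
  · by_contra hB
    rw [blockPr_inclR, if_neg hB] at h
    exact h rfl
  · intro hz; rw [hz, TensorProduct.zero_tmul, map_zero] at h0; exact h0 rfl
  · intro hz; rw [hz, TensorProduct.tmul_zero, map_zero] at h0; exact h0 rfl

end Families

/-! ### Relations between two adjacent columns. -/

section Relations

variable {k : Type u} [Field k] {V V₁ V₂ : Type u}
  [AddCommGroup V] [Module k V] [SuperSpace k V]
  [AddCommGroup V₁] [Module k V₁] [SuperSpace k V₁]
  [AddCommGroup V₂] [Module k V₂] [SuperSpace k V₂]
variable {d e f : ℕ} {K : Type}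

/-- The number of elements of `B` in column `j`. -/
def colCount (c : Fin d → ℕ) (B : Finset (Fin d)) (j : ℕ) : ℕ := (B.filter fun p => c p = j).card

/-- The colouring by columns, with the positions in `W` merged into one colour `none`. -/
def colorOf (c : Fin d → ℕ) (W : Finset (Fin d)) : Fin d → Option ℕ :=
  fun p => if p ∈ W then none else some (c p)

/-- The sets that consist of `a` positions in column `j` and `b` positions in column `j + 1`. -/
def relSets (c : Fin d → ℕ) (j a b : ℕ) : Finset (Finset (Fin d)) :=
  Finset.univ.filter fun W => (∀ p ∈ W, c p = j ∨ c p = j + 1) ∧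
    colCount c W j = a ∧ colCount c W (j + 1) = b

lemma mem_relSets {c : Fin d → ℕ} {j a b : ℕ} {W : Finset (Fin d)} :
    W ∈ relSets c j a b ↔ (∀ p ∈ W, c p = j ∨ c p = j + 1) ∧
    colCount c W j = a ∧ colCount c W (j + 1) = b := by
  simp [relSets]

/-- The image of the map
`Γ^u ⊗ Γ^{a+b} ⊗ Γ^v → Γ^u ⊗ Γ^a ⊗ Γ^b ⊗ Γ^v → Γ^{u+a} ⊗ Γ^{b+v}`
in the columns `j` and `j + 1`. -/
def relSub (k : Type u) [Field k] (V : Type u) [AddCommGroup V] [Module k V] [SuperSpace k V]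
    (c : Fin d → ℕ) (j a b : ℕ) : Submodule k (T k (Fin d) V) where
  carrier := {r | ∃ Z : (Fin d → Option ℕ) → T k (Fin d) V, EquivFam Z ∧
    r = ∑ W ∈ relSets c j a b, Z (colorOf c W)}
  zero_mem' := ⟨fun _ => 0, fun _ _ => map_zero _, by simp⟩
  add_mem' := by
    rintro _ _ ⟨Z, hZ, rfl⟩ ⟨Z', hZ', rfl⟩
    refine ⟨fun c => Z c + Z' c, fun σ c => ?_, Finset.sum_add_distrib.symm⟩
    rw [map_add, hZ, hZ']
  smul_mem' := by
    rintro t _ ⟨Z, hZ, rfl⟩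
    refine ⟨fun c => t • Z c, fun σ c => ?_, Finset.smul_sum⟩
    rw [map_smul, hZ]

/-- Merging the colours in `E` of an equivariant family gives a relation. -/
lemma sum_mem_relSub [DecidableEq K] {F : (Fin d → K) → T k (Fin d) V} (hF : EquivFam F)
    (c : Fin d → ℕ) (j a b : ℕ) (E : Finset K) (al : ℕ → Finset K) :
    ∑ W ∈ relSets c j a b, ∑ g ∈ Fintype.piFinset (fun p => (colorOf c W p).elim E al), F g ∈
      relSub k V c j a b := by
  refine ⟨fun c' => ∑ g ∈ Fintype.piFinset (fun p => (c' p).elim E al), F g, fun σ c' => ?_, rfl⟩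
  rw [map_sum]
  refine Finset.sum_bij' (fun g _ => g ∘ σ.symm) (fun g _ => g ∘ σ) ?_ ?_ ?_ ?_ ?_
  · intro g hg
    rw [Fintype.mem_piFinset] at hg ⊢
    exact fun p => hg (σ.symm p)
  · intro g hg
    rw [Fintype.mem_piFinset] at hg ⊢
    intro p
    simpa using hg (σ p)
  · intro g _; funext p; simp
  · intro g _; funext p; simp
  · intro g _; exact hF σ g

/-- A permutation within the columns permutes the sets W with given counts in columns j and j + 1,
and by equivariance it permutes the summands accordingly. -/
lemma relSub_le_gammaInv (c : Fin d → ℕ) (j a b : ℕ) :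
    relSub k V c j a b ≤ gammaInv (k := k) c V := by
  rintro _ ⟨Z, hZ, rfl⟩ σ hσ
  rw [map_sum]
  have hm : ∀ (τ : Equiv.Perm (Fin d)), InYoung c τ → ∀ W ∈ relSets c j a b,
      W.map τ.toEmbedding ∈ relSets c j a b := by
    intro τ hτ W hW
    rw [mem_relSets] at hW ⊢
    have hc : ∀ i, colCount c (W.map τ.toEmbedding) i = colCount c W i := by
      intro i
      unfold colCount
      rw [Finset.filter_map, Finset.card_map]
      congr 1
      refine Finset.filter_congr fun p _ => ?_
      simp [hτ p]
    refine ⟨?_, by rw [hc, hW.2.1], by rw [hc, hW.2.2]⟩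
    intro p hp
    obtain ⟨q, hq, rfl⟩ := Finset.mem_map.mp hp
    have := hW.1 q hq
    rwa [← hτ q] at this
  refine Finset.sum_bij' (fun W _ => W.map σ.toEmbedding) (fun W _ => W.map σ.symm.toEmbedding)
    (fun W hW => hm σ hσ W hW) (fun W hW => hm σ.symm hσ.symm W hW) ?_ ?_ ?_
  · intro W _; ext p; simp
  · intro W _; ext p; simp
  · intro W _
    rw [hZ]
    congr 1
    funext p
    simp [colorOf, hσ.symm p]

/-- A tensor that is symmetric in each column is itself a relation without factors in the second of
the two columns. -/
lemma mem_relSub_of_mem_gammaInv {c : Fin d → ℕ} {x : T k (Fin d) V}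
    (hx : x ∈ gammaInv (k := k) c V) (j : ℕ) :
    x ∈ relSub k V c j (colCount c Finset.univ j) 0 := by
  classical
  -- The whole column j. Merging it into one colour changes no stabilizer, and it is the only set
  -- with the prescribed counts, so the relation has a single term.
  let W₀ : Finset (Fin d) := Finset.univ.filter fun p => c p = j
  obtain ⟨Z, hZ, hZ0, -⟩ := exists_orbitFam (colorOf c W₀) x (fun σ hσ => hx σ fun i => by
    have h := hσ i
    simp only [colorOf, W₀, Finset.mem_filter, Finset.mem_univ, true_and] at h
    split_ifs at h with h1 h2 h2
    · rw [h1, h2]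
    · exact Option.some.inj h)
  refine ⟨Z, hZ, ?_⟩
  rw [Finset.sum_eq_single W₀, hZ0]
  · intro W hW hne
    refine absurd ?_ hne
    rw [mem_relSets] at hW
    obtain ⟨h1, h2, h3⟩ := hW
    have h4 : ∀ p ∈ W, c p = j := by
      intro p hp
      refine (h1 p hp).resolve_right fun h => ?_
      have : p ∈ W.filter fun p => c p = j + 1 := by simp [hp, h]
      rw [colCount, Finset.card_eq_zero] at h3
      rw [h3] at this
      simp at this
    refine Finset.eq_of_subset_of_card_le (fun p hp => by simp [W₀, h4 p hp]) ?_
    change colCount c Finset.univ j ≤ _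
    rw [← h2]
    exact Finset.card_le_card (Finset.filter_subset _ _)
  · intro h
    refine absurd ?_ h
    rw [mem_relSets]
    refine ⟨fun p hp => Or.inl (by simpa [W₀] using hp), ?_, ?_⟩
    · simp [colCount, W₀, Finset.filter_filter]
    · rw [colCount, Finset.card_eq_zero, Finset.filter_eq_empty_iff]
      intro p hp h
      have : c p = j := by simpa [W₀] using hp
      omega

lemma card_filter_placement (ρ : Fin e ⊕ₗ Fin f ≃ Fin d) (P : Fin d → Prop) [DecidablePred P] :
    (Finset.univ.filter P).card =
      (Finset.univ.filter fun a => P (ρ (toLex (Sum.inl a)))).card +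
      (Finset.univ.filter fun b => P (ρ (toLex (Sum.inr b)))).card := by
  simp only [Finset.card_filter]
  rw [← ρ.sum_comp, ← (toLex : Fin e ⊕ Fin f ≃ _).sum_comp, Fintype.sum_sum_type]

lemma colCount_leftSet (ρ : Fin e ⊕ₗ Fin f ≃ Fin d) (c : Fin d → ℕ) (i : ℕ) :
    colCount c (leftSet ρ) i = colCount (fun a => c (ρ (toLex (Sum.inl a)))) Finset.univ i := by
  have h : (leftSet ρ).filter (fun p => c p = i) =
      Finset.univ.filter fun p => p ∈ leftSet ρ ∧ c p = i := by
    ext p; simp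
  unfold colCount
  rw [h, card_filter_placement ρ]
  simp [inl_mem_leftSet, inr_notMem_leftSet]

lemma colCount_leftSet_compl (ρ : Fin e ⊕ₗ Fin f ≃ Fin d) (c : Fin d → ℕ) (i : ℕ) :
    colCount c Finset.univ i = colCount c (leftSet ρ) i +
      colCount (fun b => c (ρ (toLex (Sum.inr b)))) Finset.univ i := by
  rw [colCount_leftSet]
  exact card_filter_placement ρ fun p => c p = i

/-- `B` arises from `A` by moving positions from column `j + 1` to column `j`, up to permutations
within the columns. -/
def MovedLeft (c : Fin d → ℕ) (j : ℕ) (A B : Finset (Fin d)) : Prop :=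
  (∀ i, i ≠ j → i ≠ j + 1 → colCount c B i = colCount c A i) ∧
  colCount c A j ≤ colCount c B j ∧
  colCount c B j + colCount c B (j + 1) = colCount c A j + colCount c A (j + 1)

lemma card_filter_perm {c₀ : Fin d → K} (σ : Equiv.Perm (Fin d)) (P : K → Prop)
    [DecidablePred P] :
    (Finset.univ.filter fun p => P ((c₀ ∘ σ.symm) p)).card =
      (Finset.univ.filter fun p => P (c₀ p)).card := by
  simp only [Finset.card_filter]
  exact σ.symm.sum_comp fun p => if P (c₀ p) then 1 else 0

end Relations

/-! ### Extension of relations from one factor to the direct sum. -/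

section Transfer

variable {k : Type u} [Field k] {V₁ V₂ : Type u}
  [AddCommGroup V₁] [Module k V₁] [SuperSpace k V₁]
  [AddCommGroup V₂] [Module k V₂] [SuperSpace k V₂]
variable {d e f : ℕ}

/-- A relation in the second factor, multiplied by an element of the first factor, gives a relation
up to terms in which factors from `V₁` have moved to the left. -/
lemma exists_rel_right (ρ : Fin e ⊕ₗ Fin f ≃ Fin d) (c : Fin d → ℕ) {c₁ : Fin e → ℕ}
    {c₂ : Fin f → ℕ} (h₁ : ∀ a, c (ρ (toLex (Sum.inl a))) = c₁ a)
    (h₂ : ∀ b, c (ρ (toLex (Sum.inr b))) = c₂ b) {j a b : ℕ} {x : T k (Fin e) V₁}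
    (hx : x ∈ gammaInv (k := k) c₁ V₁) {y : T k (Fin f) V₂} (hy : y ∈ relSub k V₂ c₂ j a b) :
    ∃ r ∈ relSub k (V₁ × V₂) c j a (b + colCount c₁ Finset.univ (j + 1)),
      coinclR ρ r = x ⊗ₜ y ∧ ∀ B, blockPr B r ≠ 0 → MovedLeft c j (leftSet ρ) B := by
  classical
  obtain ⟨Z₂, hZ₂, rfl⟩ := hy
  obtain ⟨Z₁, hZ₁, hx1, hx0⟩ := exists_orbitFam (fun a => some (c₁ a)) x
    (fun σ hσ => hx σ fun i => Option.some.inj (hσ i))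
  obtain ⟨F, hF, hFp, hF0⟩ := exists_prodFam (d := d) hZ₁ hZ₂
  -- The V₁ factors of column j + 1 join the merged V₂ factors. Thus W admits both colours, outside
  -- of W column j + 1 admits no V₁ factor, and b grows by the number of V₁ factors in column j + 1.
  let E : Finset (Option ℕ ⊕ Option ℕ) := {Sum.inl (some (j + 1)), Sum.inr none}
  let al : ℕ → Finset (Option ℕ ⊕ Option ℕ) := fun i =>
    if i = j + 1 then {Sum.inr (some i)} else {Sum.inl (some i), Sum.inr (some i)}
  have hcount : ∀ c₁' : Fin e → Option ℕ, Z₁ c₁' ≠ 0 → ∀ i,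
      (Finset.univ.filter fun p => c₁' p = some i).card = colCount c₁ Finset.univ i := by
    intro c₁' h i
    obtain ⟨σ, rfl⟩ := hx0 _ h
    rw [card_filter_perm σ fun o => o = some i]
    simp [colCount]
  -- the colours of the factors from `V₁` and from `V₂` in an admissible colouring
  have hleft : ∀ (ρ' : Fin e ⊕ₗ Fin f ≃ Fin d) (c₁' : Fin e → Option ℕ) (c₂' : Fin f → Option ℕ)
      (W : Finset (Fin d)), (∀ p ∈ W, c p = j ∨ c p = j + 1) →
      placeCol ρ' c₁' c₂' ∈ Fintype.piFinset (fun p => (colorOf c W p).elim E al) →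
      ∀ p, (ρ' (toLex (Sum.inl p)) ∈ W ∧ c₁' p = some (j + 1) ∧
        (c (ρ' (toLex (Sum.inl p))) = j ∨ c (ρ' (toLex (Sum.inl p))) = j + 1)) ∨
        (ρ' (toLex (Sum.inl p)) ∉ W ∧ c₁' p = some (c (ρ' (toLex (Sum.inl p)))) ∧
          c (ρ' (toLex (Sum.inl p))) ≠ j + 1) := by
    intro ρ' c₁' c₂' W hW hmem p
    rw [Fintype.mem_piFinset] at hmem
    have h := hmem (ρ' (toLex (Sum.inl p)))
    rw [placeCol_inl] at h
    by_cases hp : ρ' (toLex (Sum.inl p)) ∈ W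
    · left
      simp only [colorOf, hp, if_true, Option.elim, E] at h
      refine ⟨hp, by simpa using h, hW _ hp⟩
    · right
      simp only [colorOf, hp, if_false, Option.elim, al] at h
      split_ifs at h with hj
      · simp at h
      · exact ⟨hp, by simpa using h, hj⟩
  have hright : ∀ (ρ' : Fin e ⊕ₗ Fin f ≃ Fin d) (c₁' : Fin e → Option ℕ) (c₂' : Fin f → Option ℕ)
      (W : Finset (Fin d)),
      placeCol ρ' c₁' c₂' ∈ Fintype.piFinset (fun p => (colorOf c W p).elim E al) →
      ∀ p, (ρ' (toLex (Sum.inr p)) ∈ W ∧ c₂' p = none) ∨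
        (ρ' (toLex (Sum.inr p)) ∉ W ∧ c₂' p = some (c (ρ' (toLex (Sum.inr p))))) := by
    intro ρ' c₁' c₂' W hmem p
    rw [Fintype.mem_piFinset] at hmem
    have h := hmem (ρ' (toLex (Sum.inr p)))
    rw [placeCol_inr] at h
    by_cases hp : ρ' (toLex (Sum.inr p)) ∈ W
    · left
      simp only [colorOf, hp, if_true, Option.elim, E] at h
      exact ⟨hp, by simpa using h⟩
    · right
      simp only [colorOf, hp, if_false, Option.elim, al] at h
      split_ifs at h with hj
      · exact ⟨hp, by simpa using h⟩
      · exact ⟨hp, by simpa using h⟩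
  have hA : ∀ i, colCount c (leftSet ρ) i = colCount c₁ Finset.univ i := by
    intro i; rw [colCount_leftSet]; simp only [h₁]
  refine ⟨_, sum_mem_relSub hF c j a (b + colCount c₁ Finset.univ (j + 1)) E al, ?_, ?_⟩
  · rw [map_sum]
    simp only [map_sum]
    rw [Finset.sum_sigma', TensorProduct.tmul_sum]
    symm
    -- The terms in the block of ρ: the V₁ factors keep their columns, and W is the image of W₂
    -- together with the V₁ positions of column j + 1.
    let cc : Finset (Fin f) → Fin d → Option ℕ ⊕ Option ℕ := fun W₂ =>
      placeCol ρ (fun a => some (c₁ a)) (colorOf c₂ W₂)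
    let WW : Finset (Fin f) → Finset (Fin d) := fun W₂ =>
      Finset.univ.filter fun p => cc W₂ p ∈ E
    have hWl : ∀ W₂ a, ρ (toLex (Sum.inl a)) ∈ WW W₂ ↔ c₁ a = j + 1 := by
      intro W₂ a; simp [WW, cc, E]
    have hWr : ∀ W₂ b, ρ (toLex (Sum.inr b)) ∈ WW W₂ ↔ b ∈ W₂ := by
      intro W₂ b; simp [WW, cc, E, colorOf]
    refine Finset.sum_of_injOn (fun W₂ => ⟨WW W₂, cc W₂⟩) ?_ ?_ ?_ ?_
    · intro W₂ _ W₂' _ h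
      ext b
      rw [← hWr, ← hWr, show WW W₂ = WW W₂' from congrArg Sigma.fst h]
    · intro W₂ hW₂
      rw [Finset.mem_coe, mem_relSets] at hW₂
      obtain ⟨hw1, hw2, hw3⟩ := hW₂
      rw [Finset.mem_coe, Finset.mem_sigma]
      have hcnt : ∀ i, colCount c (WW W₂) i =
          (if i = j + 1 then colCount c₁ Finset.univ (j + 1) else 0) + colCount c₂ W₂ i := by
        intro i
        have : (WW W₂).filter (fun p => c p = i) =
            Finset.univ.filter fun p => p ∈ WW W₂ ∧ c p = i := by ext p; simp
        unfold colCount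
        rw [this, card_filter_placement ρ]
        simp only [hWl, hWr, h₁, h₂]
        congr 1
        · split_ifs with hi
          · subst hi; congr 1; ext p; simp
          · rw [Finset.card_eq_zero, Finset.filter_eq_empty_iff]
            rintro p - ⟨h, h'⟩
            exact hi (h'.symm.trans h)
        · congr 1; ext p; simp
      refine ⟨mem_relSets.mpr ⟨?_, ?_, ?_⟩, ?_⟩
      · refine forall_placement ρ (fun a ha => ?_) (fun b hb => ?_)
        · rw [hWl] at ha; rw [h₁]; exact Or.inr ha
        · rw [hWr] at hb; rw [h₂]; exact hw1 b hb
      · change colCount c (WW W₂) j = a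
        rw [hcnt, if_neg (by omega), hw2, zero_add]
      · change colCount c (WW W₂) (j + 1) = _
        rw [hcnt, if_pos rfl, hw3, add_comm]
      · rw [Fintype.mem_piFinset]
        refine forall_placement ρ (fun a => ?_) (fun b => ?_)
        · by_cases ha : c₁ a = j + 1
          · simp only [colorOf, hWl, ha, if_true, Option.elim, cc, placeCol_inl, E]; simp
          · simp only [colorOf, hWl, ha, if_false, Option.elim, cc, placeCol_inl, al, h₁]; simp
        · by_cases hb : b ∈ W₂
          · simp only [colorOf, hWr, hb, if_true, Option.elim, cc, placeCol_inr, E]; simp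
          · simp only [colorOf, hWr, hb, if_false, Option.elim, cc, placeCol_inr, al, h₂]
            split_ifs <;> simp
    · rintro ⟨W, g⟩ hWg hne
      by_contra h
      refine hne ?_
      rw [Finset.mem_sigma] at hWg
      obtain ⟨hW, hg⟩ := hWg
      simp only at hW hg h
      have h' : blockPr (leftSet ρ) (F g) ≠ 0 := fun h' => h ((blockPr_eq_zero_iff ρ _).mp h')
      obtain ⟨ρ', c₁', c₂', rfl, hρ, hz1, hz2⟩ := EquivFam.exists_placeCol hFp hF0 h'
      obtain ⟨α, β, rfl⟩ := exists_blockPerm hρ.symm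
      rw [placeCol_blockPerm] at hg h ⊢
      have hz1' : Z₁ (c₁' ∘ α.symm) ≠ 0 := fun h0 => by
        rw [hFp, h0, TensorProduct.zero_tmul, map_zero, map_zero] at h; exact h rfl
      generalize c₁' ∘ α.symm = c₁'' at hg hz1' ⊢
      generalize c₂' ∘ β.symm = c₂'' at hg ⊢
      rw [mem_relSets] at hW
      obtain ⟨hw1, hw2, hw3⟩ := hW
      have hl := hleft ρ c₁'' c₂'' W hw1 hg
      have hr := hright ρ c₁'' c₂'' W hg
      simp only [h₁, h₂] at hl hr
      -- V₁ factors of colour j can only stand in column j, and there are as many as V₁ positions in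
      -- that column. They fill these positions, so no factor of colour j + 1 stands there, and the
      -- colouring of the V₁ positions is the original one.
      have hcj : (Finset.univ.filter fun p => c₁'' p = some j) =
          Finset.univ.filter fun p => c₁ p = j := by
        refine Finset.eq_of_subset_of_card_le ?_ ?_
        · intro p hp
          simp only [Finset.mem_filter, Finset.mem_univ, true_and] at hp ⊢
          rcases hl p with ⟨_, h2, _⟩ | ⟨_, h2, _⟩
          · rw [hp] at h2; simp at h2
          · rw [hp] at h2; exact (Option.some.inj h2).symm
        · rw [hcount c₁'' hz1' j]; exact le_rfl
      have hc1 : c₁'' = fun a => some (c₁ a) := by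
        funext p
        rcases hl p with ⟨_, h2, h3⟩ | ⟨_, h2, _⟩
        · rcases h3 with h3 | h3
          · have : p ∈ Finset.univ.filter fun p => c₁'' p = some j := by rw [hcj]; simp [h3]
            rw [h3]
            simpa using this
          · rw [h2, h3]
        · exact h2
      let W₂ : Finset (Fin f) := Finset.univ.filter fun b => ρ (toLex (Sum.inr b)) ∈ W
      have hc2 : c₂'' = colorOf c₂ W₂ := by
        funext b
        rcases hr b with ⟨h1, h2⟩ | ⟨h1, h2⟩
        · simp [colorOf, W₂, h1, h2]
        · simp [colorOf, W₂, h1, h2]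
      have hWW : WW W₂ = W := by
        ext p
        refine forall_placement ρ (P := fun p => p ∈ WW W₂ ↔ p ∈ W) (fun a => ?_) (fun b => ?_) p
        · rw [hWl]
          rcases hl a with ⟨h1, h2, _⟩ | ⟨h1, h2, h3⟩
          · refine ⟨fun _ => h1, fun _ => ?_⟩
            rw [hc1] at h2
            exact Option.some.inj h2
          · exact ⟨fun h => absurd h h3, fun h => absurd h h1⟩
        · rw [hWr]; simp [W₂]
      have hcnt : ∀ i, colCount c W i =
          (Finset.univ.filter fun a => ρ (toLex (Sum.inl a)) ∈ W ∧ c₁ a = i).card +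
            colCount c₂ W₂ i := by
        intro i
        have : W.filter (fun p => c p = i) =
            Finset.univ.filter fun p => p ∈ W ∧ c p = i := by ext p; simp
        unfold colCount
        rw [this, card_filter_placement ρ]
        simp only [h₁, h₂]
        congr 1
        congr 1; ext p; simp [W₂]
      refine ⟨W₂, ?_, ?_⟩
      · rw [Finset.mem_coe, mem_relSets]
        refine ⟨fun b hb => ?_, ?_, ?_⟩
        · have := hw1 _ (by simpa [W₂] using hb : ρ (toLex (Sum.inr b)) ∈ W)
          rwa [h₂] at this
        · have h3 := hcnt j
          rw [hw2] at h3
          rw [h3, right_eq_add, Finset.card_eq_zero, Finset.filter_eq_empty_iff]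
          rintro p - ⟨hp, hp'⟩
          rw [← hWW, hWl] at hp
          omega
        · have h3 := hcnt (j + 1)
          rw [hw3] at h3
          have h4 : (Finset.univ.filter fun a => ρ (toLex (Sum.inl a)) ∈ W ∧ c₁ a = j + 1) =
              Finset.univ.filter fun a => c₁ a = j + 1 := by
            refine Finset.filter_congr fun p _ => ?_
            rw [← hWW, hWl]; simp
          rw [h4] at h3
          change b + (Finset.univ.filter fun a => c₁ a = j + 1).card = _ at h3
          omega
      · simp only [hWW, cc, hc1, hc2]
    · intro W₂ _
      simp only [cc]
      rw [hFp, coinclR_inclR, hx1]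
  -- In any nonzero term the only V₁ factors that can stand outside their column are those of colour
  -- j + 1, and these can only stand in column j.
  · intro B hB
    rw [map_sum] at hB
    obtain ⟨W, hW, hB⟩ := Finset.exists_ne_zero_of_sum_ne_zero hB
    rw [map_sum] at hB
    obtain ⟨g, hg, hB⟩ := Finset.exists_ne_zero_of_sum_ne_zero hB
    obtain ⟨ρ', c₁', c₂', rfl, rfl, hz1, hz2⟩ := EquivFam.exists_placeCol hFp hF0 hB
    rw [mem_relSets] at hW
    have hl := hleft ρ' c₁' c₂' W hW.1 hg
    unfold MovedLeft
    simp only [hA, colCount_leftSet, ← hcount c₁' hz1]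
    unfold colCount
    refine ⟨fun i hi hi' => ?_, ?_, ?_⟩
    · congr 1
      refine Finset.filter_congr fun p _ => ?_
      rcases hl p with ⟨_, h2, h3⟩ | ⟨_, h2, _⟩
      · beta_reduce; rw [h2, Option.some_inj]; omega
      · rw [h2, Option.some_inj]
    · refine Finset.card_le_card fun p hp => ?_
      simp only [Finset.mem_filter, Finset.mem_univ, true_and] at hp ⊢
      rcases hl p with ⟨_, h2, _⟩ | ⟨_, h2, _⟩
      · rw [hp] at h2; simp at h2
      · rw [hp] at h2; exact (Option.some.inj h2).symm
    · rw [← Finset.card_union_of_disjoint, ← Finset.card_union_of_disjoint,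
        ← Finset.filter_or, ← Finset.filter_or]
      · congr 1
        refine Finset.filter_congr fun p _ => ?_
        rcases hl p with ⟨_, h2, h3⟩ | ⟨_, h2, _⟩
        · beta_reduce; rw [h2, Option.some_inj, Option.some_inj]; omega
        · rw [h2, Option.some_inj, Option.some_inj]
      · refine Finset.disjoint_filter.mpr fun p _ h h' => ?_
        rw [h] at h'; simp at h'
      · refine Finset.disjoint_filter.mpr fun p _ h h' => ?_
        omega

/-- A relation in the first factor, multiplied by an element of the second factor, gives a relation
up to terms in which factors from `V₁` have moved to the left. -/
lemma exists_rel_left (ρ : Fin e ⊕ₗ Fin f ≃ Fin d) (c : Fin d → ℕ) {c₁ : Fin e → ℕ}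
    {c₂ : Fin f → ℕ} (h₁ : ∀ a, c (ρ (toLex (Sum.inl a))) = c₁ a)
    (h₂ : ∀ b, c (ρ (toLex (Sum.inr b))) = c₂ b) {j a b : ℕ} {x : T k (Fin e) V₁}
    (hx : x ∈ relSub k V₁ c₁ j a b) {y : T k (Fin f) V₂} (hy : y ∈ gammaInv (k := k) c₂ V₂) :
    ∃ r ∈ relSub k (V₁ × V₂) c j (a + colCount c₂ Finset.univ j) b,
      coinclR ρ r = x ⊗ₜ y ∧ ∀ B, blockPr B r ≠ 0 → MovedLeft c j (leftSet ρ) B := by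
  classical
  obtain ⟨Z₁, hZ₁, rfl⟩ := hx
  obtain ⟨Z₂, hZ₂, hy1, hy0⟩ := exists_orbitFam (fun a => some (c₂ a)) y
    (fun σ hσ => hy σ fun i => Option.some.inj (hσ i))
  obtain ⟨F, hF, hFp, hF0⟩ := exists_prodFam (d := d) hZ₁ hZ₂
  -- The mirror image of the previous construction: now the V₂ factors of column j join W, so that a
  -- grows. They may move to column j + 1, in exchange for V₁ factors that move to the left.
  let E : Finset (Option ℕ ⊕ Option ℕ) := {Sum.inl none, Sum.inr (some j)}
  let al : ℕ → Finset (Option ℕ ⊕ Option ℕ) := fun i =>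
    if i = j then {Sum.inl (some i)} else {Sum.inl (some i), Sum.inr (some i)}
  have hcount : ∀ c₂' : Fin f → Option ℕ, Z₂ c₂' ≠ 0 → ∀ i,
      (Finset.univ.filter fun p => c₂' p = some i).card = colCount c₂ Finset.univ i := by
    intro c₂' h i
    obtain ⟨σ, rfl⟩ := hy0 _ h
    rw [card_filter_perm σ fun o => o = some i]
    simp [colCount]
  have hright : ∀ (ρ' : Fin e ⊕ₗ Fin f ≃ Fin d) (c₁' : Fin e → Option ℕ) (c₂' : Fin f → Option ℕ)
      (W : Finset (Fin d)), (∀ p ∈ W, c p = j ∨ c p = j + 1) →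
      placeCol ρ' c₁' c₂' ∈ Fintype.piFinset (fun p => (colorOf c W p).elim E al) →
      ∀ p, (ρ' (toLex (Sum.inr p)) ∈ W ∧ c₂' p = some j ∧
        (c (ρ' (toLex (Sum.inr p))) = j ∨ c (ρ' (toLex (Sum.inr p))) = j + 1)) ∨
        (ρ' (toLex (Sum.inr p)) ∉ W ∧ c₂' p = some (c (ρ' (toLex (Sum.inr p)))) ∧
          c (ρ' (toLex (Sum.inr p))) ≠ j) := by
    intro ρ' c₁' c₂' W hW hmem p
    rw [Fintype.mem_piFinset] at hmem
    have h := hmem (ρ' (toLex (Sum.inr p)))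
    rw [placeCol_inr] at h
    by_cases hp : ρ' (toLex (Sum.inr p)) ∈ W
    · left
      simp only [colorOf, hp, if_true, Option.elim, E] at h
      refine ⟨hp, by simpa using h, hW _ hp⟩
    · right
      simp only [colorOf, hp, if_false, Option.elim, al] at h
      split_ifs at h with hj
      · simp at h
      · exact ⟨hp, by simpa using h, hj⟩
  have hleft : ∀ (ρ' : Fin e ⊕ₗ Fin f ≃ Fin d) (c₁' : Fin e → Option ℕ) (c₂' : Fin f → Option ℕ)
      (W : Finset (Fin d)),
      placeCol ρ' c₁' c₂' ∈ Fintype.piFinset (fun p => (colorOf c W p).elim E al) →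
      ∀ p, (ρ' (toLex (Sum.inl p)) ∈ W ∧ c₁' p = none) ∨
        (ρ' (toLex (Sum.inl p)) ∉ W ∧ c₁' p = some (c (ρ' (toLex (Sum.inl p))))) := by
    intro ρ' c₁' c₂' W hmem p
    rw [Fintype.mem_piFinset] at hmem
    have h := hmem (ρ' (toLex (Sum.inl p)))
    rw [placeCol_inl] at h
    by_cases hp : ρ' (toLex (Sum.inl p)) ∈ W
    · left
      simp only [colorOf, hp, if_true, Option.elim, E] at h
      exact ⟨hp, by simpa using h⟩
    · right
      simp only [colorOf, hp, if_false, Option.elim, al] at h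
      split_ifs at h with hj
      · exact ⟨hp, by simpa using h⟩
      · exact ⟨hp, by simpa using h⟩
  refine ⟨_, sum_mem_relSub hF c j (a + colCount c₂ Finset.univ j) b E al, ?_, ?_⟩
  · rw [map_sum]
    simp only [map_sum]
    rw [Finset.sum_sigma', TensorProduct.sum_tmul]
    symm
    let cc : Finset (Fin e) → Fin d → Option ℕ ⊕ Option ℕ := fun W₁ =>
      placeCol ρ (colorOf c₁ W₁) (fun a => some (c₂ a))
    let WW : Finset (Fin e) → Finset (Fin d) := fun W₁ =>
      Finset.univ.filter fun p => cc W₁ p ∈ E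
    have hWr : ∀ W₁ b, ρ (toLex (Sum.inr b)) ∈ WW W₁ ↔ c₂ b = j := by
      intro W₁ b; simp [WW, cc, E]
    have hWl : ∀ W₁ a, ρ (toLex (Sum.inl a)) ∈ WW W₁ ↔ a ∈ W₁ := by
      intro W₁ a; simp [WW, cc, E, colorOf]
    refine Finset.sum_of_injOn (fun W₁ => ⟨WW W₁, cc W₁⟩) ?_ ?_ ?_ ?_
    · intro W₁ _ W₁' _ h
      ext b
      rw [← hWl, ← hWl, show WW W₁ = WW W₁' from congrArg Sigma.fst h]
    · intro W₁ hW₁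
      rw [Finset.mem_coe, mem_relSets] at hW₁
      obtain ⟨hw1, hw2, hw3⟩ := hW₁
      rw [Finset.mem_coe, Finset.mem_sigma]
      have hcnt : ∀ i, colCount c (WW W₁) i =
          colCount c₁ W₁ i + (if i = j then colCount c₂ Finset.univ j else 0) := by
        intro i
        have : (WW W₁).filter (fun p => c p = i) =
            Finset.univ.filter fun p => p ∈ WW W₁ ∧ c p = i := by ext p; simp
        unfold colCount
        rw [this, card_filter_placement ρ]
        simp only [hWl, hWr, h₁, h₂]
        congr 1
        · congr 1; ext p; simp
        · split_ifs with hi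
          · subst hi; congr 1; ext p; simp
          · rw [Finset.card_eq_zero, Finset.filter_eq_empty_iff]
            rintro p - ⟨h, h'⟩
            exact hi (h'.symm.trans h)
      refine ⟨mem_relSets.mpr ⟨?_, ?_, ?_⟩, ?_⟩
      · refine forall_placement ρ (fun a ha => ?_) (fun b hb => ?_)
        · rw [hWl] at ha; rw [h₁]; exact hw1 a ha
        · rw [hWr] at hb; rw [h₂]; exact Or.inl hb
      · change colCount c (WW W₁) j = _
        rw [hcnt, if_pos rfl, hw2]
      · change colCount c (WW W₁) (j + 1) = _
        rw [hcnt, if_neg (by omega), hw3, add_zero]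
      · rw [Fintype.mem_piFinset]
        refine forall_placement ρ (fun a => ?_) (fun b => ?_)
        · by_cases ha : a ∈ W₁
          · simp only [colorOf, hWl, ha, if_true, Option.elim, cc, placeCol_inl, E]; simp
          · simp only [colorOf, hWl, ha, if_false, Option.elim, cc, placeCol_inl, al, h₁]
            split_ifs <;> simp
        · by_cases hb : c₂ b = j
          · simp only [colorOf, hWr, hb, if_true, Option.elim, cc, placeCol_inr, E]; simp
          · simp only [colorOf, hWr, hb, if_false, Option.elim, cc, placeCol_inr, al, h₂]; simp
    · rintro ⟨W, g⟩ hWg hne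
      by_contra h
      refine hne ?_
      rw [Finset.mem_sigma] at hWg
      obtain ⟨hW, hg⟩ := hWg
      simp only at hW hg h
      have h' : blockPr (leftSet ρ) (F g) ≠ 0 := fun h' => h ((blockPr_eq_zero_iff ρ _).mp h')
      obtain ⟨ρ', c₁', c₂', rfl, hρ, hz1, hz2⟩ := EquivFam.exists_placeCol hFp hF0 h'
      obtain ⟨α, β, rfl⟩ := exists_blockPerm hρ.symm
      rw [placeCol_blockPerm] at hg h ⊢
      have hz2' : Z₂ (c₂' ∘ β.symm) ≠ 0 := fun h0 => by
        rw [hFp, h0, TensorProduct.tmul_zero, map_zero, map_zero] at h; exact h rfl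
      generalize c₁' ∘ α.symm = c₁'' at hg ⊢
      generalize c₂' ∘ β.symm = c₂'' at hg hz2' ⊢
      rw [mem_relSets] at hW
      obtain ⟨hw1, hw2, hw3⟩ := hW
      have hl := hleft ρ c₁'' c₂'' W hg
      have hr := hright ρ c₁'' c₂'' W hw1 hg
      simp only [h₁, h₂] at hl hr
      -- V₂ factors of colour j + 1 can only stand in column j + 1, and their number fills the V₂
      -- positions there; so no V₂ factor of colour j has moved.
      have hcj : (Finset.univ.filter fun p => c₂'' p = some (j + 1)) =
          Finset.univ.filter fun p => c₂ p = j + 1 := by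
        refine Finset.eq_of_subset_of_card_le ?_ ?_
        · intro p hp
          simp only [Finset.mem_filter, Finset.mem_univ, true_and] at hp ⊢
          rcases hr p with ⟨_, h2, _⟩ | ⟨_, h2, _⟩
          · rw [hp] at h2; simp at h2
          · rw [hp] at h2; exact (Option.some.inj h2).symm
        · rw [hcount c₂'' hz2' (j + 1)]; exact le_rfl
      have hc2 : c₂'' = fun a => some (c₂ a) := by
        funext p
        rcases hr p with ⟨_, h2, h3⟩ | ⟨_, h2, _⟩
        · rcases h3 with h3 | h3
          · rw [h2, h3]
          · have : p ∈ Finset.univ.filter fun p => c₂'' p = some (j + 1) := by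
              rw [hcj]; simp [h3]
            rw [h3]
            simpa using this
        · exact h2
      let W₁ : Finset (Fin e) := Finset.univ.filter fun b => ρ (toLex (Sum.inl b)) ∈ W
      have hc1 : c₁'' = colorOf c₁ W₁ := by
        funext b
        rcases hl b with ⟨h1, h2⟩ | ⟨h1, h2⟩
        · simp [colorOf, W₁, h1, h2]
        · simp [colorOf, W₁, h1, h2]
      have hWW : WW W₁ = W := by
        ext p
        refine forall_placement ρ (P := fun p => p ∈ WW W₁ ↔ p ∈ W) (fun a => ?_) (fun b => ?_) p
        · rw [hWl]; simp [W₁]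
        · rw [hWr]
          rcases hr b with ⟨h1, h2, _⟩ | ⟨h1, h2, h3⟩
          · refine ⟨fun _ => h1, fun _ => ?_⟩
            rw [hc2] at h2
            exact Option.some.inj h2
          · exact ⟨fun h => absurd h h3, fun h => absurd h h1⟩
      have hcnt : ∀ i, colCount c W i = colCount c₁ W₁ i +
          (Finset.univ.filter fun a => ρ (toLex (Sum.inr a)) ∈ W ∧ c₂ a = i).card := by
        intro i
        have : W.filter (fun p => c p = i) =
            Finset.univ.filter fun p => p ∈ W ∧ c p = i := by ext p; simp
        unfold colCount
        rw [this, card_filter_placement ρ]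
        simp only [h₁, h₂]
        congr 2
        ext p; simp [W₁]
      refine ⟨W₁, ?_, ?_⟩
      · rw [Finset.mem_coe, mem_relSets]
        refine ⟨fun b hb => ?_, ?_, ?_⟩
        · have := hw1 _ (by simpa [W₁] using hb : ρ (toLex (Sum.inl b)) ∈ W)
          rwa [h₁] at this
        · have h3 := hcnt j
          rw [hw2] at h3
          have h4 : (Finset.univ.filter fun a => ρ (toLex (Sum.inr a)) ∈ W ∧ c₂ a = j) =
              Finset.univ.filter fun a => c₂ a = j := by
            refine Finset.filter_congr fun p _ => ?_
            rw [← hWW, hWr]; simp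
          rw [h4] at h3
          change a + (Finset.univ.filter fun a => c₂ a = j).card = _ at h3
          omega
        · have h3 := hcnt (j + 1)
          rw [hw3] at h3
          rw [h3, left_eq_add, Finset.card_eq_zero, Finset.filter_eq_empty_iff]
          rintro p - ⟨hp, hp'⟩
          rw [← hWW, hWr] at hp
          omega
      · simp only [hWW, cc, hc1, hc2]
    · intro W₁ _
      simp only [cc]
      rw [hFp, coinclR_inclR, hy1]
  · intro B hB
    rw [map_sum] at hB
    obtain ⟨W, hW, hB⟩ := Finset.exists_ne_zero_of_sum_ne_zero hB
    rw [map_sum] at hB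
    obtain ⟨g, hg, hB⟩ := Finset.exists_ne_zero_of_sum_ne_zero hB
    obtain ⟨ρ', c₁', c₂', rfl, rfl, hz1, hz2⟩ := EquivFam.exists_placeCol hFp hF0 hB
    rw [mem_relSets] at hW
    have hr := hright ρ' c₁' c₂' W hW.1 hg
    -- In each column the V₁ and the V₂ positions are complementary, so the bounds for the V₂
    -- factors turn into bounds for the left sets.
    have hs := fun i => colCount_leftSet_compl ρ' c i
    have hs' := fun i => colCount_leftSet_compl ρ c i
    simp only [h₂, ← hcount c₂' hz2] at hs'
    have e1 : ∀ i, i ≠ j → i ≠ j + 1 → (Finset.univ.filter fun p => c₂' p = some i).card =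
        colCount (fun b => c (ρ' (toLex (Sum.inr b)))) Finset.univ i := by
      intro i hi hi'
      unfold colCount
      congr 1
      refine Finset.filter_congr fun p _ => ?_
      rcases hr p with ⟨_, h2, h3⟩ | ⟨_, h2, _⟩
      · beta_reduce; rw [h2, Option.some_inj]; omega
      · rw [h2, Option.some_inj]
    have e2 : (Finset.univ.filter fun p => c₂' p = some (j + 1)).card ≤
        colCount (fun b => c (ρ' (toLex (Sum.inr b)))) Finset.univ (j + 1) := by
      refine Finset.card_le_card fun p hp => ?_
      simp only [Finset.mem_filter, Finset.mem_univ, true_and] at hp ⊢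
      rcases hr p with ⟨_, h2, _⟩ | ⟨_, h2, _⟩
      · rw [hp] at h2; simp at h2
      · rw [hp] at h2; exact (Option.some.inj h2).symm
    have e3 : (Finset.univ.filter fun p => c₂' p = some j).card +
          (Finset.univ.filter fun p => c₂' p = some (j + 1)).card =
        colCount (fun b => c (ρ' (toLex (Sum.inr b)))) Finset.univ j +
        colCount (fun b => c (ρ' (toLex (Sum.inr b)))) Finset.univ (j + 1) := by
      unfold colCount
      rw [← Finset.card_union_of_disjoint, ← Finset.card_union_of_disjoint,
        ← Finset.filter_or, ← Finset.filter_or]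
      · congr 1
        refine Finset.filter_congr fun p _ => ?_
        rcases hr p with ⟨_, h2, h3⟩ | ⟨_, h2, _⟩
        · beta_reduce; rw [h2, Option.some_inj, Option.some_inj]; omega
        · rw [h2, Option.some_inj, Option.some_inj]
      · refine Finset.disjoint_filter.mpr fun p _ h h' => ?_
        omega
      · refine Finset.disjoint_filter.mpr fun p _ h h' => ?_
        rw [h] at h'; simp at h'
    refine ⟨fun i hi hi' => ?_, ?_, ?_⟩
    · have := e1 i hi hi'; have := hs i; have := hs' i; omega
    · have := hs (j + 1); have := hs' (j + 1); have := hs j; have := hs' j; omega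
    · have := hs (j + 1); have := hs' (j + 1); have := hs j; have := hs' j; omega

end Transfer

/-! ### Supports of invariant tensors and the order by moving to the left. -/

section Supports

variable {k : Type u} [Field k] {V₁ V₂ : Type u}
  [AddCommGroup V₁] [Module k V₁] [SuperSpace k V₁]
  [AddCommGroup V₂] [Module k V₂] [SuperSpace k V₂]
variable {d e f : ℕ}

/-- Colourings with the same number of positions of each colour differ by a permutation. -/
lemma exists_perm_of_card_fiber {K : Type} [DecidableEq K] (c c' : Fin d → K)
    (h : ∀ i, (Finset.univ.filter fun p => c p = i).card =
      (Finset.univ.filter fun p => c' p = i).card) :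
    ∃ σ : Equiv.Perm (Fin d), ∀ p, c' (σ p) = c p := by
  have he : ∀ i, Nonempty ({p // c p = i} ≃ {p // c' p = i}) := by
    intro i
    refine ⟨Fintype.equivOfCardEq ?_⟩
    rw [Fintype.card_subtype, Fintype.card_subtype, h i]
  let E : ∀ i, {p // c p = i} ≃ {p // c' p = i} := fun i => (he i).some
  refine ⟨((Equiv.sigmaFiberEquiv c).symm.trans (Equiv.sigmaCongrRight E)).trans
    (Equiv.sigmaFiberEquiv c'), fun p => ?_⟩
  exact (E (c p) ⟨p, rfl⟩).2

lemma colCount_compl (c : Fin d → ℕ) (B : Finset (Fin d)) (j : ℕ) :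
    colCount c B j + colCount c Bᶜ j = colCount c Finset.univ j := by
  unfold colCount
  rw [← Finset.card_union_of_disjoint, ← Finset.filter_union, Finset.union_compl]
  exact Finset.disjoint_filter_filter disjoint_compl_right

/-- Colour each position by its column and by membership; the two colourings obtained from A and B
have fibres of equal sizes. -/
lemma exists_inYoung_map {c : Fin d → ℕ} {A B : Finset (Fin d)}
    (h : ∀ j, colCount c A j = colCount c B j) :
    ∃ σ : Equiv.Perm (Fin d), InYoung c σ ∧ A.map σ.toEmbedding = B := by
  have hf : ∀ (C : Finset (Fin d)) (i : ℕ × Bool),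
      (Finset.univ.filter fun p => (c p, decide (p ∈ C)) = i).card =
        if i.2 then colCount c C i.1 else colCount c Cᶜ i.1 := by
    rintro C ⟨i, b⟩
    unfold colCount
    cases b
    · rw [if_neg (by simp)]
      congr 1; ext p; simp [and_comm]
    · rw [if_pos rfl]
      congr 1; ext p; simp [and_comm]
  obtain ⟨σ, hσ⟩ := exists_perm_of_card_fiber (fun p => (c p, decide (p ∈ A)))
    (fun p => (c p, decide (p ∈ B))) (fun i => by
      rw [hf, hf, h]
      have h1 := colCount_compl c A i.1
      have h2 := colCount_compl c B i.1
      have h3 := h i.1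
      rw [show colCount c Aᶜ i.1 = colCount c Bᶜ i.1 by omega])
  refine ⟨σ, fun p => congrArg Prod.fst (hσ p), ?_⟩
  have hm : ∀ p, σ p ∈ B ↔ p ∈ A := fun p => by
    simpa using congrArg Prod.snd (hσ p)
  ext p
  obtain ⟨q, rfl⟩ := σ.surjective p
  simp [hm]

lemma colCount_map {c : Fin d → ℕ} {σ : Equiv.Perm (Fin d)} (hσ : InYoung c σ)
    (B : Finset (Fin d)) (j : ℕ) : colCount c (B.map σ.toEmbedding) j = colCount c B j := by
  unfold colCount
  rw [Finset.filter_map, Finset.card_map]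
  congr 1
  refine Finset.filter_congr fun p _ => ?_
  simp [hσ p]

/-- Sets with equal column counts form one orbit of the column group, which permutes the components
of an invariant tensor. It therefore suffices to test one set for each family of counts. -/
lemma blockPr_eq_zero_of_colCount {c : Fin d → ℕ} {z : T k (Fin d) (V₁ × V₂)}
    (hz : z ∈ gammaInv (k := k) c (V₁ × V₂)) {A B : Finset (Fin d)}
    (h : ∀ j, colCount c A j = colCount c B j) (hA : blockPr A z = 0) : blockPr B z = 0 := by
  obtain ⟨σ, hσ, rfl⟩ := exists_inYoung_map h
  rw [← hz σ hσ, ← R_blockPr, hA, map_zero]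

/-- The elements of `Γ` whose components outside of `Q` vanish. -/
def suppSub (c : Fin d → ℕ) (Q : Finset (Fin d) → Prop) :
    Submodule k (T k (Fin d) (V₁ × V₂)) where
  carrier := {z | z ∈ gammaInv (k := k) c (V₁ × V₂) ∧ ∀ B, blockPr B z ≠ 0 → Q B}
  zero_mem' := ⟨zero_mem _, fun B hB => absurd (map_zero _) hB⟩
  add_mem' := by
    rintro x y ⟨hx, hx'⟩ ⟨hy, hy'⟩
    refine ⟨add_mem hx hy, fun B hB => ?_⟩
    by_cases h : blockPr B x = 0
    · rw [map_add, h, zero_add] at hB; exact hy' B hB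
    · exact hx' B h
  smul_mem' := by
    rintro t x ⟨hx, hx'⟩
    refine ⟨Submodule.smul_mem _ _ hx, fun B hB => hx' B fun h => hB ?_⟩
    rw [map_smul, h, smul_zero]

lemma suppSub_mono {c : Fin d → ℕ} {Q Q' : Finset (Fin d) → Prop} (h : ∀ B, Q B → Q' B) :
    suppSub (k := k) (V₁ := V₁) (V₂ := V₂) c Q ≤ suppSub c Q' :=
  fun _ hz => ⟨hz.1, fun B hB => h B (hz.2 B hB)⟩

lemma gammaInv_le_suppSub (c : Fin d → ℕ) :
    gammaInv (k := k) c (V₁ × V₂) ≤ suppSub c fun _ => True := fun _ hz => ⟨hz, fun _ _ => trivial⟩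

open Classical in
/-- The component of a tensor at the sets with the column counts `β`. -/
noncomputable def countPr (c : Fin d → ℕ) (β : ℕ → ℕ) :
    T k (Fin d) (V₁ × V₂) →ₗ[k] T k (Fin d) (V₁ × V₂) :=
  ∑ B : Finset (Fin d) with colCount c B = β, blockPr B

open Classical in
lemma countPr_apply (c : Fin d → ℕ) (β : ℕ → ℕ) (z : T k (Fin d) (V₁ × V₂)) :
    countPr c β z = ∑ B : Finset (Fin d) with colCount c B = β, blockPr B z := by
  rw [countPr, LinearMap.sum_apply]

open Classical in
lemma blockPr_countPr (c : Fin d → ℕ) (β : ℕ → ℕ) (B : Finset (Fin d))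
    (z : T k (Fin d) (V₁ × V₂)) :
    blockPr B (countPr c β z) = if colCount c B = β then blockPr B z else 0 := by
  rw [countPr_apply, map_sum]
  simp only [blockPr_blockPr]
  rw [Finset.sum_ite_eq]
  simp

open Classical in
lemma sum_countPr (c : Fin d → ℕ) (z : T k (Fin d) (V₁ × V₂)) :
    ∑ β ∈ Finset.univ.image (colCount c), countPr c β z = z := by
  conv_rhs => rw [← sum_blockPr z]
  simp only [countPr_apply]
  exact Finset.sum_fiberwise_of_maps_to (fun B _ => Finset.mem_image_of_mem _ (Finset.mem_univ B)) _

lemma countPr_mem_gammaInv {c : Fin d → ℕ} (β : ℕ → ℕ) {z : T k (Fin d) (V₁ × V₂)}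
    (hz : z ∈ gammaInv (k := k) c (V₁ × V₂)) :
    countPr c β z ∈ gammaInv (k := k) c (V₁ × V₂) := by
  classical
  intro σ hσ
  rw [countPr_apply, map_sum]
  refine Finset.sum_bij' (fun B _ => B.map σ.toEmbedding) (fun B _ => B.map σ.symm.toEmbedding)
    ?_ ?_ ?_ ?_ ?_
  · intro B hB
    simp only [Finset.mem_filter, Finset.mem_univ, true_and] at hB ⊢
    rw [← hB]; funext j; exact colCount_map hσ B j
  · intro B hB
    simp only [Finset.mem_filter, Finset.mem_univ, true_and] at hB ⊢
    rw [← hB]; funext j; exact colCount_map hσ.symm B j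
  · intro B _; ext p; simp
  · intro B _; ext p; simp
  · intro B _; rw [R_blockPr, hz σ hσ]

/-- The number of elements of `B` in the columns to the left of column `m`. -/
def leftCount (c : Fin d → ℕ) (B : Finset (Fin d)) (m : ℕ) : ℕ :=
  ∑ i ∈ Finset.range m, colCount c B i

lemma leftCount_eq_card (c : Fin d → ℕ) (B : Finset (Fin d)) (m : ℕ) :
    leftCount c B m = (B.filter fun p => c p < m).card := by
  unfold leftCount colCount
  rw [Finset.card_eq_sum_card_fiberwise (f := c) (t := Finset.range m)]
  · refine Finset.sum_congr rfl fun i hi => ?_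
    rw [Finset.filter_filter]
    congr 1
    ext p
    rw [Finset.mem_range] at hi
    simp only [Finset.mem_filter]
    constructor
    · rintro ⟨h, rfl⟩; exact ⟨h, hi, rfl⟩
    · rintro ⟨h, _, rfl⟩; exact ⟨h, rfl⟩
  · intro p hp
    simpa using (Finset.mem_filter.mp hp).2

lemma leftCount_le (c : Fin d → ℕ) (B : Finset (Fin d)) (m : ℕ) : leftCount c B m ≤ d := by
  rw [leftCount_eq_card]
  exact (Finset.card_le_univ _).trans_eq (Fintype.card_fin d)

/-- Only the cut between columns j and j + 1 sees the move; the sum over both columns is preserved.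
The additive form avoids subtraction of natural numbers. -/
lemma MovedLeft.leftCount {c : Fin d → ℕ} {j : ℕ} {A B : Finset (Fin d)} (h : MovedLeft c j A B)
    (m : ℕ) : leftCount c B m + (if m = j + 1 then colCount c A j else 0) =
      SuperSchur.leftCount c A m + (if m = j + 1 then colCount c B j else 0) := by
  have hlow : ∀ m, m ≤ j → SuperSchur.leftCount c B m = SuperSchur.leftCount c A m := by
    intro m hm
    refine Finset.sum_congr rfl fun i hi => ?_
    have := Finset.mem_range.mp hi
    exact h.1 i (by omega) (by omega)
  have hhigh : ∀ n, SuperSchur.leftCount c B (j + 2 + n) =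
      SuperSchur.leftCount c A (j + 2 + n) := by
    intro n
    induction n with
    | zero =>
      have h1 := hlow j le_rfl
      have h2 := h.2.2
      unfold SuperSchur.leftCount at h1 ⊢
      rw [add_zero, Finset.sum_range_succ, Finset.sum_range_succ, Finset.sum_range_succ,
        Finset.sum_range_succ, h1]
      omega
    | succ n ih =>
      have := h.1 (j + 2 + n) (by omega) (by omega)
      unfold SuperSchur.leftCount at ih ⊢
      rw [← add_assoc, Finset.sum_range_succ, Finset.sum_range_succ, ih, this]
  rcases lt_trichotomy m (j + 1) with hm | rfl | hm
  · rw [if_neg hm.ne, if_neg hm.ne, hlow m (by omega)]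
  · rw [if_pos rfl, if_pos rfl]
    have h1 := hlow j le_rfl
    unfold SuperSchur.leftCount at h1 ⊢
    rw [Finset.sum_range_succ, Finset.sum_range_succ, h1]
    omega
  · obtain ⟨n, rfl⟩ := Nat.exists_eq_add_of_le (show j + 2 ≤ m by omega)
    rw [if_neg hm.ne', if_neg hm.ne', hhigh]

lemma MovedLeft.leftCount_le {c : Fin d → ℕ} {j : ℕ} {A B : Finset (Fin d)}
    (h : MovedLeft c j A B) (m : ℕ) : SuperSchur.leftCount c A m ≤ SuperSchur.leftCount c B m := by
  have h1 := h.leftCount m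
  have h2 := h.2.1
  split_ifs at h1 <;> omega

/-- As the total over the two columns is fixed, the counts can only differ if column j has gained;
then the cut after column j has gained as well. -/
lemma MovedLeft.leftCount_lt {c : Fin d → ℕ} {j : ℕ} {A B : Finset (Fin d)}
    (h : MovedLeft c j A B) (hne : colCount c B ≠ colCount c A) :
    colCount c A j < colCount c B j ∧
      SuperSchur.leftCount c A (j + 1) < SuperSchur.leftCount c B (j + 1) := by
  have h1 := h.leftCount (j + 1)
  rw [if_pos rfl, if_pos rfl] at h1
  have h2 : colCount c A j ≠ colCount c B j := by
    intro hj
    refine hne (funext fun i => ?_)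
    by_cases hi : i = j
    · rw [hi, hj]
    · by_cases hi' : i = j + 1
      · have := h.2.2; subst hi'; omega
      · exact h.1 i hi hi'
  have h3 := h.2.1
  omega

lemma leftCount_eq_card_of_lt {c : Fin d → ℕ} {m : ℕ} (h : ∀ p, c p < m) (B : Finset (Fin d)) :
    leftCount c B m = B.card := by
  rw [leftCount_eq_card]
  congr 1
  exact Finset.filter_true_of_mem fun p _ => h p

lemma card_eq_of_colCount {c : Fin d → ℕ} {A B : Finset (Fin d)}
    (h : colCount c A = colCount c B) : A.card = B.card := by
  have hm : ∀ p, c p < Finset.univ.sup c + 1 := fun p =>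
    Nat.lt_succ_of_le (Finset.le_sup (Finset.mem_univ p))
  rw [← leftCount_eq_card_of_lt hm A, ← leftCount_eq_card_of_lt hm B]
  unfold leftCount
  rw [h]

lemma MovedLeft.card_eq {c : Fin d → ℕ} {j : ℕ} {A B : Finset (Fin d)} (h : MovedLeft c j A B) :
    A.card = B.card := by
  have hm : ∀ p, c p < Finset.univ.sup c + j + 2 := fun p => by
    have : c p ≤ Finset.univ.sup c := Finset.le_sup (Finset.mem_univ p)
    omega
  have h1 := h.leftCount (Finset.univ.sup c + j + 2)
  rw [if_neg (by omega), if_neg (by omega)] at h1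
  rw [leftCount_eq_card_of_lt hm, leftCount_eq_card_of_lt hm] at h1
  omega

end Supports

/-! ### Invariants of a product group in a tensor product. -/

section TensorInvariants

variable {k : Type u} [Field k] {V₁ V₂ : Type u}
  [AddCommGroup V₁] [Module k V₁] [SuperSpace k V₁]
  [AddCommGroup V₂] [Module k V₂] [SuperSpace k V₂]
variable {d e f : ℕ}

/-- Over a field U ⊗ W is the intersection of U ⊗ B and A ⊗ W, and membership in each of these is
tested by contracting the other factor with functionals. -/
lemma mem_range_map_subtype {A B : Type u} [AddCommGroup A] [Module k A] [AddCommGroup B]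
    [Module k B] (U : Submodule k A) (W : Submodule k B) {w : A ⊗[k] B}
    (h₁ : ∀ φ : B →ₗ[k] k, TensorProduct.rid k A (TensorProduct.map LinearMap.id φ w) ∈ U)
    (h₂ : ∀ φ : A →ₗ[k] k, TensorProduct.lid k B (TensorProduct.map φ LinearMap.id w) ∈ W) :
    w ∈ LinearMap.range (TensorProduct.map U.subtype W.subtype) := by
  obtain ⟨P, hP⟩ := U.subtype.exists_leftInverse_of_injective U.ker_subtype
  obtain ⟨P', hP'⟩ := W.subtype.exists_leftInverse_of_injective W.ker_subtype
  have hPU : ∀ x ∈ U, (P x : A) = x := fun x hx => by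
    have := congrArg (fun g => ((g ⟨x, hx⟩ : U) : A)) hP
    simpa using this
  have hPW : ∀ x ∈ W, (P' x : B) = x := fun x hx => by
    have := congrArg (fun g => ((g ⟨x, hx⟩ : W) : B)) hP'
    simpa using this
  -- Expanding w along a basis of B, the coefficients are contractions with coordinate functionals;
  -- they lie in U, so the projection P fixes them.
  have e1 : TensorProduct.map (U.subtype ∘ₗ P) LinearMap.id w = w := by
    let b := Module.Basis.ofVectorSpace k B
    obtain ⟨c, hc⟩ := TensorProduct.eq_repr_basis_right b w
    have hcU : ∀ i, c i ∈ U := by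
      intro i
      have := h₁ (b.coord i)
      rw [← hc, Finsupp.sum, map_sum, map_sum] at this
      simp only [TensorProduct.map_tmul, LinearMap.id_apply, Module.Basis.coord_apply,
        Module.Basis.repr_self, TensorProduct.rid_tmul] at this
      rw [Finset.sum_eq_single i] at this
      · simpa using this
      · intro l _ hl; simp [hl]
      · intro hi; simpa using hi
    conv_lhs => rw [← hc]
    conv_rhs => rw [← hc]
    rw [Finsupp.sum, map_sum]
    refine Finset.sum_congr rfl fun i _ => ?_
    simp [hPU _ (hcU i)]
  have e2 : TensorProduct.map LinearMap.id (W.subtype ∘ₗ P') w = w := by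
    let b := Module.Basis.ofVectorSpace k A
    obtain ⟨c, hc⟩ := TensorProduct.eq_repr_basis_left b w
    have hcW : ∀ i, c i ∈ W := by
      intro i
      have := h₂ (b.coord i)
      rw [← hc, Finsupp.sum, map_sum, map_sum] at this
      simp only [TensorProduct.map_tmul, LinearMap.id_apply, Module.Basis.coord_apply,
        Module.Basis.repr_self, TensorProduct.lid_tmul] at this
      rw [Finset.sum_eq_single i] at this
      · simpa using this
      · intro l _ hl; simp [hl]
      · intro hi; simpa using hi
    conv_lhs => rw [← hc]
    conv_rhs => rw [← hc]
    rw [Finsupp.sum, map_sum]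
    refine Finset.sum_congr rfl fun i _ => ?_
    simp [hPW _ (hcW i)]
  refine ⟨TensorProduct.map P P' w, ?_⟩
  have : TensorProduct.map U.subtype W.subtype (TensorProduct.map P P' w) =
      TensorProduct.map (U.subtype ∘ₗ P) LinearMap.id
        (TensorProduct.map LinearMap.id (W.subtype ∘ₗ P') w) := by
    rw [← LinearMap.comp_apply, ← LinearMap.comp_apply, ← TensorProduct.map_comp,
      ← TensorProduct.map_comp, LinearMap.comp_id, LinearMap.id_comp]
  rw [this, e2, e1]

/-- The invariants of a product of Young subgroups in a tensor product. -/
lemma mem_range_gammaInv {c₁ : Fin e → ℕ} {c₂ : Fin f → ℕ}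
    {w : T k (Fin e) V₁ ⊗[k] T k (Fin f) V₂}
    (h : ∀ α β, InYoung c₁ α → InYoung c₂ β → TensorProduct.map (R α) (R β) w = w) :
    w ∈ LinearMap.range (TensorProduct.map (gammaInv (k := k) c₁ V₁).subtype
      (gammaInv (k := k) c₂ V₂).subtype) := by
  have hR : ∀ {n : ℕ} {V : Type u} [AddCommGroup V] [Module k V] [SuperSpace k V],
      R (Equiv.refl (Fin n)) = (LinearMap.id : T k (Fin n) V →ₗ[k] _) := by
    intro n V _ _ _
    exact LinearMap.ext R_refl
  have c1 : ∀ (φ : T k (Fin f) V₂ →ₗ[k] k) (g : T k (Fin e) V₁ →ₗ[k] T k (Fin e) V₁)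
      (w : T k (Fin e) V₁ ⊗[k] T k (Fin f) V₂),
      TensorProduct.rid k _ (TensorProduct.map LinearMap.id φ
        (TensorProduct.map g LinearMap.id w)) =
      g (TensorProduct.rid k _ (TensorProduct.map LinearMap.id φ w)) := by
    intro φ g w
    induction w with
    | zero => simp
    | add x y hx hy => simp only [map_add, hx, hy]
    | tmul x y => simp
  have c2 : ∀ (φ : T k (Fin e) V₁ →ₗ[k] k) (g : T k (Fin f) V₂ →ₗ[k] T k (Fin f) V₂)
      (w : T k (Fin e) V₁ ⊗[k] T k (Fin f) V₂),
      TensorProduct.lid k _ (TensorProduct.map φ LinearMap.id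
        (TensorProduct.map LinearMap.id g w)) =
      g (TensorProduct.lid k _ (TensorProduct.map φ LinearMap.id w)) := by
    intro φ g w
    induction w with
    | zero => simp
    | add x y hx hy => simp only [map_add, hx, hy]
    | tmul x y => simp
  refine mem_range_map_subtype _ _ (fun φ σ hσ => ?_) (fun φ σ hσ => ?_)
  · have hσ' := h σ (Equiv.refl _) hσ fun _ => rfl
    rw [hR] at hσ'
    rw [← c1, hσ']
  · have hσ' := h (Equiv.refl _) σ (fun _ => rfl) hσ
    rw [hR] at hσ'
    rw [← c2, hσ']

/-- A column-preserving permutation of each block, conjugated by ρ, becomes a column-preserving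
permutation of all positions, which fixes z. So the component of z is invariant under both column
groups. -/
lemma coinclR_mem_range (ρ : Fin e ⊕ₗ Fin f ≃ Fin d) {c : Fin d → ℕ} {c₁ : Fin e → ℕ}
    {c₂ : Fin f → ℕ} (h₁ : ∀ a, c (ρ (toLex (Sum.inl a))) = c₁ a)
    (h₂ : ∀ b, c (ρ (toLex (Sum.inr b))) = c₂ b) {z : T k (Fin d) (V₁ × V₂)}
    (hz : z ∈ gammaInv (k := k) c (V₁ × V₂)) :
    coinclR ρ z ∈ LinearMap.range (TensorProduct.map (gammaInv (k := k) c₁ V₁).subtype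
      (gammaInv (k := k) c₂ V₂).subtype) := by
  refine mem_range_gammaInv fun α β hα hβ => ?_
  obtain ⟨g, hg⟩ : ∃ g : Equiv.Perm (Fin d), g.symm = (ρ.symm.trans (blockPerm α β)).trans ρ :=
    ⟨((ρ.symm.trans (blockPerm α β)).trans ρ).symm, rfl⟩
  have hgc : InYoung c g.symm := by
    rw [hg]
    refine forall_placement ρ (fun a => ?_) (fun b => ?_)
    · simp [h₁, hα a]
    · simp [h₂, hβ b]
  have e1 : ρ.trans g.symm = (blockPerm α β).trans ρ := by
    rw [hg]
    exact Equiv.ext fun p => by simp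
  have e2 := coinclR_R ρ g z
  rw [hz g hgc.symm, e1] at e2
  have e3 := coinclR_perm α β ρ z
  rwa [← e2] at e3

end TensorInvariants

/-! ### The straightening algorithm. -/

section Straightening

variable {k : Type u} [Field k] {V₁ V₂ : Type u}
  [AddCommGroup V₁] [Module k V₁] [SuperSpace k V₁]
  [AddCommGroup V₂] [Module k V₂] [SuperSpace k V₂]
variable {d e f : ℕ}

/-- The second tensor is a relation merging its whole column j, with b = 0. Its extension merges the
V₂ factors of column j with the V₁ factors of column j + 1, and all of its other terms have V₁
factors further left. -/
lemma exists_rel_of_range (ρ : Fin e ⊕ₗ Fin f ≃ Fin d) (c : Fin d → ℕ) {c₁ : Fin e → ℕ}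
    {c₂ : Fin f → ℕ} (h₁ : ∀ a, c (ρ (toLex (Sum.inl a))) = c₁ a)
    (h₂ : ∀ b, c (ρ (toLex (Sum.inr b))) = c₂ b) (j : ℕ)
    (w : gammaInv (k := k) c₁ V₁ ⊗[k] gammaInv (k := k) c₂ V₂) :
    ∃ r ∈ relSub k (V₁ × V₂) c j (colCount c₂ Finset.univ j) (colCount c₁ Finset.univ (j + 1)),
      coinclR ρ r = TensorProduct.map (gammaInv (k := k) c₁ V₁).subtype
        (gammaInv (k := k) c₂ V₂).subtype w ∧
      ∀ B, blockPr B r ≠ 0 → MovedLeft c j (leftSet ρ) B := by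
  induction w with
  | zero => exact ⟨0, zero_mem _, by simp, fun B hB => absurd (map_zero _) hB⟩
  | add w w' hw hw' =>
    obtain ⟨r, hr, hr1, hr2⟩ := hw
    obtain ⟨r', hr', hr1', hr2'⟩ := hw'
    refine ⟨r + r', add_mem hr hr', by rw [map_add, map_add, hr1, hr1'], fun B hB => ?_⟩
    by_cases h : blockPr B r = 0
    · rw [map_add, h, zero_add] at hB; exact hr2' B hB
    · exact hr2 B h
  | tmul x y =>
    have := exists_rel_right ρ c h₁ h₂ x.2 (mem_relSub_of_mem_gammaInv y.2 j)
    rw [zero_add] at this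
    exact this

/-- Straightening: modulo relations, every element of `Γ` is equivalent to one that is supported on
good sets, if the bad ones can be moved to the left. -/
lemma suppSub_le_straighten (c : Fin d → ℕ) (S : Submodule k (T k (Fin d) (V₁ × V₂)))
    (good Q : Finset (Fin d) → Prop)
    (hgood : ∀ A B, colCount c B = colCount c A → good A → good B)
    (hQ : ∀ A B, Q A → A.card = B.card → (∀ m, leftCount c A m ≤ leftCount c B m) → Q B)
    (hS : ∀ B, ¬ good B →
      ∃ j, relSub k (V₁ × V₂) c j (colCount c Bᶜ j) (colCount c B (j + 1)) ≤ S) :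
    suppSub (k := k) (V₁ := V₁) (V₂ := V₂) c Q ≤ S ⊔ suppSub c fun B => Q B ∧ good B := by
  classical
  -- The range below n₀ contains j + 1 for every nonempty column j, so the measure `ms` drops
  -- whenever a move to the left changes the column counts. As `leftCount` is at most d, no
  -- subtraction in `ms` is truncated.
  let n₀ : ℕ := Finset.univ.sup c + 2
  let ms : Finset (Fin d) → ℕ := fun B => ∑ m ∈ Finset.range n₀, (d - leftCount c B m)
  have hms : ∀ (j : ℕ) (A B : Finset (Fin d)), MovedLeft c j A B → colCount c B ≠ colCount c A →
      ms B < ms A := by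
    intro j A B h hne
    have h1 := h.leftCount_lt hne
    refine Finset.sum_lt_sum (fun m _ => ?_) ⟨j + 1, ?_, ?_⟩
    · have := h.leftCount_le m; omega
    · have hpos : 0 < colCount c B j := by omega
      obtain ⟨p, hp⟩ := Finset.card_pos.mp hpos
      have hp' : c p = j := (Finset.mem_filter.mp hp).2
      have : c p ≤ Finset.univ.sup c := Finset.le_sup (Finset.mem_univ p)
      rw [Finset.mem_range]
      omega
    · have := leftCount_le c B (j + 1)
      omega
  have hsame : ∀ A B, colCount c B = colCount c A → Q A → Q B := by
    intro A B h hA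
    refine hQ A B hA (card_eq_of_colCount h).symm fun m => ?_
    unfold leftCount; rw [h]
  suffices h : ∀ n, suppSub (k := k) (V₁ := V₁) (V₂ := V₂) c (fun B => Q B ∧ ms B < n) ≤
      S ⊔ suppSub c fun B => Q B ∧ good B by
    intro z hz
    refine h (∑ B : Finset (Fin d), ms B + 1) ⟨hz.1, fun B hB => ⟨hz.2 B hB, ?_⟩⟩
    exact Nat.lt_succ_of_le (Finset.single_le_sum (f := ms) (fun _ _ => Nat.zero_le _)
      (Finset.mem_univ B))
  intro n
  induction n with
  | zero =>
    intro z hz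
    have : z = 0 := by
      rw [← sum_blockPr z]
      refine Finset.sum_eq_zero fun B _ => ?_
      by_contra hB
      exact absurd (hz.2 B hB).2 (Nat.not_lt_zero _)
    rw [this]; exact zero_mem _
  | succ n ih =>
    intro z hz
    -- The pieces with fixed column counts are again invariant, so each can be straightened
    -- separately.
    rw [← sum_countPr c z]
    refine Submodule.sum_mem _ fun β hβ => ?_
    obtain ⟨A, -, rfl⟩ := Finset.mem_image.mp hβ
    have hzA := countPr_mem_gammaInv (colCount c A) hz.1
    by_cases hA0 : blockPr A z = 0
    · have : countPr c (colCount c A) z = 0 := by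
        rw [countPr_apply]
        refine Finset.sum_eq_zero fun B hB => ?_
        refine blockPr_eq_zero_of_colCount hz.1 (fun j => ?_) hA0
        rw [(Finset.mem_filter.mp hB).2]
      rw [this]; exact zero_mem _
    obtain ⟨hQA, hmA⟩ := hz.2 A hA0
    by_cases hgA : good A
    · refine Submodule.mem_sup_right ⟨hzA, fun B hB => ?_⟩
      rw [blockPr_countPr] at hB
      split_ifs at hB with h
      · exact ⟨hsame A B h hQA, hgood A B h hgA⟩
      · exact absurd rfl hB
    · obtain ⟨j, hj⟩ := hS A hgA
      let ρ := placeOf A rfl rfl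
      have hρ : leftSet ρ = A := leftSet_placeOf A rfl rfl
      obtain ⟨w, hw⟩ := coinclR_mem_range (c := c)
        (c₁ := fun a => c (ρ (toLex (Sum.inl a)))) (c₂ := fun b => c (ρ (toLex (Sum.inr b))))
        ρ (fun _ => rfl) (fun _ => rfl) hzA
      obtain ⟨r, hr, hr1, hr2⟩ := exists_rel_of_range ρ c (fun _ => rfl) (fun _ => rfl) j w
      have hrS : r ∈ S := by
        refine hj ?_
        have h1 := colCount_leftSet_compl ρ c j
        have h2 := colCount_compl c A j
        rw [hρ] at h1
        have h3 := colCount_leftSet ρ c (j + 1)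
        rw [hρ] at h3
        rw [show colCount c Aᶜ j = colCount (fun b => c (ρ (toLex (Sum.inr b)))) Finset.univ j by
          omega, h3]
        exact hr
      rw [hw] at hr1
      rw [hρ] at hr2
      -- The relation r has the same component at A as this piece, hence by invariance at all sets
      -- with the counts of A. What remains comes from r and is supported on sets of smaller
      -- measure.
      have hdiff : countPr c (colCount c A) z - r ∈
          suppSub (k := k) (V₁ := V₁) (V₂ := V₂) c (fun B => Q B ∧ ms B < n) := by
        have hmem := sub_mem hzA (relSub_le_gammaInv _ _ _ _ hr)
        refine ⟨hmem, fun B hB => ?_⟩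
        by_cases hc : colCount c B = colCount c A
        · refine absurd ?_ hB
          refine blockPr_eq_zero_of_colCount hmem (A := A) (fun i => by rw [hc]) ?_
          rw [← hρ, blockPr_eq_zero_iff, map_sub, hr1, hρ, sub_self]
        · rw [map_sub, blockPr_countPr, if_neg hc, zero_sub] at hB
          have hB' := hr2 B (neg_ne_zero.mp hB)
          exact ⟨hQ A B hQA hB'.card_eq hB'.leftCount_le, by have := hms j A B hB' hc; omega⟩
      rw [← sub_add_cancel (countPr c (colCount c A) z) r]
      exact add_mem (ih hdiff) (Submodule.mem_sup_left hrS)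

end Straightening

/-! ### Cells of skew diagrams and comparison of diagrams. -/

section Cells

variable {lam mu nu xi : YoungDiagram}

/-- The row of the `i`-th cell in the column reading. -/
def rowIn (lam mu : YoungDiagram) (i : Fin (skewSize lam mu)) : ℕ :=
  (ofLex (colReading lam mu i).1).2

lemma cell_mem (i : Fin (skewSize lam mu)) :
    (rowIn lam mu i, colOf lam mu i) ∈ lam.cells \ mu.cells := by
  have h := (colReading lam mu i).2
  obtain ⟨⟨a, b⟩, h1, h2⟩ := Finset.mem_map.mp h
  have h3 : (b, a) = ofLex (colReading lam mu i).1 := congrArg ofLex h2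
  unfold rowIn colOf
  rw [← h3]
  exact h1

lemma rowIn_lt (i : Fin (skewSize lam mu)) : rowIn lam mu i < lam.colLen (colOf lam mu i) :=
  YoungDiagram.mem_iff_lt_colLen.mp (Finset.mem_sdiff.mp (cell_mem i)).1

lemma le_rowIn (i : Fin (skewSize lam mu)) : mu.colLen (colOf lam mu i) ≤ rowIn lam mu i :=
  not_lt.mp fun h => (Finset.mem_sdiff.mp (cell_mem i)).2 (YoungDiagram.mem_iff_lt_colLen.mpr h)

lemma toLex_cell (i : Fin (skewSize lam mu)) :
    toLex (colOf lam mu i, rowIn lam mu i) = (colReading lam mu i).1 := rfl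

lemma cell_inj {i j : Fin (skewSize lam mu)} (h : rowIn lam mu i = rowIn lam mu j)
    (h' : colOf lam mu i = colOf lam mu j) : i = j := by
  refine (colReading lam mu).injective (Subtype.ext ?_)
  rw [← toLex_cell, ← toLex_cell, h, h']

lemma exists_cell {r c : ℕ} (h : r < lam.colLen c) (h' : mu.colLen c ≤ r) :
    ∃ i : Fin (skewSize lam mu), rowIn lam mu i = r ∧ colOf lam mu i = c := by
  have hm : toLex (c, r) ∈ colSet lam mu := by
    refine Finset.mem_map.mpr ⟨(r, c), Finset.mem_sdiff.mpr ⟨?_, ?_⟩, rfl⟩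
    · exact YoungDiagram.mem_iff_lt_colLen.mpr h
    · exact fun hh => absurd (YoungDiagram.mem_iff_lt_colLen.mp hh) (not_lt.mpr h')
  refine ⟨(colReading lam mu).symm ⟨_, hm⟩, ?_, ?_⟩ <;> simp [rowIn, colOf]

lemma cell_lt_iff {i j : Fin (skewSize lam mu)} :
    i < j ↔ toLex (colOf lam mu i, rowIn lam mu i) < toLex (colOf lam mu j, rowIn lam mu j) := by
  rw [toLex_cell, toLex_cell, Subtype.coe_lt_coe]
  exact (((colSet lam mu).orderIsoOfFin (Finset.card_map _)).lt_iff_lt).symm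

lemma colOf_mono (lam mu : YoungDiagram) : Monotone (colOf lam mu) := by
  intro i j hij
  rcases hij.eq_or_lt with rfl | h
  · exact le_rfl
  · rw [cell_lt_iff, Prod.Lex.lt_iff] at h
    rcases h with h | h
    · exact h.le
    · exact h.1.le

/-- This allows the row group, which acts on the row reading in the definition of the symmetric
powers, to be replaced by the group preserving `rowIn` on the column reading. -/
lemma rowOf_colToRow (i : Fin (skewSize lam mu)) :
    rowOf lam mu (colToRow lam mu i) = rowIn lam mu i := by
  unfold rowOf colToRow
  simp only [Equiv.trans_apply, Equiv.apply_symm_apply]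
  rfl

lemma colLen_mono (h : mu ≤ lam) (j : ℕ) : mu.colLen j ≤ lam.colLen j := by
  by_contra hh
  push Not at hh
  have := h (YoungDiagram.mem_iff_lt_colLen.mpr hh)
  exact lt_irrefl _ (YoungDiagram.mem_iff_lt_colLen.mp this)

lemma rowLen_mono (h : mu ≤ lam) (j : ℕ) : mu.rowLen j ≤ lam.rowLen j := by
  by_contra hh
  push Not at hh
  have := h (YoungDiagram.mem_iff_lt_rowLen.mpr hh)
  exact lt_irrefl _ (YoungDiagram.mem_iff_lt_rowLen.mp this)

lemma ext_colLen (h : ∀ j, mu.colLen j = lam.colLen j) : mu = lam := by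
  ext ⟨i, j⟩
  rw [YoungDiagram.mem_cells, YoungDiagram.mem_cells, YoungDiagram.mem_iff_lt_colLen,
    YoungDiagram.mem_iff_lt_colLen, h]

lemma ext_rowLen (h : ∀ j, mu.rowLen j = lam.rowLen j) : mu = lam := by
  ext ⟨i, j⟩
  rw [YoungDiagram.mem_cells, YoungDiagram.mem_cells, YoungDiagram.mem_iff_lt_rowLen,
    YoungDiagram.mem_iff_lt_rowLen, h]

/-- The positions of the cells of `lam / mu` that lie in `nu`. -/
def cellSet (lam mu nu : YoungDiagram) : Finset (Fin (skewSize lam mu)) :=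
  Finset.univ.filter fun p => rowIn lam mu p < nu.colLen (colOf lam mu p)

lemma mem_cellSet {p : Fin (skewSize lam mu)} :
    p ∈ cellSet lam mu nu ↔ rowIn lam mu p < nu.colLen (colOf lam mu p) := by simp [cellSet]

lemma lt_colLen_iff_lt_rowLen {i j : ℕ} : i < nu.colLen j ↔ j < nu.rowLen i := by
  rw [← YoungDiagram.mem_iff_lt_colLen, YoungDiagram.mem_iff_lt_rowLen]

lemma colCount_cellSet (h₁ : mu ≤ nu) (h₂ : nu ≤ lam) (j : ℕ) :
    colCount (colOf lam mu) (cellSet lam mu nu) j + mu.colLen j = nu.colLen j := by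
  have : colCount (colOf lam mu) (cellSet lam mu nu) j =
      (Finset.Ico (mu.colLen j) (nu.colLen j)).card := by
    unfold colCount
    refine Finset.card_nbij (rowIn lam mu) ?_ ?_ ?_
    · intro p hp0
      obtain ⟨hp, rfl⟩ := Finset.mem_filter.mp (Finset.mem_coe.mp hp0)
      rw [mem_cellSet] at hp
      exact Finset.mem_coe.mpr (Finset.mem_Ico.mpr ⟨le_rowIn p, hp⟩)
    · intro p hp q hq hpq
      have hp' := (Finset.mem_filter.mp hp).2
      have hq' := (Finset.mem_filter.mp hq).2
      exact cell_inj hpq (hp'.trans hq'.symm)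
    · intro r hr
      obtain ⟨hr1, hr2⟩ := Finset.mem_Ico.mp (Finset.mem_coe.mp hr)
      obtain ⟨p, hp1, hp2⟩ := exists_cell (hr2.trans_le (colLen_mono h₂ j)) hr1
      refine ⟨p, ?_, hp1⟩
      rw [Finset.mem_coe, Finset.mem_filter, mem_cellSet, hp1, hp2]
      exact ⟨hr2, rfl⟩
  rw [this, Nat.card_Ico]
  have := colLen_mono h₁ j
  omega

lemma rowCount_cellSet (h₁ : mu ≤ nu) (h₂ : nu ≤ lam) (i : ℕ) :
    colCount (rowIn lam mu) (cellSet lam mu nu) i + mu.rowLen i = nu.rowLen i := by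
  have : colCount (rowIn lam mu) (cellSet lam mu nu) i =
      (Finset.Ico (mu.rowLen i) (nu.rowLen i)).card := by
    unfold colCount
    refine Finset.card_nbij (colOf lam mu) ?_ ?_ ?_
    · intro p hp0
      obtain ⟨hp, rfl⟩ := Finset.mem_filter.mp (Finset.mem_coe.mp hp0)
      rw [mem_cellSet] at hp
      refine Finset.mem_coe.mpr (Finset.mem_Ico.mpr ⟨?_, lt_colLen_iff_lt_rowLen.mp hp⟩)
      have := le_rowIn p
      rwa [← not_lt, lt_colLen_iff_lt_rowLen, not_lt] at this
    · intro p hp q hq hpq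
      have hp' := (Finset.mem_filter.mp hp).2
      have hq' := (Finset.mem_filter.mp hq).2
      exact cell_inj (hp'.trans hq'.symm) hpq
    · intro r hr
      obtain ⟨hr1, hr2⟩ := Finset.mem_Ico.mp (Finset.mem_coe.mp hr)
      have hr3 := hr2.trans_le (rowLen_mono h₂ i)
      rw [← lt_colLen_iff_lt_rowLen] at hr3
      rw [← not_lt, ← lt_colLen_iff_lt_rowLen, not_lt] at hr1
      obtain ⟨p, hp1, hp2⟩ := exists_cell hr3 hr1
      refine ⟨p, ?_, hp2⟩
      rw [Finset.mem_coe, Finset.mem_filter, mem_cellSet, hp1, hp2, lt_colLen_iff_lt_rowLen]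
      exact ⟨hr2, rfl⟩
  rw [this, Nat.card_Ico]
  have := rowLen_mono h₁ i
  omega

lemma cellSet_self (lam mu : YoungDiagram) : cellSet lam mu lam = Finset.univ := by
  ext p; simp [mem_cellSet, rowIn_lt]

/-- The placement of the cells of `nu / mu` and of `lam / nu` as cells of `lam / mu`. -/
lemma exists_cellPlace (h₁ : mu ≤ nu) (h₂ : nu ≤ lam) :
    ∃ ρ : Fin (skewSize nu mu) ⊕ₗ Fin (skewSize lam nu) ≃ Fin (skewSize lam mu),
      (∀ a, colOf lam mu (ρ (toLex (Sum.inl a))) = colOf nu mu a) ∧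
      (∀ b, colOf lam mu (ρ (toLex (Sum.inr b))) = colOf lam nu b) ∧
      (∀ a, rowIn lam mu (ρ (toLex (Sum.inl a))) = rowIn nu mu a) ∧
      (∀ b, rowIn lam mu (ρ (toLex (Sum.inr b))) = rowIn lam nu b) := by
  have hl : ∀ a : Fin (skewSize nu mu), ∃ p : Fin (skewSize lam mu),
      rowIn lam mu p = rowIn nu mu a ∧ colOf lam mu p = colOf nu mu a := fun a =>
    exists_cell ((rowIn_lt a).trans_le (colLen_mono h₂ _)) (le_rowIn a)
  have hr : ∀ b : Fin (skewSize lam nu), ∃ p : Fin (skewSize lam mu),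
      rowIn lam mu p = rowIn lam nu b ∧ colOf lam mu p = colOf lam nu b := fun b =>
    exists_cell (rowIn_lt b) ((colLen_mono h₁ _).trans (le_rowIn b))
  choose fl hl1 hl2 using hl
  choose fr hr1 hr2 using hr
  have hinj : Function.Injective (Sum.elim fl fr) := by
    rintro (a | b) (a' | b') h
    · simp only [Sum.elim_inl] at h
      rw [cell_inj (i := a) (j := a') (by rw [← hl1, h, hl1]) (by rw [← hl2, h, hl2])]
    · simp only [Sum.elim_inl, Sum.elim_inr] at h
      have h1 := rowIn_lt a
      rw [← hl1, ← hl2, h, hr1, hr2] at h1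
      exact absurd (le_rowIn b') (not_le.mpr h1)
    · simp only [Sum.elim_inl, Sum.elim_inr] at h
      have h1 := rowIn_lt a'
      rw [← hl1, ← hl2, ← h, hr1, hr2] at h1
      exact absurd (le_rowIn b) (not_le.mpr h1)
    · simp only [Sum.elim_inr] at h
      rw [cell_inj (i := b) (j := b') (by rw [← hr1, h, hr1]) (by rw [← hr2, h, hr2])]
  have hbij : Function.Bijective (Sum.elim fl fr) := by
    rw [Fintype.bijective_iff_injective_and_card]
    refine ⟨hinj, ?_⟩
    rw [Fintype.card_sum, Fintype.card_fin, Fintype.card_fin, Fintype.card_fin,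
      skewSize_add h₁ h₂]
  refine ⟨ofLex.trans (Equiv.ofBijective _ hbij), ?_, ?_, ?_, ?_⟩ <;> intro a <;> simp [*]

/-- The placement that preserves cells. -/
noncomputable def cellPlace (h₁ : mu ≤ nu) (h₂ : nu ≤ lam) :
    Fin (skewSize nu mu) ⊕ₗ Fin (skewSize lam nu) ≃ Fin (skewSize lam mu) :=
  (exists_cellPlace h₁ h₂).choose

section CellPlace

variable (h₁ : mu ≤ nu) (h₂ : nu ≤ lam)

lemma colOf_cellPlace_inl (a : Fin (skewSize nu mu)) :
    colOf lam mu (cellPlace h₁ h₂ (toLex (Sum.inl a))) = colOf nu mu a :=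
  (exists_cellPlace h₁ h₂).choose_spec.1 a

lemma colOf_cellPlace_inr (b : Fin (skewSize lam nu)) :
    colOf lam mu (cellPlace h₁ h₂ (toLex (Sum.inr b))) = colOf lam nu b :=
  (exists_cellPlace h₁ h₂).choose_spec.2.1 b

lemma rowIn_cellPlace_inl (a : Fin (skewSize nu mu)) :
    rowIn lam mu (cellPlace h₁ h₂ (toLex (Sum.inl a))) = rowIn nu mu a :=
  (exists_cellPlace h₁ h₂).choose_spec.2.2.1 a

lemma rowIn_cellPlace_inr (b : Fin (skewSize lam nu)) :
    rowIn lam mu (cellPlace h₁ h₂ (toLex (Sum.inr b))) = rowIn lam nu b :=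
  (exists_cellPlace h₁ h₂).choose_spec.2.2.2 b

lemma cellPlace_inl_strictMono :
    StrictMono fun a => cellPlace h₁ h₂ (toLex (Sum.inl a)) := by
  intro a a' h
  rw [cell_lt_iff] at h ⊢
  simpa only [colOf_cellPlace_inl, rowIn_cellPlace_inl] using h

lemma cellPlace_inr_strictMono :
    StrictMono fun b => cellPlace h₁ h₂ (toLex (Sum.inr b)) := by
  intro a a' h
  rw [cell_lt_iff] at h ⊢
  simpa only [colOf_cellPlace_inr, rowIn_cellPlace_inr] using h

lemma leftSet_cellPlace : leftSet (cellPlace h₁ h₂) = cellSet lam mu nu := by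
  ext p
  refine forall_placement (cellPlace h₁ h₂) (P := fun p => p ∈ leftSet (cellPlace h₁ h₂) ↔
    p ∈ cellSet lam mu nu) (fun a => ?_) (fun b => ?_) p
  · refine ⟨fun _ => ?_, fun _ => inl_mem_leftSet _ a⟩
    rw [mem_cellSet, rowIn_cellPlace_inl, colOf_cellPlace_inl]
    exact rowIn_lt a
  · refine ⟨fun h => absurd h (inr_notMem_leftSet _ b), fun h => ?_⟩
    rw [mem_cellSet, rowIn_cellPlace_inr, colOf_cellPlace_inr] at h
    exact absurd (le_rowIn b) (not_le.mpr h)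

end CellPlace

/-- At the first row where the diagrams differ, the partial sums compare exactly these two rows.
Dominance thus refines to the lexicographic order, and all comparisons below are obtained through
it. -/
lemma lexLe_of_sum_le (h : ∀ r, ∑ i ∈ Finset.range r, nu.rowLen i ≤
    ∑ i ∈ Finset.range r, xi.rowLen i) : lexLe nu xi := by
  by_cases he : ∃ i, nu.rowLen i ≠ xi.rowLen i
  · right
    classical
    refine ⟨Nat.find he, fun j hj => by simpa using Nat.find_min he hj, ?_⟩
    refine lt_of_le_of_ne ?_ (Nat.find_spec he)
    have h1 := h (Nat.find he + 1)
    have h2 : ∑ i ∈ Finset.range (Nat.find he), nu.rowLen i =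
        ∑ i ∈ Finset.range (Nat.find he), xi.rowLen i :=
      Finset.sum_congr rfl fun j hj => by simpa using Nat.find_min he (Finset.mem_range.mp hj)
    rw [Finset.sum_range_succ, Finset.sum_range_succ, h2] at h1
    exact Nat.le_of_add_le_add_left h1
  · left
    push Not at he
    exact ext_rowLen he

lemma lexLt_irrefl (nu : YoungDiagram) : ¬ lexLt nu nu := fun ⟨_, _, h⟩ => lt_irrefl _ h

lemma lexLt_trans {a b c : YoungDiagram} (h : lexLt a b) (h' : lexLt b c) : lexLt a c := by
  obtain ⟨i, hi, hi'⟩ := h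
  obtain ⟨j, hj, hj'⟩ := h'
  rcases lt_trichotomy i j with hij | rfl | hij
  · exact ⟨i, fun l hl => (hi l hl).trans (hj l (hl.trans hij)), by rwa [← hj i hij]⟩
  · exact ⟨i, fun l hl => (hi l hl).trans (hj l hl), hi'.trans hj'⟩
  · exact ⟨j, fun l hl => (hi l (hl.trans hij)).trans (hj l hl), by rwa [hi j hij]⟩

lemma lexLe_of_le (h : nu ≤ xi) : lexLe nu xi :=
  lexLe_of_sum_le fun _ => Finset.sum_le_sum fun _ _ => rowLen_mono h _

lemma lexLe_antisymm_lt {a b : YoungDiagram} (h : lexLe a b) (h' : lexLt b a) : False := by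
  rcases h with rfl | h
  · exact lexLt_irrefl _ h'
  · exact lexLt_irrefl _ (lexLt_trans h h')

lemma lexLe_lt_trans {a b c : YoungDiagram} (h : lexLe a b) (h' : lexLt b c) : lexLt a c := by
  rcases h with rfl | h
  · exact h'
  · exact lexLt_trans h h'

lemma lexLe_trans {a b c : YoungDiagram} (h : lexLe a b) (hbc : lexLe b c) : lexLe a c := by
  rcases hbc with rfl | hbc
  · exact h
  · exact Or.inr (lexLe_lt_trans h hbc)

/-- Comparison of the partial row sums of two diagrams between `mu` and `lam`. -/
lemma sum_rowLen_eq {B : Finset (Fin (skewSize lam mu))}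
    (hB : ∀ i, colCount (rowIn lam mu) B i + mu.rowLen i = nu.rowLen i) (r : ℕ) :
    ∑ i ∈ Finset.range r, nu.rowLen i =
      (B.filter fun p => rowIn lam mu p < r).card + ∑ i ∈ Finset.range r, mu.rowLen i := by
  rw [← leftCount_eq_card, leftCount, ← Finset.sum_add_distrib]
  exact Finset.sum_congr rfl fun i _ => (hB i).symm

/-- The cells of `B` cannot lie above those of the diagram with the same column lengths. -/
lemma card_filter_le_cellSet (h₁ : mu ≤ nu) (h₂ : nu ≤ lam) {B : Finset (Fin (skewSize lam mu))}
    (hB : ∀ j, colCount (colOf lam mu) B j + mu.colLen j = nu.colLen j) (j r : ℕ) :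
    (B.filter fun p => colOf lam mu p = j ∧ rowIn lam mu p < r).card ≤
      ((cellSet lam mu nu).filter fun p => colOf lam mu p = j ∧ rowIn lam mu p < r).card := by
  -- Either all cells of column j above row r belong to nu, or nu has its full column above row r,
  -- with as many cells as B has in that column.
  by_cases hr : r ≤ nu.colLen j
  · refine Finset.card_le_card fun p hp => ?_
    obtain ⟨_, rfl, h⟩ := Finset.mem_filter.mp hp
    exact Finset.mem_filter.mpr ⟨mem_cellSet.mpr (h.trans_le hr), rfl, h⟩
  · have h3 := colCount_cellSet h₁ h₂ j
    have h4 := hB j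
    have h5 : ((cellSet lam mu nu).filter fun p => colOf lam mu p = j ∧ rowIn lam mu p < r).card =
        colCount (colOf lam mu) (cellSet lam mu nu) j := by
      unfold colCount
      congr 1
      refine Finset.filter_congr fun p hp => ?_
      rw [mem_cellSet] at hp
      refine ⟨And.left, ?_⟩
      rintro rfl
      exact ⟨rfl, by omega⟩
    rw [h5, show colCount (colOf lam mu) (cellSet lam mu nu) j = colCount (colOf lam mu) B j by
      omega]
    refine Finset.card_le_card fun p hp => ?_
    obtain ⟨h, h', _⟩ := Finset.mem_filter.mp hp
    exact Finset.mem_filter.mpr ⟨h, h'⟩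

lemma card_filter_row (B : Finset (Fin (skewSize lam mu))) (r n : ℕ)
    (hn : ∀ p, colOf lam mu p < n) :
    (B.filter fun p => rowIn lam mu p < r).card = ∑ j ∈ Finset.range n,
      (B.filter fun p => colOf lam mu p = j ∧ rowIn lam mu p < r).card := by
  rw [Finset.card_eq_sum_card_fiberwise (f := colOf lam mu) (t := Finset.range n)
    fun p _ => by simpa using hn p]
  refine Finset.sum_congr rfl fun j _ => ?_
  rw [Finset.filter_filter]
  congr 1
  ext p; simp [and_comm]

/-- Triangularity: if `B` has the column lengths of `nu / mu` and the row lengths of `xi / mu`, then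
`xi ≼ nu`, with equality only if `B` consists of the cells of `nu / mu`. -/
lemma lexLe_of_counts (h₁ : mu ≤ nu) (h₂ : nu ≤ lam) (h₃ : mu ≤ xi) (h₄ : xi ≤ lam)
    {B : Finset (Fin (skewSize lam mu))}
    (hB : ∀ j, colCount (colOf lam mu) B j + mu.colLen j = nu.colLen j)
    (hB' : ∀ i, colCount (rowIn lam mu) B i + mu.rowLen i = xi.rowLen i) :
    lexLe xi nu ∧ (nu = xi → B = cellSet lam mu nu) := by
  have hn : ∀ p, colOf lam mu p < Finset.univ.sup (colOf lam mu) + 1 := fun p =>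
    Nat.lt_succ_of_le (Finset.le_sup (Finset.mem_univ p))
  constructor
  -- The cells in the first r rows are counted column by column; in each column nu / mu has its
  -- cells as high as possible.
  · refine lexLe_of_sum_le fun r => ?_
    rw [sum_rowLen_eq hB', sum_rowLen_eq (rowCount_cellSet h₁ h₂),
      card_filter_row B r _ hn, card_filter_row _ r _ hn]
    exact Nat.add_le_add_right
      (Finset.sum_le_sum fun j _ => card_filter_le_cellSet h₁ h₂ hB j r) _
  · rintro rfl
    -- If the diagrams agree, the columnwise inequalities add up to an equality and are equalities
    -- themselves.
    have heq : ∀ j r, (B.filter fun p => colOf lam mu p = j ∧ rowIn lam mu p < r).card =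
        ((cellSet lam mu nu).filter fun p => colOf lam mu p = j ∧ rowIn lam mu p < r).card := by
      intro j r
      have hs := sum_rowLen_eq hB' r
      rw [sum_rowLen_eq (rowCount_cellSet h₁ h₂), card_filter_row B r _ hn,
        card_filter_row _ r _ hn] at hs
      by_cases hj : j ∈ Finset.range (Finset.univ.sup (colOf lam mu) + 1)
      · exact (Finset.sum_eq_sum_iff_of_le
          (fun j _ => card_filter_le_cellSet h₁ h₂ hB j r)).mp (by omega) j hj
      · have : ∀ C : Finset (Fin (skewSize lam mu)),
            C.filter (fun p => colOf lam mu p = j ∧ rowIn lam mu p < r) = ∅ := by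
          intro C
          rw [Finset.filter_eq_empty_iff]
          rintro p - ⟨rfl, _⟩
          exact hj (Finset.mem_range.mpr (hn p))
        rw [this, this]
    have hsub : B ⊆ cellSet lam mu nu := by
      intro p hp
      rw [mem_cellSet]
      set j := colOf lam mu p with hj
      -- For r equal to the length of column j of nu, all nu-cells of the column are counted; hence
      -- so are all cells of B in the column, which therefore lie in nu.
      have h5 := heq j (nu.colLen j)
      have h6 : ((cellSet lam mu nu).filter fun p => colOf lam mu p = j ∧
          rowIn lam mu p < nu.colLen j).card = colCount (colOf lam mu) B j := by
        have h7 := colCount_cellSet h₁ h₂ j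
        have h8 := hB j
        rw [show colCount (colOf lam mu) B j = colCount (colOf lam mu) (cellSet lam mu nu) j by
          omega]
        unfold colCount
        congr 1
        refine Finset.filter_congr fun q hq => ?_
        rw [mem_cellSet] at hq
        refine ⟨And.left, fun h => ⟨h, by rwa [h] at hq⟩⟩
      rw [h6] at h5
      have h9 := Finset.eq_of_subset_of_card_le (s := B.filter fun p => colOf lam mu p = j ∧
        rowIn lam mu p < nu.colLen j) (t := B.filter fun p => colOf lam mu p = j)
        (fun q hq => by
          obtain ⟨h, h', _⟩ := Finset.mem_filter.mp hq
          exact Finset.mem_filter.mpr ⟨h, h'⟩) h5.ge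
      have h10 : p ∈ B.filter fun p => colOf lam mu p = j := Finset.mem_filter.mpr ⟨hp, rfl⟩
      rw [← h9] at h10
      exact (Finset.mem_filter.mp h10).2.2
    refine Finset.eq_of_subset_of_card_le hsub ?_
    refine (card_eq_of_colCount (c := colOf lam mu) (funext fun j => ?_)).le
    have h7 := colCount_cellSet h₁ h₂ j
    have h8 := hB j
    omega

/-- Conjugation reverses the dominance order. -/
lemma lexLe_of_leftCount (h₁ : mu ≤ nu) (h₂ : nu ≤ lam) (h₃ : mu ≤ xi) (h₄ : xi ≤ lam)
    (hcard : (cellSet lam mu xi).card = (cellSet lam mu nu).card)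
    (h : ∀ m, leftCount (colOf lam mu) (cellSet lam mu xi) m ≤
      leftCount (colOf lam mu) (cellSet lam mu nu) m) : lexLe nu xi := by
  refine lexLe_of_sum_le fun r => ?_
  rw [sum_rowLen_eq (rowCount_cellSet h₁ h₂), sum_rowLen_eq (rowCount_cellSet h₃ h₄)]
  refine Nat.add_le_add_right ?_ _
  -- To the left of column s all cells of lam / mu above row r belong to xi, and from column s on
  -- every cell of xi lies above row r. The comparison of the first r rows thus follows from equal
  -- cardinality and the comparison of left counts at s.
  set s := xi.rowLen r
  have hsplit : ∀ C : Finset (Fin (skewSize lam mu)), C.card =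
      leftCount (colOf lam mu) C s + (C.filter fun p => ¬ colOf lam mu p < s).card := by
    intro C
    rw [leftCount_eq_card, Finset.card_filter_add_card_filter_not]
  have hsplit' : ∀ C : Finset (Fin (skewSize lam mu)),
      (C.filter fun p => rowIn lam mu p < r).card =
      ((C.filter fun p => rowIn lam mu p < r).filter fun p => colOf lam mu p < s).card +
      ((C.filter fun p => rowIn lam mu p < r).filter fun p => ¬ colOf lam mu p < s).card :=
    fun C => (Finset.card_filter_add_card_filter_not _).symm
  have e1 : ((cellSet lam mu nu).filter fun p => rowIn lam mu p < r).filter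
      (fun p => colOf lam mu p < s) ⊆ ((cellSet lam mu xi).filter fun p => rowIn lam mu p < r).filter
      (fun p => colOf lam mu p < s) := by
    intro p hp
    simp only [Finset.mem_filter, mem_cellSet] at hp ⊢
    refine ⟨⟨?_, hp.1.2⟩, hp.2⟩
    exact hp.1.2.trans (lt_colLen_iff_lt_rowLen.mpr hp.2)
  have e2 : ((cellSet lam mu nu).filter fun p => rowIn lam mu p < r).filter
      (fun p => ¬ colOf lam mu p < s) ⊆ (cellSet lam mu nu).filter
      (fun p => ¬ colOf lam mu p < s) :=
    Finset.filter_subset_filter _ (Finset.filter_subset _ _)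
  have e3 : ((cellSet lam mu xi).filter fun p => rowIn lam mu p < r).filter
      (fun p => ¬ colOf lam mu p < s) = (cellSet lam mu xi).filter
      (fun p => ¬ colOf lam mu p < s) := by
    ext p
    simp only [Finset.mem_filter, mem_cellSet]
    refine ⟨fun h => ⟨h.1.1, h.2⟩, fun h => ⟨⟨h.1, ?_⟩, h.2⟩⟩
    have h5 := h.2
    rw [← lt_colLen_iff_lt_rowLen] at h5
    omega
  have f1 := hsplit' (cellSet lam mu nu)
  have f2 := hsplit' (cellSet lam mu xi)
  have f3 := Finset.card_le_card e1
  have f4 := Finset.card_le_card e2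
  rw [e3] at f2
  have f5 := hsplit (cellSet lam mu nu)
  have f6 := hsplit (cellSet lam mu xi)
  have f7 := h s
  omega

/-- A set of cells whose column lengths, added to those of `mu`, do not increase has the column
lengths of a diagram. -/
lemma exists_diagram (hmu : mu ≤ lam) (B : Finset (Fin (skewSize lam mu)))
    (h : ∀ j, colCount (colOf lam mu) B (j + 1) + mu.colLen (j + 1) ≤
      colCount (colOf lam mu) B j + mu.colLen j) :
    ∃ nu, mu ≤ nu ∧ nu ≤ lam ∧ ∀ j, colCount (colOf lam mu) B j + mu.colLen j = nu.colLen j := by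
  have hanti : Antitone fun j => colCount (colOf lam mu) B j + mu.colLen j :=
    antitone_nat_of_succ_le h
  have hle : ∀ j, colCount (colOf lam mu) B j + mu.colLen j ≤ lam.colLen j := by
    intro j
    have h1 := colCount_cellSet (lam := lam) hmu le_rfl j
    rw [cellSet_self] at h1
    have h2 : colCount (colOf lam mu) B j ≤ colCount (colOf lam mu) Finset.univ j :=
      Finset.card_le_card (Finset.filter_subset_filter _ (Finset.subset_univ _))
    omega
  -- The columns are prescribed, and cutting them out of lam loses nothing by `hle`; that they
  -- weakly decrease makes the result a lower set.
  let nu : YoungDiagram :=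
    { cells := lam.cells.filter fun q => q.1 < colCount (colOf lam mu) B q.2 + mu.colLen q.2
      isLowerSet := by
        rintro ⟨i, j⟩ ⟨i', j'⟩ hle' hq
        simp only [Finset.coe_filter, Set.mem_ofPred_eq, YoungDiagram.mem_cells] at hq ⊢
        obtain ⟨hi, hj⟩ := Prod.mk_le_mk.mp hle'
        exact ⟨YoungDiagram.up_left_mem lam hi hj hq.1,
          (hi.trans_lt hq.2).trans_le (hanti hj)⟩ }
  have hmem : ∀ i j, (i, j) ∈ nu ↔ i < colCount (colOf lam mu) B j + mu.colLen j := by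
    intro i j
    rw [← YoungDiagram.mem_cells]
    simp only [nu, Finset.mem_filter, YoungDiagram.mem_cells, YoungDiagram.mem_iff_lt_colLen]
    exact ⟨And.right, fun h => ⟨h.trans_le (hle j), h⟩⟩
  refine ⟨nu, ?_, ?_, fun j => ?_⟩
  · rintro ⟨i, j⟩ hq
    rw [YoungDiagram.mem_iff_lt_colLen] at hq
    exact (hmem i j).mpr (hq.trans_le (Nat.le_add_left _ _))
  · rintro ⟨i, j⟩ hq
    exact YoungDiagram.mem_iff_lt_colLen.mpr (((hmem i j).mp hq).trans_le (hle j))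
  · refine eq_of_forall_lt_iff fun i => ?_
    rw [← hmem, YoungDiagram.mem_iff_lt_colLen]

end Cells

/-! ### Shuffles and their image in the invariants. -/

section Shuffles

variable {k : Type u} [Field k] {V₁ V₂ : Type u}
  [AddCommGroup V₁] [Module k V₁] [SuperSpace k V₁]
  [AddCommGroup V₂] [Module k V₂] [SuperSpace k V₂]
variable {d e f : ℕ}

/-- `ρ` is a shuffle in each column. -/
def IsShuffle (c : Fin d → ℕ) (c₁ : Fin e → ℕ) (c₂ : Fin f → ℕ) (ρ : Fin e ⊕ₗ Fin f ≃ Fin d) :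
    Prop :=
  (∀ a, c (ρ (toLex (Sum.inl a))) = c₁ a) ∧ (∀ b, c (ρ (toLex (Sum.inr b))) = c₂ b) ∧
  StrictMono (fun a => ρ (toLex (Sum.inl a))) ∧ StrictMono (fun b => ρ (toLex (Sum.inr b)))

open Classical in
/-- The sum over all shuffles. -/
noncomputable def shuf (c : Fin d → ℕ) (c₁ : Fin e → ℕ) (c₂ : Fin f → ℕ) :
    T k (Fin e) V₁ ⊗[k] T k (Fin f) V₂ →ₗ[k] T k (Fin d) (V₁ × V₂) :=
  ∑ ρ : Fin e ⊕ₗ Fin f ≃ Fin d with IsShuffle c c₁ c₂ ρ, inclR ρ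

variable {c : Fin d → ℕ} {c₁ : Fin e → ℕ} {c₂ : Fin f → ℕ}

lemma range_inl_eq_leftSet (ρ : Fin e ⊕ₗ Fin f ≃ Fin d) :
    Set.range (fun a => ρ (toLex (Sum.inl a))) = leftSet ρ := by
  ext p; simp [mem_leftSet_iff]

lemma range_inr_eq_leftSet_compl (ρ : Fin e ⊕ₗ Fin f ≃ Fin d) :
    Set.range (fun b => ρ (toLex (Sum.inr b))) = (leftSet ρ : Set (Fin d))ᶜ := by
  ext p
  revert p
  refine forall_placement ρ (fun a => ?_) (fun b => ?_)
  · simp [inl_mem_leftSet]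
  · simp [inr_notMem_leftSet]

/-- A strictly increasing map is determined by its range, and the left set determines the ranges on
both blocks. -/
lemma IsShuffle.eq_of_leftSet {ρ ρ' : Fin e ⊕ₗ Fin f ≃ Fin d} (h : IsShuffle c c₁ c₂ ρ)
    (h' : IsShuffle c c₁ c₂ ρ') (hl : leftSet ρ = leftSet ρ') : ρ = ρ' := by
  have h1 := (h.2.2.1.range_inj h'.2.2.1).mp (by
    rw [range_inl_eq_leftSet, range_inl_eq_leftSet, hl])
  have h2 := (h.2.2.2.range_inj h'.2.2.2).mp (by
    rw [range_inr_eq_leftSet_compl, range_inr_eq_leftSet_compl, hl])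
  ext p
  rcases hp : ofLex p with a | b
  · have : p = toLex (Sum.inl a) := by rw [← hp]; rfl
    rw [this]; exact congrArg Fin.val (congrFun h1 a)
  · have : p = toLex (Sum.inr b) := by rw [← hp]; rfl
    rw [this]; exact congrArg Fin.val (congrFun h2 b)

/-- Different shuffles have different left sets, so exactly one summand lies in a given block. In
particular the shuffle map can be inverted by projecting to the block of any one shuffle. -/
lemma IsShuffle.blockPr_shuf {ρ : Fin e ⊕ₗ Fin f ≃ Fin d} (h : IsShuffle c c₁ c₂ ρ)
    (w : T k (Fin e) V₁ ⊗[k] T k (Fin f) V₂) :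
    blockPr (leftSet ρ) (shuf c c₁ c₂ w) = inclR ρ w := by
  classical
  rw [shuf, LinearMap.sum_apply, map_sum, Finset.sum_eq_single ρ]
  · rw [blockPr_inclR, if_pos rfl]
  · intro ρ' hρ' hne
    rw [blockPr_inclR, if_neg]
    intro hl
    exact hne ((h.eq_of_leftSet (Finset.mem_filter.mp hρ').2 hl).symm)
  · intro hn
    exact absurd (Finset.mem_filter.mpr ⟨Finset.mem_univ _, h⟩) hn

lemma exists_isShuffle_of_blockPr_shuf {w : T k (Fin e) V₁ ⊗[k] T k (Fin f) V₂}
    {B : Finset (Fin d)} (h : blockPr B (shuf c c₁ c₂ w) ≠ 0) :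
    ∃ ρ, IsShuffle c c₁ c₂ ρ ∧ B = leftSet ρ := by
  classical
  by_contra hn
  push Not at hn
  refine h ?_
  rw [shuf, LinearMap.sum_apply, map_sum]
  refine Finset.sum_eq_zero fun ρ hρ => ?_
  rw [blockPr_inclR, if_neg (hn ρ (Finset.mem_filter.mp hρ).2)]

lemma IsShuffle.coinclR_shuf {ρ : Fin e ⊕ₗ Fin f ≃ Fin d} (h : IsShuffle c c₁ c₂ ρ)
    (w : T k (Fin e) V₁ ⊗[k] T k (Fin f) V₂) : coinclR ρ (shuf c c₁ c₂ w) = w := by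
  rw [← coinclR_blockPr, h.blockPr_shuf, coinclR_inclR]

/-- On invariants, a placement that respects the columns may be replaced by a shuffle. -/
lemma exists_isShuffle (hc : Monotone c) (hc₁ : Monotone c₁) (hc₂ : Monotone c₂)
    {ρ : Fin e ⊕ₗ Fin f ≃ Fin d} (h₁ : ∀ a, c (ρ (toLex (Sum.inl a))) = c₁ a)
    (h₂ : ∀ b, c (ρ (toLex (Sum.inr b))) = c₂ b) :
    ∃ ρ', IsShuffle c c₁ c₂ ρ' ∧ leftSet ρ' = leftSet ρ ∧
      ∀ w : gammaInv (k := k) c₁ V₁ ⊗[k] gammaInv (k := k) c₂ V₂,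
        inclR ρ (TensorProduct.map (gammaInv (k := k) c₁ V₁).subtype
          (gammaInv (k := k) c₂ V₂).subtype w) =
        inclR ρ' (TensorProduct.map (gammaInv (k := k) c₁ V₁).subtype
          (gammaInv (k := k) c₂ V₂).subtype w) := by
  -- Every placement is an increasing one preceded by a permutation of each block.
  obtain ⟨A, he, hf, α, β, rfl⟩ := exists_placeOf ρ
  have hl : StrictMono fun a => placeOf A he hf (toLex (Sum.inl a)) := by
    have : (fun a => placeOf A he hf (toLex (Sum.inl a))) = A.orderEmbOfFin he := by
      funext a; simp [placeOf]
    rw [this]; exact (A.orderEmbOfFin he).strictMono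
  have hr : StrictMono fun b => placeOf A he hf (toLex (Sum.inr b)) := by
    have : (fun b => placeOf A he hf (toLex (Sum.inr b))) = Aᶜ.orderEmbOfFin hf := by
      funext a; simp [placeOf]
    rw [this]; exact (Aᶜ.orderEmbOfFin hf).strictMono
  have h1 : (fun a => c (placeOf A he hf (toLex (Sum.inl a)))) ∘ α = c₁ := funext h₁
  have h2 : (fun b => c (placeOf A he hf (toLex (Sum.inr b)))) ∘ β = c₂ := funext h₂
  -- Both colourings are monotone and are rearrangements of each other, so they agree. Hence α
  -- preserves the columns and acts trivially on the invariants; likewise for β.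
  have h1' : (fun a => c (placeOf A he hf (toLex (Sum.inl a)))) = c₁ := by
    rw [← h1]
    exact (Tuple.unique_monotone (σ := α) (τ := 1) (by rw [h1]; exact hc₁)
      (hc.comp hl.monotone)).symm
  have h2' : (fun b => c (placeOf A he hf (toLex (Sum.inr b)))) = c₂ := by
    rw [← h2]
    exact (Tuple.unique_monotone (σ := β) (τ := 1) (by rw [h2]; exact hc₂)
      (hc.comp hr.monotone)).symm
  refine ⟨placeOf A he hf, ⟨congrFun h1', congrFun h2', hl, hr⟩, (leftSet_blockPerm _ _ _).symm,
    fun w => ?_⟩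
  rw [inclR_perm]
  congr 1
  have hα : InYoung c₁ α := fun a => by rw [← congrFun h1 a, ← h1']; rfl
  have hβ : InYoung c₂ β := fun a => by rw [← congrFun h2 a, ← h2']; rfl
  induction w with
  | zero => simp
  | add x y hx hy => rw [map_add, map_add, hx, hy]
  | tmul x y =>
    simp only [TensorProduct.map_tmul, Submodule.subtype_apply]
    rw [x.2 α hα, y.2 β hβ]

lemma eq_of_blockPr {z z' : T k (Fin d) (V₁ × V₂)} (h : ∀ B, blockPr B z = blockPr B z') :
    z = z' := by
  rw [← sum_blockPr z, ← sum_blockPr z']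
  exact Finset.sum_congr rfl fun B _ => h B

/-- A column permutation takes a shuffle to a placement respecting the columns, which on invariants
may be replaced by a shuffle with the same left set. So it permutes the summands, as is checked
block by block. -/
lemma shuf_mem_gammaInv (hc : Monotone c) (hc₁ : Monotone c₁) (hc₂ : Monotone c₂)
    (w : gammaInv (k := k) c₁ V₁ ⊗[k] gammaInv (k := k) c₂ V₂) :
    shuf c c₁ c₂ (TensorProduct.map (gammaInv (k := k) c₁ V₁).subtype
      (gammaInv (k := k) c₂ V₂).subtype w) ∈ gammaInv (k := k) c (V₁ × V₂) := by
  intro σ hσ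
  set w' := TensorProduct.map (gammaInv (k := k) c₁ V₁).subtype
      (gammaInv (k := k) c₂ V₂).subtype w with hw'
  have key : ∀ B : Finset (Fin d), blockPr B (R σ (shuf c c₁ c₂ w')) =
      R σ (blockPr (B.map σ.symm.toEmbedding) (shuf c c₁ c₂ w')) := by
    intro B
    rw [R_blockPr, Finset.map_map, ← Equiv.trans_toEmbedding, Equiv.symm_trans_self,
      Equiv.refl_toEmbedding, Finset.map_refl]
  refine eq_of_blockPr fun B => ?_
  rw [key]
  by_cases hB : ∃ ρ, IsShuffle c c₁ c₂ ρ ∧ B = leftSet ρ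
  · obtain ⟨ρ, hρ, rfl⟩ := hB
    obtain ⟨ρ', hρ', hl, hw⟩ := exists_isShuffle (k := k) (V₁ := V₁) (V₂ := V₂) hc hc₁ hc₂
      (ρ := ρ.trans σ.symm) (fun a => (hσ.symm _).trans (hρ.1 a))
      (fun b => (hσ.symm _).trans (hρ.2.1 b))
    rw [← leftSet_trans, ← hl, hρ'.blockPr_shuf, hρ.blockPr_shuf, hw', ← hw, R_inclR, Equiv.trans_assoc,
      Equiv.symm_trans_self, Equiv.trans_refl]
  · have h1 : blockPr B (shuf c c₁ c₂ w') = 0 := by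
      by_contra h; exact hB (exists_isShuffle_of_blockPr_shuf h)
    rw [h1]
    by_contra h
    have h2 : blockPr (B.map σ.symm.toEmbedding) (shuf c c₁ c₂ w') ≠ 0 := by
      intro h3; rw [h3, map_zero] at h; exact h rfl
    obtain ⟨ρ, hρ, hl⟩ := exists_isShuffle_of_blockPr_shuf h2
    obtain ⟨ρ', hρ', hl', -⟩ := exists_isShuffle (k := k) (V₁ := V₁) (V₂ := V₂) hc hc₁ hc₂
      (ρ := ρ.trans σ) (fun a => (hσ _).trans (hρ.1 a)) (fun b => (hσ _).trans (hρ.2.1 b))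
    refine hB ⟨ρ', hρ', ?_⟩
    rw [hl', leftSet_trans, ← hl]
    ext p; simp

/-- The image of the shuffle map is the part of the invariants with given column counts. -/
lemma range_shuf (hc : Monotone c) (hc₁ : Monotone c₁) (hc₂ : Monotone c₂)
    {ρ : Fin e ⊕ₗ Fin f ≃ Fin d} (hρ : IsShuffle c c₁ c₂ ρ) :
    LinearMap.range (shuf c c₁ c₂ ∘ₗ TensorProduct.map (gammaInv (k := k) c₁ V₁).subtype
      (gammaInv (k := k) c₂ V₂).subtype) =
    suppSub c fun B => colCount c B = colCount c (leftSet ρ) := by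
  apply le_antisymm
  · rintro _ ⟨w, rfl⟩
    refine ⟨shuf_mem_gammaInv hc hc₁ hc₂ w, fun B hB => ?_⟩
    obtain ⟨ρ', hρ', rfl⟩ := exists_isShuffle_of_blockPr_shuf hB
    funext j
    rw [colCount_leftSet, colCount_leftSet, funext hρ'.1, funext hρ.1]
  · rintro z ⟨hz, hz'⟩
    -- The preimage is the component in the block of the one shuffle ρ. The shuffle map reproduces z
    -- in this block, hence in all blocks with the same column counts.
    obtain ⟨w, hw⟩ := coinclR_mem_range ρ hρ.1 hρ.2.1 hz
    refine ⟨w, ?_⟩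
    rw [LinearMap.comp_apply]
    refine eq_of_blockPr fun B => ?_
    rw [← sub_eq_zero, ← map_sub]
    by_cases hB : colCount c B = colCount c (leftSet ρ)
    · refine blockPr_eq_zero_of_colCount (sub_mem (shuf_mem_gammaInv hc hc₁ hc₂ w) hz)
        (A := leftSet ρ) (fun j => (congrFun hB j).symm) ?_
      rw [blockPr_eq_zero_iff, map_sub, hρ.coinclR_shuf, hw, sub_self]
    · rw [map_sub]
      have h1 : blockPr B z = 0 := by
        by_contra h; exact hB (hz' B h)
      have h2 : blockPr B (shuf c c₁ c₂ (TensorProduct.map (gammaInv (k := k) c₁ V₁).subtype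
          (gammaInv (k := k) c₂ V₂).subtype w)) = 0 := by
        by_contra h
        obtain ⟨ρ', hρ', rfl⟩ := exists_isShuffle_of_blockPr_shuf h
        refine hB (funext fun j => ?_)
        rw [colCount_leftSet, colCount_leftSet, funext hρ'.1, funext hρ.1]
      rw [h1, h2, sub_self]

/-- `countPr` cuts an invariant tensor into invariant pieces of fixed column counts, so a support
condition on the counts alone splits as a sum. -/
lemma iSup_suppSub {I : Type} (β : I → ℕ → ℕ) :
    ⨆ i, suppSub (k := k) (V₁ := V₁) (V₂ := V₂) c (fun B => colCount c B = β i) =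
      suppSub c fun B => ∃ i, colCount c B = β i := by
  classical
  apply le_antisymm
  · exact iSup_le fun i => suppSub_mono fun B hB => ⟨i, hB⟩
  · rintro z ⟨hz, hz'⟩
    rw [← sum_countPr c z]
    refine sum_mem fun γ _ => ?_
    by_cases h : ∃ i, γ = β i
    · obtain ⟨i, rfl⟩ := h
      refine Submodule.mem_iSup_of_mem i ⟨countPr_mem_gammaInv _ hz, fun B hB => ?_⟩
      rw [blockPr_countPr] at hB
      by_contra hn
      rw [if_neg hn] at hB
      exact hB rfl
    · have : countPr c γ z = 0 := by
        refine eq_of_blockPr fun B => ?_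
        rw [blockPr_countPr, map_zero]
        split_ifs with hB
        · by_contra hn
          obtain ⟨i, hi⟩ := hz' B hn
          exact h ⟨i, hB.symm.trans hi⟩
        · rfl
      rw [this]; exact zero_mem _

end Shuffles

/-! ### Shuffles of diagrams, and invariants supported on diagrams. -/

section ShapeShuffles

variable {k : Type u} [Field k] {V₁ V₂ : Type u}
  [AddCommGroup V₁] [Module k V₁] [SuperSpace k V₁]
  [AddCommGroup V₂] [Module k V₂] [SuperSpace k V₂]
variable {lam mu nu xi : YoungDiagram}

/-- `B` has the column lengths of `nu / mu`. -/
def HasShape (lam mu nu : YoungDiagram) (B : Finset (Fin (skewSize lam mu))) : Prop :=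
  ∀ j, colCount (colOf lam mu) B j + mu.colLen j = nu.colLen j

lemma hasShape_cellSet (h₁ : mu ≤ nu) (h₂ : nu ≤ lam) :
    HasShape lam mu nu (cellSet lam mu nu) := colCount_cellSet h₁ h₂

lemma hasShape_iff (h₁ : mu ≤ nu) (h₂ : nu ≤ lam) {B : Finset (Fin (skewSize lam mu))} :
    HasShape lam mu nu B ↔ colCount (colOf lam mu) B = colCount (colOf lam mu) (cellSet lam mu nu) := by
  rw [funext_iff]
  refine forall_congr' fun j => ?_
  have := colCount_cellSet h₁ h₂ j
  omega

lemma HasShape.eq {nu' : YoungDiagram} {B : Finset (Fin (skewSize lam mu))}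
    (h : HasShape lam mu nu B) (h' : HasShape lam mu nu' B) : nu = nu' :=
  ext_colLen fun j => (h j).symm.trans (h' j)

lemma isShuffle_cellPlace (h₁ : mu ≤ nu) (h₂ : nu ≤ lam) :
    IsShuffle (colOf lam mu) (colOf nu mu) (colOf lam nu) (cellPlace h₁ h₂) :=
  ⟨colOf_cellPlace_inl h₁ h₂, colOf_cellPlace_inr h₁ h₂, cellPlace_inl_strictMono h₁ h₂,
    cellPlace_inr_strictMono h₁ h₂⟩

/-- The shuffle map for three diagrams, on the invariants. -/
noncomputable def shapeShuf (k : Type u) [Field k] (V₁ V₂ : Type u) [AddCommGroup V₁]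
    [Module k V₁] [SuperSpace k V₁] [AddCommGroup V₂] [Module k V₂] [SuperSpace k V₂]
    (lam nu mu : YoungDiagram) :
    gammaInv (k := k) (colOf nu mu) V₁ ⊗[k] gammaInv (k := k) (colOf lam nu) V₂ →ₗ[k]
      T k (Fin (skewSize lam mu)) (V₁ × V₂) :=
  shuf (colOf lam mu) (colOf nu mu) (colOf lam nu) ∘ₗ
    TensorProduct.map (gammaInv (k := k) (colOf nu mu) V₁).subtype
      (gammaInv (k := k) (colOf lam nu) V₂).subtype

/-- The invariants supported in the diagrams `nu` with `P nu`. -/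
def shapeSub (k : Type u) [Field k] (V₁ V₂ : Type u) [AddCommGroup V₁]
    [Module k V₁] [SuperSpace k V₁] [AddCommGroup V₂] [Module k V₂] [SuperSpace k V₂]
    (lam mu : YoungDiagram) (P : YoungDiagram → Prop) :
    Submodule k (T k (Fin (skewSize lam mu)) (V₁ × V₂)) :=
  suppSub (colOf lam mu) fun B => ∃ nu, mu ≤ nu ∧ nu ≤ lam ∧ P nu ∧ HasShape lam mu nu B

lemma range_shapeShuf (h₁ : mu ≤ nu) (h₂ : nu ≤ lam) :
    LinearMap.range (shapeShuf k V₁ V₂ lam nu mu) =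
      suppSub (colOf lam mu) (HasShape lam mu nu) := by
  rw [shapeShuf, range_shuf (colOf_mono _ _) (colOf_mono _ _) (colOf_mono _ _)
    (isShuffle_cellPlace h₁ h₂), leftSet_cellPlace]
  congr 1
  funext B
  exact propext (hasShape_iff h₁ h₂).symm

/-- The block of the cells of nu / mu serves as the leading component; there the shuffle map is the
identity. -/
lemma coinclR_shapeShuf (h₁ : mu ≤ nu) (h₂ : nu ≤ lam)
    (w : gammaInv (k := k) (colOf nu mu) V₁ ⊗[k] gammaInv (k := k) (colOf lam nu) V₂) :
    coinclR (cellPlace h₁ h₂) (shapeShuf k V₁ V₂ lam nu mu w) =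
      TensorProduct.map (gammaInv (k := k) (colOf nu mu) V₁).subtype
        (gammaInv (k := k) (colOf lam nu) V₂).subtype w :=
  (isShuffle_cellPlace h₁ h₂).coinclR_shuf _

lemma iSup_range_shapeShuf (P : YoungDiagram → Prop) :
    ⨆ nu : {nu : YoungDiagram // mu ≤ nu ∧ nu ≤ lam ∧ P nu},
      LinearMap.range (shapeShuf k V₁ V₂ lam nu.1 mu) = shapeSub k V₁ V₂ lam mu P := by
  have : ∀ nu : {nu : YoungDiagram // mu ≤ nu ∧ nu ≤ lam ∧ P nu},
      LinearMap.range (shapeShuf k V₁ V₂ lam nu.1 mu) =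
      suppSub (colOf lam mu) fun B => colCount (colOf lam mu) B =
        colCount (colOf lam mu) (cellSet lam mu nu.1) := by
    rintro ⟨nu, h₁, h₂, h₃⟩
    rw [range_shapeShuf h₁ h₂]
    congr 1
    funext B
    exact propext (hasShape_iff h₁ h₂)
  rw [iSup_congr this, iSup_suppSub]
  unfold shapeSub
  congr 1
  funext B
  refine propext ⟨?_, ?_⟩
  · rintro ⟨⟨nu, h₁, h₂, h₃⟩, h⟩
    exact ⟨nu, h₁, h₂, h₃, (hasShape_iff h₁ h₂).mpr h⟩
  · rintro ⟨nu, h₁, h₂, h₃, h⟩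
    exact ⟨⟨nu, h₁, h₂, h₃⟩, (hasShape_iff h₁ h₂).mp h⟩

/-- An element of `shapeSub` that has no component at `xi` lies in the part strictly below `xi`. -/
lemma mem_shapeSub_lt (h₁ : mu ≤ xi) (h₂ : xi ≤ lam) {z : T k (Fin (skewSize lam mu)) (V₁ × V₂)}
    (hz : z ∈ shapeSub k V₁ V₂ lam mu fun nu => lexLe nu xi)
    (h : coinclR (cellPlace h₁ h₂) z = 0) : z ∈ shapeSub k V₁ V₂ lam mu fun nu => lexLt nu xi := by
  refine ⟨hz.1, fun B hB => ?_⟩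
  obtain ⟨nu, h₃, h₄, h₅, h₆⟩ := hz.2 B hB
  refine ⟨nu, h₃, h₄, ?_, h₆⟩
  rcases h₅ with rfl | h₅
  · rw [← blockPr_eq_zero_iff, leftSet_cellPlace] at h
    exact absurd (blockPr_eq_zero_of_colCount hz.1
      (fun j => (congrFun ((hasShape_iff h₁ h₂).mp h₆) j).symm) h) hB
  · exact h₅

end ShapeShuffles

/-! ### The filtration of Γ in terms of supports. -/

section ShapeOfShuffle

variable {k : Type u} [Field k]

set_option maxHeartbeats 400000 in
-- the parity change commutes with direct sums by unfolding
lemma shuffle_eq (lam nu mu : YoungDiagram) (M N : SVec k)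
    (w : T k (Fin (skewSize nu mu)) (Parity M) ⊗[k] T k (Fin (skewSize lam nu)) (Parity N)) :
    shuffle lam nu mu M N w =
      shuf (k := k) (V₁ := Parity M) (V₂ := Parity N) (colOf lam mu) (colOf nu mu)
        (colOf lam nu) w := by
  classical
  rw [shuffle, shuf, LinearMap.sum_apply, LinearMap.sum_apply]
  refine Finset.sum_congr ?_ fun ρ _ => rfl
  ext ρ
  exact ⟨fun h => Finset.mem_filter.mpr ⟨Finset.mem_univ _, (Finset.mem_filter.mp h).2⟩,
    fun h => Finset.mem_filter.mpr ⟨Finset.mem_univ _, (Finset.mem_filter.mp h).2⟩⟩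

lemma shuffle_comp_eq (lam nu mu : YoungDiagram) (M N : SVec k) :
    shuffle lam nu mu M N ∘ₗ TensorProduct.map (gammaPiIncl nu mu M) (gammaPiIncl lam nu N) =
      shapeShuf k (Parity M) (Parity N) lam nu mu :=
  LinearMap.ext fun _ => shuffle_eq lam nu mu M N _

/-- Replaces sums of images of shuffle maps by a condition on supports, which makes stability under
morphisms and leading components accessible. -/
lemma kSub_eq (lam mu : YoungDiagram) (P : YoungDiagram → Prop) (M N : SVec k) :
    kSub lam mu P M N = shapeSub k (Parity M) (Parity N) lam mu P := by
  rw [← iSup_range_shapeShuf, kSub]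
  refine iSup_congr fun nu => ?_
  rw [shuffle_comp_eq]
  rfl

end ShapeOfShuffle

/-! ### The signed row relations. -/

section SignedCoinvariants

variable {k : Type u} [Field k] {V : Type u} [AddCommGroup V] [Module k V] [SuperSpace k V]
variable {d : ℕ}

lemma invSgn_eq_sign (σ : Equiv.Perm (Fin d)) : invSgn σ = (Equiv.Perm.sign σ : ℤ) := by
  rw [Equiv.Perm.sign_eq_prod_prod_Ioi, invSgn, sgn, pairProd, Fintype.prod_prod_type]
  push_cast
  refine Finset.prod_congr rfl fun i _ => ?_
  rw [← Finset.prod_filter]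
  refine Finset.prod_congr (by ext; simp) fun j hj => ?_
  have hne : σ i ≠ σ j := fun h => (Finset.mem_Ioi.mp hj).ne (σ.injective h)
  rcases lt_or_gt_of_ne hne with h | h
  · simp [h, h.not_gt]
  · simp [h, h.not_gt, kos]

/-- The span of the elements `x - sgn(σ) σx`, for `σ` in a Young subgroup. -/
def skewCoinv (k : Type u) [Field k] (V : Type u) [AddCommGroup V] [Module k V] [SuperSpace k V]
    (c : Fin d → ℕ) : Submodule k (T k (Fin d) V) :=
  Submodule.span k {y | ∃ σ, InYoung c σ ∧ ∃ x : T k (Fin d) V, y = x - (invSgn σ : k) • R σ x}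

/-- The transposition has sign -1, so x is equivalent to its negative; here the characteristic must
not be 2. -/
lemma mem_skewCoinv_of_swap (hk : (2 : k) ≠ 0) {c : Fin d → ℕ} {x : T k (Fin d) V} {p q : Fin d}
    (hpq : p ≠ q) (hc : c p = c q) (hx : R (Equiv.swap p q) x = x) : x ∈ skewCoinv k V c := by
  have h2 : (2 : k) • x ∈ skewCoinv k V c := by
    refine Submodule.subset_span ⟨Equiv.swap p q, fun i => ?_, x, ?_⟩
    · rw [Equiv.swap_apply_def]
      split_ifs with h h'
      · rw [h, hc]
      · rw [h', hc]
      · rfl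
    · rw [hx, invSgn_eq_sign, Equiv.Perm.sign_swap hpq]
      simp [two_smul]
  exact ((skewCoinv k V c).smul_mem_iff hk).mp h2

end SignedCoinvariants

/-! ### Column relations die under θ. -/

section ColumnRelations

variable {k : Type u} [Field k] {V : Type u} [AddCommGroup V] [Module k V] [SuperSpace k V]
variable {lam mu nu xi : YoungDiagram}

/-- The straightening relations between adjacent columns. -/
def colRel (k : Type u) [Field k] (V : Type u) [AddCommGroup V] [Module k V] [SuperSpace k V]
    (lam mu : YoungDiagram) : Submodule k (T k (Fin (skewSize lam mu)) V) :=
  ⨆ p : {p : ℕ × ℕ × ℕ // lam.colLen p.1 < p.2.1 + p.2.2 + mu.colLen (p.1 + 1)},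
    relSub k V (colOf lam mu) p.1.1 p.1.2.1 p.1.2.2

lemma relSub_le_colRel {j a b : ℕ} (h : lam.colLen j < a + b + mu.colLen (j + 1)) :
    relSub k V (colOf lam mu) j a b ≤ colRel k V lam mu :=
  le_iSup (fun p : {p : ℕ × ℕ × ℕ // lam.colLen p.1 < p.2.1 + p.2.2 + mu.colLen (p.1 + 1)} =>
    relSub k V (colOf lam mu) p.1.1 p.1.2.1 p.1.2.2) ⟨(j, a, b), h⟩

lemma colRel_le {S : Submodule k (T k (Fin (skewSize lam mu)) V)}
    (h : ∀ j a b, lam.colLen j < a + b + mu.colLen (j + 1) →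
      relSub k V (colOf lam mu) j a b ≤ S) : colRel k V lam mu ≤ S :=
  iSup_le fun p => h _ _ _ p.2

lemma colRel_le_gammaInv : colRel k V lam mu ≤ gammaInv (k := k) (colOf lam mu) V :=
  colRel_le fun _ _ _ _ => relSub_le_gammaInv _ _ _ _

/-- The a + b positions of W lie in rows from `mu.colLen (j + 1)` up to `lam.colLen j`, which are
fewer than a + b rows, so two of them share a row. They have the same merged colour, hence the
summand is fixed by their transposition. -/
lemma colRel_le_skewCoinv (hk : (2 : k) ≠ 0) (hmu : mu ≤ lam) :
    colRel k V lam mu ≤ skewCoinv k V (rowIn lam mu) := by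
  refine colRel_le fun j a b h => ?_
  rintro _ ⟨Z, hZ, rfl⟩
  refine sum_mem fun W hW => ?_
  obtain ⟨h1, h2, h3⟩ := mem_relSets.mp hW
  have hcard : W.card = a + b := by
    rw [← h2, ← h3, colCount, colCount, ← Finset.card_union_of_disjoint]
    · congr 1
      ext p
      simp only [Finset.mem_union, Finset.mem_filter]
      exact ⟨fun hp => (h1 p hp).imp (⟨hp, ·⟩) (⟨hp, ·⟩), fun hp => hp.elim And.left And.left⟩
    · rw [Finset.disjoint_left]
      intro p hp hp'
      have := (Finset.mem_filter.mp hp).2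
      have := (Finset.mem_filter.mp hp').2
      omega
  obtain ⟨p, hp, q, hq, hpq, hr⟩ := Finset.exists_ne_map_eq_of_card_lt_of_maps_to (s := W)
    (t := Finset.Ico (mu.colLen (j + 1)) (lam.colLen j)) (f := rowIn lam mu)
    (by
      rw [Nat.card_Ico]
      have := colLen_mono hmu (j + 1)
      have := lam.colLen_anti j (j + 1) (by omega)
      omega) (by
      intro p hp
      have h4 := rowIn_lt p
      have h5 := le_rowIn p
      have h6 := lam.colLen_anti j (j + 1) (by omega)
      have h7 := mu.colLen_anti j (j + 1) (by omega)
      rw [Finset.mem_coe, Finset.mem_Ico]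
      rcases h1 p hp with h | h <;> rw [h] at h4 h5 <;> omega)
  refine mem_skewCoinv_of_swap hk hpq hr ?_
  rw [hZ]
  congr 1
  funext i
  simp only [Function.comp_apply, Equiv.symm_swap, Equiv.swap_apply_def]
  split_ifs with h h'
  · subst h; simp [colorOf, hp, hq]
  · subst h'; simp [colorOf, hp, hq]
  · rfl

end ColumnRelations

/-! ### Straightening of skew diagrams. -/

section Straighten

variable {k : Type u} [Field k] {V₁ V₂ : Type u}
  [AddCommGroup V₁] [Module k V₁] [SuperSpace k V₁]
  [AddCommGroup V₂] [Module k V₂] [SuperSpace k V₂]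
variable {lam mu nu xi : YoungDiagram}

lemma colCount_univ (h : mu ≤ lam) (j : ℕ) :
    colCount (colOf lam mu) Finset.univ j + mu.colLen j = lam.colLen j := by
  rw [← cellSet_self]; exact colCount_cellSet h le_rfl j

/-- If the prescribed column lengths increase from j to j + 1, then the V₂ cells of column j and the
V₁ cells of column j + 1 together exceed the number of available rows, so the relation used for
straightening lies in `colRel`. -/
lemma suppSub_le_colRel (hmu : mu ≤ lam) (Q : Finset (Fin (skewSize lam mu)) → Prop)
    (hQ : ∀ A B, Q A → A.card = B.card →
      (∀ m, leftCount (colOf lam mu) A m ≤ leftCount (colOf lam mu) B m) → Q B) :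
    suppSub (k := k) (V₁ := V₁) (V₂ := V₂) (colOf lam mu) Q ≤ colRel k (V₁ × V₂) lam mu ⊔
      suppSub (colOf lam mu) fun B => Q B ∧ ∃ nu, mu ≤ nu ∧ nu ≤ lam ∧ HasShape lam mu nu B := by
  refine suppSub_le_straighten (colOf lam mu) _ _ Q ?_ hQ ?_
  · rintro A B h ⟨nu, h₁, h₂, h₃⟩
    exact ⟨nu, h₁, h₂, (hasShape_iff h₁ h₂).mpr (h.trans ((hasShape_iff h₁ h₂).mp h₃))⟩
  · intro B hB
    have : ¬ ∀ j, colCount (colOf lam mu) B (j + 1) + mu.colLen (j + 1) ≤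
        colCount (colOf lam mu) B j + mu.colLen j := fun h => hB (exists_diagram hmu B h)
    push Not at this
    obtain ⟨j, hj⟩ := this
    refine ⟨j, relSub_le_colRel ?_⟩
    have h1 := colCount_compl (colOf lam mu) B j
    have h2 := colCount_univ hmu j
    omega

/-- Modulo relations every invariant tensor is supported on diagrams between mu and lam. Inclusion
implies the lexicographic order, so lam bounds them all; this makes the filtration exhaustive. -/
lemma gammaInv_le_colRel (hmu : mu ≤ lam) :
    gammaInv (k := k) (colOf lam mu) (V₁ × V₂) ≤ colRel k (V₁ × V₂) lam mu ⊔
      shapeSub k V₁ V₂ lam mu fun nu => lexLe nu lam := by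
  refine (gammaInv_le_suppSub _).trans ((suppSub_le_colRel hmu _ fun _ _ _ _ _ => trivial).trans ?_)
  refine sup_le_sup le_rfl (suppSub_mono ?_)
  rintro B ⟨-, nu, h₁, h₂, h₃⟩
  exact ⟨nu, h₁, h₂, lexLe_of_le h₂, h₃⟩

/-- Relations in one of the two factors are relations modulo smaller diagrams. -/
lemma shapeShuf_mem_of_rel (h₁ : mu ≤ xi) (h₂ : xi ≤ lam)
    {w : gammaInv (k := k) (colOf xi mu) V₁ ⊗[k] gammaInv (k := k) (colOf lam xi) V₂}
    {r : T k (Fin (skewSize lam mu)) (V₁ × V₂)} (hr : r ∈ colRel k (V₁ × V₂) lam mu)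
    (hw : coinclR (cellPlace h₁ h₂) r = TensorProduct.map
      (gammaInv (k := k) (colOf xi mu) V₁).subtype (gammaInv (k := k) (colOf lam xi) V₂).subtype w)
    {j : ℕ} (hB : ∀ B, blockPr B r ≠ 0 → MovedLeft (colOf lam mu) j (cellSet lam mu xi) B) :
    shapeShuf k V₁ V₂ lam xi mu w ∈ colRel k (V₁ × V₂) lam mu ⊔
      shapeSub k V₁ V₂ lam mu fun nu => lexLt nu xi := by
  set c := colOf lam mu with hc
  -- Sets lying weakly to the left of the cells of xi, and strictly at some cut. The condition
  -- survives further moves to the left, so straightening cannot lead back to xi.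
  let Q : Finset (Fin (skewSize lam mu)) → Prop := fun B =>
    (cellSet lam mu xi).card = B.card ∧
      (∀ m, leftCount c (cellSet lam mu xi) m ≤ leftCount c B m) ∧
      ∃ m, leftCount c (cellSet lam mu xi) m < leftCount c B m
  have hs : shapeShuf k V₁ V₂ lam xi mu w ∈ suppSub c (HasShape lam mu xi) := by
    rw [← range_shapeShuf h₁ h₂]; exact ⟨w, rfl⟩
  have hz : shapeShuf k V₁ V₂ lam xi mu w - r ∈ suppSub c Q := by
    have hinv := sub_mem hs.1 (colRel_le_gammaInv hr)
    refine ⟨hinv, fun B hB' => ?_⟩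
    have hne : colCount c B ≠ colCount c (cellSet lam mu xi) := by
      intro he
      refine hB' (blockPr_eq_zero_of_colCount hinv (A := cellSet lam mu xi)
        (fun j => (congrFun he j).symm) ?_)
      rw [← leftSet_cellPlace h₁ h₂, blockPr_eq_zero_iff, map_sub, hw, coinclR_shapeShuf, sub_self]
    have h3 : blockPr B (shapeShuf k V₁ V₂ lam xi mu w) = 0 := by
      by_contra h
      exact hne ((hasShape_iff h₁ h₂).mp (hs.2 B h))
    have h4 : blockPr B r ≠ 0 := by
      intro h; rw [map_sub, h3, h, sub_zero] at hB'; exact hB' rfl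
    have h5 := hB B h4
    exact ⟨h5.card_eq, h5.leftCount_le, _, (h5.leftCount_lt hne).2⟩
  have hz' := suppSub_le_colRel (h₁.trans h₂) Q (by
    rintro A B ⟨hA1, hA2, m, hA3⟩ hcard hl
    exact ⟨hA1.trans hcard, fun m => (hA2 m).trans (hl m), m, hA3.trans_le (hl m)⟩) hz
  rw [← sub_add_cancel (shapeShuf k V₁ V₂ lam xi mu w) r]
  refine add_mem ?_ (Submodule.mem_sup_left hr)
  refine (sup_le_sup le_rfl (suppSub_mono ?_) : (_ : Submodule k _) ≤ _) hz'
  rintro B ⟨⟨hQ1, hQ2, m, hQ3⟩, nu, h₃, h₄, h₅⟩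
  have he := (hasShape_iff h₃ h₄).mp h₅
  have hl : ∀ m, leftCount c B m = leftCount c (cellSet lam mu nu) m := fun m => by
    unfold leftCount; rw [he]
  refine ⟨nu, h₃, h₄, ?_, h₅⟩
  -- More cells to the left means smaller partial row sums; the strict cut excludes equality.
  have := lexLe_of_leftCount h₃ h₄ h₁ h₂ (hQ1.trans (card_eq_of_colCount he))
    (fun m => (hl m) ▸ hQ2 m)
  rcases this with rfl | h
  · rw [hl] at hQ3; exact absurd hQ3 (lt_irrefl _)
  · exact h

/-- The extended relation also merges all cells of lam / xi in column j. This raises a by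
`lam.colLen j - xi.colLen j`, exactly the amount by which the bound for the number of rows rises. -/
lemma shapeShuf_mem_left (h₁ : mu ≤ xi) (h₂ : xi ≤ lam) {x : gammaInv (k := k) (colOf xi mu) V₁}
    (hx : x.1 ∈ colRel k V₁ xi mu) (y : gammaInv (k := k) (colOf lam xi) V₂) :
    shapeShuf k V₁ V₂ lam xi mu (x ⊗ₜ y) ∈ colRel k (V₁ × V₂) lam mu ⊔
      shapeSub k V₁ V₂ lam mu fun nu => lexLt nu xi := by
  -- Relations are tensors while `shapeShuf` acts on the subtype of invariants; the image under the
  -- inclusion bridges the two, and linearity reduces to generators.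
  have : colRel k V₁ xi mu ≤ (Submodule.comap (shapeShuf k V₁ V₂ lam xi mu ∘ₗ
      (TensorProduct.mk k _ _).flip y) (colRel k (V₁ × V₂) lam mu ⊔
      shapeSub k V₁ V₂ lam mu fun nu => lexLt nu xi)).map
        (gammaInv (k := k) (colOf xi mu) V₁).subtype := by
    refine colRel_le fun j a b h x hx => ?_
    refine ⟨⟨x, relSub_le_gammaInv _ _ _ _ hx⟩, ?_, rfl⟩
    obtain ⟨r, hr, hr', hB⟩ := exists_rel_left (cellPlace h₁ h₂) (colOf lam mu)
      (colOf_cellPlace_inl h₁ h₂) (colOf_cellPlace_inr h₁ h₂) hx y.2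
    rw [leftSet_cellPlace] at hB
    refine shapeShuf_mem_of_rel h₁ h₂ (relSub_le_colRel ?_ hr) hr' hB
    have := colCount_univ h₂ j
    have := colLen_mono h₂ j
    omega
  obtain ⟨x', h, h'⟩ := this hx
  rw [← Subtype.ext h']
  exact h

/-- The counterpart for the second factor: merging the cells of xi / mu in column j + 1 raises b by
`xi.colLen (j + 1) - mu.colLen (j + 1)`, which makes up for replacing xi by mu in the bound. -/
lemma shapeShuf_mem_right (h₁ : mu ≤ xi) (h₂ : xi ≤ lam) (x : gammaInv (k := k) (colOf xi mu) V₁)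
    {y : gammaInv (k := k) (colOf lam xi) V₂} (hy : y.1 ∈ colRel k V₂ lam xi) :
    shapeShuf k V₁ V₂ lam xi mu (x ⊗ₜ y) ∈ colRel k (V₁ × V₂) lam mu ⊔
      shapeSub k V₁ V₂ lam mu fun nu => lexLt nu xi := by
  have : colRel k V₂ lam xi ≤ (Submodule.comap (shapeShuf k V₁ V₂ lam xi mu ∘ₗ
      TensorProduct.mk k _ _ x) (colRel k (V₁ × V₂) lam mu ⊔
      shapeSub k V₁ V₂ lam mu fun nu => lexLt nu xi)).map
        (gammaInv (k := k) (colOf lam xi) V₂).subtype := by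
    refine colRel_le fun j a b h y hy => ?_
    refine ⟨⟨y, relSub_le_gammaInv _ _ _ _ hy⟩, ?_, rfl⟩
    obtain ⟨r, hr, hr', hB⟩ := exists_rel_right (cellPlace h₁ h₂) (colOf lam mu)
      (colOf_cellPlace_inl h₁ h₂) (colOf_cellPlace_inr h₁ h₂) x.2 hy
    rw [leftSet_cellPlace] at hB
    refine shapeShuf_mem_of_rel h₁ h₂ (relSub_le_colRel ?_ hr) hr' hB
    have := colCount_univ h₁ (j + 1)
    have := colLen_mono h₁ (j + 1)
    omega
  obtain ⟨x', h, h'⟩ := this hy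
  rw [← Subtype.ext h']
  exact h

end Straighten

/-! ### The kernel of θ. -/

section Theta

variable {k : Type u} [Field k]

variable {M : Type u} [AddCommGroup M] [Module k M] [SuperSpace k M] {d : ℕ}

lemma oneMap_smul_R (σ : Equiv.Perm (Fin d)) (x : T k (Fin d) (Parity M)) :
    oneMap ((invSgn σ : k) • R σ x) = R σ (oneMap x) := by
  rw [map_smul, oneMap_R, smul_smul, ← Int.cast_mul, invSgn_sq, Int.cast_one, one_smul]

/-- `oneMap` turns sgn(σ)σ into σ, and conjugation by π exchanges the Young subgroups of c and c'.
So the generators of the two spans correspond, up to sign. -/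
lemma mem_skewCoinv_iff (c c' : Fin d → ℕ) (π : Equiv.Perm (Fin d)) (hπ : ∀ i, c' (π i) = c i)
    (z : T k (Fin d) (Parity M)) :
    R π (oneMap z) ∈ Submodule.span k {y : T k (Fin d) M | ∃ σ, InYoung c' σ ∧ ∃ x, y = R σ x - x} ↔
      z ∈ skewCoinv k (Parity M) c := by
  constructor
  · intro hz
    have hle : Submodule.span k {y : T k (Fin d) M | ∃ σ, InYoung c' σ ∧ ∃ x, y = R σ x - x} ≤
        (skewCoinv k (Parity M) c).comap (oneInv ∘ₗ R π.symm) := by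
      refine Submodule.span_le.mpr ?_
      rintro _ ⟨σ, hσ, x, rfl⟩
      obtain ⟨y, rfl⟩ : ∃ y, R π (oneMap y) = x := ⟨oneInv (R π.symm x), by
        rw [oneMap_oneInv]; exact R_symm_R π.symm x⟩
      let τ : Equiv.Perm (Fin d) := (π.trans σ).trans π.symm
      have hτ : InYoung c τ := fun i => by
        rw [← hπ, ← hπ]
        change c' (π (π.symm _)) = _
        rw [Equiv.apply_symm_apply]
        exact hσ _
      have h : oneInv (R π.symm (R σ (R π (oneMap y)) - R π (oneMap y))) =
          -(y - (invSgn τ : k) • R τ y) := by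
        rw [neg_sub, map_sub, map_sub, R_symm_R, oneInv_oneMap,
          ← oneInv_oneMap ((invSgn τ : k) • R τ y), oneMap_smul_R, R_R, R_R]
        rfl
      rw [SetLike.mem_coe, Submodule.mem_comap, LinearMap.comp_apply, h]
      exact neg_mem (Submodule.subset_span ⟨τ, hτ, y, rfl⟩)
    have h := hle hz
    rwa [Submodule.mem_comap, LinearMap.comp_apply, R_symm_R, oneInv_oneMap] at h
  · intro hz
    have hle : skewCoinv k (Parity M) c ≤ (Submodule.span k
        {y : T k (Fin d) M | ∃ σ, InYoung c' σ ∧ ∃ x, y = R σ x - x}).comap (R π ∘ₗ oneMap) := by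
      refine Submodule.span_le.mpr ?_
      rintro _ ⟨σ, hσ, x, rfl⟩
      let τ : Equiv.Perm (Fin d) := (π.symm.trans σ).trans π
      have hτ : InYoung c' τ := fun i => by
        change c' (π _) = _
        rw [hπ]
        refine (hσ _).trans ?_
        rw [← hπ, Equiv.apply_symm_apply]
      have h : R π (oneMap (x - (invSgn σ : k) • R σ x)) =
          -(R τ (R π (oneMap x)) - R π (oneMap x)) := by
        rw [map_sub, oneMap_smul_R, map_sub, neg_sub, R_R, R_R]
        congr 2
        rw [← Equiv.trans_assoc, ← Equiv.trans_assoc, Equiv.self_trans_symm, Equiv.refl_trans]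
      rw [SetLike.mem_coe, Submodule.mem_comap, LinearMap.comp_apply, h]
      exact neg_mem (Submodule.subset_span ⟨τ, hτ, _, rfl⟩)
    exact hle hz

/-- The kernel of `thetaT`. -/
lemma thetaT_eq_zero_iff (lam mu : YoungDiagram) (M : SVec k)
    (z : T k (Fin (skewSize lam mu)) (Parity M)) :
    thetaT lam mu M z = 0 ↔ z ∈ skewCoinv k (Parity M) (rowIn lam mu) :=
  (Submodule.Quotient.mk_eq_zero _).trans
    (mem_skewCoinv_iff _ _ (colToRow lam mu) rowOf_colToRow z)

end Theta

/-! ### The signed sum of the components with given row lengths. -/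

section RowComponents

variable {k : Type u} [Field k] {V₁ V₂ : Type u}
  [AddCommGroup V₁] [Module k V₁] [SuperSpace k V₁]
  [AddCommGroup V₂] [Module k V₂] [SuperSpace k V₂]
variable {d e f : ℕ}

lemma invSgn_trans {ι κ ω : Type} [Fintype ι] [LinearOrder ι] [Fintype κ] [LinearOrder κ]
    [Fintype ω] [LinearOrder ω] (g : ι ≃ κ) (h : κ ≃ ω) :
    invSgn (g.trans h) = invSgn g * invSgn h := (sgn_trans _ g h).symm

lemma invSgn_symm (σ : Equiv.Perm (Fin d)) : invSgn σ.symm = invSgn σ := by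
  rw [invSgn_eq_sign, invSgn_eq_sign, Equiv.Perm.sign_symm]

lemma prod_sumLex {ι κ : Type} [Fintype ι] [Fintype κ] (g : ι ⊕ₗ κ → ℤ) :
    ∏ q, g q = (∏ a, g (toLex (Sum.inl a))) * ∏ b, g (toLex (Sum.inr b)) := by
  rw [← (toLex : ι ⊕ κ ≃ ι ⊕ₗ κ).prod_comp, Fintype.prod_sum_type]

lemma invSgn_blockPerm (α : Equiv.Perm (Fin e)) (β : Equiv.Perm (Fin f)) :
    invSgn (blockPerm α β) = invSgn α * invSgn β := by
  unfold invSgn sgn pairProd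
  rw [Fintype.prod_prod_type, prod_sumLex]
  simp only [prod_sumLex]
  rw [Fintype.prod_prod_type, Fintype.prod_prod_type]
  congr 1 <;> refine Finset.prod_congr rfl fun a _ => ?_ <;> simp

lemma mkQ_skewCoinv_R {V : Type u} [AddCommGroup V] [Module k V] [SuperSpace k V] {c : Fin d → ℕ}
    {σ : Equiv.Perm (Fin d)} (hσ : InYoung c σ) (x : T k (Fin d) V) :
    (skewCoinv k V c).mkQ (R σ x) = (invSgn σ : k) • (skewCoinv k V c).mkQ x := by
  have h : (skewCoinv k V c).mkQ (x - (invSgn σ : k) • R σ x) = 0 :=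
    (Submodule.Quotient.mk_eq_zero _).mpr (Submodule.subset_span ⟨σ, hσ, x, rfl⟩)
  rw [map_sub, sub_eq_zero] at h
  rw [h, map_smul, smul_smul, ← Int.cast_mul, invSgn_sq, Int.cast_one, one_smul]

/-- `ρ` respects the rows. -/
def RowPlace (c : Fin d → ℕ) (c₁ : Fin e → ℕ) (c₂ : Fin f → ℕ) (ρ : Fin e ⊕ₗ Fin f ≃ Fin d) :
    Prop :=
  (∀ a, c (ρ (toLex (Sum.inl a))) = c₁ a) ∧ (∀ b, c (ρ (toLex (Sum.inr b))) = c₂ b)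

/-- The component of a tensor at a placement, in the signed coinvariants. -/
def rowComp (c₁ : Fin e → ℕ) (c₂ : Fin f → ℕ) (ρ : Fin e ⊕ₗ Fin f ≃ Fin d) :
    T k (Fin d) (V₁ × V₂) →ₗ[k]
      (T k (Fin e) V₁ ⧸ skewCoinv k V₁ c₁) ⊗[k] (T k (Fin f) V₂ ⧸ skewCoinv k V₂ c₂) :=
  (invSgn ρ : k) • (TensorProduct.map (skewCoinv k V₁ c₁).mkQ (skewCoinv k V₂ c₂).mkQ ∘ₗ coinclR ρ)

variable {c : Fin d → ℕ} {c₁ : Fin e → ℕ} {c₂ : Fin f → ℕ}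

/-- A row-preserving permutation of each block multiplies the class in the signed coinvariants by
sgn(α) sgn(β). This is also the ratio of the signs of the two placements, so the component depends
only on the left set. -/
lemma rowComp_eq {ρ ρ' : Fin e ⊕ₗ Fin f ≃ Fin d} (h : RowPlace c c₁ c₂ ρ)
    (h' : RowPlace c c₁ c₂ ρ') (hl : leftSet ρ' = leftSet ρ) :
    rowComp (k := k) (V₁ := V₁) (V₂ := V₂) c₁ c₂ ρ' = rowComp c₁ c₂ ρ := by
  obtain ⟨α, β, rfl⟩ := exists_blockPerm hl
  have hα : InYoung c₁ α := fun a => (h.1 _).symm.trans (h'.1 a)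
  have hβ : InYoung c₂ β := fun b => (h.2 _).symm.trans (h'.2 b)
  have key : TensorProduct.map (skewCoinv k V₁ c₁).mkQ (skewCoinv k V₂ c₂).mkQ ∘ₗ
      TensorProduct.map (R α) (R β) = ((invSgn α : k) * (invSgn β : k)) •
        TensorProduct.map (skewCoinv k V₁ c₁).mkQ (skewCoinv k V₂ c₂).mkQ := by
    refine TensorProduct.ext' fun x y => ?_
    simp only [LinearMap.comp_apply, TensorProduct.map_tmul, LinearMap.smul_apply]
    rw [mkQ_skewCoinv_R hα, mkQ_skewCoinv_R hβ, TensorProduct.smul_tmul_smul]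
  refine LinearMap.ext fun z => ?_
  simp only [rowComp, LinearMap.smul_apply, LinearMap.comp_apply]
  rw [← coinclR_perm α β ρ z]
  have := LinearMap.congr_fun key (coinclR ((blockPerm α β).trans ρ) z)
  simp only [LinearMap.comp_apply, LinearMap.smul_apply] at this
  rw [this, invSgn_trans, invSgn_blockPerm, smul_smul]
  congr 1
  push_cast
  ring

lemma rowComp_R (ρ : Fin e ⊕ₗ Fin f ≃ Fin d) (σ : Equiv.Perm (Fin d))
    (z : T k (Fin d) (V₁ × V₂)) :
    rowComp c₁ c₂ ρ ((invSgn σ : k) • R σ z) = rowComp c₁ c₂ (ρ.trans σ.symm) z := by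
  simp only [rowComp, LinearMap.smul_apply, LinearMap.comp_apply, map_smul]
  rw [coinclR_R, invSgn_trans, invSgn_symm, smul_smul, Int.cast_mul, mul_comm (invSgn σ : k)]

open Classical in
/-- The sum of the components over all sets of positions with given row counts. -/
noncomputable def rowSum (c : Fin d → ℕ) (c₁ : Fin e → ℕ) (c₂ : Fin f → ℕ) :
    T k (Fin d) (V₁ × V₂) →ₗ[k]
      (T k (Fin e) V₁ ⧸ skewCoinv k V₁ c₁) ⊗[k] (T k (Fin f) V₂ ⧸ skewCoinv k V₂ c₂) :=
  ∑ A : Finset (Fin d), if h : ∃ ρ, RowPlace c c₁ c₂ ρ ∧ leftSet ρ = A then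
    rowComp c₁ c₂ h.choose else 0

/-- A row permutation permutes the sets with the given row counts. Since sgn(σ)σ carries the
component at A to the component at σ(A) without a further sign, it does not change the sum. -/
lemma rowSum_eq_zero {z : T k (Fin d) (V₁ × V₂)} (hz : z ∈ skewCoinv k (V₁ × V₂) c) :
    rowSum c c₁ c₂ z = 0 := by
  classical
  suffices h : skewCoinv k (V₁ × V₂) c ≤ LinearMap.ker (rowSum (k := k) c c₁ c₂) from h hz
  refine Submodule.span_le.mpr ?_
  rintro _ ⟨σ, hσ, x, rfl⟩
  rw [SetLike.mem_coe, LinearMap.mem_ker, map_sub, sub_eq_zero, rowSum, LinearMap.sum_apply,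
    LinearMap.sum_apply]
  refine Finset.sum_equiv σ.finsetCongr (by simp) fun A _ => ?_
  have hA : σ.finsetCongr A = A.map σ.toEmbedding := rfl
  by_cases h : ∃ ρ, RowPlace c c₁ c₂ ρ ∧ leftSet ρ = A
  · obtain ⟨h1, h2⟩ := h.choose_spec
    have h' : ∃ ρ, RowPlace c c₁ c₂ ρ ∧ leftSet ρ = σ.finsetCongr A := by
      refine ⟨h.choose.trans σ, ⟨fun a => (hσ _).trans (h1.1 a), fun b => (hσ _).trans (h1.2 b)⟩, ?_⟩
      rw [leftSet_trans, h2, hA]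
    obtain ⟨h3, h4⟩ := h'.choose_spec
    rw [dif_pos h, dif_pos h', rowComp_R]
    refine (LinearMap.congr_fun (rowComp_eq (c := c) h1 ⟨fun a => (hσ.symm _).trans (h3.1 a),
      fun b => (hσ.symm _).trans (h3.2 b)⟩ ?_) x).symm
    rw [leftSet_trans, h4, h2, hA, Finset.map_map, ← Equiv.trans_toEmbedding,
      Equiv.self_trans_symm, Equiv.refl_toEmbedding, Finset.map_refl]
  · have h' : ¬ ∃ ρ, RowPlace c c₁ c₂ ρ ∧ leftSet ρ = σ.finsetCongr A := by
      rintro ⟨ρ, h1, h2⟩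
      refine h ⟨ρ.trans σ.symm, ⟨fun a => (hσ.symm _).trans (h1.1 a),
        fun b => (hσ.symm _).trans (h1.2 b)⟩, ?_⟩
      rw [leftSet_trans, h2, hA, Finset.map_map, ← Equiv.trans_toEmbedding,
        Equiv.self_trans_symm, Equiv.refl_toEmbedding, Finset.map_refl]
    rw [dif_neg h, dif_neg h', LinearMap.zero_apply, LinearMap.zero_apply]

/-- Under the hypothesis the vanishing sum `rowSum` has only one possibly nonzero term. -/
lemma map_coinclR_eq_zero {ρ : Fin e ⊕ₗ Fin f ≃ Fin d} (hρ : RowPlace c c₁ c₂ ρ)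
    {z : T k (Fin d) (V₁ × V₂)} (hz : z ∈ skewCoinv k (V₁ × V₂) c)
    (h : ∀ ρ', RowPlace c c₁ c₂ ρ' → leftSet ρ' ≠ leftSet ρ → blockPr (leftSet ρ') z = 0) :
    TensorProduct.map (skewCoinv k V₁ c₁).mkQ (skewCoinv k V₂ c₂).mkQ (coinclR ρ z) = 0 := by
  classical
  have h0 := rowSum_eq_zero (c₁ := c₁) (c₂ := c₂) hz
  rw [rowSum, LinearMap.sum_apply, Finset.sum_eq_single (leftSet ρ)] at h0
  · have hρ' : ∃ ρ', RowPlace c c₁ c₂ ρ' ∧ leftSet ρ' = leftSet ρ := ⟨ρ, hρ, rfl⟩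
    rw [dif_pos hρ', rowComp_eq hρ hρ'.choose_spec.1 hρ'.choose_spec.2, rowComp,
      LinearMap.smul_apply, LinearMap.comp_apply] at h0
    have h1 := congrArg (fun t => (invSgn ρ : k) • t) h0
    simp only [smul_smul, ← Int.cast_mul, invSgn_sq, Int.cast_one, one_smul, smul_zero] at h1
    exact h1
  · intro A _ hA
    by_cases hA' : ∃ ρ', RowPlace c c₁ c₂ ρ' ∧ leftSet ρ' = A
    · rw [dif_pos hA', rowComp, LinearMap.smul_apply, LinearMap.comp_apply]
      have := h _ hA'.choose_spec.1 (by rw [hA'.choose_spec.2]; exact hA)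
      rw [blockPr_eq_zero_iff] at this
      rw [this, map_zero, smul_zero]
    · rw [dif_neg hA', LinearMap.zero_apply]
  · simp

end RowComponents

/-! ### Triangularity of θ. -/

section Triangular

variable {k : Type u} [Field k] {V₁ V₂ : Type u}
  [AddCommGroup V₁] [Module k V₁] [SuperSpace k V₁]
  [AddCommGroup V₂] [Module k V₂] [SuperSpace k V₂]
variable {lam mu nu xi : YoungDiagram}

lemma rowCount_univ (h : mu ≤ lam) (i : ℕ) :
    colCount (rowIn lam mu) Finset.univ i + mu.rowLen i = lam.rowLen i := by
  rw [← cellSet_self]; exact rowCount_cellSet h le_rfl i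

/-- The leading term of an element of the kernel of `θ` lies in the kernel of `θ ⊠ θ`. -/
lemma leading_mem_ker (h₁ : mu ≤ xi) (h₂ : xi ≤ lam) {z : T k (Fin (skewSize lam mu)) (V₁ × V₂)}
    (hz : z ∈ shapeSub k V₁ V₂ lam mu fun nu => lexLe nu xi)
    (hz' : z ∈ skewCoinv k (V₁ × V₂) (rowIn lam mu)) :
    TensorProduct.map (skewCoinv k V₁ (rowIn xi mu)).mkQ (skewCoinv k V₂ (rowIn lam xi)).mkQ
      (coinclR (cellPlace h₁ h₂) z) = 0 := by
  refine map_coinclR_eq_zero (c := rowIn lam mu)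
    ⟨rowIn_cellPlace_inl h₁ h₂, rowIn_cellPlace_inr h₁ h₂⟩ hz' fun ρ hρ hne => ?_
  by_contra h
  obtain ⟨nu, h₃, h₄, h₅, h₆⟩ := hz.2 _ h
  have hc : ∀ i, colCount (rowIn lam mu) (leftSet ρ) i + mu.rowLen i = xi.rowLen i := by
    intro i
    rw [colCount_leftSet, funext hρ.1]
    exact rowCount_univ h₁ i
  -- The set has the row lengths of xi / mu and, by the support of z, the column lengths of some nu
  -- ≼ xi; since also xi ≼ nu, it can only be the set of cells of xi / mu.
  obtain ⟨h₇, h₈⟩ := lexLe_of_counts h₃ h₄ h₁ h₂ h₆ hc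
  rcases h₅ with rfl | h₅
  · exact hne (by rw [h₈ rfl, leftSet_cellPlace])
  · exact lexLe_antisymm_lt h₇ h₅

end Triangular

/-! ### The kernel of a tensor product of maps. -/

section KernelOfTensor

variable {k : Type u} [Field k] {A B A' B' : Type u} [AddCommGroup A] [Module k A]
  [AddCommGroup B] [Module k B] [AddCommGroup A'] [Module k A'] [AddCommGroup B'] [Module k B']

lemma map_injective_of_injective {i : A →ₗ[k] A'} {j : B →ₗ[k] B'} (hi : Function.Injective i)
    (hj : Function.Injective j) : Function.Injective (TensorProduct.map i j) := by
  obtain ⟨i', hi'⟩ := i.exists_leftInverse_of_injective (LinearMap.ker_eq_bot.mpr hi)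
  obtain ⟨j', hj'⟩ := j.exists_leftInverse_of_injective (LinearMap.ker_eq_bot.mpr hj)
  refine Function.LeftInverse.injective (g := TensorProduct.map i' j') fun w => ?_
  rw [← LinearMap.comp_apply, ← TensorProduct.map_comp, hi', hj', TensorProduct.map_id,
    LinearMap.id_apply]

/-- The kernel is ker g ⊗ B + A ⊗ ker g'. Passing to the ranges first makes the maps surjective, and
injectivity of the tensor product of the inclusions allows this. -/
lemma mem_of_map_eq_zero (g : A →ₗ[k] A') (g' : B →ₗ[k] B') (S : Submodule k (A ⊗[k] B))
    (h : ∀ x y, g x = 0 → x ⊗ₜ y ∈ S) (h' : ∀ x y, g' y = 0 → x ⊗ₜ y ∈ S) {w : A ⊗[k] B}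
    (hw : TensorProduct.map g g' w = 0) : w ∈ S := by
  have h1 : TensorProduct.map g.rangeRestrict g'.rangeRestrict w = 0 := by
    refine map_injective_of_injective (Submodule.injective_subtype (LinearMap.range g))
      (Submodule.injective_subtype (LinearMap.range g')) ?_
    rw [← LinearMap.comp_apply, ← TensorProduct.map_comp, map_zero]
    exact hw
  have h2 : w ∈ LinearMap.ker (TensorProduct.map g.rangeRestrict g'.rangeRestrict) := h1
  have e1 : Function.Exact (LinearMap.ker g).subtype g.rangeRestrict := by
    rw [LinearMap.exact_iff, LinearMap.ker_rangeRestrict, Submodule.range_subtype]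
  have e2 : Function.Exact (LinearMap.ker g').subtype g'.rangeRestrict := by
    rw [LinearMap.exact_iff, LinearMap.ker_rangeRestrict, Submodule.range_subtype]
  rw [TensorProduct.map_ker e1 g.surjective_rangeRestrict e2 g'.surjective_rangeRestrict] at h2
  refine (sup_le ?_ ?_ : _ ≤ S) h2
  · rintro _ ⟨t, rfl⟩
    induction t with
    | zero => rw [map_zero]; exact zero_mem _
    | add x y hx hy => rw [map_add]; exact add_mem hx hy
    | tmul x y => exact h' _ _ y.2
  · rintro _ ⟨t, rfl⟩
    induction t with
    | zero => rw [map_zero]; exact zero_mem _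
    | add x y hx hy => rw [map_add]; exact add_mem hx hy
    | tmul x y => exact h _ _ x.2

end KernelOfTensor

/-! ### The lexicographic order is total and well-founded on an interval. -/

section LexOrder

lemma lexLe_total (a b : YoungDiagram) : lexLe a b ∨ lexLt b a := by
  classical
  by_cases he : ∃ i, a.rowLen i ≠ b.rowLen i
  · have hlt : ∀ j < Nat.find he, a.rowLen j = b.rowLen j := fun j hj => by
      simpa using Nat.find_min he hj
    rcases lt_or_gt_of_ne (Nat.find_spec he) with h | h
    · exact Or.inl (Or.inr ⟨_, hlt, h⟩)
    · exact Or.inr ⟨_, fun j hj => (hlt j hj).symm, h⟩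
  · push Not at he
    exact Or.inl (Or.inl (ext_rowLen he))

variable {lam mu : YoungDiagram}

lemma lexLt_wf (lam mu : YoungDiagram) :
    WellFounded fun a b : Set.Icc mu lam => lexLt a.1 b.1 := by
  have : IsTrans (Set.Icc mu lam) fun a b => lexLt a.1 b.1 := ⟨fun _ _ _ => lexLt_trans⟩
  have : Std.Irrefl fun a b : Set.Icc mu lam => lexLt a.1 b.1 := ⟨fun a => lexLt_irrefl a.1⟩
  exact Finite.wellFounded_of_trans_of_irrefl _

/-- Provides a greatest diagram among those below a given one. -/
lemma lexLt_wf_swap (lam mu : YoungDiagram) :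
    WellFounded fun a b : Set.Icc mu lam => lexLt b.1 a.1 := by
  have : IsTrans (Set.Icc mu lam) fun a b => lexLt b.1 a.1 :=
    ⟨fun _ _ _ h h' => lexLt_trans h' h⟩
  have : Std.Irrefl fun a b : Set.Icc mu lam => lexLt b.1 a.1 := ⟨fun a => lexLt_irrefl a.1⟩
  exact Finite.wellFounded_of_trans_of_irrefl _

end LexOrder

/-! ### The kernel of θ for a direct sum. -/

section ProductStep

variable {k : Type u} [Field k] {V₁ V₂ : Type u}
  [AddCommGroup V₁] [Module k V₁] [SuperSpace k V₁]
  [AddCommGroup V₂] [Module k V₂] [SuperSpace k V₂]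
variable {lam mu nu xi : YoungDiagram}

/-- The straightening relations span the kernel of `θ`, for all skew shapes. -/
def ColKer (k : Type u) [Field k] (V : Type u) [AddCommGroup V] [Module k V] [SuperSpace k V] :
    Prop :=
  ∀ lam mu : YoungDiagram, mu ≤ lam → ∀ z ∈ gammaInv (k := k) (colOf lam mu) V,
    z ∈ skewCoinv k V (rowIn lam mu) → z ∈ colRel k V lam mu

lemma shapeSub_mono {P Q : YoungDiagram → Prop} (h : ∀ nu, P nu → Q nu) :
    shapeSub k V₁ V₂ lam mu P ≤ shapeSub k V₁ V₂ lam mu Q :=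
  suppSub_mono fun _ ⟨nu, h₁, h₂, h₃, h₄⟩ => ⟨nu, h₁, h₂, h nu h₃, h₄⟩

lemma shapeShuf_mem_shapeSub (h₁ : mu ≤ nu) (h₂ : nu ≤ lam) {P : YoungDiagram → Prop} (h : P nu)
    (w : gammaInv (k := k) (colOf nu mu) V₁ ⊗[k] gammaInv (k := k) (colOf lam nu) V₂) :
    shapeShuf k V₁ V₂ lam nu mu w ∈ shapeSub k V₁ V₂ lam mu P := by
  have : shapeShuf k V₁ V₂ lam nu mu w ∈ suppSub (colOf lam mu) (HasShape lam mu nu) := by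
    rw [← range_shapeShuf h₁ h₂]; exact ⟨w, rfl⟩
  exact suppSub_mono (fun B hB => ⟨nu, h₁, h₂, h, hB⟩) this

/-- Column lengths determine the diagram, so a component at the cells of xi would make xi smaller
than itself. -/
lemma coinclR_eq_zero_of_lt (h₁ : mu ≤ xi) (h₂ : xi ≤ lam)
    {z : T k (Fin (skewSize lam mu)) (V₁ × V₂)}
    (hz : z ∈ shapeSub k V₁ V₂ lam mu fun nu => lexLt nu xi) :
    coinclR (cellPlace h₁ h₂) z = 0 := by
  rw [← blockPr_eq_zero_iff, leftSet_cellPlace]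
  by_contra h
  obtain ⟨nu, h₃, h₄, h₅, h₆⟩ := hz.2 _ h
  rw [h₆.eq (hasShape_cellSet h₁ h₂)] at h₅
  exact lexLt_irrefl _ h₅

/-- There are finitely many diagrams in the interval, so the strict condition below xi is the weak
condition for the greatest diagram below xi, unless there is none. -/
lemma exists_shapeSub_le {z : T k (Fin (skewSize lam mu)) (V₁ × V₂)}
    (hz : z ∈ shapeSub k V₁ V₂ lam mu fun nu => lexLt nu xi) :
    z = 0 ∨ ∃ nu : Set.Icc mu lam, lexLt nu.1 xi ∧
      z ∈ shapeSub k V₁ V₂ lam mu fun nu' => lexLe nu' nu.1 := by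
  by_cases h : ∃ nu : Set.Icc mu lam, lexLt nu.1 xi
  · right
    obtain ⟨nu, hnu, hmax⟩ := (lexLt_wf_swap lam mu).has_min {nu | lexLt nu.1 xi} h
    refine ⟨nu, hnu, suppSub_mono ?_ hz⟩
    rintro B ⟨nu', h₁, h₂, h₃, h₄⟩
    exact ⟨nu', h₁, h₂, (lexLe_total _ _).resolve_right (hmax ⟨nu', h₁, h₂⟩ h₃), h₄⟩
  · left
    refine eq_of_blockPr fun B => ?_
    rw [map_zero]
    by_contra hB
    obtain ⟨nu, h₁, h₂, h₃, -⟩ := hz.2 B hB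
    exact h ⟨⟨nu, h₁, h₂⟩, h₃⟩

/-- The kernel of `θ ⊠ θ` consists of relations modulo smaller diagrams. -/
lemma shapeShuf_mem_of_ker (hV₁ : ColKer k V₁) (hV₂ : ColKer k V₂) (h₁ : mu ≤ xi) (h₂ : xi ≤ lam)
    {w : gammaInv (k := k) (colOf xi mu) V₁ ⊗[k] gammaInv (k := k) (colOf lam xi) V₂}
    (hw : TensorProduct.map (skewCoinv k V₁ (rowIn xi mu)).mkQ (skewCoinv k V₂ (rowIn lam xi)).mkQ
      (TensorProduct.map (gammaInv (k := k) (colOf xi mu) V₁).subtype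
        (gammaInv (k := k) (colOf lam xi) V₂).subtype w) = 0) :
    shapeShuf k V₁ V₂ lam xi mu w ∈ colRel k (V₁ × V₂) lam mu ⊔
      shapeSub k V₁ V₂ lam mu fun nu => lexLt nu xi := by
  rw [← LinearMap.comp_apply, ← TensorProduct.map_comp] at hw
  rw [← Submodule.mem_comap]
  -- It suffices to treat x ⊗ y with x or y in the kernel of its θ; such an x or y is a combination
  -- of column relations by hypothesis.
  refine mem_of_map_eq_zero _ _ (Submodule.comap (shapeShuf k V₁ V₂ lam xi mu) _) ?_ ?_ hw
  · intro x y hx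
    exact shapeShuf_mem_left h₁ h₂
      (hV₁ xi mu h₁ x.1 x.2 ((Submodule.Quotient.mk_eq_zero _).mp hx)) y
  · intro x y hy
    exact shapeShuf_mem_right h₁ h₂ x
      (hV₂ lam xi h₂ y.1 y.2 ((Submodule.Quotient.mk_eq_zero _).mp hy))

/-- By induction along the lexicographic order. The leading component of an element of the kernel
lies in the kernel of θ ⊠ θ by triangularity, so its shuffle is a relation modulo smaller diagrams.
Relations lie in the kernel of θ themselves, hence what remains is a kernel element with a smaller
leading diagram. -/
lemma ColKer.prod (hk : (2 : k) ≠ 0) (hV₁ : ColKer k V₁) (hV₂ : ColKer k V₂) :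
    ColKer k (V₁ × V₂) := by
  intro lam mu hmu
  have key : ∀ xi : Set.Icc mu lam, ∀ z ∈ shapeSub k V₁ V₂ lam mu fun nu => lexLe nu xi.1,
      z ∈ skewCoinv k (V₁ × V₂) (rowIn lam mu) → z ∈ colRel k (V₁ × V₂) lam mu := by
    intro xi
    induction xi using (lexLt_wf lam mu).induction with
    | _ xi ih =>
    obtain ⟨xi, h₁, h₂⟩ := xi
    intro z hz hz'
    obtain ⟨w, hw⟩ := coinclR_mem_range (cellPlace h₁ h₂) (colOf_cellPlace_inl h₁ h₂)
      (colOf_cellPlace_inr h₁ h₂) hz.1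
    have h3 := leading_mem_ker h₁ h₂ hz hz'
    rw [← hw] at h3
    have h4 := shapeShuf_mem_of_ker hV₁ hV₂ h₁ h₂ h3
    have h5 : z - shapeShuf k V₁ V₂ lam xi mu w ∈
        shapeSub k V₁ V₂ lam mu fun nu => lexLt nu xi := by
      refine mem_shapeSub_lt h₁ h₂ (sub_mem hz (shapeShuf_mem_shapeSub h₁ h₂ (Or.inl rfl) w)) ?_
      rw [map_sub, coinclR_shapeShuf, hw, sub_self]
    have h6 := add_mem (Submodule.mem_sup_right h5) h4
    rw [sub_add_cancel] at h6
    obtain ⟨r, hr, y, hy, rfl⟩ := Submodule.mem_sup.mp h6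
    refine add_mem hr ?_
    have hyD : y ∈ skewCoinv k (V₁ × V₂) (rowIn lam mu) := by
      have := sub_mem hz' (colRel_le_skewCoinv hk hmu hr)
      rwa [add_sub_cancel_left] at this
    rcases exists_shapeSub_le hy with rfl | ⟨nu, hnu, hy'⟩
    · exact zero_mem _
    · exact ih nu hnu y hy' hyD
  intro z hz hz'
  obtain ⟨r, hr, y, hy, rfl⟩ := Submodule.mem_sup.mp (gammaInv_le_colRel hmu hz)
  refine add_mem hr (key ⟨lam, hmu, le_rfl⟩ y hy ?_)
  have := sub_mem hz' (colRel_le_skewCoinv hk hmu hr)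
  rwa [add_sub_cancel_left] at this

end ProductStep

/-! ### Invariance under even isomorphisms. -/

section Transport

variable {k : Type u} [Field k] {V V' : Type u}
  [AddCommGroup V] [Module k V] [SuperSpace k V]
  [AddCommGroup V'] [Module k V'] [SuperSpace k V']
variable {d : ℕ} {lam mu : YoungDiagram}

lemma R_map_const {f : V →ₗ[k] V'} (hf : ∀ a x, pr k a (f x) = f (pr k a x))
    (σ : Equiv.Perm (Fin d)) (x : T k (Fin d) V) :
    R σ (PiTensorProduct.map (fun _ => f) x) = PiTensorProduct.map (fun _ => f) (R σ x) :=
  R_map σ (fun _ => f) (fun _ a x hx => (hf a x).trans (congrArg f hx)) x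

lemma map_mem_gammaInv {f : V →ₗ[k] V'} (hf : ∀ a x, pr k a (f x) = f (pr k a x))
    {c : Fin d → ℕ} {x : T k (Fin d) V} (hx : x ∈ gammaInv (k := k) c V) :
    PiTensorProduct.map (fun _ => f) x ∈ gammaInv (k := k) c V' := fun σ hσ => by
  rw [R_map_const hf, hx σ hσ]

lemma map_mem_skewCoinv {f : V →ₗ[k] V'} (hf : ∀ a x, pr k a (f x) = f (pr k a x))
    {c : Fin d → ℕ} {x : T k (Fin d) V} (hx : x ∈ skewCoinv k V c) :
    PiTensorProduct.map (fun _ => f) x ∈ skewCoinv k V' c := by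
  suffices h : skewCoinv k V c ≤ (skewCoinv k V' c).comap (PiTensorProduct.map fun _ => f) from h hx
  refine Submodule.span_le.mpr ?_
  rintro _ ⟨σ, hσ, x, rfl⟩
  refine Submodule.subset_span ⟨σ, hσ, PiTensorProduct.map (fun _ => f) x, ?_⟩
  rw [R_map_const hf, map_sub, map_smul]

lemma map_mem_colRel {f : V →ₗ[k] V'} (hf : ∀ a x, pr k a (f x) = f (pr k a x))
    {x : T k (Fin (skewSize lam mu)) V} (hx : x ∈ colRel k V lam mu) :
    PiTensorProduct.map (fun _ => f) x ∈ colRel k V' lam mu := by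
  suffices h : colRel k V lam mu ≤ (colRel k V' lam mu).comap (PiTensorProduct.map fun _ => f) from
    h hx
  refine colRel_le fun j a b h => ?_
  rintro _ ⟨Z, hZ, rfl⟩
  refine relSub_le_colRel h ⟨fun c => PiTensorProduct.map (fun _ => f) (Z c), fun σ c => ?_, ?_⟩
  · rw [R_map_const hf, hZ]
  · rw [map_sum]

lemma ColKer.of_equiv (e : V ≃ₗ[k] V') (he : ∀ a x, pr k a (e x) = e (pr k a x))
    (h : ColKer k V') : ColKer k V := by
  intro lam mu hmu z hz hz'
  have he' : ∀ a x, pr k a (e.symm x) = e.symm (pr k a x) := fun a x => by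
    rw [e.eq_symm_apply, ← he, e.apply_symm_apply]
  have := map_mem_colRel (f := e.symm.toLinearMap) he'
    (h lam mu hmu _ (map_mem_gammaInv (f := e.toLinearMap) he hz)
      (map_mem_skewCoinv (f := e.toLinearMap) he hz'))
  rw [← LinearMap.comp_apply, ← PiTensorProduct.map_comp] at this
  simpa using this

end Transport

/-! ### The kernel of θ for spaces of dimension at most one. -/

section Line

variable {k : Type u} [Field k] {V : Type u} [AddCommGroup V] [Module k V] [SuperSpace k V]
variable {d : ℕ} {lam mu : YoungDiagram}

lemma exists_smul_tprod {v : V} (hv : ∀ x : V, ∃ t : k, x = t • v) (x : T k (Fin d) V) :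
    ∃ t : k, x = t • PiTensorProduct.tprod k fun _ : Fin d => v := by
  induction x using PiTensorProduct.induction_on with
  | smul_tprod r w =>
    choose t ht using fun i => hv (w i)
    refine ⟨r * ∏ i, t i, ?_⟩
    rw [show w = fun i => t i • v from funext ht, MultilinearMap.map_smul_univ, smul_smul]
  | add x y hx hy =>
    obtain ⟨s, rfl⟩ := hx
    obtain ⟨t, rfl⟩ := hy
    exact ⟨s + t, (add_smul _ _ _).symm⟩

lemma skewCoinv_eq_bot {c : Fin d → ℕ}
    (h : ∀ σ, InYoung c σ → ∀ x : T k (Fin d) V, R σ x = (invSgn σ : k) • x) :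
    skewCoinv k V c = ⊥ := by
  rw [skewCoinv, Submodule.span_eq_bot]
  rintro _ ⟨σ, hσ, x, rfl⟩
  rw [h σ hσ, smul_smul, ← Int.cast_mul, invSgn_sq, Int.cast_one, one_smul, sub_self]

/-- On a power of an odd line a permutation acts by its sign, so there are no signed row relations
at all and θ is injective. -/
lemma colKer_odd_line {v : V} (hv : ∀ x : V, ∃ t : k, x = t • v) (h : Homog k 1 v) :
    ColKer k V := by
  intro lam mu hmu z hz hz'
  rw [skewCoinv_eq_bot, Submodule.mem_bot] at hz'
  · rw [hz']; exact zero_mem _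
  · intro σ _ x
    obtain ⟨t, rfl⟩ := exists_smul_tprod hv x
    rw [map_smul, R_homog σ (δ := fun _ => 1) fun _ => h, smul_comm]
    rfl

/-- Two cells in the same row lie in overlapping columns. -/
lemma exists_overlap {p q : Fin (skewSize lam mu)} (hpq : p ≠ q)
    (hr : rowIn lam mu p = rowIn lam mu q) : ∃ j, mu.colLen j < lam.colLen (j + 1) := by
  wlog h : colOf lam mu p < colOf lam mu q generalizing p q
  · refine this hpq.symm hr.symm (lt_of_le_of_ne (not_lt.mp h) fun he => hpq (cell_inj hr he.symm))
  · refine ⟨colOf lam mu p, (le_rowIn p).trans_lt ?_⟩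
    rw [hr]
    exact (rowIn_lt q).trans_le (lam.colLen_anti _ _ h)

/-- Merge columns j and j + 1 completely. There is only one such set W, so the relation is x itself,
and the overlap says precisely that these two columns together have too many cells. -/
lemma mem_colRel_of_overlap (hmu : mu ≤ lam) {j : ℕ} (hj : mu.colLen j < lam.colLen (j + 1))
    {x : T k (Fin (skewSize lam mu)) V} (hx : ∀ σ : Equiv.Perm (Fin (skewSize lam mu)), R σ x = x) :
    x ∈ colRel k V lam mu := by
  set c := colOf lam mu with hc
  have h1 := colCount_univ hmu j
  have h2 := colCount_univ hmu (j + 1)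
  refine relSub_le_colRel (j := j) (a := colCount c Finset.univ j)
    (b := colCount c Finset.univ (j + 1)) (by rw [hc]; omega) ⟨fun _ => x, fun σ _ => hx σ, ?_⟩
  have hs : relSets c j (colCount c Finset.univ j) (colCount c Finset.univ (j + 1)) =
      {Finset.univ.filter fun p => c p = j ∨ c p = j + 1} := by
    ext W
    rw [mem_relSets, Finset.mem_singleton]
    constructor
    · rintro ⟨h3, h4, h5⟩
      ext p
      simp only [Finset.mem_filter, Finset.mem_univ, true_and]
      refine ⟨h3 p, ?_⟩
      have h6 : ∀ i, colCount c W i = colCount c Finset.univ i → c p = i → p ∈ W := by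
        intro i hi hp
        have := Finset.eq_of_subset_of_card_le (s := W.filter fun p => c p = i)
          (t := Finset.univ.filter fun p => c p = i)
          (Finset.filter_subset_filter _ (Finset.subset_univ _)) hi.ge
        have hm : p ∈ Finset.univ.filter fun p => c p = i := by simp [hp]
        rw [← this] at hm
        exact (Finset.mem_filter.mp hm).1
      rintro (hp | hp)
      · exact h6 j h4 hp
      · exact h6 (j + 1) h5 hp
    · rintro rfl
      refine ⟨fun p hp => (Finset.mem_filter.mp hp).2, ?_, ?_⟩ <;>
      · unfold colCount
        rw [Finset.filter_filter]
        congr 1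
        ext p
        simp only [Finset.mem_filter, Finset.mem_univ, true_and]
        omega
  rw [hs, Finset.sum_singleton]

/-- Permutations act trivially on a power of an even line. If two cells share a row, every tensor is
a column relation; otherwise the row group is trivial and θ is injective. -/
lemma colKer_even_line {v : V} (hv : ∀ x : V, ∃ t : k, x = t • v) (h : Homog k 0 v) :
    ColKer k V := by
  have hR : ∀ {d : ℕ} (σ : Equiv.Perm (Fin d)) (x : T k (Fin d) V), R σ x = x := by
    intro d σ x
    obtain ⟨t, rfl⟩ := exists_smul_tprod hv x
    have hs : sgn (fun _ => 0) σ = 1 := pairProd_one fun i j _ => by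
      rw [kos_zero_left, ite_self]
    rw [map_smul, R_homog σ (δ := fun _ => 0) fun _ => h, hs, Int.cast_one, one_smul]
  intro lam mu hmu z hz hz'
  by_cases hrow : Function.Injective (rowIn lam mu)
  · rw [skewCoinv_eq_bot, Submodule.mem_bot] at hz'
    · rw [hz']; exact zero_mem _
    · intro σ hσ x
      have : σ = Equiv.refl _ := Equiv.ext fun i => hrow (hσ i)
      rw [hR, this, invSgn_eq_sign]
      simp
  · simp only [Function.Injective, not_forall] at hrow
    obtain ⟨p, q, hr, hpq⟩ := hrow
    obtain ⟨j, hj⟩ := exists_overlap hpq hr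
    exact mem_colRel_of_overlap hmu hj fun σ => hR σ z

end Line

/-! ### The kernel of θ in finite dimension. -/

section Induction

variable {k : Type u} [Field k]

lemma exists_homog_ne_zero {V : Type u} [AddCommGroup V] [Module k V] [SuperSpace k V]
    [Nontrivial V] : ∃ (a : ZMod 2) (v : V), Homog k a v ∧ v ≠ 0 := by
  obtain ⟨x, hx⟩ := exists_ne (0 : V)
  by_cases h : pr k 0 x = 0
  · refine ⟨1, pr k 1 x, homog_pr _ _, fun h' => hx ?_⟩
    rw [← pr_add (k := k) x, h, h', add_zero]
  · exact ⟨0, _, homog_pr _ _, h⟩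

/-- A homogeneous line has a complement that is a subsuperspace. -/
lemma exists_isCompl_isSubsuper {V : Type u} [AddCommGroup V] [Module k V] [SuperSpace k V]
    {a : ZMod 2} {v : V} (hv : Homog k a v) (h0 : v ≠ 0) :
    IsSubsuper (k ∙ v) ∧ ∃ W : Submodule k V, IsSubsuper W ∧ IsCompl (k ∙ v) W := by
  constructor
  · intro b x hx
    obtain ⟨t, rfl⟩ := Submodule.mem_span_singleton.mp hx
    rw [map_smul]
    refine Submodule.smul_mem _ _ ?_
    by_cases h : b = a
    · subst h; rw [hv]; exact Submodule.mem_span_singleton_self v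
    · rw [hv.pr_of_ne h]; exact zero_mem _
  · obtain ⟨f, hf⟩ := (LinearMap.toSpanSingleton k V v).exists_leftInverse_of_injective
      (LinearMap.ker_toSpanSingleton k h0)
    have hfv : f (pr k a v) = 1 := by
      rw [hv]; simpa using LinearMap.congr_fun hf 1
    -- Composing with the projection to the parity of v makes the functional homogeneous, so that
    -- its kernel is graded.
    refine ⟨LinearMap.ker (f ∘ₗ pr k a), fun b x hx => ?_, ?_⟩
    · rw [LinearMap.mem_ker, LinearMap.comp_apply] at *
      by_cases h : a = b
      · subst h; rwa [pr_same]
      · rw [pr_ne h, map_zero]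
    · refine isCompl_iff.mpr ⟨?_, ?_⟩
      · rw [Submodule.disjoint_def]
        intro x hx hx'
        obtain ⟨t, rfl⟩ := Submodule.mem_span_singleton.mp hx
        rw [LinearMap.mem_ker, LinearMap.comp_apply, map_smul, map_smul, hfv, smul_eq_mul,
          mul_one] at hx'
        rw [hx', zero_smul]
      · rw [codisjoint_iff, eq_top_iff]
        intro x _
        rw [← add_sub_cancel (f (pr k a x) • v) x]
        refine Submodule.add_mem_sup (Submodule.smul_mem _ _ (Submodule.mem_span_singleton_self v)) ?_
        rw [LinearMap.mem_ker, LinearMap.comp_apply, map_sub, map_sub, map_smul, map_smul, hfv,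
          smul_eq_mul, mul_one, sub_self]

/-- Split off a homogeneous line with a graded complement and apply `ColKer.prod`. -/
theorem colKer_of_finite (hk : (2 : k) ≠ 0) (V : Type u) [AddCommGroup V] [Module k V]
    [SuperSpace k V] [Module.Finite k V] : ColKer k V := by
  induction hn : Module.finrank k V using Nat.strong_induction_on generalizing V with
  | _ n ih =>
  rcases subsingleton_or_nontrivial V with hV | hV
  -- The zero space counts as spanned by the odd vector 0.
  · exact colKer_odd_line (v := 0) (fun x => ⟨0, Subsingleton.elim _ _⟩) (map_zero _)
  obtain ⟨a, v, hv, h0⟩ := exists_homog_ne_zero (k := k) (V := V)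
  obtain ⟨hL, W, hW, hc⟩ := exists_isCompl_isSubsuper hv h0
  let _ := superSub (k ∙ v) hL
  let _ := superSub W hW
  have hW' : ColKer k W := by
    refine ih (Module.finrank k W) ?_ W rfl
    have h1 := Submodule.finrank_add_eq_of_isCompl hc
    rw [finrank_span_singleton h0] at h1
    omega
  have hL' : ColKer k (k ∙ v) := by
    have hs : ∀ x : k ∙ v, ∃ t : k, x = t • (⟨v, Submodule.mem_span_singleton_self v⟩ : k ∙ v) := by
      rintro ⟨x, hx⟩
      obtain ⟨t, rfl⟩ := Submodule.mem_span_singleton.mp hx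
      exact ⟨t, rfl⟩
    rcases zmod2_cases a with rfl | rfl
    · exact colKer_even_line hs (Subtype.ext hv)
    · exact colKer_odd_line hs (Subtype.ext hv)
  refine ColKer.of_equiv (Submodule.prodEquivOfIsCompl _ _ hc).symm (fun b x => ?_)
    (hL'.prod hk hW')
  obtain ⟨⟨p, q⟩, rfl⟩ := (Submodule.prodEquivOfIsCompl _ _ hc).surjective x
  rw [LinearEquiv.symm_apply_apply, LinearEquiv.eq_symm_apply]
  simp only [Submodule.coe_prodEquivOfIsCompl', map_add]
  rfl

end Induction

/-! ### Kernels and images of tensor products with signs. -/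

section SuperTensor

variable {k : Type u} [Field k] {A B A' B' : Type u}
  [AddCommGroup A] [Module k A] [SuperSpace k A]
  [AddCommGroup B] [Module k B] [SuperSpace k B]
  [AddCommGroup A'] [Module k A'] [SuperSpace k A']
  [AddCommGroup B'] [Module k B'] [SuperSpace k B']

lemma par_par (x : A) : par k (par k x) = x := by
  simp only [par, LinearMap.sub_apply, map_sub, pr_same, pr_01, pr_10]
  rw [sub_zero, zero_sub, sub_neg_eq_add, pr_add]

lemma Homog.pr_apply {a : ZMod 2} {f : A →ₗ[k] A'} (hf : Homog k a f) (b : ZMod 2) (x : A) :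
    pr k (a + b) (f x) = f (pr k b x) := by
  have h := homog_hom_iff.mp hf
  conv_lhs => rw [← sum_pr (k := k) x, map_sum, map_sum]
  rw [Finset.sum_eq_single b]
  · exact h b _ (homog_pr b x)
  · intro c _ hc
    exact (h c _ (homog_pr c x)).pr_of_ne fun he => hc (add_left_cancel he).symm
  · simp

/-- Up to an automorphism of the target, `superTensor` is the tensor product of maps. -/
lemma superTensor_eq_zero_iff {f : A →ₗ[k] A'} {g : B →ₗ[k] B'} {a b : ZMod 2}
    (hf : Homog k a f) (hg : Homog k b g) (w : A ⊗[k] B) :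
    superTensor f g w = 0 ↔ TensorProduct.map f g w = 0 := by
  rcases zmod2_cases b with rfl | rfl
  · have : superTensor f g = TensorProduct.map f g := by
      refine TensorProduct.ext' fun x y => ?_
      rw [superTensor_apply, hg.pr_of_ne (a := 1) (by decide), show pr k 0 g = g from hg]
      simp
    rw [this]
  · have hpar : ∀ x, f (par k x) = (kos a 1 : k) • par k (f x) := by
      intro x
      rw [← pr_add (k := k) x, map_add, map_add, map_add, map_add, smul_add]
      congr 1
      all_goals
        rw [(homog_pr _ x).par_eq, map_smul,
          (homog_hom_iff.mp hf _ _ (homog_pr _ x)).par_eq, smul_smul, kos_add_left, Int.cast_mul,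
          ← mul_assoc, ← Int.cast_mul, kos_sq, Int.cast_one, one_mul]
    -- For odd g the rule of signs amounts, up to a global sign, to the parity involution on the
    -- first factor of the target.
    have : superTensor f g = (kos a 1 : k) • TensorProduct.map (par k) LinearMap.id ∘ₗ
        TensorProduct.map f g := by
      refine TensorProduct.ext' fun x y => ?_
      rw [superTensor_apply, hg.pr_of_ne (a := 0) (by decide), show pr k 1 g = g from hg, hpar]
      simp [TensorProduct.smul_tmul']
    rw [this, LinearMap.smul_apply, LinearMap.comp_apply]
    have hk : (kos a 1 : k) ≠ 0 := by
      intro h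
      have := congrArg (Int.cast : ℤ → k) (kos_sq a 1)
      rw [Int.cast_mul, h, zero_mul, Int.cast_one] at this
      exact zero_ne_one this
    rw [smul_eq_zero_iff_right hk]
    have hinj : Function.Injective
        (TensorProduct.map (par k) LinearMap.id : A' ⊗[k] B' →ₗ[k] A' ⊗[k] B') :=
      map_injective_of_injective (Function.LeftInverse.injective par_par) Function.injective_id
    rw [map_eq_zero_iff _ hinj]

lemma superTensor_surjective {f : A →ₗ[k] A'} {g : B →ₗ[k] B'} {b : ZMod 2}
    (hg : Homog k b g) (hf : Function.Surjective f) (hg' : Function.Surjective g) :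
    Function.Surjective (superTensor f g) := by
  intro z
  suffices h : z ∈ LinearMap.range (superTensor f g) from h
  induction z with
  | zero => exact zero_mem _
  | add x y hx hy => exact add_mem hx hy
  | tmul x y =>
    obtain ⟨x, rfl⟩ := hf x
    obtain ⟨y, rfl⟩ := hg' y
    have h : ∀ c, f (pr k c x) ⊗ₜ[k] g y ∈ LinearMap.range (superTensor f g) := fun c =>
      ⟨(kos b c : k) • (pr k c x ⊗ₜ y), by
        rw [map_smul, superTensor_homog f hg (homog_pr c x), smul_smul, ← Int.cast_mul, kos_sq,
          Int.cast_one, one_smul]⟩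
    have := add_mem (h 0) (h 1)
    rwa [← TensorProduct.add_tmul, ← map_add, pr_add] at this

/-- The kernel depends only on the kernels of the two maps, so θ̂ may be replaced by the projection
to the signed coinvariants. -/
lemma map_eq_zero_iff_of_ker {A₁ B₁ : Type u} [AddCommGroup A₁] [Module k A₁] [AddCommGroup B₁]
    [Module k B₁] {f : A →ₗ[k] A'} {f₁ : A →ₗ[k] A₁} {g : B →ₗ[k] B'} {g₁ : B →ₗ[k] B₁}
    (hf : ∀ x, f x = 0 ↔ f₁ x = 0) (hg : ∀ y, g y = 0 ↔ g₁ y = 0) (w : A ⊗[k] B) :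
    TensorProduct.map f g w = 0 ↔ TensorProduct.map f₁ g₁ w = 0 := by
  constructor <;> intro hw
  · refine mem_of_map_eq_zero f g (LinearMap.ker (TensorProduct.map f₁ g₁)) ?_ ?_ hw <;> intro x y h
    · rw [LinearMap.mem_ker, TensorProduct.map_tmul, (hf x).mp h, TensorProduct.zero_tmul]
    · rw [LinearMap.mem_ker, TensorProduct.map_tmul, (hg y).mp h, TensorProduct.tmul_zero]
  · refine mem_of_map_eq_zero f₁ g₁ (LinearMap.ker (TensorProduct.map f g)) ?_ ?_ hw <;> intro x y h
    · rw [LinearMap.mem_ker, TensorProduct.map_tmul, (hf x).mpr h, TensorProduct.zero_tmul]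
    · rw [LinearMap.mem_ker, TensorProduct.map_tmul, (hg y).mpr h, TensorProduct.tmul_zero]

/-- Two surjections with the same kernel have isomorphic targets. -/
lemma exists_equiv_of_ker_eq {f : A →ₗ[k] A'} {g : A →ₗ[k] B'} (hf : Function.Surjective f)
    (hg : Function.Surjective g) (h : ∀ x, f x = 0 ↔ g x = 0) :
    ∃ e : A' ≃ₗ[k] B', ∀ x, e (f x) = g x := by
  have hk : LinearMap.ker f = LinearMap.ker g := Submodule.ext h
  refine ⟨((f.quotKerEquivOfSurjective hf).symm.trans (Submodule.quotEquivOfEq _ _ hk)).trans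
    (g.quotKerEquivOfSurjective hg), fun x => ?_⟩
  have : (f.quotKerEquivOfSurjective hf).symm (f x) = Submodule.Quotient.mk x := by
    rw [LinearEquiv.symm_apply_eq]; rfl
  simp only [LinearEquiv.trans_apply]
  rw [this]
  rfl

end SuperTensor

/-! ### The odd identity on the tensor power of a direct sum. -/

section OddIdentity

variable {k : Type u} [Field k] {M N : Type u}
  [AddCommGroup M] [Module k M] [SuperSpace k M]
  [AddCommGroup N] [Module k N] [SuperSpace k N]
variable {ι : Type} [Fintype ι] [LinearOrder ι] {d e f : ℕ}

lemma homog_oneMap : Homog k (Fintype.card ι : ZMod 2) (oneMap (k := k) (M := M) (ι := ι)) := by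
  refine homog_hom_iff.mpr fun b x hx => ?_
  unfold Homog
  rw [pr_oneMap, show ((Fintype.card ι : ZMod 2) + b + Fintype.card ι) = b by
    rw [add_comm, ← add_assoc, CharTwo.add_self_eq_zero, zero_add], hx]

lemma kos_sum_left (δ : ι → ZMod 2) (c : ZMod 2) : kos (∑ i, δ i) c = ∏ i, kos (δ i) c := by
  classical
  induction (Finset.univ : Finset ι) using Finset.induction_on with
  | empty => simp [kos_zero_left]
  | insert a s ha ih => rw [Finset.sum_insert ha, Finset.prod_insert ha, kos_add_left, ih]

lemma kos_natCast (a : ZMod 2) (n : ℕ) : kos a n = kos a 1 ^ n := by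
  induction n with
  | zero => simp [kos_zero_right]
  | succ n ih => rw [Nat.cast_succ, kos_add_right, ih, pow_succ]

/-- The pairs with one position in each block contribute each parity δ a once for every position of
the second block. Together they form the Koszul sign of moving 1^{⊗f} past the first tensor. -/
lemma oneSgn_elim (δ : Fin e → ZMod 2) (ε : Fin f → ZMod 2) :
    oneSgn (fun i : Fin e ⊕ₗ Fin f => Sum.elim δ ε (ofLex i)) =
      kos f (∑ i, δ i) * (oneSgn δ * oneSgn ε) := by
  have h : kos f (∑ i, δ i) = ∏ a : Fin e, ∏ _b : Fin f, kos (δ a) 1 := by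
    rw [kos_comm, kos_sum_left]
    refine Finset.prod_congr rfl fun a _ => ?_
    rw [kos_natCast, Finset.prod_const, Finset.card_univ, Fintype.card_fin]
  rw [h]
  unfold oneSgn pairProd
  rw [Fintype.prod_prod_type, prod_sumLex]
  simp only [prod_sumLex]
  rw [Fintype.prod_prod_type, Fintype.prod_prod_type, ← mul_assoc, ← Finset.prod_mul_distrib]
  congr 1
  · refine Finset.prod_congr rfl fun a _ => ?_
    rw [mul_comm]
    simp
  · refine Finset.prod_congr rfl fun a _ => ?_
    simp

/-- `oneMap` for a direct sum. -/
def oneProd : T k ι (Parity M × Parity N) →ₗ[k] T k ι (M × N) := oneMap (k := k) (M := M × N)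

lemma oneProd_homog {δ : ι → ZMod 2} {v : ι → Parity M × Parity N}
    (hv : ∀ i, Homog k (δ i) (v i)) : oneProd (PiTensorProduct.tprod k v) =
      (oneSgn δ : k) • PiTensorProduct.tprod k (fun i => (unPar k (v i).1, unPar k (v i).2)) :=
  oneMap_homog (k := k) (M := M × N) hv

lemma oneProd_R {κ : Type} [Fintype κ] [LinearOrder κ] (g : ι ≃ κ)
    (x : T k ι (Parity M × Parity N)) : oneProd (R g x) = (invSgn g : k) • R g (oneProd x) :=
  oneMap_R (k := k) (M := M × N) g x

lemma oneProd_injective : Function.Injective (oneProd (k := k) (M := M) (N := N) (ι := ι)) :=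
  Function.LeftInverse.injective (oneInv_oneMap (k := k) (M := M × N))

lemma oneProd_incl (w : T k (Fin e) (Parity M) ⊗[k] T k (Fin f) (Parity N)) :
    oneProd (incl w) = incl (superTensor oneMap oneMap w) := by
  suffices h : oneProd (k := k) (M := M) (N := N) ∘ₗ incl = incl ∘ₗ superTensor oneMap oneMap from
    LinearMap.congr_fun h w
  apply TT_ext
  intro δ v ε w hv hw
  have h1 : Homog k (∑ i, δ i) (PiTensorProduct.tprod k v) := by
    unfold Homog; rw [pr_T_homog hv, if_pos rfl]
  have h2 : Homog k (f : ZMod 2) (oneMap (k := k) (M := N) (ι := Fin f)) := by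
    have := homog_oneMap (k := k) (M := N) (ι := Fin f)
    rwa [Fintype.card_fin] at this
  rw [LinearMap.comp_apply, LinearMap.comp_apply, superTensor_homog _ h2 h1, oneMap_homog hv,
    oneMap_homog hw, TensorProduct.smul_tmul_smul, smul_smul, map_smul, incl_tmul, incl_tmul,
    ← Int.cast_mul, ← Int.cast_mul, ← oneSgn_elim, oneProd_homog (homog_elim hv hw)]
  congr 2

/-- Up to the sign of ρ, the odd identity on a block is the signed tensor product of the odd
identities on its two factors; this is the source of the sign rule in θ̂ ⊠ θ̂. -/
lemma oneProd_inclR (ρ : Fin e ⊕ₗ Fin f ≃ Fin d)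
    (w : T k (Fin e) (Parity M) ⊗[k] T k (Fin f) (Parity N)) :
    oneProd (inclR ρ w) = (invSgn ρ : k) • inclR ρ (superTensor oneMap oneMap w) := by
  rw [inclR, LinearMap.comp_apply, oneProd_R, oneProd_incl]
  rfl

lemma oneProd_blockPr (B : Finset ι) (z : T k ι (Parity M × Parity N)) :
    oneProd (blockPr B z) = blockPr B (oneProd z) := by
  suffices h : oneProd (k := k) (M := M) (N := N) ∘ₗ blockPr B = blockPr B ∘ₗ oneProd from
    LinearMap.congr_fun h z
  apply T_ext
  intro δ v hv
  have h : ∀ i, Homog k (δ i) (if i ∈ B then ((v i).1, 0) else (0, (v i).2) :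
      Parity M × Parity N) := fun i => by
    split_ifs
    · exact homog_inl (congrArg Prod.fst (hv i))
    · exact homog_inr (congrArg Prod.snd (hv i))
  rw [LinearMap.comp_apply, LinearMap.comp_apply, blockPr_tprod, oneProd_homog h, oneProd_homog hv,
    map_smul, blockPr_tprod]
  congr 2

end OddIdentity

/-! ### Morphisms of pairs preserve the blocks. -/

section BiLin

variable {k : Type u} [Field k] {d : ℕ}

lemma blockPr_biLin {X Y : GammaBi k d} (φ : X ⟶ Y) (B : Finset (Fin d))
    (z : T k (Fin d) (X.fst.sum X.snd)) :
    blockPr (M := Y.fst) (N := Y.snd) B (biLin φ z) =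
      biLin φ (blockPr (M := X.fst) (N := X.snd) B z) := by
  suffices h : blockPr (M := Y.fst) (N := Y.snd) B ∘ₗ biLin φ =
      biLin φ ∘ₗ blockPr (M := X.fst) (N := X.snd) B from LinearMap.congr_fun h z
  apply bi_ext
  intro e f h ρ x
  rw [LinearMap.comp_apply, LinearMap.comp_apply, biLin_inclR φ h, blockPr_inclR, blockPr_inclR]
  split_ifs
  · rw [biLin_inclR φ h]
  · rw [map_zero]

end BiLin

open CategoryTheory

/-! ### The action of morphisms on Γ_Π. -/

section Twist

variable {k : Type u} [Field k] {d : ℕ}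

/-- A morphism of `Γ^d` acting on the tensor power of the parity changed spaces. -/
def twist {M M' : SVec k} (φ : (⟨M⟩ : GammaObj k d) ⟶ ⟨M'⟩) :
    T k (Fin d) (Parity M) →ₗ[k] T k (Fin d) (Parity M') := oneInv ∘ₗ φ.1 ∘ₗ oneMap

lemma oneMap_twist {M M' : SVec k} (φ : (⟨M⟩ : GammaObj k d) ⟶ ⟨M'⟩)
    (z : T k (Fin d) (Parity M)) : oneMap (twist φ z) = φ.1 (oneMap z) := oneMap_oneInv _

/-- The sign of σ arises once from each of the two odd identities, and so cancels. -/
lemma twist_R {M M' : SVec k} (φ : (⟨M⟩ : GammaObj k d) ⟶ ⟨M'⟩) (σ : Equiv.Perm (Fin d))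
    (z : T k (Fin d) (Parity M)) : R σ (twist φ z) = twist φ (R σ z) := by
  refine Function.LeftInverse.injective oneInv_oneMap ?_
  rw [oneMap_R, oneMap_twist, oneMap_twist, oneMap_R, map_smul, φ.2]

lemma twist_mem_gammaInv {M M' : SVec k} (φ : (⟨M⟩ : GammaObj k d) ⟶ ⟨M'⟩) {c : Fin d → ℕ}
    {z : T k (Fin d) (Parity M)} (hz : z ∈ gammaInv (k := k) c (Parity M)) :
    twist φ z ∈ gammaInv (k := k) c (Parity M') := fun σ hσ => by
  rw [twist_R, hz σ hσ]

lemma homog_twist {M M' : SVec k} {φ : (⟨M⟩ : GammaObj k d) ⟶ ⟨M'⟩} {a : ZMod 2}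
    (hφ : Homog k a φ.1) : Homog k a (twist φ) := by
  refine homog_hom_iff.mpr fun b z hz => ?_
  have h1 : Homog k (d + b) (oneMap z) := by
    have := homog_hom_iff.mp (homog_oneMap (k := k) (M := M) (ι := Fin d)) b z hz
    rwa [Fintype.card_fin] at this
  have h2 := homog_hom_iff.mp hφ _ _ h1
  refine Function.LeftInverse.injective oneInv_oneMap ?_
  have h3 := pr_oneMap (a + b + d) (twist φ z)
  rw [Fintype.card_fin, show a + b + d + d = a + b by
    rw [add_assoc, CharTwo.add_self_eq_zero, add_zero]] at h3
  rw [← h3, oneMap_twist, show a + b + (d : ZMod 2) = a + (d + b) by ring]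
  exact h2

lemma thetaT_twist (lam mu : YoungDiagram) {M M' : SVec k}
    (φ : (⟨M⟩ : GammaObj k (skewSize lam mu)) ⟶ ⟨M'⟩)
    (z : T k (Fin (skewSize lam mu)) (Parity M)) :
    thetaT lam mu M' (twist φ z) = (symPow k (rowOf lam mu)).map φ (thetaT lam mu M z) := by
  change symMk _ _ (R _ (oneMap (twist φ z))) = (symPow k (rowOf lam mu)).map φ (symMk _ _ (R _ _))
  rw [map_symMk, oneMap_twist, φ.2]

/-- The action of a morphism of pairs on the tensor power of a direct sum. -/
def twistProd {X Y : GammaBi k d} (φ : X ⟶ Y) :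
    T k (Fin d) (Parity X.fst × Parity X.snd) →ₗ[k] T k (Fin d) (Parity Y.fst × Parity Y.snd) :=
  twist (biMap φ)

lemma oneProd_twistProd {X Y : GammaBi k d} (φ : X ⟶ Y)
    (z : T k (Fin d) (Parity X.fst × Parity X.snd)) :
    oneProd (twistProd φ z) = biLin φ (oneProd z) := oneMap_twist (biMap φ) z

lemma blockPr_twistProd {X Y : GammaBi k d} (φ : X ⟶ Y) (B : Finset (Fin d))
    (z : T k (Fin d) (Parity X.fst × Parity X.snd)) :
    blockPr B (twistProd φ z) = twistProd φ (blockPr B z) := by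
  refine oneProd_injective ?_
  rw [oneProd_blockPr, oneProd_twistProd, oneProd_twistProd, oneProd_blockPr]
  exact blockPr_biLin φ B (oneProd z)

lemma twistProd_mem_gammaInv {X Y : GammaBi k d} (φ : X ⟶ Y) {c : Fin d → ℕ}
    {z : T k (Fin d) (Parity X.fst × Parity X.snd)}
    (hz : z ∈ gammaInv (k := k) c (Parity X.fst × Parity X.snd)) :
    twistProd φ z ∈ gammaInv (k := k) c (Parity Y.fst × Parity Y.snd) :=
  twist_mem_gammaInv (biMap φ) hz

lemma twistProd_mem_shapeSub {lam mu : YoungDiagram} {X Y : GammaBi k (skewSize lam mu)}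
    (φ : X ⟶ Y) {P : YoungDiagram → Prop}
    {z : T k (Fin (skewSize lam mu)) (Parity X.fst × Parity X.snd)}
    (hz : z ∈ shapeSub k (Parity X.fst) (Parity X.snd) lam mu P) :
    twistProd φ z ∈ shapeSub k (Parity Y.fst) (Parity Y.snd) lam mu P := by
  refine ⟨twistProd_mem_gammaInv φ hz.1, fun B hB => hz.2 B fun h => hB ?_⟩
  rw [blockPr_twistProd, h, map_zero]

/-- Both sides are compared after applying the injective map `oneProd`, where the morphism acts on
each placement in the same way, by `biLin_inclR`. -/
lemma twistProd_shuf {X Y : GammaBi k d} (φ : X ⟶ Y) {e f : ℕ} (h : e + f = d) (c : Fin d → ℕ)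
    (c₁ : Fin e → ℕ) (c₂ : Fin f → ℕ)
    {w : T k (Fin e) (Parity X.fst) ⊗[k] T k (Fin f) (Parity X.snd)}
    {w' : T k (Fin e) (Parity Y.fst) ⊗[k] T k (Fin f) (Parity Y.snd)}
    (hw : superTensor oneMap oneMap w' = realize (φ ⟨(e, f), h⟩) (superTensor oneMap oneMap w)) :
    twistProd φ (shuf c c₁ c₂ w) = shuf c c₁ c₂ w' := by
  classical
  refine oneProd_injective ?_
  rw [oneProd_twistProd, shuf, shuf, LinearMap.sum_apply, LinearMap.sum_apply, map_sum, map_sum,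
    map_sum]
  refine Finset.sum_congr rfl fun ρ _ => ?_
  rw [oneProd_inclR, oneProd_inclR, hw]
  refine (map_smul (biLin φ) _ _).trans ?_
  congr 1
  exact biLin_inclR φ h ρ _

end Twist

/-! ### Lifting the actions of morphisms to Γ_Π ⊗ Γ_Π. -/

section Lift

variable {k : Type u} [Field k]

/-- The signs come from moving t past f and g' past u. They depend only on parities, so squares of
maps with the same parities have the same sign. -/
lemma superTensor_lift {A A' B B' C C' D D' : Type u}
    [AddCommGroup A] [Module k A] [SuperSpace k A] [AddCommGroup A'] [Module k A'] [SuperSpace k A']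
    [AddCommGroup B] [Module k B] [SuperSpace k B] [AddCommGroup B'] [Module k B'] [SuperSpace k B']
    [AddCommGroup C] [Module k C] [SuperSpace k C] [AddCommGroup C'] [Module k C'] [SuperSpace k C']
    [AddCommGroup D] [Module k D] [SuperSpace k D] [AddCommGroup D'] [Module k D'] [SuperSpace k D']
    {f : A →ₗ[k] C} {f' : A' →ₗ[k] C'} {u : A →ₗ[k] A'} {v : C →ₗ[k] C'}
    {g : B →ₗ[k] D} {g' : B' →ₗ[k] D'} {s : B →ₗ[k] B'} {t : D →ₗ[k] D'} {p q a b : ZMod 2}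
    (hf : Homog k p f) (hg : Homog k q g) (hg' : Homog k q g')
    (hu : Homog k a u) (hs : Homog k b s) (ht : Homog k b t)
    (h₁ : v ∘ₗ f = f' ∘ₗ u) (h₂ : t ∘ₗ g = g' ∘ₗ s) (w : A ⊗[k] B) :
    superTensor v t (superTensor f g w) =
      superTensor f' g' (((kos b p * kos q a : ℤ) : k) • superTensor u s w) := by
  have e1 := LinearMap.congr_fun (superTensor_comp (f' := v) hf hg ht) w
  have e2 := LinearMap.congr_fun (superTensor_comp (f' := f') hu hs hg') w
  rw [LinearMap.comp_apply, LinearMap.smul_apply] at e1 e2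
  rw [e1, map_smul, e2, h₁, h₂, smul_smul, ← Int.cast_mul, mul_assoc, kos_sq, mul_one]

variable {lam mu : YoungDiagram}

lemma gammaPiIncl_pr (M : SVec k) (a : ZMod 2) (x : gammaPi lam mu M) :
    gammaPiIncl lam mu M (pr k a x) = pr k a (gammaPiIncl lam mu M x) := rfl

lemma homog_gammaPiIncl (M : SVec k) {a : ZMod 2} {x : gammaPi lam mu M} :
    Homog k a x ↔ Homog k a (gammaPiIncl lam mu M x) :=
  SubFunctor.homog_sub (gammaInv_isSubsuper _ _)

/-- The action of a morphism on `gammaPi`. -/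
def gammaMap (lam mu : YoungDiagram) {M M' : SVec k}
    (φ : (⟨M⟩ : GammaObj k (skewSize lam mu)) ⟶ ⟨M'⟩) : gammaPi lam mu M →ₗ[k] gammaPi lam mu M' :=
  (twist φ ∘ₗ gammaPiIncl lam mu M).codRestrict (gammaInv (k := k) (colOf lam mu) (Parity M'))
    fun x => twist_mem_gammaInv φ x.2

lemma gammaPiIncl_gammaMap {M M' : SVec k}
    (φ : (⟨M⟩ : GammaObj k (skewSize lam mu)) ⟶ ⟨M'⟩) (x : gammaPi lam mu M) :
    gammaPiIncl lam mu M' (gammaMap lam mu φ x) = twist φ (gammaPiIncl lam mu M x) := rfl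

lemma homog_gammaMap {M M' : SVec k} {φ : (⟨M⟩ : GammaObj k (skewSize lam mu)) ⟶ ⟨M'⟩}
    {a : ZMod 2} (hφ : Homog k a φ.1) : Homog k a (gammaMap lam mu φ) := by
  refine homog_hom_iff.mpr fun b x hx => ?_
  rw [homog_gammaPiIncl] at hx ⊢
  exact homog_hom_iff.mp (homog_twist hφ) b _ hx

lemma schurIncl_injective (lam mu : YoungDiagram) (M : SVec k) :
    Function.Injective (schurIncl lam mu M) := Submodule.injective_subtype _

lemma schurIncl_thetaHat (M : SVec k) (x : gammaPi lam mu M) :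
    schurIncl lam mu M (thetaHat lam mu M x) = thetaT lam mu M (gammaPiIncl lam mu M x) := rfl

lemma schurIncl_pr (M : SVec k) (a : ZMod 2) (x : (schur k lam mu).obj ⟨M⟩) :
    schurIncl lam mu M (pr k a x) = pr k a (schurIncl lam mu M x) := rfl

lemma schurIncl_map {M M' : SVec k} (φ : (⟨M⟩ : GammaObj k (skewSize lam mu)) ⟶ ⟨M'⟩)
    (x : (schur k lam mu).obj ⟨M⟩) :
    schurIncl lam mu M' ((schur k lam mu).map φ x) =
      (symPow k (rowOf lam mu)).map φ (schurIncl lam mu M x) := rfl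

lemma thetaHat_surjective (lam mu : YoungDiagram) (M : SVec k) :
    Function.Surjective (thetaHat lam mu M) := LinearMap.surjective_rangeRestrict _

lemma pr_thetaT (M : SVec k) (a : ZMod 2) (z : T k (Fin (skewSize lam mu)) (Parity M)) :
    pr k a (thetaT lam mu M z) = thetaT lam mu M (pr k (a + skewSize lam mu) z) := by
  change pr k a (symMk _ _ (R _ (oneMap z))) = symMk _ _ (R _ (oneMap _))
  rw [pr_symMk, pr_R, pr_oneMap, Fintype.card_fin]

lemma homog_thetaHat (lam mu : YoungDiagram) (M : SVec k) :
    Homog k (skewSize lam mu : ZMod 2) (thetaHat lam mu M) := by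
  refine homog_hom_iff.mpr fun b x hx => ?_
  refine schurIncl_injective lam mu M ?_
  rw [schurIncl_pr, schurIncl_thetaHat, pr_thetaT, ← gammaPiIncl_pr,
    show (skewSize lam mu : ZMod 2) + b + skewSize lam mu = b by
      rw [add_comm, ← add_assoc, CharTwo.add_self_eq_zero, zero_add], hx]

lemma map_thetaHat {M M' : SVec k} (φ : (⟨M⟩ : GammaObj k (skewSize lam mu)) ⟶ ⟨M'⟩) :
    (schur k lam mu).map φ ∘ₗ thetaHat lam mu M = thetaHat lam mu M' ∘ₗ gammaMap lam mu φ := by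
  refine LinearMap.ext fun x => schurIncl_injective lam mu M' ?_
  rw [LinearMap.comp_apply, LinearMap.comp_apply, schurIncl_map, schurIncl_thetaHat,
    schurIncl_thetaHat, gammaPiIncl_gammaMap, thetaT_twist]

lemma thetaHat_eq_zero_iff (M : SVec k) (x : gammaPi lam mu M) :
    thetaHat lam mu M x = 0 ↔
      gammaPiIncl lam mu M x ∈ skewCoinv k (Parity M) (rowIn lam mu) := by
  rw [← thetaT_eq_zero_iff, ← schurIncl_thetaHat, map_eq_zero_iff _ (schurIncl_injective lam mu M)]

/-- `oneMap` on `gammaPi`. -/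
def gammaOne (lam mu : YoungDiagram) (M : SVec k) :
    gammaPi lam mu M →ₗ[k] T k (Fin (skewSize lam mu)) M := oneMap ∘ₗ gammaPiIncl lam mu M

lemma homog_gammaOne (lam mu : YoungDiagram) (M : SVec k) :
    Homog k (skewSize lam mu : ZMod 2) (gammaOne lam mu M) := by
  refine homog_hom_iff.mpr fun b x hx => ?_
  have := homog_hom_iff.mp (homog_oneMap (k := k) (M := M) (ι := Fin (skewSize lam mu))) b
    _ ((homog_gammaPiIncl M).mp hx)
  rwa [Fintype.card_fin] at this

lemma map_gammaOne {M M' : SVec k} (φ : (⟨M⟩ : GammaObj k (skewSize lam mu)) ⟶ ⟨M'⟩) :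
    φ.1 ∘ₗ gammaOne lam mu M = gammaOne lam mu M' ∘ₗ gammaMap lam mu φ :=
  LinearMap.ext fun x => (oneMap_twist φ (gammaPiIncl lam mu M x)).symm

variable {xi : YoungDiagram}

lemma superTensor_gammaOne (M N : SVec k) (w : gammaPi xi mu M ⊗[k] gammaPi lam xi N) :
    superTensor oneMap oneMap (TensorProduct.map (gammaPiIncl xi mu M) (gammaPiIncl lam xi N) w) =
      superTensor (gammaOne xi mu M) (gammaOne lam xi N) w := by
  induction w with
  | zero => simp
  | add x y hx hy => rw [map_add, map_add, map_add, hx, hy]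
  | tmul x y => rw [TensorProduct.map_tmul, superTensor_apply, superTensor_apply]; rfl

/-- The actions of a morphism on `Ŝ ⊠ Ŝ` and on tensor powers lift simultaneously. -/
lemma exists_lift {M M' N N' : SVec k}
    (ψ : ((⟨M⟩ : GammaObj k (skewSize xi mu)) ⟶ ⟨M'⟩) ⊗[k]
      ((⟨N⟩ : GammaObj k (skewSize lam xi)) ⟶ ⟨N'⟩))
    (w : gammaPi xi mu M ⊗[k] gammaPi lam xi N) :
    ∃ w' : gammaPi xi mu M' ⊗[k] gammaPi lam xi N',
      superTensor (thetaHat xi mu M') (thetaHat lam xi N') w' =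
        extMap (schur k xi mu) (schur k lam xi) ψ
          (superTensor (thetaHat xi mu M) (thetaHat lam xi N) w) ∧
      superTensor (gammaOne xi mu M') (gammaOne lam xi N') w' =
        realize ψ (superTensor (gammaOne xi mu M) (gammaOne lam xi N) w) := by
  refine tensor_ind (p := fun ψ => ∃ w' : gammaPi xi mu M' ⊗[k] gammaPi lam xi N',
      superTensor (thetaHat xi mu M') (thetaHat lam xi N') w' =
        extMap (schur k xi mu) (schur k lam xi) ψ
          (superTensor (thetaHat xi mu M) (thetaHat lam xi N) w) ∧
      superTensor (gammaOne xi mu M') (gammaOne lam xi N') w' =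
        realize ψ (superTensor (gammaOne xi mu M) (gammaOne lam xi N) w)) ψ ?_ ?_ ?_
  · exact ⟨0, by rw [map_zero, map_zero, LinearMap.zero_apply],
      by rw [map_zero, map_zero, LinearMap.zero_apply]⟩
  · rintro ψ ψ' ⟨w₁, h₁, h₁'⟩ ⟨w₂, h₂, h₂'⟩
    exact ⟨w₁ + w₂, by rw [map_add, map_add, LinearMap.add_apply, h₁, h₂],
      by rw [map_add, map_add, LinearMap.add_apply, h₁', h₂']⟩
  · intro a b φ φ' hφ hφ'
    have hφ1 : Homog k a φ.1 := (SubFunctor.homog_sub (equivar_isSubsuper _ _ _)).mp hφ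
    have hφ1' : Homog k b φ'.1 := (SubFunctor.homog_sub (equivar_isSubsuper _ _ _)).mp hφ'
    -- One sign serves both equations, because `thetaHat` and `gammaOne` have the same parity,
    -- namely that of the number of cells.
    refine ⟨((kos b (skewSize xi mu) * kos (skewSize lam xi) a : ℤ) : k) •
      superTensor (gammaMap xi mu φ) (gammaMap lam xi φ') w, ?_, ?_⟩
    · rw [extMap, LinearMap.comp_apply, TensorProduct.map_tmul, superTensorL_tmul]
      exact (superTensor_lift (homog_thetaHat xi mu M) (homog_thetaHat lam xi N)
        (homog_thetaHat lam xi N') (homog_gammaMap hφ1) (homog_gammaMap hφ1')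
        ((schur k lam xi).map_even φ' b hφ') (map_thetaHat φ) (map_thetaHat φ') w).symm
    · rw [realize, LinearMap.comp_apply, TensorProduct.map_tmul, superTensorL_tmul]
      exact (superTensor_lift (homog_gammaOne xi mu M) (homog_gammaOne lam xi N)
        (homog_gammaOne lam xi N') (homog_gammaMap hφ1) (homog_gammaMap hφ1')
        hφ1' (map_gammaOne φ) (map_gammaOne φ') w).symm

end Lift

open CategoryTheory

/-! ### The subfunctors of the filtration. -/

section Layers

variable {k : Type u} [Field k] {lam mu xi : YoungDiagram}

/-- `thetaT` for a direct sum. -/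
def thetaProd (lam mu : YoungDiagram) (M N : SVec k) :
    T k (Fin (skewSize lam mu)) (Parity M × Parity N) →ₗ[k]
      (symPow k (rowOf lam mu)).obj ⟨M.sum N⟩ := thetaT lam mu (M.sum N)

lemma thetaProd_eq_zero_iff (M N : SVec k)
    (z : T k (Fin (skewSize lam mu)) (Parity M × Parity N)) :
    thetaProd lam mu M N z = 0 ↔ z ∈ skewCoinv k (Parity M × Parity N) (rowIn lam mu) :=
  thetaT_eq_zero_iff lam mu (M.sum N) z

lemma pr_thetaProd (M N : SVec k) (a : ZMod 2)
    (z : T k (Fin (skewSize lam mu)) (Parity M × Parity N)) :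
    pr k a (thetaProd lam mu M N z) = thetaProd lam mu M N (pr k (a + skewSize lam mu) z) :=
  pr_thetaT (M.sum N) a z

lemma thetaProd_twistProd {X Y : GammaBi k (skewSize lam mu)} (φ : X ⟶ Y)
    (z : T k (Fin (skewSize lam mu)) (Parity X.fst × Parity X.snd)) :
    thetaProd lam mu Y.fst Y.snd (twistProd φ z) =
      (symPow k (rowOf lam mu)).map (biMap φ) (thetaProd lam mu X.fst X.snd z) :=
  thetaT_twist lam mu (biMap φ) z

lemma exists_schurIncl {M N : SVec k} {z : T k (Fin (skewSize lam mu)) (Parity M × Parity N)}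
    (hz : z ∈ gammaInv (k := k) (colOf lam mu) (Parity M × Parity N)) :
    ∃ l : (schur k lam mu).obj ⟨M.sum N⟩,
      schurIncl lam mu (M.sum N) l = thetaProd lam mu M N z :=
  ⟨thetaHat lam mu (M.sum N) ⟨z, hz⟩, rfl⟩

lemma exists_thetaProd {M N : SVec k} (l : (schur k lam mu).obj ⟨M.sum N⟩) :
    ∃ z ∈ gammaInv (k := k) (colOf lam mu) (Parity M × Parity N),
      thetaProd lam mu M N z = schurIncl lam mu (M.sum N) l := by
  obtain ⟨x, rfl⟩ := thetaHat_surjective lam mu (M.sum N) l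
  exact ⟨x.1, x.2, rfl⟩

lemma pr_mem_shapeSub {M N : SVec k} {P : YoungDiagram → Prop} (a : ZMod 2)
    {z : T k (Fin (skewSize lam mu)) (Parity M × Parity N)}
    (hz : z ∈ shapeSub k (Parity M) (Parity N) lam mu P) :
    pr k a z ∈ shapeSub k (Parity M) (Parity N) lam mu P := by
  refine ⟨gammaInv_isSubsuper _ _ a z hz.1, fun B hB => hz.2 B fun h => hB ?_⟩
  rw [← pr_blockPr, h, map_zero]

/-- The image of `shapeSub` in `Ŝ_{lam/mu}(M ⊕ N)`. -/
def layerSub (lam mu : YoungDiagram) (P : YoungDiagram → Prop) (M N : SVec k) :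
    Submodule k ((schur k lam mu).obj ⟨M.sum N⟩) :=
  ((shapeSub k (Parity M) (Parity N) lam mu P).map (thetaProd lam mu M N)).comap
    (schurIncl lam mu (M.sum N))

lemma mem_layerSub {P : YoungDiagram → Prop} {M N : SVec k}
    {l : (schur k lam mu).obj ⟨M.sum N⟩} : l ∈ layerSub lam mu P M N ↔
      ∃ z ∈ shapeSub k (Parity M) (Parity N) lam mu P,
        thetaProd lam mu M N z = schurIncl lam mu (M.sum N) l := Iff.rfl

lemma layerSub_mono {P Q : YoungDiagram → Prop} (h : ∀ nu, P nu → Q nu) (M N : SVec k) :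
    layerSub lam mu P M N ≤ layerSub lam mu Q M N :=
  Submodule.comap_mono (Submodule.map_mono (shapeSub_mono h))

/-- The subfunctor of `(Ŝ_{lam/mu})^{bi}` of the diagrams `nu` with `P nu`. -/
def layer (k : Type u) [Field k] (lam mu : YoungDiagram) (P : YoungDiagram → Prop) :
    SubFunctor (bi (schur k lam mu)) where
  sub X := layerSub lam mu P X.fst X.snd
  isSubsuper X a l hl := by
    obtain ⟨z, hz, hzl⟩ := mem_layerSub.mp hl
    refine mem_layerSub.mpr ⟨_, pr_mem_shapeSub (a + skewSize lam mu) hz, ?_⟩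
    rw [← pr_thetaProd, hzl]
    rfl
  stable {X Y} φ l hl := by
    obtain ⟨z, hz, hzl⟩ := mem_layerSub.mp hl
    refine mem_layerSub.mpr ⟨_, twistProd_mem_shapeSub φ hz, ?_⟩
    rw [thetaProd_twistProd, hzl]
    rfl

/-- Tensors in `shapeSub` are column invariants, so their images under θ lie in the Schur functor
and nothing is lost by the preimage in `layerSub`. -/
lemma map_layerSub (P : YoungDiagram → Prop) (M N : SVec k) :
    (layerSub lam mu P M N).map (schurIncl lam mu (M.sum N)) =
      (kSub lam mu P M N).map (thetaT lam mu (M.sum N)) := by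
  rw [kSub_eq]
  refine le_antisymm ?_ ?_
  · rintro _ ⟨l, ⟨z, hz, hzl⟩, rfl⟩
    exact ⟨z, hz, hzl⟩
  · rintro _ ⟨z, hz, rfl⟩
    obtain ⟨l, hl⟩ := exists_schurIncl (M := M) (N := N) (z := z) hz.1
    exact ⟨l, ⟨z, hz, hl.symm⟩, hl⟩

/-- Straightening leaves only diagrams up to lam, and the discarded relations vanish under θ. -/
lemma layerSub_top (hk : (2 : k) ≠ 0) (hmu : mu ≤ lam) (M N : SVec k) :
    layerSub lam mu (fun nu => lexLe nu lam) M N = ⊤ := by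
  refine eq_top_iff.mpr fun l _ => ?_
  obtain ⟨z, hz, hzl⟩ := exists_thetaProd l
  obtain ⟨r, hr, y, hy, rfl⟩ := Submodule.mem_sup.mp (gammaInv_le_colRel hmu hz)
  refine mem_layerSub.mpr ⟨y, hy, ?_⟩
  rw [← hzl, map_add, (thetaProd_eq_zero_iff M N r).mpr (colRel_le_skewCoinv hk hmu hr), zero_add]

lemma layerSub_lt_eq_iSup (xi : YoungDiagram) (M N : SVec k) :
    layerSub lam mu (fun nu => lexLt nu xi) M N =
      ⨆ nu : {nu : Set.Icc mu lam // lexLt nu.1 xi},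
        layerSub lam mu (fun nu' => lexLe nu' nu.1.1) M N := by
  refine le_antisymm ?_ (iSup_le fun nu => layerSub_mono (fun nu' h => lexLe_lt_trans h nu.2) M N)
  intro l hl
  obtain ⟨z, hz, hzl⟩ := mem_layerSub.mp hl
  rcases exists_shapeSub_le hz with rfl | ⟨nu, hnu, hz'⟩
  · rw [map_zero] at hzl
    rw [schurIncl_injective lam mu (M.sum N) (hzl.symm.trans (map_zero _).symm)]
    exact zero_mem _
  · exact Submodule.mem_iSup_of_mem ⟨nu, hnu⟩ ⟨z, hz', hzl⟩

end Layers

/-! ### The graded pieces. -/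

section Graded

variable {k : Type u} [Field k] {lam mu xi : YoungDiagram}

lemma pr_shuf {V₁ V₂ : Type u} [AddCommGroup V₁] [Module k V₁] [SuperSpace k V₁]
    [AddCommGroup V₂] [Module k V₂] [SuperSpace k V₂] [Module.Finite k V₁] [Module.Finite k V₂]
    {d e f : ℕ} (c : Fin d → ℕ) (c₁ : Fin e → ℕ) (c₂ : Fin f → ℕ)
    (a : ZMod 2) (w : T k (Fin e) V₁ ⊗[k] T k (Fin f) V₂) :
    pr k a (shuf c c₁ c₂ w) = shuf c c₁ c₂ (pr k a w) := by
  rw [shuf, LinearMap.sum_apply, LinearMap.sum_apply, map_sum]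
  exact Finset.sum_congr rfl fun ρ _ => pr_inclR (M := ⟨V₁⟩) (N := ⟨V₂⟩) ρ a w

lemma pr_map_gammaPiIncl (M N : SVec k) (a : ZMod 2) (w : gammaPi xi mu M ⊗[k] gammaPi lam xi N) :
    pr k a (TensorProduct.map (gammaPiIncl xi mu M) (gammaPiIncl lam xi N) w) =
      TensorProduct.map (gammaPiIncl xi mu M) (gammaPiIncl lam xi N) (pr k a w) := by
  induction w with
  | zero => rw [map_zero, map_zero, map_zero, map_zero]
  | add x y hx hy => rw [map_add, map_add, map_add, map_add, hx, hy]
  | tmul x y =>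
    rw [TensorProduct.map_tmul, pr_tmul, pr_tmul, map_add, TensorProduct.map_tmul,
      TensorProduct.map_tmul, gammaPiIncl_pr, gammaPiIncl_pr, gammaPiIncl_pr, gammaPiIncl_pr]

/-- The map `x ⊗ y ↦ x ⊛ y`. -/
noncomputable def gammaShuf (lam xi mu : YoungDiagram) (M N : SVec k) :
    gammaPi xi mu M ⊗[k] gammaPi lam xi N →ₗ[k]
      T k (Fin (skewSize lam mu)) (Parity M × Parity N) :=
  shuf (colOf lam mu) (colOf xi mu) (colOf lam xi) ∘ₗ
    TensorProduct.map (gammaPiIncl xi mu M) (gammaPiIncl lam xi N)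

lemma pr_gammaShuf (M N : SVec k) (a : ZMod 2) (w : gammaPi xi mu M ⊗[k] gammaPi lam xi N) :
    pr k a (gammaShuf lam xi mu M N w) = gammaShuf lam xi mu M N (pr k a w) := by
  have : Module.Finite k (Parity M) := M.finite
  have : Module.Finite k (Parity N) := N.finite
  rw [gammaShuf, LinearMap.comp_apply, LinearMap.comp_apply, pr_shuf, pr_map_gammaPiIncl]

lemma gammaShuf_mem_shapeSub (h₁ : mu ≤ xi) (h₂ : xi ≤ lam) {P : YoungDiagram → Prop} (hP : P xi)
    (M N : SVec k) (w : gammaPi xi mu M ⊗[k] gammaPi lam xi N) :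
    gammaShuf lam xi mu M N w ∈ shapeSub k (Parity M) (Parity N) lam mu P :=
  shapeShuf_mem_shapeSub h₁ h₂ hP w

lemma coinclR_gammaShuf (h₁ : mu ≤ xi) (h₂ : xi ≤ lam) (M N : SVec k)
    (w : gammaPi xi mu M ⊗[k] gammaPi lam xi N) :
    coinclR (cellPlace h₁ h₂) (gammaShuf lam xi mu M N w) =
      TensorProduct.map (gammaPiIncl xi mu M) (gammaPiIncl lam xi N) w :=
  coinclR_shapeShuf h₁ h₂ w

lemma exists_coinclR_eq (h₁ : mu ≤ xi) (h₂ : xi ≤ lam) (M N : SVec k)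
    {z : T k (Fin (skewSize lam mu)) (Parity M × Parity N)}
    (hz : z ∈ gammaInv (k := k) (colOf lam mu) (Parity M × Parity N)) :
    ∃ w : gammaPi xi mu M ⊗[k] gammaPi lam xi N,
      TensorProduct.map (gammaPiIncl xi mu M) (gammaPiIncl lam xi N) w =
        coinclR (cellPlace h₁ h₂) z :=
  coinclR_mem_range (cellPlace h₁ h₂) (colOf_cellPlace_inl h₁ h₂) (colOf_cellPlace_inr h₁ h₂) hz

/-- The map `x ⊗ y ↦ θ̂(x ⊛ y)`. -/
noncomputable def gradedLift (h₁ : mu ≤ xi) (h₂ : xi ≤ lam) (X : GammaBi k (skewSize lam mu)) :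
    gammaPi xi mu X.fst ⊗[k] gammaPi lam xi X.snd →ₗ[k]
      (layer k lam mu fun nu => lexLe nu xi).sub X :=
  ((thetaProd lam mu X.fst X.snd ∘ₗ
    gammaShuf lam xi mu X.fst X.snd).codRestrict
      ((schurSub k lam mu).sub ⟨X.fst.sum X.snd⟩) fun w =>
        ⟨⟨_, (gammaShuf_mem_shapeSub h₁ h₂ (P := fun _ => True) trivial _ _ w).1⟩, rfl⟩).codRestrict
    (layerSub lam mu (fun nu => lexLe nu xi) X.fst X.snd)
    fun w => ⟨_, gammaShuf_mem_shapeSub h₁ h₂ (Or.inl rfl) _ _ w, rfl⟩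

lemma schurIncl_gradedLift (h₁ : mu ≤ xi) (h₂ : xi ≤ lam) (X : GammaBi k (skewSize lam mu))
    (w : gammaPi xi mu X.fst ⊗[k] gammaPi lam xi X.snd) :
    schurIncl lam mu (X.fst.sum X.snd) (gradedLift h₁ h₂ X w).1 = thetaProd lam mu X.fst X.snd
      (gammaShuf lam xi mu X.fst X.snd w) := rfl

/-- The map `x ⊗ y ↦ [θ̂(x ⊛ y)]`. -/
noncomputable def gradedMap (h₁ : mu ≤ xi) (h₂ : xi ≤ lam) (X : GammaBi k (skewSize lam mu)) :
    gammaPi xi mu X.fst ⊗[k] gammaPi lam xi X.snd →ₗ[k]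
      ((layer k lam mu fun nu => lexLe nu xi).subquotient
        (layer k lam mu fun nu => lexLt nu xi)).obj X :=
  (layer k lam mu fun nu => lexLe nu xi).mkSubquot (layer k lam mu fun nu => lexLt nu xi) X ∘ₗ
    gradedLift h₁ h₂ X

lemma mkSubquot_eq_zero_iff {X : GammaBi k (skewSize lam mu)}
    (l : (layer k lam mu fun nu => lexLe nu xi).sub X) :
    (layer k lam mu fun nu => lexLe nu xi).mkSubquot (layer k lam mu fun nu => lexLt nu xi) X l = 0 ↔
      l.1 ∈ layerSub lam mu (fun nu => lexLt nu xi) X.fst X.snd :=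
  Submodule.Quotient.mk_eq_zero _

/-- Subtracting the shuffle of its leading component at xi moves an element of the layer into the
part strictly below xi. -/
lemma gradedMap_surjective (h₁ : mu ≤ xi) (h₂ : xi ≤ lam) (X : GammaBi k (skewSize lam mu)) :
    Function.Surjective (gradedMap (k := k) h₁ h₂ X) := by
  intro y
  obtain ⟨l, rfl⟩ : ∃ l, (layer k lam mu fun nu => lexLe nu xi).mkSubquot
      (layer k lam mu fun nu => lexLt nu xi) X l = y := Submodule.mkQ_surjective _ y
  obtain ⟨z, hz, hzl⟩ := mem_layerSub.mp l.2
  obtain ⟨w, hw⟩ := exists_coinclR_eq h₁ h₂ X.fst X.snd hz.1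
  refine ⟨w, ?_⟩
  have h : z - gammaShuf lam xi mu X.fst X.snd w ∈
      shapeSub k (Parity X.fst) (Parity X.snd) lam mu fun nu => lexLt nu xi := by
    refine mem_shapeSub_lt h₁ h₂ (sub_mem hz (gammaShuf_mem_shapeSub h₁ h₂ (Or.inl rfl) _ _ w)) ?_
    rw [map_sub, coinclR_gammaShuf, hw, sub_self]
  have h' : l.1 - (gradedLift h₁ h₂ X w).1 ∈
      layerSub lam mu (fun nu => lexLt nu xi) X.fst X.snd := by
    refine ⟨_, h, ?_⟩
    rw [map_sub, hzl]
    rfl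
  have h'' := (mkSubquot_eq_zero_iff (l - gradedLift h₁ h₂ X w)).mpr h'
  rw [map_sub] at h''
  exact (sub_eq_zero.mp h'').symm

/-- The two directions are the two halves of the proof: straightening shows that ψ_ξ is well
defined, triangularity that it is injective. -/
lemma gradedMap_eq_zero_iff (hk : (2 : k) ≠ 0) (h₁ : mu ≤ xi) (h₂ : xi ≤ lam)
    (X : GammaBi k (skewSize lam mu)) (w : gammaPi xi mu X.fst ⊗[k] gammaPi lam xi X.snd) :
    superTensor (thetaHat xi mu X.fst) (thetaHat lam xi X.snd) w = 0 ↔ gradedMap h₁ h₂ X w = 0 := by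
  have : Module.Finite k (Parity X.fst) := X.fst.finite
  have : Module.Finite k (Parity X.snd) := X.snd.finite
  have hker : superTensor (thetaHat xi mu X.fst) (thetaHat lam xi X.snd) w = 0 ↔
      TensorProduct.map (skewCoinv k (Parity X.fst) (rowIn xi mu)).mkQ
        (skewCoinv k (Parity X.snd) (rowIn lam xi)).mkQ
        (TensorProduct.map (gammaPiIncl xi mu X.fst) (gammaPiIncl lam xi X.snd) w) = 0 := by
    rw [superTensor_eq_zero_iff (homog_thetaHat xi mu X.fst) (homog_thetaHat lam xi X.snd),
      ← LinearMap.comp_apply, ← TensorProduct.map_comp]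
    refine map_eq_zero_iff_of_ker (fun x => ?_) (fun y => ?_) w
    · exact (thetaHat_eq_zero_iff X.fst x).trans (Submodule.Quotient.mk_eq_zero _).symm
    · exact (thetaHat_eq_zero_iff X.snd y).trans (Submodule.Quotient.mk_eq_zero _).symm
  refine hker.trans (Iff.trans ?_ (mkSubquot_eq_zero_iff (gradedLift h₁ h₂ X w)).symm)
  constructor
  -- The presentation of the kernels in the two factors makes the shuffle a relation plus an element
  -- y supported on smaller diagrams; θ kills the relation.
  · intro h
    obtain ⟨r, hr, y, hy, hry⟩ := Submodule.mem_sup.mp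
      (shapeShuf_mem_of_ker (colKer_of_finite hk _) (colKer_of_finite hk _) h₁ h₂ h)
    refine ⟨y, hy, ?_⟩
    have hry' : r + y = gammaShuf lam xi mu X.fst X.snd w := hry
    rw [schurIncl_gradedLift, ← hry', map_add, (thetaProd_eq_zero_iff _ _ r).mpr
      (colRel_le_skewCoinv hk (h₁.trans h₂) hr), zero_add]
  -- The difference of the shuffle and z lies in the kernel of θ and has the same leading component
  -- as the shuffle, since z has none at xi.
  · rintro ⟨z, hz, hzw⟩
    rw [schurIncl_gradedLift] at hzw
    have h3 : gammaShuf lam xi mu X.fst X.snd w - z ∈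
        skewCoinv k (Parity X.fst × Parity X.snd) (rowIn lam mu) := by
      rw [← thetaProd_eq_zero_iff, map_sub, hzw, sub_self]
    have h4 := leading_mem_ker h₁ h₂ (sub_mem (gammaShuf_mem_shapeSub h₁ h₂ (Or.inl rfl) _ _ w)
      (shapeSub_mono (fun nu h => Or.inr h) hz)) h3
    rw [map_sub, coinclR_gammaShuf, coinclR_eq_zero_of_lt h₁ h₂ hz, sub_zero] at h4
    exact h4

/-- Shuffling is even, so the parity comes from 1^{⊗d} alone. It agrees with the parity of θ̂ ⊠ θ̂,
as the numbers of cells add up; therefore the induced isomorphism is even. -/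
lemma homog_gradedMap (h₁ : mu ≤ xi) (h₂ : xi ≤ lam) (X : GammaBi k (skewSize lam mu)) :
    Homog k (skewSize lam mu : ZMod 2) (gradedMap (k := k) h₁ h₂ X) := by
  refine homog_hom_iff.mpr fun b w hw => ?_
  refine congrArg ((layer k lam mu fun nu => lexLe nu xi).mkSubquot
    (layer k lam mu fun nu => lexLt nu xi) X) (Subtype.ext
      (schurIncl_injective lam mu (X.fst.sum X.snd) ?_) :
    (⟨pr k ((skewSize lam mu : ZMod 2) + b) (gradedLift h₁ h₂ X w).1,
      (layer k lam mu fun nu => lexLe nu xi).isSubsuper X _ _ (gradedLift h₁ h₂ X w).2⟩ :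
      (layer k lam mu fun nu => lexLe nu xi).sub X) = gradedLift h₁ h₂ X w)
  rw [schurIncl_gradedLift]
  change pr k _ (thetaProd lam mu X.fst X.snd _) = _
  rw [pr_thetaProd, pr_gammaShuf,
    show (skewSize lam mu : ZMod 2) + b + skewSize lam mu = b by
      rw [add_comm, ← add_assoc, CharTwo.add_self_eq_zero, zero_add], hw]

/-- The hypothesis is phrased after the odd identities, since the morphism acts on the tensor powers
of the unshifted spaces. -/
lemma gradedMap_natural (h₁ : mu ≤ xi) (h₂ : xi ≤ lam) {X Y : GammaBi k (skewSize lam mu)}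
    (φ : X ⟶ Y) {w : gammaPi xi mu X.fst ⊗[k] gammaPi lam xi X.snd}
    {w' : gammaPi xi mu Y.fst ⊗[k] gammaPi lam xi Y.snd}
    (hw : superTensor (gammaOne xi mu Y.fst) (gammaOne lam xi Y.snd) w' =
      realize (φ ⟨(_, _), skewSize_add h₁ h₂⟩)
        (superTensor (gammaOne xi mu X.fst) (gammaOne lam xi X.snd) w)) :
    gradedMap h₁ h₂ Y w' = ((layer k lam mu fun nu => lexLe nu xi).subquotient
      (layer k lam mu fun nu => lexLt nu xi)).map φ (gradedMap h₁ h₂ X w) := by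
  refine congrArg ((layer k lam mu fun nu => lexLe nu xi).mkSubquot
    (layer k lam mu fun nu => lexLt nu xi) Y) (Subtype.ext
      (schurIncl_injective lam mu (Y.fst.sum Y.snd) ?_) :
    gradedLift h₁ h₂ Y w' = (⟨(bi (schur k lam mu)).map φ (gradedLift h₁ h₂ X w).1,
      (layer k lam mu fun nu => lexLe nu xi).stable φ _ (gradedLift h₁ h₂ X w).2⟩ :
      (layer k lam mu fun nu => lexLe nu xi).sub Y))
  rw [schurIncl_gradedLift]
  change _ = (symPow k (rowOf lam mu)).map (biMap φ) (thetaProd lam mu X.fst X.snd _)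
  rw [← thetaProd_twistProd]
  congr 1
  refine (twistProd_shuf φ (skewSize_add h₁ h₂) _ _ _ ?_).symm
  refine (superTensor_gammaOne Y.fst Y.snd w').trans (hw.trans ?_)
  exact congrArg _ (superTensor_gammaOne X.fst X.snd w).symm

lemma pr_superTensor_thetaHat (h₁ : mu ≤ xi) (h₂ : xi ≤ lam) (M N : SVec k) (a : ZMod 2)
    (w : gammaPi xi mu M ⊗[k] gammaPi lam xi N) :
    pr k a (superTensor (thetaHat xi mu M) (thetaHat lam xi N) w) =
      superTensor (thetaHat xi mu M) (thetaHat lam xi N)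
        (pr k ((skewSize lam mu : ZMod 2) + a) w) := by
  have h := superTensor_even (homog_thetaHat xi mu M) (homog_thetaHat lam xi N)
  rw [← Nat.cast_add, skewSize_add h₁ h₂] at h
  rw [← h.pr_apply, ← add_assoc, CharTwo.add_self_eq_zero, zero_add]

set_option maxHeartbeats 2000000 in
lemma exists_gradedMap_eq (h₁ : mu ≤ xi) (h₂ : xi ≤ lam) {X Y : GammaBi k (skewSize lam mu)}
    (φ : X ⟶ Y) (w : gammaPi xi mu X.fst ⊗[k] gammaPi lam xi X.snd) :
    ∃ w' : gammaPi xi mu Y.fst ⊗[k] gammaPi lam xi Y.snd,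
      superTensor (thetaHat xi mu Y.fst) (thetaHat lam xi Y.snd) w' =
        extMap (schur k xi mu) (schur k lam xi) (φ ⟨(_, _), skewSize_add h₁ h₂⟩)
          (superTensor (thetaHat xi mu X.fst) (thetaHat lam xi X.snd) w) ∧
      gradedMap h₁ h₂ Y w' = ((layer k lam mu fun nu => lexLe nu xi).subquotient
        (layer k lam mu fun nu => lexLt nu xi)).map φ (gradedMap h₁ h₂ X w) := by
  obtain ⟨w', hw', hw''⟩ := exists_lift (φ ⟨(_, _), skewSize_add h₁ h₂⟩) w
  exact ⟨w', hw', gradedMap_natural h₁ h₂ φ hw''⟩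

-- Both maps out of Γ_Π ⊗ Γ_Π are onto with one kernel, which yields the isomorphism. Parity and
-- naturality are then verified on preimages, where `exists_gradedMap_eq` provides a common lift.
set_option maxHeartbeats 2000000 in
lemma exists_evenIso (hk : (2 : k) ≠ 0) (h₁ : mu ≤ xi) (h₂ : xi ≤ lam) :
    ∃ Ψ : EvenIso (extTensor (skewSize_add h₁ h₂) (schur k xi mu) (schur k lam xi))
        ((layer k lam mu fun nu => lexLe nu xi).subquotient (layer k lam mu fun nu => lexLt nu xi)),
      ∀ (X : GammaBi k (skewSize lam mu)) (w : gammaPi xi mu X.fst ⊗[k] gammaPi lam xi X.snd),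
        Ψ.app X (superTensor (thetaHat xi mu X.fst) (thetaHat lam xi X.snd) w) =
          gradedMap h₁ h₂ X w := by
  have hsurj : ∀ X : GammaBi k (skewSize lam mu),
      Function.Surjective (superTensor (thetaHat xi mu X.fst) (thetaHat lam xi X.snd)) := fun X =>
    superTensor_surjective (homog_thetaHat lam xi X.snd) (thetaHat_surjective _ _ _)
      (thetaHat_surjective _ _ _)
  choose e he using fun X : GammaBi k (skewSize lam mu) =>
    exists_equiv_of_ker_eq (hsurj X) (gradedMap_surjective h₁ h₂ X)
      (gradedMap_eq_zero_iff hk h₁ h₂ X)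
  refine ⟨⟨e, fun X a x hx => ?_, fun {X Y} φ x => ?_⟩, he⟩
  · obtain ⟨w, rfl⟩ := hsurj X x
    have h3 := pr_superTensor_thetaHat h₁ h₂ X.fst X.snd a w
    have h4 := (homog_gradedMap h₁ h₂ X).pr_apply ((skewSize lam mu : ZMod 2) + a) w
    rw [← add_assoc, CharTwo.add_self_eq_zero, zero_add] at h4
    have h5 : gradedMap h₁ h₂ X (pr k ((skewSize lam mu : ZMod 2) + a) w) =
        gradedMap h₁ h₂ X w := (he X _).symm.trans ((congrArg (e X) (h3.symm.trans hx)).trans (he X w))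
    exact (congrArg (pr k a) (he X w)).trans (h4.trans (h5.trans (he X w).symm))
  · obtain ⟨w, rfl⟩ := hsurj X x
    obtain ⟨w', hw', h3⟩ := exists_gradedMap_eq h₁ h₂ φ w
    exact ((congrArg (e Y) hw').symm.trans ((he Y w').trans h3)).trans
      (congrArg _ (he X w).symm)

end Graded

/-! ### Inverses and direct sums of even isomorphisms. -/

section EvenIso

variable {k : Type u} [Field k] {C : Type w} [Category.{u} C] [Preadditive C] [Linear k C]
  [SvecEnriched k C]

/-- The inverse of an even isomorphism. -/
def EvenIso.symm {F G : SuperFunctor k C} (Ψ : EvenIso F G) : EvenIso G F where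
  app X := (Ψ.app X).symm
  even X a x hx := by
    obtain ⟨y, rfl⟩ := (Ψ.app X).surjective x
    rw [LinearEquiv.symm_apply_apply]
    have h : pr k a (Ψ.app X y) = Ψ.app X (pr k a y) := by
      conv_lhs => rw [← sum_pr (k := k) y, map_sum, map_sum]
      rw [Finset.sum_eq_single a]
      · exact Ψ.even X a _ (homog_pr a y)
      · exact fun b _ hb => (Ψ.even X b _ (homog_pr b y)).pr_of_ne hb.symm
      · exact fun h => absurd (Finset.mem_univ a) h
    exact (Ψ.app X).injective (h.symm.trans hx)
  natural f x := by
    rw [LinearEquiv.symm_apply_eq, Ψ.natural, LinearEquiv.apply_symm_apply]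

/-- The direct sum of even isomorphisms. -/
def EvenIso.directSum {ι : Type} [Finite ι] {F G : ι → SuperFunctor k C}
    (Ψ : ∀ i, EvenIso (F i) (G i)) : EvenIso (directSum F) (directSum G) where
  app X := LinearEquiv.piCongrRight fun i => (Ψ i).app X
  even X a x hx := funext fun i => (Ψ i).even X a (x i) (congrFun hx i)
  natural f x := funext fun i => (Ψ i).natural f (x i)

end EvenIso

end SuperSchur

/-! ### Assembly of the theorem. -/

theorem mainTheorem2 {k : Type u} [Field k] (hk : (2 : k) ≠ 0) (lam mu : YoungDiagram)
    (hmu : mu ≤ lam) :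
    -- the bisuperfunctors `L_ξ` and `L̇_ξ`, for `mu ⊆ ξ ⊆ lam`, inside `(Ŝ_{lam/mu})^{bi}`
    ∃ L Ldot : Set.Icc mu lam → SubFunctor (bi (schur k lam mu)),
      (∀ (xi : Set.Icc mu lam) (X : GammaBi k (skewSize lam mu)),
        ((L xi).sub X).map (schurIncl lam mu (X.fst.sum X.snd)) =
            lSub lam mu xi X.fst X.snd ∧
        ((Ldot xi).sub X).map (schurIncl lam mu (X.fst.sum X.snd)) =
            lDotSub lam mu xi X.fst X.snd) ∧
      -- the canonical map `Ŝ_{ξ/mu} ⊠ Ŝ_{lam/ξ} → L_ξ / L̇_ξ` is an isomorphism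
      (∀ xi : Set.Icc mu lam,
        ∃ Ψ : EvenIso
            (extTensor (skewSize_add xi.2.1 xi.2.2) (schur k xi mu) (schur k lam xi))
            ((L xi).subquotient (Ldot xi)),
          ∀ (X : GammaBi k (skewSize lam mu)) (x : gammaPi xi mu X.fst) (y : gammaPi lam xi X.snd),
            ∃ l : (L xi).sub X,
              schurIncl lam mu (X.fst.sum X.snd) l.1 =
                thetaT lam mu (X.fst.sum X.snd) (shuffle lam xi mu X.fst X.snd
                  (gammaPiIncl xi mu X.fst x ⊗ₜ gammaPiIncl lam xi X.snd y)) ∧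
              Ψ.app X (superTensor (thetaHat xi mu X.fst) (thetaHat lam xi X.snd) (x ⊗ₜ y)) =
                (L xi).mkSubquot (Ldot xi) X l) ∧
      -- the `L_ξ` form a filtration of `(Ŝ_{lam/mu})^{bi}`
      (∀ nu xi : Set.Icc mu lam, lexLe nu.1 xi.1 → L nu ≤ L xi) ∧
      L ⟨lam, hmu, le_rfl⟩ = ⊤ ∧
      (∀ xi : Set.Icc mu lam,
        Ldot xi = SubFunctor.sum fun nu : {nu : Set.Icc mu lam // lexLt nu.1 xi.1} => L nu) ∧
      -- its associated graded object
      Nonempty (EvenIso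
        (directSum fun xi : Set.Icc mu lam => (L xi).subquotient
          (SubFunctor.sum fun nu : {nu : Set.Icc mu lam // lexLt nu.1 xi.1} => L nu))
        (directSum fun xi : Set.Icc mu lam =>
          extTensor (skewSize_add xi.2.1 xi.2.2) (schur k xi mu) (schur k lam xi))) := by
  have hsum : ∀ xi : Set.Icc mu lam, (layer k lam mu fun nu => lexLt nu xi.1) =
      SubFunctor.sum fun nu : {nu : Set.Icc mu lam // lexLt nu.1 xi.1} =>
        layer k lam mu fun nu' => lexLe nu' nu.1.1 := fun xi =>
    SubFunctor.ext (funext fun X => layerSub_lt_eq_iSup xi.1 X.fst X.snd)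
  refine ⟨fun xi => layer k lam mu fun nu => lexLe nu xi.1,
    fun xi => layer k lam mu fun nu => lexLt nu xi.1,
    fun xi X => ⟨map_layerSub _ _ _, map_layerSub _ _ _⟩, fun xi => ?_,
    fun nu xi h X => layerSub_mono (fun nu' h' => lexLe_trans h' h) _ _,
    SubFunctor.ext (funext fun X => layerSub_top hk hmu X.fst X.snd), hsum, ?_⟩
  · obtain ⟨Ψ, hΨ⟩ := exists_evenIso (k := k) hk xi.2.1 xi.2.2
    refine ⟨Ψ, fun X x y => ⟨gradedLift xi.2.1 xi.2.2 X (x ⊗ₜ y), ?_, hΨ X (x ⊗ₜ y)⟩⟩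
    rw [shuffle_eq, schurIncl_gradedLift, gammaShuf, LinearMap.comp_apply, TensorProduct.map_tmul]
    rfl
  · have h : ∀ xi : Set.Icc mu lam, Nonempty (EvenIso
        ((layer k lam mu fun nu => lexLe nu xi.1).subquotient
          (SubFunctor.sum fun nu : {nu : Set.Icc mu lam // lexLt nu.1 xi.1} =>
            layer k lam mu fun nu' => lexLe nu' nu.1.1))
        (extTensor (skewSize_add xi.2.1 xi.2.2) (schur k xi mu) (schur k lam xi))) := fun xi => by
      obtain ⟨Ψ, -⟩ := exists_evenIso (k := k) hk xi.2.1 xi.2.2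
      -- The graded piece is formed with the sum of the smaller L_ν, which is the same subfunctor as
      -- `Ldot xi`.
      exact hsum xi ▸ ⟨Ψ.symm⟩
    exact ⟨EvenIso.directSum fun xi => Classical.choice (h xi)⟩
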